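/- Let $0<\varepsilon<1$. There is an algorithm which, for every large enough integer $t$, constructs from the input $t$ a lattice $\tilde\Lambda\subset\mathbb{R}^{4t}$ of rank $4t$ whose packing density satisfies $$\Delta(\tilde\Lambda)\;\ge\;(1-\varepsilon)\cdot\frac{24\,t\,\zeta(4t)}{2^{4t}\cdot e\,(1-e^{-t})},$$ and which uses at most $e^{4t^2\log (t)\,(1+o(1))}$ bit operations as $t\to\infty$. Here $\zeta$ is the Riemann zeta function, $\Delta(\Lambda)$ is the volume of a ball of radius $\lambda_1(\Lambda)/2$ divided by the covolume of $\Lambda$, where $\lambda_1(\Lambda)$ is the length of a shortest nonzero vector of $\Lambda$, and to construct the lattice means to write down, row by row, a $4t\times 4t$ integer matrix whose rows form a basis of it. Bit operations are counted for while-programs over finitely many integer variables: adding, subtracting, copying, testing and printing integers costs their binary lengths, and multiplying or dividing two integers costs the product of their binary lengths. -/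

import Mathlib

open Filter Topology MeasureTheory

/-! ### Model of computation

A program is a while-program over finitely many variables that hold integers of arbitrary size,
together with a write-only output tape of integers.  Every operation is charged the number of bit
operations of the schoolbook method on binary numerals, so that (each variable being kept on a tape
of its own) the cost of a run is, up to a constant factor that depends on the program only, the
running time on a multitape Turing machine. -/

namespace BitMachine

/-- The length of the binary numeral of an integer, with its sign. -/
def bits (z : ℤ) : ℕ := Nat.size z.natAbs + 1

/-- Binary arithmetic operations. -/
inductive Op where
  | add
  | sub
  | mul
  | div
  | mod

/-- Value of an operation; `div` and `mod` are Euclidean division (quotient `0` and remainder `a`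
if the divisor is `0`). -/
def Op.eval : Op → ℤ → ℤ → ℤ
  | .add, a, b => a + b
  | .sub, a, b => a - b
  | .mul, a, b => a * b
  | .div, a, b => a / b
  | .mod, a, b => a % b

/-- Bit cost of an operation: linear for addition and subtraction, the product of the lengths for
(schoolbook) multiplication and division. -/
def Op.cost : Op → ℤ → ℤ → ℕ
  | .add, a, b => bits a + bits b
  | .sub, a, b => bits a + bits b
  | .mul, a, b => bits a * bits b
  | .div, a, b => bits a * bits b
  | .mod, a, b => bits a * bits b

/-- Arithmetic expressions in the variables `var 0`, `var 1`, … -/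
inductive Expr where
  | const (c : ℤ)
  | var (x : ℕ)
  | bin (o : Op) (e₁ e₂ : Expr)

/-- The value of an expression when the variables have the values `s`. -/
def Expr.eval (s : ℕ → ℤ) : Expr → ℤ
  | .const c => c
  | .var x => s x
  | .bin o e₁ e₂ => o.eval (e₁.eval s) (e₂.eval s)

/-- The number of bit operations spent on evaluating an expression. -/
def Expr.cost (s : ℕ → ℤ) : Expr → ℕ
  | .const c => bits c
  | .var x => bits (s x)
  | .bin o e₁ e₂ => e₁.cost s + e₂.cost s + o.cost (e₁.eval s) (e₂.eval s)

/-- Programs.  `ite e` and `loop e` test whether the value of `e` is positive; `emit e` writes the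
value of `e` on the output tape. -/
inductive Prog where
  | skip
  | assign (x : ℕ) (e : Expr)
  | emit (e : Expr)
  | seq (p q : Prog)
  | ite (e : Expr) (p q : Prog)
  | loop (e : Expr) (p : Prog)

/-- A configuration: the values of the variables, and what has been written so far. -/
structure Config where
  val : ℕ → ℤ
  out : List ℤ

/-- `Run p c c' n`: the program `p`, started in the configuration `c`, halts in the configuration
`c'` after `n` bit operations. -/
inductive Run : Prog → Config → Config → ℕ → Prop
  | skip (c : Config) : Run .skip c c 1
  | assign (x : ℕ) (e : Expr) (c : Config) :
      Run (.assign x e) c ⟨Function.update c.val x (e.eval c.val), c.out⟩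
        (e.cost c.val + bits (e.eval c.val))
  | emit (e : Expr) (c : Config) :
      Run (.emit e) c ⟨c.val, c.out ++ [e.eval c.val]⟩ (e.cost c.val + bits (e.eval c.val))
  | seq {p q : Prog} {c c' c'' : Config} {n m : ℕ} (hp : Run p c c' n) (hq : Run q c' c'' m) :
      Run (.seq p q) c c'' (n + m)
  | ite_pos {e : Expr} {p : Prog} (q : Prog) {c c' : Config} {n : ℕ}
      (he : 0 < e.eval c.val) (hp : Run p c c' n) :
      Run (.ite e p q) c c' (e.cost c.val + n)
  | ite_neg {e : Expr} (p : Prog) {q : Prog} {c c' : Config} {n : ℕ}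
      (he : e.eval c.val ≤ 0) (hq : Run q c c' n) :
      Run (.ite e p q) c c' (e.cost c.val + n)
  | loop_stop {e : Expr} (p : Prog) {c : Config} (he : e.eval c.val ≤ 0) :
      Run (.loop e p) c c (e.cost c.val)
  | loop_step {e : Expr} {p : Prog} {c c' c'' : Config} {n m : ℕ}
      (he : 0 < e.eval c.val) (hp : Run p c c' n) (hl : Run (.loop e p) c' c'' m) :
      Run (.loop e p) c c'' (e.cost c.val + n + m)

/-- The initial configuration on the input `t`: variable `0` holds `t`, all others hold `0`, and the
output tape is empty. -/
def init (t : ℕ) : Config := ⟨Function.update (fun _ => 0) 0 (t : ℤ), []⟩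

/-- On the input `t` the program `p` halts after `n` bit operations with output `l`. -/
def Outputs (p : Prog) (t : ℕ) (l : List ℤ) (n : ℕ) : Prop :=
  ∃ c : Config, Run p (init t) c n ∧ c.out = l

end BitMachine

/-! ### Lattices -/

/-- The entries of a square matrix, row after row. -/
def matrixEntries {d : ℕ} (B : Matrix (Fin d) (Fin d) ℤ) : List ℤ :=
  (List.ofFn fun i => List.ofFn fun j => B i j).flatten

/-- The subgroup of Euclidean space `ℝᵈ` generated by the rows of an integer matrix (a lattice with
the rows as a basis if the determinant is nonzero). -/
noncomputable def rowLattice {d : ℕ} (B : Matrix (Fin d) (Fin d) ℤ) :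
    Submodule ℤ (EuclideanSpace ℝ (Fin d)) :=
  Submodule.span ℤ (Set.range fun i : Fin d => WithLp.toLp 2 fun j : Fin d => (B i j : ℝ))

/-- The length of a shortest nonzero vector. -/
noncomputable def shortestLength {d : ℕ} (L : Submodule ℤ (EuclideanSpace ℝ (Fin d))) : ℝ :=
  sInf {r : ℝ | ∃ v ∈ L, v ≠ 0 ∧ ‖v‖ = r}

/-- The density of the lattice sphere packing: the volume of a ball whose radius is half the length
of a shortest nonzero vector, divided by the covolume. -/
noncomputable def packingDensity {d : ℕ} (L : Submodule ℤ (EuclideanSpace ℝ (Fin d))) : ℝ :=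
  volume.real (Metric.ball (0 : EuclideanSpace ℝ (Fin d)) (shortestLength L / 2)) /
    ZLattice.covolume L

/-! ### Lengths of integers and costs of expressions -/

namespace BitMachine

/-! Existence of a dense lattice. For a prime p and a, b with a² + b² = -1 mod p, quaternions act on
F_p² by 2×2 matrices, and each w in (F_p²)ᵗ cuts out of D₄ᵗ the sublattice `annLattice` of the
vectors annihilating w. It is closed under the 24 Hurwitz units (`unitClosed_annLattice`), so its
nonzero vectors come in orbits of 24 equally long ones. Fix the first entry of w as (1,0) and let
the others vary: a nonzero x in D₄ᵗ with squared length below p lies in at most a fraction 1/p² of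
these lattices (`card_annihilated_le`). Hence some lattice has no more short vectors than the
average (`exists_potential_le`), and the average is bounded by a volume (`card_short_le`,
`sum_card_short_le`).

The factor t/e is gained by tolerating short vectors and removing them afterwards. Put S = kt and ρ
= 1 + 1/(4kt). Whenever a nonzero vector has squared length below R, stretch the quaternionic line
through it by ρ. This multiplies the determinant by ρ⁴, shortens no vector and commutes with the
quaternions. The potential counts the pairs of a level j ≤ S and a vector x with ρ²ʲ|x|² < R. As
long as it is below 24(S+1), every stretch lowers it by at least 24 (`potential_mul_quatStretch`). A
potential of at most 24kt at the start thus allows at most kt stretches, and the determinant grows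
by at most (1 + 1/(4kt))^(4kt) ≤ e. With V the volume of the unit ball, the mean potential at the
start is at most V R²ᵗ (1+δ)(k+1) / (2ᵗp²), because the levels form a geometric series with sum at
most k+1. The largest R that keeps this below 24kt (`exists_parameters`) yields, up to ε, the
density 24t / (2⁴ᵗe). Since ζ(4t) and 1 - e⁻ᵗ tend to 1, they disappear in ε (`eventually_zeta_le`,
`density_bound`).

The algorithm knows none of p, a, b, w, R. It runs through all R < t⁴, all moduli P ≤ Q = 2(Ct²)ᵗ
and all c < Q^(2t+4), whose digits to the base P encode a triangular matrix of determinant 2ᵗP²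
(`det_startMatrix`). Short vectors of its lattice have coordinates of size at most 20tR
(`abs_coord_le`). Going through this box and stretching along each short vector either takes more
than kt stretches or certifies a density (`density_of_stretched`). The best certified matrix is
kept, and a candidate sure to be certified exists (`exists_good_candidate`).

The number of moduli and candidates is Q^(2t+5), that is t^(4t²) up to a factor 2^O(t²). The box has
t^O(t) vectors. A stretch raises the bound for all integers at most to its 32nd power, so their
lengths are 2^O(t), and all this is of lower order (`eventually_cost_le`). The program is written
for a register machine with arrays, verified by rules such as `wp_for`, and translated to the bit
machine by packing each array into one integer (`Exec.simulate`, `outputs_of_wp`). -/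

theorem bits_le_succ_iff {z : ℤ} {n : ℕ} : bits z ≤ n + 1 ↔ z.natAbs < 2 ^ n := by
  simp [bits, Nat.size_le]

theorem one_le_bits (z : ℤ) : 1 ≤ bits z := by simp [bits]

theorem natAbs_lt_two_pow_bits (z : ℤ) : z.natAbs < 2 ^ (bits z - 1) := by
  simpa [bits] using Nat.lt_size_self z.natAbs

theorem bits_mono {a b : ℤ} (h : |a| ≤ |b|) : bits a ≤ bits b := by
  have : a.natAbs ≤ b.natAbs := by zify; exact h
  simpa [bits] using Nat.size_le_size this

theorem bits_add_le (a b : ℤ) : bits (a + b) ≤ bits a + bits b := by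
  have ha := natAbs_lt_two_pow_bits a
  have hb := natAbs_lt_two_pow_bits b
  have h1 := one_le_bits a
  have h2 := one_le_bits b
  obtain ⟨m, hm⟩ := Nat.exists_eq_add_of_le h1
  obtain ⟨n, hn⟩ := Nat.exists_eq_add_of_le h2
  rw [show bits a + bits b = (m + n + 1) + 1 by omega, bits_le_succ_iff]
  rw [hm] at ha
  rw [hn] at hb
  simp only [Nat.add_sub_cancel_left] at ha hb
  have hab : (a + b).natAbs ≤ a.natAbs + b.natAbs := Int.natAbs_add_le a b
  have e1 : 2 ^ m ≤ 2 ^ (m + n) := Nat.pow_le_pow_right (by norm_num) (by omega)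
  have e2 : 2 ^ n ≤ 2 ^ (m + n) := Nat.pow_le_pow_right (by norm_num) (by omega)
  rw [pow_succ]
  omega

theorem bits_neg (a : ℤ) : bits (-a) = bits a := by simp [bits]

theorem bits_sub_le (a b : ℤ) : bits (a - b) ≤ bits a + bits b := by
  simpa [sub_eq_add_neg, bits_neg] using bits_add_le a (-b)

theorem bits_mul_le (a b : ℤ) : bits (a * b) ≤ bits a + bits b := by
  have ha := natAbs_lt_two_pow_bits a
  have hb := natAbs_lt_two_pow_bits b
  have h1 := one_le_bits a
  have h2 := one_le_bits b
  obtain ⟨m, hm⟩ := Nat.exists_eq_add_of_le h1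
  obtain ⟨n, hn⟩ := Nat.exists_eq_add_of_le h2
  rw [show bits a + bits b = (m + n + 1) + 1 by omega, bits_le_succ_iff]
  rw [hm] at ha
  rw [hn] at hb
  simp only [Nat.add_sub_cancel_left] at ha hb
  calc (a * b).natAbs = a.natAbs * b.natAbs := Int.natAbs_mul a b
    _ < 2 ^ m * 2 ^ n := Nat.mul_lt_mul'' ha hb
    _ = 2 ^ (m + n) := (pow_add _ _ _).symm
    _ ≤ 2 ^ (m + n + 1) := Nat.pow_le_pow_right (by norm_num) (by omega)

theorem bits_div_le (a b : ℤ) : bits (a / b) ≤ bits a :=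
  bits_mono (by simpa using Int.abs_ediv_le_abs a b)

theorem bits_mod_le (a b : ℤ) : bits (a % b) ≤ bits a + bits b := by
  rcases eq_or_ne b 0 with rfl | hb
  · simp
  · refine (bits_mono ?_).trans (Nat.le_add_left (bits b) (bits a))
    rw [abs_of_nonneg (Int.emod_nonneg a hb)]
    exact (Int.emod_lt_abs a hb).le

namespace Expr

/-- The size of an expression, with its constants counted with their binary lengths. -/
def wt : Expr → ℕ
  | const c => bits c
  | var _ => 1
  | bin _ e₁ e₂ => e₁.wt + e₂.wt

theorem one_le_wt : ∀ e : Expr, 1 ≤ e.wt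
  | const c => one_le_bits c
  | var _ => le_rfl
  | bin _ e₁ _ => (one_le_wt e₁).trans (Nat.le_add_right _ _)

/-- No operation yields a result longer than its two operands together, so lengths add up along the
tree just as `wt` does. -/
theorem bits_eval_le {s : ℕ → ℤ} {β : ℕ} (hβ : 1 ≤ β) (hs : ∀ x, bits (s x) ≤ β) :
    ∀ e : Expr, bits (e.eval s) ≤ e.wt * β
  | const c => Nat.le_mul_of_pos_right _ hβ
  | var x => by simpa [wt, eval] using hs x
  | bin o e₁ e₂ => by
    have h1 := bits_eval_le hβ hs e₁
    have h2 := bits_eval_le hβ hs e₂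
    have : bits ((bin o e₁ e₂).eval s) ≤ bits (e₁.eval s) + bits (e₂.eval s) := by
      cases o
      · exact bits_add_le _ _
      · exact bits_sub_le _ _
      · exact bits_mul_le _ _
      · exact (bits_div_le _ _).trans (Nat.le_add_right _ _)
      · exact bits_mod_le _ _
    simp only [wt, add_mul]
    omega

/-- The square of `β` is that of schoolbook multiplication. The cube of `wt` leaves room to sum the
costs of all nodes: the mixed terms of `(x + y) ^ 3` pay for the operation at the root. -/
theorem cost_le {s : ℕ → ℤ} {β : ℕ} (hβ : 1 ≤ β) (hs : ∀ x, bits (s x) ≤ β) :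
    ∀ e : Expr, e.cost s ≤ e.wt ^ 3 * β ^ 2
  | const c => by
    have h := one_le_bits c
    calc bits c ≤ bits c ^ 3 := Nat.le_self_pow (by norm_num) _
      _ ≤ bits c ^ 3 * β ^ 2 := Nat.le_mul_of_pos_right _ (by positivity)
  | var x => by
    simpa [wt, cost] using (hs x).trans (Nat.le_self_pow (by norm_num) _)
  | bin o e₁ e₂ => by
    have h1 := cost_le hβ hs e₁
    have h2 := cost_le hβ hs e₂
    have b1 := bits_eval_le hβ hs e₁
    have b2 := bits_eval_le hβ hs e₂
    have w1 := one_le_wt e₁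
    have w2 := one_le_wt e₂
    have ho : o.cost (e₁.eval s) (e₂.eval s) ≤ 2 * (e₁.wt * e₂.wt) * β ^ 2 +
        (e₁.wt + e₂.wt) * β ^ 2 := by
      have hm : bits (e₁.eval s) * bits (e₂.eval s) ≤ e₁.wt * e₂.wt * β ^ 2 := by
        calc _ ≤ (e₁.wt * β) * (e₂.wt * β) := Nat.mul_le_mul b1 b2
          _ = _ := by ring
      have ha : bits (e₁.eval s) + bits (e₂.eval s) ≤ (e₁.wt + e₂.wt) * β ^ 2 := by
        calc _ ≤ (e₁.wt + e₂.wt) * β := by linarith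
          _ ≤ _ := Nat.mul_le_mul_left _ (Nat.le_self_pow (by norm_num) _)
      cases o <;> simp only [Op.cost] <;> nlinarith
    have key : e₁.wt ^ 3 + e₂.wt ^ 3 + 2 * (e₁.wt * e₂.wt) + (e₁.wt + e₂.wt) ≤
        (e₁.wt + e₂.wt) ^ 3 := by
      obtain ⟨x, hx⟩ := Nat.exists_eq_add_of_le w1
      obtain ⟨y, hy⟩ := Nat.exists_eq_add_of_le w2
      rw [hx, hy]
      have : 0 ≤ x * y := by positivity
      ring_nf
      nlinarith [Nat.zero_le (x^2), Nat.zero_le (y^2), Nat.zero_le (x*y), Nat.zero_le (x^2*y),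
        Nat.zero_le (x*y^2)]
    simp only [cost, wt]
    calc _ ≤ e₁.wt ^ 3 * β ^ 2 + e₂.wt ^ 3 * β ^ 2 + (2 * (e₁.wt * e₂.wt) * β ^ 2 +
        (e₁.wt + e₂.wt) * β ^ 2) := by gcongr
      _ = (e₁.wt ^ 3 + e₂.wt ^ 3 + 2 * (e₁.wt * e₂.wt) + (e₁.wt + e₂.wt)) * β ^ 2 := by ring
      _ ≤ _ := Nat.mul_le_mul_right _ key

/-- Rename the variables of an expression. -/
def rename (f : ℕ → ℕ) : Expr → Expr
  | const c => const c
  | var x => var (f x)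
  | bin o e₁ e₂ => bin o (e₁.rename f) (e₂.rename f)

theorem eval_rename (f : ℕ → ℕ) (s : ℕ → ℤ) :
    ∀ e : Expr, (e.rename f).eval s = e.eval (fun x => s (f x))
  | const _ => rfl
  | var _ => rfl
  | bin o e₁ e₂ => by simp only [rename, eval, eval_rename f s e₁, eval_rename f s e₂]

theorem wt_rename (f : ℕ → ℕ) : ∀ e : Expr, (e.rename f).wt = e.wt
  | const _ => rfl
  | var _ => rfl
  | bin _ e₁ e₂ => by simp only [rename, wt, wt_rename f e₁, wt_rename f e₂]

/-- The variables of an expression. -/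
def vars : Expr → List ℕ
  | const _ => []
  | var x => [x]
  | bin _ e₁ e₂ => e₁.vars ++ e₂.vars

theorem eval_congr {s s' : ℕ → ℤ} : ∀ {e : Expr}, (∀ x ∈ e.vars, s' x = s x) → e.eval s' = e.eval s
  | const _, _ => rfl
  | var x, h => h x (by simp [vars])
  | bin o e₁ e₂, h => by
    simp only [eval]
    rw [eval_congr (e := e₁) fun x hx => h x (by simp [vars, hx]),
      eval_congr (e := e₂) fun x hx => h x (by simp [vars, hx])]

instance : Add Expr := ⟨.bin .add⟩
instance : Sub Expr := ⟨.bin .sub⟩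
instance : Mul Expr := ⟨.bin .mul⟩
instance : Div Expr := ⟨.bin .div⟩
instance : Mod Expr := ⟨.bin .mod⟩

@[simp] theorem eval_add (s : ℕ → ℤ) (a b : Expr) : (a + b).eval s = a.eval s + b.eval s := rfl
@[simp] theorem eval_sub (s : ℕ → ℤ) (a b : Expr) : (a - b).eval s = a.eval s - b.eval s := rfl
@[simp] theorem eval_mul (s : ℕ → ℤ) (a b : Expr) : (a * b).eval s = a.eval s * b.eval s := rfl
@[simp] theorem eval_div (s : ℕ → ℤ) (a b : Expr) : (a / b).eval s = a.eval s / b.eval s := rfl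
@[simp] theorem eval_mod (s : ℕ → ℤ) (a b : Expr) : (a % b).eval s = a.eval s % b.eval s := rfl
@[simp] theorem eval_const (s : ℕ → ℤ) (c : ℤ) : (const c).eval s = c := rfl
@[simp] theorem eval_var (s : ℕ → ℤ) (x : ℕ) : (var x).eval s = s x := rfl

end Expr

/-! ### Arrays packed into one integer by signed digits -/

/-- The integer with signed base-`M` digits `f 0, …, f (A - 1)`. -/
def pack (M : ℤ) (f : ℕ → ℤ) (A : ℕ) : ℤ := ∑ i ∈ Finset.range A, f i * M ^ i

/-- Digits below half the base keep the number below half of the next power. This makes the rounding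
in `pack_digit` exact. -/
theorem abs_pack_le {M h : ℤ} (hM : 2 * h = M) {f : ℕ → ℤ} (hf : ∀ i, |f i| < h) (A : ℕ) :
    2 * |pack M f A| < M ^ A := by
  have h0 : 0 < h := (abs_nonneg _).trans_lt (hf 0)
  induction A with
  | zero => simp [pack]
  | succ A ih =>
    have hMA : 0 < M ^ A := pow_pos (by omega) A
    rw [pack, Finset.sum_range_succ, ← pack, pow_succ]
    have h1 : |f A * M ^ A| = |f A| * M ^ A := by rw [abs_mul, abs_of_pos hMA]
    have h2 := abs_add_le (pack M f A) (f A * M ^ A)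
    have h3 : |f A| * M ^ A ≤ (h - 1) * M ^ A := by
      have := hf A
      gcongr
      omega
    nlinarith

/-- The quotient rounds `pack M f A / M ^ i` to the nearest integer. That removes the digits below
`i`, whose value is less than half of `M ^ i`. Shifting by `h` before and after the reduction modulo
`M` selects the residue between `-h` and `h`. -/
theorem pack_digit {M h : ℤ} (hM : 2 * h = M) {f : ℕ → ℤ} (hf : ∀ i, |f i| < h) {A i : ℕ}
    (hi : i < A) : ((2 * pack M f A + M ^ i) / (2 * M ^ i) + h) % M - h = f i := by
  have h0 : 0 < h := (abs_nonneg _).trans_lt (hf 0)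
  have hMi : 0 < M ^ i := pow_pos (by omega) i
  obtain ⟨k, rfl⟩ := Nat.exists_eq_add_of_lt hi
  have hsplit : ∃ R, pack M f (i + k + 1) = pack M f i + M ^ i * (f i + M * R) := by
    refine ⟨∑ j ∈ Finset.range k, f (i + 1 + j) * M ^ j, ?_⟩
    simp only [pack]
    rw [show i + k + 1 = (i + 1) + k by omega, Finset.sum_range_add, Finset.sum_range_succ,
      mul_add, Finset.mul_sum, Finset.mul_sum, add_assoc]
    congr 1
    rw [mul_comm (f i)]
    congr 1
    refine Finset.sum_congr rfl fun j _ => ?_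
    ring
  obtain ⟨R, hR⟩ := hsplit
  have hlow := abs_pack_le hM hf i
  rw [hR, show 2 * (pack M f i + M ^ i * (f i + M * R)) + M ^ i =
    (2 * pack M f i + M ^ i) + 2 * M ^ i * (f i + M * R) by ring,
    Int.add_mul_ediv_left _ _ (by omega)]
  rw [Int.ediv_eq_zero_of_lt (by have := neg_abs_le (pack M f i); omega)
    (by have := le_abs_self (pack M f i); omega)]
  have := abs_lt.1 (hf i)
  rw [show 0 + (f i + M * R) + h = (f i + h) + M * R by ring, Int.add_mul_emod_self_left,
    Int.emod_eq_of_lt (by omega) (by omega)]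
  ring

theorem pack_update (M : ℤ) (f : ℕ → ℤ) {A i : ℕ} (hi : i < A) (v : ℤ) :
    pack M (Function.update f i v) A = pack M f A + (v - f i) * M ^ i := by
  have hmem : i ∈ Finset.range A := Finset.mem_range.2 hi
  simp only [pack]
  rw [← Finset.add_sum_erase _ _ hmem, ← Finset.add_sum_erase _ (fun j => f j * M ^ j) hmem]
  have : ∑ x ∈ (Finset.range A).erase i, Function.update f i v x * M ^ x =
      ∑ x ∈ (Finset.range A).erase i, f x * M ^ x := by
    refine Finset.sum_congr rfl fun x hx => ?_
    rw [Function.update_of_ne (Finset.ne_of_mem_erase hx)]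
  rw [this]
  simp
  ring

end BitMachine

/-! ### A register machine with arrays -/

namespace Ram

open BitMachine

/-- A state: scalar variables, arrays, and the output. -/
structure St where
  v : ℕ → ℤ
  a : ℕ → ℕ → ℤ
  out : List ℤ

/-- Assign a scalar variable. -/
def St.setv (s : St) (x : ℕ) (z : ℤ) : St := ⟨Function.update s.v x z, s.a, s.out⟩

/-- Assign an array variable. -/
def St.seta (s : St) (b : ℕ) (f : ℕ → ℤ) : St := ⟨s.v, Function.update s.a b f, s.out⟩

/-- Commands. -/
inductive Cmd where
  | set (x : ℕ) (e : Expr)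
  | load (x a : ℕ) (i : Expr)
  | store (a : ℕ) (i e : Expr)
  | copy (a b : ℕ)
  | emit (e : Expr)
  | seq (p q : Cmd)
  | ite (e : Expr) (p q : Cmd)
  | loop (e : Expr) (p : Cmd)

/-- Execution in a number of steps, with all values below `h` and all addresses below `A`. -/
inductive Exec (h : ℤ) (A : ℕ) : Cmd → St → St → ℕ → Prop
  | set (x : ℕ) (e : Expr) (s : St) (he : |e.eval s.v| < h) :
      Exec h A (.set x e) s (s.setv x (e.eval s.v)) 1
  | load (x a : ℕ) (i : Expr) (s : St) (j : ℕ) (hi : i.eval s.v = j) (hj : j < A) :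
      Exec h A (.load x a i) s (s.setv x (s.a a j)) 1
  | store (a : ℕ) (i e : Expr) (s : St) (j : ℕ) (hi : i.eval s.v = j) (hj : j < A)
      (he : |e.eval s.v| < h) :
      Exec h A (.store a i e) s (s.seta a (Function.update (s.a a) j (e.eval s.v))) 1
  | copy (a b : ℕ) (s : St) : Exec h A (.copy a b) s (s.seta a (s.a b)) 1
  | emit (e : Expr) (s : St) : Exec h A (.emit e) s ⟨s.v, s.a, s.out ++ [e.eval s.v]⟩ 1
  | seq {p q : Cmd} {s s' s'' : St} {n m : ℕ} (hp : Exec h A p s s' n) (hq : Exec h A q s' s'' m) :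
      Exec h A (.seq p q) s s'' (n + m)
  | ite_pos {e : Expr} {p : Cmd} (q : Cmd) {s s' : St} {n : ℕ} (he : 0 < e.eval s.v)
      (hp : Exec h A p s s' n) : Exec h A (.ite e p q) s s' (1 + n)
  | ite_neg {e : Expr} (p : Cmd) {q : Cmd} {s s' : St} {n : ℕ} (he : e.eval s.v ≤ 0)
      (hq : Exec h A q s s' n) : Exec h A (.ite e p q) s s' (1 + n)
  | loop_done {e : Expr} (p : Cmd) {s : St} (he : e.eval s.v ≤ 0) : Exec h A (.loop e p) s s 1
  | loop_step {e : Expr} {p : Cmd} {s s' s'' : St} {n m : ℕ} (he : 0 < e.eval s.v)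
      (hp : Exec h A p s s' n) (hl : Exec h A (.loop e p) s' s'' m) :
      Exec h A (.loop e p) s s'' (1 + n + m)

/-- The place of a scalar variable among the variables of the bit machine. -/
def scal (x : ℕ) : ℕ := 3 * x

/-- The place of an array variable among the variables of the bit machine. -/
def arr (a : ℕ) : ℕ := 3 * a + 1

/-- Compute the power of the base that belongs to an address. -/
def powProg (i : Expr) : Prog :=
  .seq (.assign 5 (i.rename scal)) (.seq (.assign 2 (.const 1))
    (.loop (.var 5) (.seq (.assign 2 (.var 2 * (.const 2 * .var 8)))
      (.assign 5 (.var 5 - .const 1)))))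

/-- The digit of an array at the place given by the power of the base in variable `2`. -/
def digitExpr (a : ℕ) : Expr :=
  ((.const 2 * .var (arr a) + .var 2) / (.const 2 * .var 2) + .var 8) % (.const 2 * .var 8) - .var 8

theorem digitExpr_wt (a : ℕ) : (digitExpr a).wt = 15 := by
  have h1 : bits 2 = 3 := by decide
  have : (digitExpr a).wt = ((bits 2 + 1 + 1) + (bits 2 + 1) + 1) + (bits 2 + 1) + 1 := rfl
  rw [this, h1]

/-- Translation of commands into programs of the bit machine. -/
def Cmd.compile : Cmd → Prog
  | .set x e => .assign (scal x) (e.rename scal)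
  | .load x a i => .seq (powProg i) (.assign (scal x) (digitExpr a))
  | .store a i e => .seq (powProg i)
      (.assign (arr a) (.var (arr a) + (e.rename scal - digitExpr a) * .var 2))
  | .copy a b => .assign (arr a) (.var (arr b))
  | .emit e => .emit (e.rename scal)
  | .seq p q => .seq p.compile q.compile
  | .ite e p q => .ite (e.rename scal) p.compile q.compile
  | .loop e p => .loop (e.rename scal) p.compile

/-- A factor for the cost of a command. -/
def Cmd.fac : Cmd → ℕ
  | .set _ e => 2 * e.wt ^ 3
  | .load _ _ i => 2 * i.wt ^ 3 + 20000
  | .store _ i e => 2 * i.wt ^ 3 + 2 * (e.wt + 17) ^ 3 + 2000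
  | .copy _ _ => 2
  | .emit e => 2 * e.wt ^ 3
  | .seq p q => p.fac + q.fac
  | .ite e p q => e.wt ^ 3 + (p.fac + q.fac)
  | .loop e p => e.wt ^ 3 + p.fac

/-- A configuration of the bit machine that represents a state. -/
structure Rep (h : ℤ) (A : ℕ) (s : St) (c : Config) : Prop where
  v : ∀ x, c.val (scal x) = s.v x
  a : ∀ b, c.val (arr b) = pack (2 * h) (s.a b) A
  base : c.val 8 = h
  out : c.out = s.out
  pw : |c.val 2| ≤ (2 * h) ^ A
  cnt : |c.val 5| ≤ (2 * h) ^ A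
  rest : ∀ x, |c.val (3 * x + 2)| ≤ (2 * h) ^ A

/-- All values are below `h`. -/
structure Bdd (h : ℤ) (s : St) : Prop where
  v : ∀ x, |s.v x| < h
  a : ∀ b i, |s.a b i| < h

theorem Exec.bdd {h : ℤ} {A : ℕ} {p : Cmd} {s s' : St} {n : ℕ} (H : Exec h A p s s' n)
    (hs : Bdd h s) : Bdd h s' := by
  induction H with
  | set x e s he =>
    refine ⟨fun y => ?_, hs.a⟩
    simp only [St.setv, Function.update_apply]
    split_ifs
    exacts [he, hs.v y]
  | load x a i s j hi hj =>
    refine ⟨fun y => ?_, hs.a⟩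
    simp only [St.setv, Function.update_apply]
    split_ifs
    exacts [hs.a a j, hs.v y]
  | store a i e s j hi hj he =>
    refine ⟨hs.v, fun b k => ?_⟩
    simp only [St.seta, Function.update_apply]
    split_ifs with h1
    · simp only [Function.update_apply]
      split_ifs
      exacts [he, hs.a a k]
    · exact hs.a b k
  | copy a b s =>
    refine ⟨hs.v, fun c k => ?_⟩
    simp only [St.seta, Function.update_apply]
    split_ifs
    exacts [hs.a b k, hs.a c k]
  | emit e s => exact ⟨hs.v, hs.a⟩
  | seq _ _ ih1 ih2 => exact ih2 (ih1 hs)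
  | ite_pos _ _ _ ih => exact ih hs
  | ite_neg _ _ _ ih => exact ih hs
  | loop_done => exact hs
  | loop_step _ _ _ ih1 ih2 => exact ih2 (ih1 hs)

/-! ### Simulation of the register machine on the bit machine -/

section Simulation

variable {h : ℤ} {A β : ℕ}

/-- One bound for all three residue classes of variables, namely scalars, packed arrays and work
variables, so that a single length `β` governs every cost. -/
theorem Rep.abs_val_le {s : St} {c : Config} (hc : Rep h A s c) (hs : Bdd h s) (hA : 1 ≤ A) (x : ℕ) :
    |c.val x| ≤ (2 * h) ^ A := by
  have h0 : 0 < h := (abs_nonneg _).trans_lt (hs.v 0)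
  have hle : 2 * h ≤ (2 * h) ^ A := le_self_pow₀ (by omega) (by omega)
  obtain ⟨y, hy⟩ : ∃ y, x = 3 * y ∨ x = 3 * y + 1 ∨ x = 3 * y + 2 := ⟨x / 3, by omega⟩
  rcases hy with rfl | rfl | rfl
  · have := hs.v y
    rw [← hc.v y, scal] at this
    omega
  · have := abs_pack_le (h := h) rfl (hs.a y) A
    rw [← hc.a y, arr] at this
    omega
  · exact hc.rest y

theorem Rep.bits_le {s : St} {c : Config} (hc : Rep h A s c) (hs : Bdd h s) (hA : 1 ≤ A)
    (hβ : bits ((2 * h) ^ A) ≤ β) (x : ℕ) : bits (c.val x) ≤ β := by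
  refine (bits_mono ?_).trans hβ
  exact (hc.abs_val_le hs hA x).trans (le_abs_self _)

theorem assign_cost_le {s : ℕ → ℤ} (hβ : 1 ≤ β) (hs : ∀ x, bits (s x) ≤ β) (e : Expr) :
    e.cost s + bits (e.eval s) ≤ 2 * e.wt ^ 3 * β ^ 2 := by
  have h1 := Expr.cost_le hβ hs e
  have h2 := Expr.bits_eval_le hβ hs e
  have h3 : e.wt * β ≤ e.wt ^ 3 * β ^ 2 :=
    Nat.mul_le_mul (Nat.le_self_pow (by norm_num) _) (Nat.le_self_pow (by norm_num) _)
  linarith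

theorem powLoop_run {s : St} (hs : Bdd h s) (hA : 1 ≤ A)
    (hAh : (A : ℤ) ≤ (2 * h) ^ A) (hβ : bits ((2 * h) ^ A) ≤ β) :
    ∀ (m j : ℕ) (c : Config), Rep h A s c → c.val 2 = (2 * h) ^ j → c.val 5 = m → j + m ≤ A →
    ∃ c' n, Run (.loop (.var 5) (.seq (.assign 2 (.var 2 * (.const 2 * .var 8)))
      (.assign 5 (.var 5 - .const 1)))) c c' n ∧ n ≤ (m + 1) * (500 * β ^ 2) ∧ Rep h A s c' ∧
      c'.val 2 = (2 * h) ^ (j + m) := by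
  have h0 : 0 < h := (abs_nonneg _).trans_lt (hs.v 0)
  have hβ1 : 1 ≤ β := (one_le_bits _).trans hβ
  intro m
  induction m with
  | zero =>
    intro j c hc h2 h5 _
    refine ⟨c, _, Run.loop_stop _ (by simp [h5]), ?_, hc, by simpa using h2⟩
    have := Expr.cost_le hβ1 (hc.bits_le hs hA hβ) (.var 5)
    simp only [Expr.wt] at this
    nlinarith
  | succ m ih =>
    intro j c hc h2 h5 hj
    set c1 : Config := ⟨Function.update c.val 2 ((2 * h) ^ (j + 1)), c.out⟩ with hc1
    have hp : ∀ i, i ≤ A → |(2 * h) ^ i| ≤ (2 * h) ^ A := fun i hi => by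
      rw [abs_of_pos (by positivity)]
      exact pow_le_pow_right₀ (by omega) hi
    have r1 : Rep h A s c1 := by
      refine ⟨fun x => ?_, fun x => ?_, ?_, hc.out, ?_, ?_, fun x => ?_⟩
      · simp only [hc1]
        rw [Function.update_of_ne (by simp only [scal]; omega), hc.v]
      · simp only [hc1]
        rw [Function.update_of_ne (by simp only [arr]; omega), hc.a]
      · simp [hc1, hc.base]
      · simpa [hc1] using hp (j + 1) (by omega)
      · simpa [hc1] using hc.cnt
      · simp only [hc1, Function.update_apply]
        split_ifs
        exacts [hp _ (by omega), hc.rest x]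
    set c2 : Config := ⟨Function.update c1.val 5 (m : ℤ), c1.out⟩ with hc2
    have hm : |(m : ℤ)| ≤ (2 * h) ^ A := by
      rw [abs_of_nonneg (by positivity)]
      refine le_trans ?_ hAh
      exact_mod_cast (by omega : m ≤ A)
    have r2 : Rep h A s c2 := by
      refine ⟨fun x => ?_, fun x => ?_, ?_, r1.out, ?_, ?_, fun x => ?_⟩
      · simp only [hc2]
        rw [Function.update_of_ne (by simp only [scal]; omega), r1.v]
      · simp only [hc2]
        rw [Function.update_of_ne (by simp only [arr]; omega), r1.a]
      · simpa [hc2] using r1.base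
      · simpa [hc2] using r1.pw
      · simpa [hc2] using hm
      · simp only [hc2, Function.update_apply]
        split_ifs
        exacts [hm, r1.rest x]
    obtain ⟨c', n, hrun, hn, hrep, hval⟩ := ih (j + 1) c2 r2 (by simp [hc2, hc1]) (by simp [hc2])
      (by omega)
    have e1 : (Expr.var 2 * (Expr.const 2 * Expr.var 8)).eval c.val = (2 * h) ^ (j + 1) := by
      simp [h2, hc.base]
      ring
    have run1 : Run (.assign 2 (.var 2 * (.const 2 * .var 8))) c c1
        ((Expr.var 2 * (Expr.const 2 * Expr.var 8)).cost c.val + bits ((2 * h) ^ (j + 1))) := by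
      have := Run.assign 2 (Expr.var 2 * (Expr.const 2 * Expr.var 8)) c
      rw [e1] at this
      exact this
    have e2 : (Expr.var 5 - Expr.const 1).eval c1.val = m := by
      simp [hc1, h5]
    have run2 : Run (.assign 5 (.var 5 - .const 1)) c1 c2
        ((Expr.var 5 - Expr.const 1).cost c1.val + bits (m : ℤ)) := by
      have := Run.assign 5 (Expr.var 5 - Expr.const 1) c1
      rw [e2] at this
      exact this
    refine ⟨c', _, Run.loop_step (by simp [h5]) (Run.seq run1 run2) hrun, ?_, hrep, ?_⟩
    · have k1 := assign_cost_le hβ1 (hc.bits_le hs hA hβ) (.var 2 * (.const 2 * .var 8))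
      have k2 := assign_cost_le hβ1 (r1.bits_le hs hA hβ) (.var 5 - .const 1)
      have k3 := Expr.cost_le hβ1 (hc.bits_le hs hA hβ) (.var 5)
      rw [e1] at k1
      rw [e2] at k2
      have w1 : (Expr.var 2 * (Expr.const 2 * Expr.var 8)).wt = 5 := by decide
      have w2 : (Expr.var 5 - Expr.const 1).wt = 3 := by decide
      have w3 : (Expr.var 5).wt = 1 := rfl
      rw [w1] at k1
      rw [w2] at k2
      rw [w3] at k3
      nlinarith
    · rw [hval]
      congr 1
      omega

theorem powProg_run {s : St} {c : Config} (hc : Rep h A s c) (hs : Bdd h s) (hA : 1 ≤ A)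
    (hAh : (A : ℤ) ≤ (2 * h) ^ A) (hβ : bits ((2 * h) ^ A) ≤ β) {i : Expr} {j : ℕ}
    (hi : i.eval s.v = j) (hj : j < A) :
    ∃ c' n, Run (powProg i) c c' n ∧ n ≤ (A + 1) * ((2 * i.wt ^ 3 + 600) * β ^ 2) ∧ Rep h A s c' ∧
      c'.val 2 = (2 * h) ^ j := by
  have h0 : 0 < h := (abs_nonneg _).trans_lt (hs.v 0)
  have hβ1 : 1 ≤ β := (one_le_bits _).trans hβ
  have hev : (i.rename scal).eval c.val = j := by
    rw [Expr.eval_rename, ← hi]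
    congr 1
    funext x
    exact hc.v x
  set c1 : Config := ⟨Function.update c.val 5 (j : ℤ), c.out⟩ with hc1
  have hm : |(j : ℤ)| ≤ (2 * h) ^ A := by
    rw [abs_of_nonneg (by positivity)]
    refine le_trans ?_ hAh
    exact_mod_cast (by omega : j ≤ A)
  have r1 : Rep h A s c1 := by
    refine ⟨fun x => ?_, fun x => ?_, ?_, hc.out, ?_, ?_, fun x => ?_⟩
    · simp only [hc1]
      rw [Function.update_of_ne (by simp only [scal]; omega), hc.v]
    · simp only [hc1]
      rw [Function.update_of_ne (by simp only [arr]; omega), hc.a]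
    · simpa [hc1] using hc.base
    · simpa [hc1] using hc.pw
    · simpa [hc1] using hm
    · simp only [hc1, Function.update_apply]
      split_ifs
      exacts [hm, hc.rest x]
  set c2 : Config := ⟨Function.update c1.val 2 (1 : ℤ), c1.out⟩ with hc2
  have hone : |(1 : ℤ)| ≤ (2 * h) ^ A := by
    rw [abs_one]
    exact one_le_pow₀ (by omega)
  have r2 : Rep h A s c2 := by
    refine ⟨fun x => ?_, fun x => ?_, ?_, r1.out, ?_, ?_, fun x => ?_⟩
    · simp only [hc2]
      rw [Function.update_of_ne (by simp only [scal]; omega), r1.v]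
    · simp only [hc2]
      rw [Function.update_of_ne (by simp only [arr]; omega), r1.a]
    · simpa [hc2] using r1.base
    · simpa [hc2] using hone
    · simpa [hc2] using r1.cnt
    · simp only [hc2, Function.update_apply]
      split_ifs
      exacts [hone, r1.rest x]
  obtain ⟨c', n, hrun, hn, hrep, hval⟩ := powLoop_run hs hA hAh hβ j 0 c2 r2 (by simp [hc2])
    (by simp [hc2, hc1]) (by omega)
  have run1 : Run (.assign 5 (i.rename scal)) c c1 ((i.rename scal).cost c.val + bits (j : ℤ)) := by
    have := Run.assign 5 (i.rename scal) c
    rw [hev] at this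
    exact this
  have run2 : Run (.assign 2 (.const 1)) c1 c2 ((Expr.const 1).cost c1.val + bits 1) :=
    Run.assign 2 (Expr.const 1) c1
  refine ⟨c', _, Run.seq run1 (Run.seq run2 hrun), ?_, hrep, by simpa using hval⟩
  have k1 := assign_cost_le hβ1 (hc.bits_le hs hA hβ) (i.rename scal)
  have k2 := assign_cost_le hβ1 (r1.bits_le hs hA hβ) (.const 1)
  rw [hev, Expr.wt_rename] at k1
  have w : (Expr.const 1).wt = 2 := by decide
  rw [w, Expr.eval_const] at k2
  have k3 : (j + 1) * (500 * β ^ 2) ≤ A * (500 * β ^ 2) := Nat.mul_le_mul_right _ hj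
  have k4 : 2 * i.wt ^ 3 * β ^ 2 ≤ A * (2 * i.wt ^ 3 * β ^ 2) := Nat.le_mul_of_pos_left _ (by omega)
  have k5 : β ^ 2 ≤ A * β ^ 2 := Nat.le_mul_of_pos_left _ (by omega)
  nlinarith

theorem digitExpr_eval {s : St} {c : Config} (hc : Rep h A s c) (hs : Bdd h s) {a j : ℕ} (hj : j < A)
    (h2 : c.val 2 = (2 * h) ^ j) : (digitExpr a).eval c.val = s.a a j := by
  simp only [digitExpr, Expr.eval_sub, Expr.eval_mod, Expr.eval_add, Expr.eval_div, Expr.eval_mul,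
    Expr.eval_const, Expr.eval_var, h2, hc.base, hc.a]
  exact pack_digit rfl (hs.a a) hj

theorem Rep.set_scal {s : St} {c : Config} (hc : Rep h A s c) (x : ℕ) (z : ℤ) :
    Rep h A (s.setv x z) ⟨Function.update c.val (scal x) z, c.out⟩ := by
  refine ⟨fun y => ?_, fun y => ?_, ?_, hc.out, ?_, ?_, fun y => ?_⟩
  · simp only [St.setv, Function.update_apply, scal]
    by_cases hxy : y = x
    · simp [hxy]
    · rw [if_neg (by omega), if_neg hxy]
      exact hc.v y
  · have : arr y ≠ scal x := by simp only [arr, scal]; omega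
    simpa [St.setv, Function.update_of_ne this] using hc.a y
  · have : 8 ≠ scal x := by simp only [scal]; omega
    simpa [Function.update_of_ne this] using hc.base
  · have : 2 ≠ scal x := by simp only [scal]; omega
    simpa [Function.update_of_ne this] using hc.pw
  · have : 5 ≠ scal x := by simp only [scal]; omega
    simpa [Function.update_of_ne this] using hc.cnt
  · have : 3 * y + 2 ≠ scal x := by simp only [scal]; omega
    simpa [Function.update_of_ne this] using hc.rest y

theorem Rep.set_arr {s : St} {c : Config} (hc : Rep h A s c) (a : ℕ) (f : ℕ → ℤ) :
    Rep h A (s.seta a f) ⟨Function.update c.val (arr a) (pack (2 * h) f A), c.out⟩ := by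
  refine ⟨fun y => ?_, fun y => ?_, ?_, hc.out, ?_, ?_, fun y => ?_⟩
  · have : scal y ≠ arr a := by simp only [arr, scal]; omega
    simpa [St.seta, Function.update_of_ne this] using hc.v y
  · simp only [St.seta, Function.update_apply, arr]
    by_cases hxy : y = a
    · simp [hxy]
    · rw [if_neg (by omega), if_neg hxy]
      exact hc.a y
  · have : 8 ≠ arr a := by simp only [arr]; omega
    simpa [Function.update_of_ne this] using hc.base
  · have : 2 ≠ arr a := by simp only [arr]; omega
    simpa [Function.update_of_ne this] using hc.pw
  · have : 5 ≠ arr a := by simp only [arr]; omega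
    simpa [Function.update_of_ne this] using hc.cnt
  · have : 3 * y + 2 ≠ arr a := by simp only [arr]; omega
    simpa [Function.update_of_ne this] using hc.rest y

theorem Rep.eval_rename {s : St} {c : Config} (hc : Rep h A s c) (e : Expr) :
    (e.rename scal).eval c.val = e.eval s.v := by
  rw [Expr.eval_rename]
  congr 1
  funext x
  exact hc.v x

/-- Every step becomes a bounded number of operations on integers of at most `β` bits, except that
an array access builds the power of the base by as many multiplications as the address says. This
accounts for `A + 1`. The factor `fac` depends on the command only. -/
theorem Exec.simulate {p : Cmd} {s s' : St} {n : ℕ} (H : Exec h A p s s' n) (hA : 1 ≤ A)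
    (hAh : (A : ℤ) ≤ (2 * h) ^ A) (hβ : bits ((2 * h) ^ A) ≤ β) (hs : Bdd h s) :
    ∀ c, Rep h A s c →
    ∃ c' m, Run p.compile c c' m ∧ m ≤ n * (p.fac * ((A + 1) * β ^ 2)) ∧ Rep h A s' c' := by
  have hβ1 : 1 ≤ β := (one_le_bits _).trans hβ
  have hX : β ^ 2 ≤ (A + 1) * β ^ 2 := Nat.le_mul_of_pos_left _ (by omega)
  induction H with
  | set x e s he =>
    intro c hc
    refine ⟨_, _, Run.assign _ _ c, ?_, ?_⟩
    · have := assign_cost_le hβ1 (hc.bits_le hs hA hβ) (e.rename scal)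
      rw [Expr.wt_rename] at this
      simp only [Cmd.fac, one_mul]
      exact this.trans (Nat.mul_le_mul_left _ hX)
    · rw [hc.eval_rename]
      exact hc.set_scal x _
  | load x a i s j hi hj =>
    intro c hc
    obtain ⟨c1, n1, hrun, hn1, r1, h2⟩ := powProg_run hc hs hA hAh hβ hi hj
    refine ⟨_, _, Run.seq hrun (Run.assign _ _ c1), ?_, ?_⟩
    · have := assign_cost_le hβ1 (r1.bits_le hs hA hβ) (digitExpr a)
      have w : (digitExpr a).wt = 15 := digitExpr_wt a
      rw [w] at this
      simp only [Cmd.fac, one_mul]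
      nlinarith
    · rw [digitExpr_eval r1 hs hj h2]
      exact r1.set_scal x _
  | store a i e s j hi hj he =>
    intro c hc
    obtain ⟨c1, n1, hrun, hn1, r1, h2⟩ := powProg_run hc hs hA hAh hβ hi hj
    refine ⟨_, _, Run.seq hrun (Run.assign _ _ c1), ?_, ?_⟩
    · have := assign_cost_le hβ1 (r1.bits_le hs hA hβ)
        (.var (arr a) + (e.rename scal - digitExpr a) * .var 2)
      have w0 : (digitExpr a).wt = 15 := digitExpr_wt a
      have w : (Expr.var (arr a) + (e.rename scal - digitExpr a) * .var 2).wt = e.wt + 17 := by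
        have : (Expr.var (arr a) + (e.rename scal - digitExpr a) * .var 2).wt =
          1 + (((e.rename scal).wt + 15) + 1) := by
          rw [← w0]; rfl
        rw [this, Expr.wt_rename]
        omega
      rw [w] at this
      simp only [Cmd.fac, one_mul]
      have h3 := Nat.mul_le_mul_left (2 * (e.wt + 17) ^ 3) hX
      have h4 := Nat.zero_le (1400 * ((A + 1) * β ^ 2))
      nlinarith
    · have : (Expr.var (arr a) + (e.rename scal - digitExpr a) * .var 2).eval c1.val =
          pack (2 * h) (Function.update (s.a a) j (e.eval s.v)) A := by
        rw [pack_update _ _ hj]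
        simp [r1.eval_rename, digitExpr_eval r1 hs hj h2, h2, r1.a]
      rw [this]
      exact r1.set_arr a _
  | copy a b s =>
    intro c hc
    refine ⟨_, _, Run.assign _ _ c, ?_, ?_⟩
    · have := assign_cost_le hβ1 (hc.bits_le hs hA hβ) (.var (arr b))
      have w : (Expr.var (arr b)).wt = 1 := rfl
      rw [w] at this
      simp only [Cmd.fac, one_mul]
      linarith
    · rw [Expr.eval_var, hc.a]
      exact hc.set_arr a _
  | emit e s =>
    intro c hc
    refine ⟨_, _, Run.emit _ c, ?_, ?_⟩
    · have := assign_cost_le hβ1 (hc.bits_le hs hA hβ) (e.rename scal)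
      rw [Expr.wt_rename] at this
      simp only [Cmd.fac, one_mul]
      exact this.trans (Nat.mul_le_mul_left _ hX)
    · rw [hc.eval_rename]
      exact ⟨hc.v, hc.a, hc.base, by simp [hc.out], hc.pw, hc.cnt, hc.rest⟩
  | @seq p q s s1 s2 n m h1 h2 ih1 ih2 =>
    intro c hc
    obtain ⟨c1, m1, r1, b1, hc1⟩ := ih1 hs c hc
    obtain ⟨c2, m2, r2, b2, hc2⟩ := ih2 (h1.bdd hs) c1 hc1
    refine ⟨c2, _, Run.seq r1 r2, ?_, hc2⟩
    simp only [Cmd.fac]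
    calc m1 + m2 ≤ n * (p.fac * ((A + 1) * β ^ 2)) + m * (q.fac * ((A + 1) * β ^ 2)) :=
          add_le_add b1 b2
      _ ≤ n * ((p.fac + q.fac) * ((A + 1) * β ^ 2)) + m * ((p.fac + q.fac) * ((A + 1) * β ^ 2)) := by
          gcongr <;> omega
      _ = _ := by ring
  | @ite_pos e p q s s1 n he h1 ih =>
    intro c hc
    obtain ⟨c1, m1, r1, b1, hc1⟩ := ih hs c hc
    refine ⟨c1, _, Run.ite_pos _ (by rwa [hc.eval_rename]) r1, ?_, hc1⟩
    have k := Expr.cost_le hβ1 (hc.bits_le hs hA hβ) (e.rename scal)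
    rw [Expr.wt_rename] at k
    simp only [Cmd.fac]
    calc _ ≤ e.wt ^ 3 * ((A + 1) * β ^ 2) + n * (p.fac * ((A + 1) * β ^ 2)) :=
          add_le_add (k.trans (Nat.mul_le_mul_left _ hX)) b1
      _ ≤ (e.wt ^ 3 + (p.fac + q.fac)) * ((A + 1) * β ^ 2) +
          n * ((e.wt ^ 3 + (p.fac + q.fac)) * ((A + 1) * β ^ 2)) := by
          gcongr <;> omega
      _ = _ := by ring
  | @ite_neg e p q s s1 n he h1 ih =>
    intro c hc
    obtain ⟨c1, m1, r1, b1, hc1⟩ := ih hs c hc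
    refine ⟨c1, _, Run.ite_neg _ (by rwa [hc.eval_rename]) r1, ?_, hc1⟩
    have k := Expr.cost_le hβ1 (hc.bits_le hs hA hβ) (e.rename scal)
    rw [Expr.wt_rename] at k
    simp only [Cmd.fac]
    calc _ ≤ e.wt ^ 3 * ((A + 1) * β ^ 2) + n * (q.fac * ((A + 1) * β ^ 2)) :=
          add_le_add (k.trans (Nat.mul_le_mul_left _ hX)) b1
      _ ≤ (e.wt ^ 3 + (p.fac + q.fac)) * ((A + 1) * β ^ 2) +
          n * ((e.wt ^ 3 + (p.fac + q.fac)) * ((A + 1) * β ^ 2)) := by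
          gcongr <;> omega
      _ = _ := by ring
  | @loop_done e p s he =>
    intro c hc
    refine ⟨c, _, Run.loop_stop _ (by rwa [hc.eval_rename]), ?_, hc⟩
    have k := Expr.cost_le hβ1 (hc.bits_le hs hA hβ) (e.rename scal)
    rw [Expr.wt_rename] at k
    simp only [Cmd.fac, one_mul]
    exact (k.trans (Nat.mul_le_mul_left _ hX)).trans (Nat.mul_le_mul_right _ (by omega))
  | @loop_step e p s s1 s2 n m he h1 h2 ih1 ih2 =>
    intro c hc
    obtain ⟨c1, m1, r1, b1, hc1⟩ := ih1 hs c hc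
    obtain ⟨c2, m2, r2, b2, hc2⟩ := ih2 (h1.bdd hs) c1 hc1
    refine ⟨c2, _, Run.loop_step (by rwa [hc.eval_rename]) r1 r2, ?_, hc2⟩
    have k := Expr.cost_le hβ1 (hc.bits_le hs hA hβ) (e.rename scal)
    rw [Expr.wt_rename] at k
    simp only [Cmd.fac] at b2 ⊢
    calc _ ≤ e.wt ^ 3 * ((A + 1) * β ^ 2) + n * (p.fac * ((A + 1) * β ^ 2)) +
          m * ((e.wt ^ 3 + p.fac) * ((A + 1) * β ^ 2)) :=
          add_le_add (add_le_add (k.trans (Nat.mul_le_mul_left _ hX)) b1) b2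
      _ ≤ (e.wt ^ 3 + p.fac) * ((A + 1) * β ^ 2) + n * ((e.wt ^ 3 + p.fac) * ((A + 1) * β ^ 2)) +
          m * ((e.wt ^ 3 + p.fac) * ((A + 1) * β ^ 2)) := by
          gcongr <;> omega
      _ = _ := by ring

end Simulation

end Ram

/-! ### Proof rules for programs of the register machine -/

namespace Ram

open BitMachine

@[simp] theorem St.setv_v (s : St) (x y : ℕ) (z : ℤ) :
    (s.setv x z).v y = if y = x then z else s.v y := by
  simp [St.setv, Function.update_apply]

@[simp] theorem St.setv_a (s : St) (x : ℕ) (z : ℤ) : (s.setv x z).a = s.a := rfl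

@[simp] theorem St.setv_out (s : St) (x : ℕ) (z : ℤ) : (s.setv x z).out = s.out := rfl

@[simp] theorem St.seta_v (s : St) (b : ℕ) (f : ℕ → ℤ) : (s.seta b f).v = s.v := rfl

@[simp] theorem St.seta_a (s : St) (b c : ℕ) (f : ℕ → ℤ) :
    (s.seta b f).a c = if c = b then f else s.a c := by
  simp [St.seta, Function.update_apply]

namespace Cmd

/-- The scalar variables that a command may change. -/
def wv : Cmd → List ℕ
  | set x _ => [x]
  | load x _ _ => [x]
  | store _ _ _ => []
  | copy _ _ => []
  | emit _ => []
  | seq p q => p.wv ++ q.wv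
  | ite _ p q => p.wv ++ q.wv
  | loop _ p => p.wv

/-- The array variables that a command may change. -/
def wa : Cmd → List ℕ
  | set _ _ => []
  | load _ _ _ => []
  | store a _ _ => [a]
  | copy a _ => [a]
  | emit _ => []
  | seq p q => p.wa ++ q.wa
  | ite _ p q => p.wa ++ q.wa
  | loop _ p => p.wa

/-- Whether a command contains no output command. -/
def silent : Cmd → Bool
  | emit _ => false
  | seq p q => p.silent && q.silent
  | ite _ p q => p.silent && q.silent
  | loop _ p => p.silent
  | _ => true

/-- The loop `for x = 0, …, e - 1 do p`. -/
def for_ (x : ℕ) (e : Expr) (p : Cmd) : Cmd :=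
  .seq (.set x (.const 0)) (.loop (e - .var x) (.seq p (.set x (.var x + .const 1))))

end Cmd

/-- What a command leaves unchanged. -/
structure Frame (p : Cmd) (s s' : St) : Prop where
  v : ∀ y, y ∉ p.wv → s'.v y = s.v y
  a : ∀ b, b ∉ p.wa → s'.a b = s.a b
  out : p.silent = true → s'.out = s.out

/-- What stays unchanged is read off the syntax, so that later proofs get it from `decide` and loop
invariants need not mention it. -/
theorem Exec.frame {h : ℤ} {A : ℕ} {p : Cmd} {s s' : St} {n : ℕ} (H : Exec h A p s s' n) :
    Frame p s s' := by
  induction H with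
  | set x e s he =>
    exact ⟨fun y hy => by simp_all [Cmd.wv], fun _ _ => rfl, fun _ => rfl⟩
  | load x a i s j hi hj =>
    exact ⟨fun y hy => by simp_all [Cmd.wv], fun _ _ => rfl, fun _ => rfl⟩
  | store a i e s j hi hj he =>
    exact ⟨fun y hy => rfl, fun b hb => by simp_all [Cmd.wa], fun _ => rfl⟩
  | copy a b s =>
    exact ⟨fun y hy => rfl, fun b hb => by simp_all [Cmd.wa], fun _ => rfl⟩
  | emit e s => exact ⟨fun _ _ => rfl, fun _ _ => rfl, fun h => by simp [Cmd.silent] at h⟩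
  | seq _ _ ih1 ih2 =>
    refine ⟨fun y hy => ?_, fun b hb => ?_, fun ho => ?_⟩
    · simp only [Cmd.wv, List.mem_append, not_or] at hy
      rw [ih2.v y hy.2, ih1.v y hy.1]
    · simp only [Cmd.wa, List.mem_append, not_or] at hb
      rw [ih2.a b hb.2, ih1.a b hb.1]
    · simp only [Cmd.silent, Bool.and_eq_true] at ho
      rw [ih2.out ho.2, ih1.out ho.1]
  | ite_pos _ _ _ ih =>
    refine ⟨fun y hy => ?_, fun b hb => ?_, fun ho => ?_⟩
    · simp only [Cmd.wv, List.mem_append, not_or] at hy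
      exact ih.v y hy.1
    · simp only [Cmd.wa, List.mem_append, not_or] at hb
      exact ih.a b hb.1
    · simp only [Cmd.silent, Bool.and_eq_true] at ho
      exact ih.out ho.1
  | ite_neg _ _ _ ih =>
    refine ⟨fun y hy => ?_, fun b hb => ?_, fun ho => ?_⟩
    · simp only [Cmd.wv, List.mem_append, not_or] at hy
      exact ih.v y hy.2
    · simp only [Cmd.wa, List.mem_append, not_or] at hb
      exact ih.a b hb.2
    · simp only [Cmd.silent, Bool.and_eq_true] at ho
      exact ih.out ho.2
  | loop_done => exact ⟨fun _ _ => rfl, fun _ _ => rfl, fun _ => rfl⟩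
  | loop_step _ _ _ ih1 ih2 =>
    refine ⟨fun y hy => ?_, fun b hb => ?_, fun ho => ?_⟩
    · rw [ih2.v y hy, ih1.v y hy]
    · rw [ih2.a b hb, ih1.a b hb]
    · rw [ih2.out ho, ih1.out ho]

/-- The command `p` halts on the state `s`, and its result and its number of steps satisfy `Q`. -/
def Wp (h : ℤ) (A : ℕ) (p : Cmd) (s : St) (Q : St → ℕ → Prop) : Prop :=
  ∃ s' n, Exec h A p s s' n ∧ Q s' n

section Rules

variable {h : ℤ} {A : ℕ} {s : St} {Q : St → ℕ → Prop}

theorem Wp.mono {p : Cmd} {Q' : St → ℕ → Prop} (H : Wp h A p s Q')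
    (hQ : ∀ s' n, Frame p s s' → Q' s' n → Q s' n) : Wp h A p s Q := by
  obtain ⟨s', n, he, hq⟩ := H
  exact ⟨s', n, he, hQ s' n he.frame hq⟩

theorem wp_set {x : ℕ} {e : Expr} (he : |e.eval s.v| < h) (hQ : Q (s.setv x (e.eval s.v)) 1) :
    Wp h A (.set x e) s Q := ⟨_, _, .set x e s he, hQ⟩

theorem wp_load {x a : ℕ} {i : Expr} (j : ℕ) (hi : i.eval s.v = j) (hj : j < A)
    (hQ : Q (s.setv x (s.a a j)) 1) : Wp h A (.load x a i) s Q := ⟨_, _, .load x a i s j hi hj, hQ⟩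

theorem wp_store {a : ℕ} {i e : Expr} (j : ℕ) (hi : i.eval s.v = j) (hj : j < A)
    (he : |e.eval s.v| < h)
    (hQ : Q (s.seta a (Function.update (s.a a) j (e.eval s.v))) 1) : Wp h A (.store a i e) s Q :=
  ⟨_, _, .store a i e s j hi hj he, hQ⟩

theorem wp_copy {a b : ℕ} (hQ : Q (s.seta a (s.a b)) 1) : Wp h A (.copy a b) s Q :=
  ⟨_, _, .copy a b s, hQ⟩

theorem wp_emit {e : Expr} (hQ : Q ⟨s.v, s.a, s.out ++ [e.eval s.v]⟩ 1) : Wp h A (.emit e) s Q :=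
  ⟨_, _, .emit e s, hQ⟩

theorem wp_seq {p q : Cmd} (H : Wp h A p s fun s' n => Wp h A q s' fun s'' m => Q s'' (n + m)) :
    Wp h A (.seq p q) s Q := by
  obtain ⟨s', n, h1, s'', m, h2, hQ⟩ := H
  exact ⟨s'', _, .seq h1 h2, hQ⟩

theorem wp_ite {e : Expr} {p q : Cmd}
    (h1 : 0 < e.eval s.v → Wp h A p s fun s' n => Q s' (1 + n))
    (h2 : e.eval s.v ≤ 0 → Wp h A q s fun s' n => Q s' (1 + n)) : Wp h A (.ite e p q) s Q := by
  rcases lt_or_ge 0 (e.eval s.v) with he | he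
  · obtain ⟨s', n, hx, hQ⟩ := h1 he
    exact ⟨s', _, .ite_pos q he hx, hQ⟩
  · obtain ⟨s', n, hx, hQ⟩ := h2 he
    exact ⟨s', _, .ite_neg p he hx, hQ⟩

/-- Induction on the number `m` of rounds left. The frame relative to the state before the loop is
carried along, and by `hev` the body cannot change the value of the bound `e`. -/
theorem wp_for_aux {x : ℕ} {e : Expr} {p : Cmd} (N T : ℕ) (Inv : ℕ → St → Prop)
    (hx : x ∉ p.wv) (hev : ∀ y ∈ e.vars, y ∉ p.wv ∧ y ≠ x) (hNh : (N : ℤ) < h)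
    (hstep : ∀ i s', i < N → Frame (Cmd.for_ x e p) s s' → s'.v x = i → Inv i s' →
      Wp h A p s' fun s'' n => n ≤ T ∧ Inv (i + 1) (s''.setv x (i + 1 : ℕ))) :
    ∀ (m i : ℕ), i + m = N → ∀ s', Frame (Cmd.for_ x e p) s s' → s'.v x = i → e.eval s'.v = N →
      Inv i s' → ∃ s'' n, Exec h A (.loop (e - .var x) (.seq p (.set x (.var x + .const 1)))) s' s'' n ∧
        n ≤ m * (T + 2) + 1 ∧ Frame (Cmd.for_ x e p) s s'' ∧ Inv N s'' := by
  intro m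
  induction m with
  | zero =>
    intro i hi s' hf hvx he hI
    obtain rfl : i = N := by omega
    exact ⟨s', 1, .loop_done _ (by simp [hvx, he]), by omega, hf, hI⟩
  | succ m ih =>
    intro i hi s' hf hvx he hI
    obtain ⟨s1, n1, hx1, hT, hI1⟩ := hstep i s' (by omega) hf hvx hI
    have hf1 := hx1.frame
    have hvx1 : s1.v x = i := by rw [hf1.v x hx, hvx]
    have hset : Exec h A (.set x (.var x + .const 1)) s1 (s1.setv x (i + 1 : ℕ)) 1 := by
      have := Exec.set (h := h) (A := A) x (.var x + .const 1) s1 (by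
        simp only [Expr.eval_add, Expr.eval_var, Expr.eval_const, hvx1]
        rw [abs_of_nonneg (by positivity)]
        omega)
      simp only [Expr.eval_add, Expr.eval_var, Expr.eval_const, hvx1] at this
      simpa using this
    have hf2 : Frame (Cmd.for_ x e p) s (s1.setv x (i + 1 : ℕ)) := by
      refine ⟨fun y hy => ?_, fun b hb => ?_, fun ho => ?_⟩
      · rw [← hf.v y hy]
        simp only [Cmd.for_, Cmd.wv, List.mem_append, List.mem_singleton, not_or] at hy
        rw [St.setv_v, if_neg hy.1, hf1.v y hy.2.1]
      · rw [← hf.a b hb]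
        simp only [Cmd.for_, Cmd.wa, List.mem_append, List.not_mem_nil, not_or] at hb
        rw [St.setv_a, hf1.a b hb.2.1]
      · rw [← hf.out ho]
        simp only [Cmd.for_, Cmd.silent, Bool.and_eq_true] at ho
        rw [St.setv_out, hf1.out ho.2.1]
    obtain ⟨s2, n2, hx2, hT2, hfin⟩ := ih (i + 1) (by omega) _ hf2 (by simp) (by
      rw [← he]
      refine Expr.eval_congr fun y hy => ?_
      rw [St.setv_v, if_neg (hev y hy).2, hf1.v y (hev y hy).1]) hI1
    refine ⟨s2, _, .loop_step (by simp [hvx, he]; omega) (.seq hx1 hset) hx2, ?_, hfin⟩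
    rw [add_mul]
    omega

/-- The rule for `for` loops with an invariant. -/
theorem wp_for {x : ℕ} {e : Expr} {p : Cmd} (N T : ℕ) (Inv : ℕ → St → Prop)
    (hx : x ∉ p.wv) (hev : ∀ y ∈ e.vars, y ∉ p.wv ∧ y ≠ x) (hN : e.eval s.v = N) (hNh : (N : ℤ) < h)
    (h0 : Inv 0 (s.setv x 0))
    (hstep : ∀ i s', i < N → Frame (Cmd.for_ x e p) s s' → s'.v x = i → Inv i s' →
      Wp h A p s' fun s'' n => n ≤ T ∧ Inv (i + 1) (s''.setv x (i + 1 : ℕ)))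
    (hQ : ∀ s' n, Frame (Cmd.for_ x e p) s s' → n ≤ N * (T + 2) + 2 → Inv N s' → Q s' n) :
    Wp h A (Cmd.for_ x e p) s Q := by
  have hset : Exec h A (.set x (.const 0)) s (s.setv x 0) 1 := by
    exact Exec.set x (.const 0) s (by simp; omega)
  have hf : Frame (Cmd.for_ x e p) s (s.setv x 0) := by
    refine ⟨fun y hy => ?_, fun b hb => rfl, fun ho => rfl⟩
    simp only [Cmd.for_, Cmd.wv, List.mem_append, List.mem_singleton, not_or] at hy
    rw [St.setv_v, if_neg hy.1]
  obtain ⟨s', n, hx', hn, hf', hI⟩ := wp_for_aux N T Inv hx hev hNh hstep N 0 (by omega) _ hf (by simp)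
    (by
      rw [← hN]
      refine Expr.eval_congr fun y hy => ?_
      rw [St.setv_v, if_neg (hev y hy).2]) h0
  exact ⟨s', _, .seq hset hx', hQ s' _ hf' (by omega) hI⟩

end Rules

end Ram

/-! ### Quaternionic structure on coordinate vectors -/

namespace QuatLattice

open Matrix

variable {t : ℕ}

/-- The coordinate with number `q` in the block with number `l`. -/
def blk (l : Fin t) (q : Fin 4) : Fin (4 * t) :=
  finCongr (Nat.mul_comm t 4) (finProdFinEquiv (l, q))

/-- Block and number of a coordinate. -/
def unblk (j : Fin (4 * t)) : Fin t × Fin 4 :=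
  finProdFinEquiv.symm ((finCongr (Nat.mul_comm t 4)).symm j)

@[simp] theorem unblk_blk (l : Fin t) (q : Fin 4) : unblk (blk l q) = (l, q) := by
  simp [unblk, blk]

@[simp] theorem blk_unblk (j : Fin (4 * t)) : blk (unblk j).1 (unblk j).2 = j := by
  simp only [unblk, blk, Prod.mk.eta, Equiv.apply_symm_apply]

theorem blk_val (l : Fin t) (q : Fin 4) : (blk l q : ℕ) = 4 * l + q := by
  simp [blk]
  omega

theorem blk_injective {l l' : Fin t} {q q' : Fin 4} (h : blk l q = blk l' q') : l = l' ∧ q = q' := by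
  have := congrArg unblk h
  simpa using this

theorem forall_blk {P : Fin (4 * t) → Prop} :
    (∀ j, P j) ↔ ∀ l : Fin t, P (blk l 0) ∧ P (blk l 1) ∧ P (blk l 2) ∧ P (blk l 3) := by
  refine ⟨fun h l => ⟨h _, h _, h _, h _⟩, fun h j => ?_⟩
  rw [← blk_unblk j]
  obtain ⟨h0, h1, h2, h3⟩ := h (unblk j).1
  generalize (unblk j).2 = q
  fin_cases q <;> assumption

theorem sum_blk {M : Type*} [AddCommMonoid M] (f : Fin (4 * t) → M) :
    ∑ j, f j = ∑ l : Fin t, (f (blk l 0) + f (blk l 1) + f (blk l 2) + f (blk l 3)) := by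
  have : ∑ j, f j = ∑ x : Fin t × Fin 4, f (blk x.1 x.2) :=
    (Fintype.sum_equiv ((finProdFinEquiv).trans (finCongr (Nat.mul_comm t 4))) _ _
      fun x => rfl).symm
  rw [this, Fintype.sum_prod_type]
  simp [Fin.sum_univ_four]

section Ring

variable {R : Type*} [CommRing R]

/-- Left multiplication by the quaternion `i` in every block. -/
def quatI (x : Fin (4 * t) → R) : Fin (4 * t) → R := fun j =>
  ![-x (blk (unblk j).1 1), x (blk (unblk j).1 0), -x (blk (unblk j).1 3), x (blk (unblk j).1 2)]
    (unblk j).2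

/-- Left multiplication by the quaternion `j` in every block. -/
def quatJ (x : Fin (4 * t) → R) : Fin (4 * t) → R := fun j =>
  ![-x (blk (unblk j).1 2), x (blk (unblk j).1 3), x (blk (unblk j).1 0), -x (blk (unblk j).1 1)]
    (unblk j).2

@[simp] theorem quatI_blk0 (x : Fin (4 * t) → R) (l : Fin t) :
    quatI x (blk l 0) = -x (blk l 1) := by simp [quatI]
@[simp] theorem quatI_blk1 (x : Fin (4 * t) → R) (l : Fin t) :
    quatI x (blk l 1) = x (blk l 0) := by simp [quatI]
@[simp] theorem quatI_blk2 (x : Fin (4 * t) → R) (l : Fin t) :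
    quatI x (blk l 2) = -x (blk l 3) := by simp [quatI]
@[simp] theorem quatI_blk3 (x : Fin (4 * t) → R) (l : Fin t) :
    quatI x (blk l 3) = x (blk l 2) := by simp [quatI]
@[simp] theorem quatJ_blk0 (x : Fin (4 * t) → R) (l : Fin t) :
    quatJ x (blk l 0) = -x (blk l 2) := by simp [quatJ]
@[simp] theorem quatJ_blk1 (x : Fin (4 * t) → R) (l : Fin t) :
    quatJ x (blk l 1) = x (blk l 3) := by simp [quatJ]
@[simp] theorem quatJ_blk2 (x : Fin (4 * t) → R) (l : Fin t) :
    quatJ x (blk l 2) = x (blk l 0) := by simp [quatJ]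
@[simp] theorem quatJ_blk3 (x : Fin (4 * t) → R) (l : Fin t) :
    quatJ x (blk l 3) = -x (blk l 1) := by simp [quatJ]

theorem ext_blk {R : Type*} {x y : Fin (4 * t) → R} (h : ∀ l : Fin t, x (blk l 0) = y (blk l 0) ∧
    x (blk l 1) = y (blk l 1) ∧ x (blk l 2) = y (blk l 2) ∧ x (blk l 3) = y (blk l 3)) : x = y :=
  funext (forall_blk.2 h)

theorem dot_blk (x y : Fin (4 * t) → R) : x ⬝ᵥ y = ∑ l : Fin t,
    (x (blk l 0) * y (blk l 0) + x (blk l 1) * y (blk l 1) + x (blk l 2) * y (blk l 2) +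
      x (blk l 3) * y (blk l 3)) := sum_blk _

theorem quatI_add (x y : Fin (4 * t) → R) : quatI (x + y) = quatI x + quatI y :=
  ext_blk fun l => by simp; constructor <;> ring
theorem quatJ_add (x y : Fin (4 * t) → R) : quatJ (x + y) = quatJ x + quatJ y :=
  ext_blk fun l => by simp; constructor <;> ring
theorem quatI_smul (c : R) (x : Fin (4 * t) → R) : quatI (c • x) = c • quatI x :=
  ext_blk fun l => by simp
theorem quatJ_smul (c : R) (x : Fin (4 * t) → R) : quatJ (c • x) = c • quatJ x :=
  ext_blk fun l => by simp
theorem quatI_neg (x : Fin (4 * t) → R) : quatI (-x) = -quatI x :=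
  ext_blk fun l => by simp
theorem quatI_quatI (x : Fin (4 * t) → R) : quatI (quatI x) = -x :=
  ext_blk fun l => by simp
theorem quatJ_quatJ (x : Fin (4 * t) → R) : quatJ (quatJ x) = -x :=
  ext_blk fun l => by simp
theorem quatJ_quatI (x : Fin (4 * t) → R) : quatJ (quatI x) = -quatI (quatJ x) :=
  ext_blk fun l => by simp

theorem quatI_dot (x y : Fin (4 * t) → R) : quatI x ⬝ᵥ y = -(x ⬝ᵥ quatI y) := by
  rw [dot_blk, dot_blk, ← Finset.sum_neg_distrib]
  refine Finset.sum_congr rfl fun l _ => ?_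
  simp
  ring
theorem quatJ_dot (x y : Fin (4 * t) → R) : quatJ x ⬝ᵥ y = -(x ⬝ᵥ quatJ y) := by
  rw [dot_blk, dot_blk, ← Finset.sum_neg_distrib]
  refine Finset.sum_congr rfl fun l _ => ?_
  simp
  ring

theorem dot_quatI (x y : Fin (4 * t) → R) : x ⬝ᵥ quatI y = -(quatI x ⬝ᵥ y) := by
  rw [quatI_dot, neg_neg]
theorem dot_quatJ (x y : Fin (4 * t) → R) : x ⬝ᵥ quatJ y = -(quatJ x ⬝ᵥ y) := by
  rw [quatJ_dot, neg_neg]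

/-- A combination of a vector and its images under `i`, `j` and `k`. -/
def comb (c : Fin 4 → R) (x : Fin (4 * t) → R) : Fin (4 * t) → R :=
  c 0 • x + c 1 • quatI x + c 2 • quatJ x + c 3 • quatI (quatJ x)

end Ring

section Real

theorem self_dot_quatI (x : Fin (4 * t) → ℝ) : x ⬝ᵥ quatI x = 0 := by
  have := quatI_dot x x
  rw [dotProduct_comm] at this
  linarith

theorem self_dot_quatJ (x : Fin (4 * t) → ℝ) : x ⬝ᵥ quatJ x = 0 := by
  have := quatJ_dot x x
  rw [dotProduct_comm] at this
  linarith

theorem self_dot_quatIJ (x : Fin (4 * t) → ℝ) : x ⬝ᵥ quatI (quatJ x) = 0 := by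
  have h1 : x ⬝ᵥ quatI (quatJ x) = -(quatI x ⬝ᵥ quatJ x) := by rw [dot_quatI]
  have h2 : quatI x ⬝ᵥ quatJ x = -(quatJ (quatI x) ⬝ᵥ x) := by rw [dot_quatJ]
  rw [quatJ_quatI, neg_dotProduct, dotProduct_comm, neg_neg, dotProduct_comm (quatI (quatJ x))] at h2
  rw [dotProduct_comm] at h2
  linarith

theorem quatI_dot_quatI (x y : Fin (4 * t) → ℝ) : quatI x ⬝ᵥ quatI y = x ⬝ᵥ y := by
  rw [quatI_dot, quatI_quatI, dotProduct_neg, neg_neg]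

theorem quatJ_dot_quatJ (x y : Fin (4 * t) → ℝ) : quatJ x ⬝ᵥ quatJ y = x ⬝ᵥ y := by
  rw [quatJ_dot, quatJ_quatJ, dotProduct_neg, neg_neg]

theorem quatI_dot_quatJ (x : Fin (4 * t) → ℝ) : quatI x ⬝ᵥ quatJ x = 0 := by
  rw [quatI_dot, self_dot_quatIJ, neg_zero]

/-- A vector and its images under `i`, `j`, `k` are pairwise orthogonal and equally long, so the
norm of a quaternion is multiplicative on vectors. -/
theorem comb_dot_self (c : Fin 4 → ℝ) (x : Fin (4 * t) → ℝ) :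
    comb c x ⬝ᵥ comb c x = (c 0 ^ 2 + c 1 ^ 2 + c 2 ^ 2 + c 3 ^ 2) * (x ⬝ᵥ x) := by
  have a1 := self_dot_quatI x
  have a2 := self_dot_quatJ x
  have a3 := self_dot_quatIJ x
  have a4 := quatI_dot_quatJ x
  have a5 : quatI x ⬝ᵥ quatI (quatJ x) = 0 := by rw [quatI_dot_quatI, a2]
  have a6 : quatJ x ⬝ᵥ quatI (quatJ x) = 0 := self_dot_quatI (quatJ x)
  have b1 := quatI_dot_quatI x x
  have b2 := quatJ_dot_quatJ x x
  have b3 := quatI_dot_quatI (quatJ x) (quatJ x)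
  simp only [comb, add_dotProduct, dotProduct_add, smul_dotProduct, dotProduct_smul, smul_eq_mul]
  rw [dotProduct_comm (quatI x) x, dotProduct_comm (quatJ x) x, dotProduct_comm (quatJ x) (quatI x),
    dotProduct_comm (quatI (quatJ x)) x, dotProduct_comm (quatI (quatJ x)) (quatI x),
    dotProduct_comm (quatI (quatJ x)) (quatJ x), a1, a2, a3, a4, a5, a6, b3, b2, b1]
  ring

theorem comb_eq_zero {c : Fin 4 → ℝ} {x : Fin (4 * t) → ℝ} (hx : x ≠ 0) (h : comb c x = 0) :
    c = 0 := by
  have h1 := comb_dot_self c x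
  rw [h, zero_dotProduct] at h1
  have h2 : x ⬝ᵥ x ≠ 0 := fun h => hx (dotProduct_self_eq_zero.1 h)
  have h3 : c 0 ^ 2 + c 1 ^ 2 + c 2 ^ 2 + c 3 ^ 2 = 0 := by
    rcases mul_eq_zero.1 h1.symm with h | h
    exacts [h, absurd h h2]
  funext q
  fin_cases q <;> simp <;> nlinarith [sq_nonneg (c 0), sq_nonneg (c 1), sq_nonneg (c 2), sq_nonneg (c 3)]

/-- The map that stretches the direction `y` by the factor `1 + α`, acting on row vectors. -/
noncomputable def stretch (α : ℝ) (y : Fin (4 * t) → ℝ) : Matrix (Fin (4 * t)) (Fin (4 * t)) ℝ :=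
  1 + (α / (y ⬝ᵥ y)) • vecMulVec y y

theorem vecMul_stretch (α : ℝ) (x y : Fin (4 * t) → ℝ) :
    x ᵥ* stretch α y = x + (α / (y ⬝ᵥ y) * (x ⬝ᵥ y)) • y := by
  rw [stretch, vecMul_add, vecMul_one, vecMul_smul, vecMul_vecMulVec, smul_smul]

theorem det_stretch (α : ℝ) {y : Fin (4 * t) → ℝ} (hy : y ≠ 0) : (stretch α y).det = 1 + α := by
  have h2 : y ⬝ᵥ y ≠ 0 := fun h => hy (dotProduct_self_eq_zero.1 h)
  rw [stretch, ← smul_vecMulVec, vecMulVec_eq Unit, det_one_add_replicateCol_mul_replicateRow,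
    dotProduct_smul, smul_eq_mul]
  field_simp

theorem dot_self_nonneg (x : Fin (4 * t) → ℝ) : 0 ≤ x ⬝ᵥ x :=
  Finset.sum_nonneg fun i _ => mul_self_nonneg (x i)

theorem dot_self_le_vecMul_stretch {α : ℝ} (hα : 0 ≤ α) (x y : Fin (4 * t) → ℝ) :
    x ⬝ᵥ x ≤ (x ᵥ* stretch α y) ⬝ᵥ (x ᵥ* stretch α y) := by
  rw [vecMul_stretch]
  simp only [add_dotProduct, dotProduct_add, smul_dotProduct, dotProduct_smul, smul_eq_mul]
  rw [dotProduct_comm y x]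
  have h1 := dot_self_nonneg y
  have h2 : 0 ≤ α / (y ⬝ᵥ y) := by positivity
  have h3 := mul_nonneg h2 (mul_self_nonneg (x ⬝ᵥ y))
  have h4 := mul_nonneg (mul_self_nonneg (α / (y ⬝ᵥ y) * (x ⬝ᵥ y))) h1
  nlinarith

/-- The map that stretches the quaternionic line through `y` by the factor `1 + α`. -/
noncomputable def quatStretch (α : ℝ) (y : Fin (4 * t) → ℝ) :
    Matrix (Fin (4 * t)) (Fin (4 * t)) ℝ :=
  stretch α y * stretch α (quatI y) * stretch α (quatJ (quatI y)) *
    stretch α (quatI (quatJ (quatI y)))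

/-- The directions in `quatStretch` arise by applying `quatI`, `quatJ`, `quatI` in turn, as the
program does with a single vector in place. Up to sign they are `y` and its images under `i`, `k`,
`j`. -/
theorem quatIJI (y : Fin (4 * t) → ℝ) : quatI (quatJ (quatI y)) = quatJ y := by
  rw [quatJ_quatI, quatI_neg, quatI_quatI, neg_neg]

theorem quatI_ne_zero {y : Fin (4 * t) → ℝ} (hy : y ≠ 0) : quatI y ≠ 0 := by
  intro h
  have := quatI_quatI y
  rw [h] at this
  apply hy
  rw [← neg_eq_zero, ← this]
  exact ext_blk fun l => by simp

theorem quatJ_ne_zero {y : Fin (4 * t) → ℝ} (hy : y ≠ 0) : quatJ y ≠ 0 := by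
  intro h
  have := quatJ_quatJ y
  rw [h] at this
  apply hy
  rw [← neg_eq_zero, ← this]
  exact ext_blk fun l => by simp

theorem det_quatStretch (α : ℝ) {y : Fin (4 * t) → ℝ} (hy : y ≠ 0) :
    (quatStretch α y).det = (1 + α) ^ 4 := by
  rw [quatStretch, det_mul, det_mul, det_mul, det_stretch α hy, det_stretch α (quatI_ne_zero hy),
    det_stretch α (quatJ_ne_zero (quatI_ne_zero hy)),
    det_stretch α (quatI_ne_zero (quatJ_ne_zero (quatI_ne_zero hy)))]
  ring

theorem dot_self_le_vecMul_quatStretch {α : ℝ} (hα : 0 ≤ α) (x y : Fin (4 * t) → ℝ) :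
    x ⬝ᵥ x ≤ (x ᵥ* quatStretch α y) ⬝ᵥ (x ᵥ* quatStretch α y) := by
  simp only [quatStretch, ← vecMul_vecMul]
  exact (dot_self_le_vecMul_stretch hα _ _).trans ((dot_self_le_vecMul_stretch hα _ _).trans
    ((dot_self_le_vecMul_stretch hα _ _).trans (dot_self_le_vecMul_stretch hα _ _)))

/-- The four directions are orthogonal, so the four stretches do not interact and together add `α`
times the projection to the quaternionic line of `y`. In this form the map is seen to commute with
`quatI` and `quatJ`. -/
theorem vecMul_quatStretch (α : ℝ) (x y : Fin (4 * t) → ℝ) :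
    x ᵥ* quatStretch α y = x + (α / (y ⬝ᵥ y)) • comb ![x ⬝ᵥ y, x ⬝ᵥ quatI y, x ⬝ᵥ quatJ y,
      x ⬝ᵥ quatI (quatJ y)] y := by
  have b3 := quatI_dot_quatI (quatJ y) (quatJ y)
  have b2 := quatJ_dot_quatJ y y
  have b1 := quatI_dot_quatI y y
  have a1 := self_dot_quatI y
  have a2 := self_dot_quatJ y
  have a3 := self_dot_quatIJ y
  have a4 := quatI_dot_quatJ y
  have a5 : quatI y ⬝ᵥ quatI (quatJ y) = 0 := by rw [quatI_dot_quatI, a2]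
  have a7 : quatI (quatJ y) ⬝ᵥ quatJ y = 0 := by rw [dotProduct_comm, self_dot_quatI]
  rw [quatStretch, quatIJI, quatJ_quatI]
  simp only [← vecMul_vecMul, vecMul_stretch, add_dotProduct,
    smul_dotProduct, dotProduct_neg, neg_dotProduct, b1, b2, b3, a1, a2, a3, a4, a5, a7,
    smul_eq_mul, smul_neg, mul_neg, neg_neg]
  simp [comb, smul_smul]
  abel

theorem quatI_comb (c : Fin 4 → ℝ) (x : Fin (4 * t) → ℝ) :
    quatI (comb c x) = comb ![-c 1, c 0, -c 3, c 2] x := by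
  simp only [comb, quatI_add, quatI_smul, quatI_quatI]
  simp
  abel

theorem quatJ_comb (c : Fin 4 → ℝ) (x : Fin (4 * t) → ℝ) :
    quatJ (comb c x) = comb ![-c 2, c 3, c 0, -c 1] x := by
  simp only [comb, quatJ_add, quatJ_smul, quatJ_quatJ, quatJ_quatI, quatI_neg]
  simp
  abel

theorem quatI_vecMul_quatStretch (α : ℝ) (x y : Fin (4 * t) → ℝ) :
    quatI (x ᵥ* quatStretch α y) = quatI x ᵥ* quatStretch α y := by
  rw [vecMul_quatStretch, vecMul_quatStretch, quatI_add, quatI_smul, quatI_comb]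
  congr 3
  simp only [quatI_dot, quatI_quatI, dotProduct_neg, neg_neg]
  simp

theorem quatJ_vecMul_quatStretch (α : ℝ) (x y : Fin (4 * t) → ℝ) :
    quatJ (x ᵥ* quatStretch α y) = quatJ x ᵥ* quatStretch α y := by
  rw [vecMul_quatStretch, vecMul_quatStretch, quatJ_add, quatJ_smul, quatJ_comb]
  congr 3
  simp only [quatJ_dot, quatJ_quatJ, quatJ_quatI, quatI_neg, dotProduct_neg, neg_neg]
  simp

theorem comb_vecMul_quatStretch (α : ℝ) (c : Fin 4 → ℝ) {y : Fin (4 * t) → ℝ} (hy : y ≠ 0) :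
    comb c y ᵥ* quatStretch α y = (1 + α) • comb c y := by
  have h2 : y ⬝ᵥ y ≠ 0 := fun h => hy (dotProduct_self_eq_zero.1 h)
  have b3 := quatI_dot_quatI (quatJ y) (quatJ y)
  have b2 := quatJ_dot_quatJ y y
  have b1 := quatI_dot_quatI y y
  have a1 := self_dot_quatI y
  have a2 := self_dot_quatJ y
  have a3 := self_dot_quatIJ y
  have a4 := quatI_dot_quatJ y
  have a5 : quatI y ⬝ᵥ quatI (quatJ y) = 0 := by rw [quatI_dot_quatI, a2]
  have a6 : quatJ y ⬝ᵥ quatI (quatJ y) = 0 := self_dot_quatI (quatJ y)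
  have hc : ![comb c y ⬝ᵥ y, comb c y ⬝ᵥ quatI y, comb c y ⬝ᵥ quatJ y, comb c y ⬝ᵥ quatI (quatJ y)] =
      (y ⬝ᵥ y) • c := by
    funext q
    fin_cases q <;>
    simp only [comb, add_dotProduct, smul_dotProduct, smul_eq_mul] <;>
    simp [dotProduct_comm (quatI y) y, dotProduct_comm (quatJ y) y,
      dotProduct_comm (quatJ y) (quatI y), dotProduct_comm (quatI (quatJ y)) y,
      dotProduct_comm (quatI (quatJ y)) (quatI y), dotProduct_comm (quatI (quatJ y)) (quatJ y),
      a1, a2, a3, a4, a5, a6, b1, b2, b3, mul_comm]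
  rw [vecMul_quatStretch, hc]
  have : comb ((y ⬝ᵥ y) • c) y = (y ⬝ᵥ y) • comb c y := by
    simp [comb, smul_smul]
  rw [this, smul_smul, div_mul_cancel₀ _ h2, add_smul, one_smul]

end Real

end QuatLattice

/-! ### Hurwitz units and the potential of short vectors -/

namespace QuatLattice

open Matrix

variable {t : ℕ}

/-- Integer vectors as real vectors. -/
def toReal (x : Fin (4 * t) → ℤ) : Fin (4 * t) → ℝ := fun j => (x j : ℝ)

theorem toReal_dot (x y : Fin (4 * t) → ℤ) : toReal x ⬝ᵥ toReal y = ((x ⬝ᵥ y : ℤ) : ℝ) := by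
  simp [toReal, dotProduct]

theorem toReal_quatI (x : Fin (4 * t) → ℤ) : toReal (quatI x) = quatI (toReal x) :=
  ext_blk fun l => by simp [toReal]

theorem toReal_quatJ (x : Fin (4 * t) → ℤ) : toReal (quatJ x) = quatJ (toReal x) :=
  ext_blk fun l => by simp [toReal]

theorem toReal_comb (c : Fin 4 → ℤ) (x : Fin (4 * t) → ℤ) :
    toReal (comb c x) = comb (fun q => (c q : ℝ)) (toReal x) := by
  simp only [comb, ← toReal_quatJ, ← toReal_quatI]
  funext j
  simp [toReal]

/-- Twice the coordinates of the `24` Hurwitz units. -/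
def units : Finset (Fin 4 → ℤ) :=
  (Fintype.piFinset fun _ => {-2, -1, 0, 1, 2}).filter fun c =>
    c 0 ^ 2 + c 1 ^ 2 + c 2 ^ 2 + c 3 ^ 2 = 4 ∧ c 0 % 2 = c 1 % 2 ∧ c 1 % 2 = c 2 % 2 ∧
      c 2 % 2 = c 3 % 2

theorem card_units : units.card = 24 := by decide +kernel

theorem sq_sum_of_mem_units {c : Fin 4 → ℤ} (hc : c ∈ units) :
    c 0 ^ 2 + c 1 ^ 2 + c 2 ^ 2 + c 3 ^ 2 = 4 := (Finset.mem_filter.1 hc).2.1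

/-- A matrix acting on row vectors is linear for the quaternions. -/
structure QuatLinear (T : Matrix (Fin (4 * t)) (Fin (4 * t)) ℝ) : Prop where
  i : ∀ x, quatI (x ᵥ* T) = quatI x ᵥ* T
  j : ∀ x, quatJ (x ᵥ* T) = quatJ x ᵥ* T

theorem QuatLinear.one : QuatLinear (1 : Matrix (Fin (4 * t)) (Fin (4 * t)) ℝ) :=
  ⟨fun x => by simp, fun x => by simp⟩

theorem QuatLinear.mul_quatStretch {T : Matrix (Fin (4 * t)) (Fin (4 * t)) ℝ} (hT : QuatLinear T)
    (α : ℝ) (y : Fin (4 * t) → ℝ) : QuatLinear (T * quatStretch α y) :=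
  ⟨fun x => by rw [← vecMul_vecMul, quatI_vecMul_quatStretch, hT.i, vecMul_vecMul],
    fun x => by rw [← vecMul_vecMul, quatJ_vecMul_quatStretch, hT.j, vecMul_vecMul]⟩

theorem QuatLinear.comb {T : Matrix (Fin (4 * t)) (Fin (4 * t)) ℝ} (hT : QuatLinear T)
    (c : Fin 4 → ℝ) (x : Fin (4 * t) → ℝ) :
    QuatLattice.comb c x ᵥ* T = QuatLattice.comb c (x ᵥ* T) := by
  simp only [QuatLattice.comb, add_vecMul, smul_vecMul, hT.i, hT.j]

/-- The squared length of the image of an integer vector. -/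
noncomputable def nrm (T : Matrix (Fin (4 * t)) (Fin (4 * t)) ℝ) (x : Fin (4 * t) → ℤ) : ℝ :=
  (toReal x ᵥ* T) ⬝ᵥ (toReal x ᵥ* T)

theorem nrm_nonneg (T : Matrix (Fin (4 * t)) (Fin (4 * t)) ℝ) (x : Fin (4 * t) → ℤ) :
    0 ≤ nrm T x := dot_self_nonneg _

theorem nrm_le_nrm_mul_quatStretch {α : ℝ} (hα : 0 ≤ α) (T : Matrix (Fin (4 * t)) (Fin (4 * t)) ℝ)
    (y : Fin (4 * t) → ℝ) (x : Fin (4 * t) → ℤ) : nrm T x ≤ nrm (T * quatStretch α y) x := by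
  simp only [nrm, ← vecMul_vecMul]
  exact dot_self_le_vecMul_quatStretch hα _ _

/-- The number of pairs of a level `j ≤ S` and a vector that is short at the level `j`. -/
noncomputable def potential (X : Finset (Fin (4 * t) → ℤ)) (ρ r : ℝ) (S : ℕ)
    (T : Matrix (Fin (4 * t)) (Fin (4 * t)) ℝ) : ℕ :=
  ∑ j ∈ Finset.range (S + 1), (X.filter fun x => ρ ^ (2 * j) * nrm T x < r).card

/-- A set of integer vectors is closed under multiplication by the Hurwitz units. -/
def UnitClosed (X : Set (Fin (4 * t) → ℤ)) : Prop :=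
  ∀ x ∈ X, ∀ c ∈ units, ∃ z ∈ X, (2 : ℤ) • z = comb c x

/-- The 24 unit multiples of `x` are distinct, equally long under `T`, and lengthened by exactly
`ρ`. If they were short on all `S + 1` levels, they alone would make up a potential of `24 * (S +
1)`. So they have a last level `j0 ≤ S`, and the stretch removes all of them from it. No level gains
a vector, because nothing gets shorter. -/
theorem potential_mul_quatStretch {X : Finset (Fin (4 * t) → ℤ)} (hX : UnitClosed (X : Set (Fin (4 * t) → ℤ)))
    {ρ r : ℝ} {S : ℕ} (hρ : 1 ≤ ρ)
    {T : Matrix (Fin (4 * t)) (Fin (4 * t)) ℝ} (hT : QuatLinear T)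
    (hlt : potential X ρ r S T < 24 * (S + 1)) {x : Fin (4 * t) → ℤ} (hx : x ∈ X)
    (hxT : toReal x ᵥ* T ≠ 0) (hxr : nrm T x < r) :
    potential X ρ r S (T * quatStretch (ρ - 1) (toReal x ᵥ* T)) + 24 ≤ potential X ρ r S T := by
  classical
  set y := toReal x ᵥ* T with hy
  set T' := T * quatStretch (ρ - 1) y with hT'
  have hx0 : toReal x ≠ 0 := by
    rintro h
    rw [hy, h, zero_vecMul] at hxT
    exact hxT rfl
  choose! f hf hf2 using hX x hx
  have hfinj : Set.InjOn f (units : Set (Fin 4 → ℤ)) := by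
    intro c hc c' hc' h
    have h1 := hf2 c hc
    have h2 := hf2 c' hc'
    rw [h, h2] at h1
    have h3 := congrArg toReal h1
    rw [toReal_comb, toReal_comb] at h3
    have h4 : comb (fun q => ((c q : ℝ) - c' q)) (toReal x) = 0 := by
      have : comb (fun q => ((c q : ℝ) - c' q)) (toReal x) =
          comb (fun q => (c q : ℝ)) (toReal x) - comb (fun q => (c' q : ℝ)) (toReal x) := by
        simp only [comb, sub_smul]
        abel
      rw [this, h3, sub_self]
    have h5 := comb_eq_zero hx0 h4
    funext q
    have := congrFun h5 q
    simp only [Pi.zero_apply, sub_eq_zero] at this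
    exact_mod_cast this
  have himg : ∀ c ∈ units, toReal (f c) = (1 / 2 : ℝ) • comb (fun q => (c q : ℝ)) (toReal x) := by
    intro c hc
    rw [← toReal_comb, ← hf2 c hc]
    funext j
    simp [toReal]
  have hsq : ∀ c ∈ units, ((c 0 : ℝ) ^ 2 + (c 1 : ℝ) ^ 2 + (c 2 : ℝ) ^ 2 + (c 3 : ℝ) ^ 2) = 4 := by
    intro c hc
    exact_mod_cast sq_sum_of_mem_units hc
  have hTf : ∀ c ∈ units, nrm T (f c) = nrm T x := by
    intro c hc
    simp only [nrm]
    rw [himg c hc, smul_vecMul, hT.comb, smul_dotProduct, dotProduct_smul, comb_dot_self, hsq c hc,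
      smul_eq_mul, smul_eq_mul]
    ring
  have hT'f : ∀ c ∈ units, nrm T' (f c) = ρ ^ 2 * nrm T x := by
    intro c hc
    simp only [nrm]
    rw [himg c hc, smul_vecMul, hT', ← vecMul_vecMul, hT.comb, comb_vecMul_quatStretch _ _ hxT,
      smul_dotProduct, dotProduct_smul, smul_dotProduct, dotProduct_smul, comb_dot_self, hsq c hc]
    simp only [smul_eq_mul]
    ring
  have hmono : ∀ z, nrm T z ≤ nrm T' z := fun z =>
    nrm_le_nrm_mul_quatStretch (by linarith) T y z
  have hρ0 : 0 < ρ := by linarith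
  have hsub : ∀ j, (X.filter fun x => ρ ^ (2 * j) * nrm T' x < r) ⊆
      X.filter fun x => ρ ^ (2 * j) * nrm T x < r := by
    intro j z hz
    rw [Finset.mem_filter] at hz ⊢
    exact ⟨hz.1, (mul_le_mul_of_nonneg_left (hmono z) (by positivity)).trans_lt hz.2⟩
  have hex : ∃ j ∈ Finset.range (S + 1), r ≤ ρ ^ (2 * (j + 1)) * nrm T x := by
    by_contra! hcon
    have hall : ∀ j ∈ Finset.range (S + 1), ρ ^ (2 * j) * nrm T x < r := by
      intro j hj
      rcases Nat.eq_zero_or_pos j with rfl | hj0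
      · simpa using hxr
      · obtain ⟨i, rfl⟩ : ∃ i, j = i + 1 := ⟨j - 1, by omega⟩
        exact hcon i (by simp at hj ⊢; omega)
    have : 24 * (S + 1) ≤ potential X ρ r S T := by
      rw [potential, mul_comm, ← smul_eq_mul, ← Finset.card_range (S + 1)]
      conv_rhs => rw [Finset.card_range]
      refine Finset.card_nsmul_le_sum _ _ _ fun j hj => ?_
      rw [← card_units, ← Finset.card_image_of_injOn hfinj]
      refine Finset.card_le_card fun z hz => ?_
      obtain ⟨c, hc, rfl⟩ := Finset.mem_image.1 hz
      rw [Finset.mem_filter, hTf c hc]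
      exact ⟨hf c hc, hall j hj⟩
    omega
  -- The last level on which `x` is short: one more factor `ρ` carries the whole orbit beyond `r`.
  set j0 := Nat.find (⟨hex.choose, hex.choose_spec.2⟩ : ∃ j, r ≤ ρ ^ (2 * (j + 1)) * nrm T x) with hj0
  have hj0r : r ≤ ρ ^ (2 * (j0 + 1)) * nrm T x := Nat.find_spec
    (⟨hex.choose, hex.choose_spec.2⟩ : ∃ j, r ≤ ρ ^ (2 * (j + 1)) * nrm T x)
  have hj0S : j0 ∈ Finset.range (S + 1) := by
    have h1 : j0 ≤ hex.choose := Nat.find_min' _ hex.choose_spec.2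
    have h2 := hex.choose_spec.1
    rw [Finset.mem_range] at h2 ⊢
    omega
  have hj0lt : ρ ^ (2 * j0) * nrm T x < r := by
    rcases Nat.eq_zero_or_pos j0 with h | h
    · rw [h]
      simpa using hxr
    · obtain ⟨i, hi⟩ : ∃ i, j0 = i + 1 := ⟨j0 - 1, by omega⟩
      have := Nat.find_min (⟨hex.choose, hex.choose_spec.2⟩ :
        ∃ j, r ≤ ρ ^ (2 * (j + 1)) * nrm T x) (m := i) (by rw [← hj0]; omega)
      rw [hi]
      exact not_le.1 this
  have hdrop : (X.filter fun x => ρ ^ (2 * j0) * nrm T' x < r).card + 24 ≤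
      (X.filter fun x => ρ ^ (2 * j0) * nrm T x < r).card := by
    rw [← card_units, ← Finset.card_image_of_injOn hfinj, ← Finset.card_union_of_disjoint]
    · refine Finset.card_le_card (Finset.union_subset (hsub j0) fun z hz => ?_)
      obtain ⟨c, hc, rfl⟩ := Finset.mem_image.1 hz
      rw [Finset.mem_filter, hTf c hc]
      exact ⟨hf c hc, hj0lt⟩
    · rw [Finset.disjoint_right]
      intro z hz hz'
      obtain ⟨c, hc, rfl⟩ := Finset.mem_image.1 hz
      rw [Finset.mem_filter, hT'f c hc] at hz'
      have := hz'.2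
      rw [← mul_assoc, ← pow_add, show 2 * j0 + 2 = 2 * (j0 + 1) by ring] at this
      linarith
  rw [potential, potential, ← Finset.add_sum_erase _ _ hj0S, ← Finset.add_sum_erase _ (fun j =>
    (X.filter fun x => ρ ^ (2 * j) * nrm T x < r).card) hj0S]
  have hrest : ∑ j ∈ (Finset.range (S + 1)).erase j0, (X.filter fun x => ρ ^ (2 * j) * nrm T' x < r).card
      ≤ ∑ j ∈ (Finset.range (S + 1)).erase j0, (X.filter fun x => ρ ^ (2 * j) * nrm T x < r).card :=
    Finset.sum_le_sum fun j _ => Finset.card_le_card (hsub j)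
  omega

end QuatLattice

/-! ### Sublattices of `D₄ᵗ` that annihilate a vector modulo `p`, and their mean value -/

namespace QuatLattice

open Matrix

variable {t : ℕ}

/-- Vectors that lie in the lattice `D₄` in every block. -/
def InD4 (x : Fin (4 * t) → ℤ) : Prop :=
  ∀ l : Fin t, Even (x (blk l 0) + x (blk l 1) + x (blk l 2) + x (blk l 3))

section Field

variable {F : Type*} [CommRing F]

/-- The first coordinate of the action of the blocks of `x` on vectors `w`, through the matrices
that represent quaternions when `a ^ 2 + b ^ 2 = -1`. -/
def psi₁ (a b : F) (w : Fin t → F × F) (x : Fin (4 * t) → ℤ) : F :=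
  ∑ l, ((x (blk l 0) + x (blk l 2) * a - x (blk l 3) * b) * (w l).1 +
    (-x (blk l 1) + x (blk l 2) * b + x (blk l 3) * a) * (w l).2)

/-- The second coordinate of the same action. -/
def psi₂ (a b : F) (w : Fin t → F × F) (x : Fin (4 * t) → ℤ) : F :=
  ∑ l, ((x (blk l 1) + x (blk l 2) * b + x (blk l 3) * a) * (w l).1 +
    (x (blk l 0) - x (blk l 2) * a + x (blk l 3) * b) * (w l).2)

/-- The lattice of the vectors in `D₄ᵗ` that annihilate `w`. -/
def annLattice (a b : F) (w : Fin t → F × F) : Set (Fin (4 * t) → ℤ) :=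
  {x | InD4 x ∧ psi₁ a b w x = 0 ∧ psi₂ a b w x = 0}

variable {a b : F} (w : Fin t → F × F) (x : Fin (4 * t) → ℤ)

theorem psi₁_add (y : Fin (4 * t) → ℤ) : psi₁ a b w (x + y) = psi₁ a b w x + psi₁ a b w y := by
  simp only [psi₁, ← Finset.sum_add_distrib]
  refine Finset.sum_congr rfl fun l _ => ?_
  simp only [Pi.add_apply, Int.cast_add]
  ring

theorem psi₂_add (y : Fin (4 * t) → ℤ) : psi₂ a b w (x + y) = psi₂ a b w x + psi₂ a b w y := by
  simp only [psi₂, ← Finset.sum_add_distrib]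
  refine Finset.sum_congr rfl fun l _ => ?_
  simp only [Pi.add_apply, Int.cast_add]
  ring

theorem psi₁_smul (c : ℤ) : psi₁ a b w (c • x) = c * psi₁ a b w x := by
  simp only [psi₁, Finset.mul_sum]
  refine Finset.sum_congr rfl fun l _ => ?_
  simp only [Pi.smul_apply, smul_eq_mul, Int.cast_mul]
  ring

theorem psi₂_smul (c : ℤ) : psi₂ a b w (c • x) = c * psi₂ a b w x := by
  simp only [psi₂, Finset.mul_sum]
  refine Finset.sum_congr rfl fun l _ => ?_
  simp only [Pi.smul_apply, smul_eq_mul, Int.cast_mul]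
  ring

/-- With the next three lemmas: the pair `(psi₁, psi₂)` turns left multiplication by `i` and `j`
into the matrices with rows `(0, -1), (1, 0)` and `(a, b), (b, -a)`. The second has square `-1`
exactly because `a ^ 2 + b ^ 2 = -1`. -/
theorem psi₁_quatI : psi₁ a b w (quatI x) = -psi₂ a b w x := by
  simp only [psi₁, psi₂, ← Finset.sum_neg_distrib]
  refine Finset.sum_congr rfl fun l _ => ?_
  simp only [quatI_blk0, quatI_blk1, quatI_blk2, quatI_blk3, Int.cast_neg]
  ring

theorem psi₂_quatI : psi₂ a b w (quatI x) = psi₁ a b w x := by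
  simp only [psi₁, psi₂]
  refine Finset.sum_congr rfl fun l _ => ?_
  simp only [quatI_blk0, quatI_blk1, quatI_blk2, quatI_blk3, Int.cast_neg]
  ring

theorem psi₁_quatJ (hab : a ^ 2 + b ^ 2 = -1) :
    psi₁ a b w (quatJ x) = a * psi₁ a b w x + b * psi₂ a b w x := by
  simp only [psi₁, psi₂, Finset.mul_sum, ← Finset.sum_add_distrib]
  refine Finset.sum_congr rfl fun l _ => ?_
  simp only [quatJ_blk0, quatJ_blk1, quatJ_blk2, quatJ_blk3, Int.cast_neg]
  linear_combination (-(x (blk l 2) : F) * (w l).1 - (x (blk l 3) : F) * (w l).2) * hab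

theorem psi₂_quatJ (hab : a ^ 2 + b ^ 2 = -1) :
    psi₂ a b w (quatJ x) = b * psi₁ a b w x - a * psi₂ a b w x := by
  simp only [psi₁, psi₂, Finset.mul_sum, ← Finset.sum_sub_distrib]
  refine Finset.sum_congr rfl fun l _ => ?_
  simp only [quatJ_blk0, quatJ_blk1, quatJ_blk2, quatJ_blk3, Int.cast_neg]
  linear_combination ((x (blk l 3) : F) * (w l).1 - (x (blk l 2) : F) * (w l).2) * hab

end Field

/-- `D₄` is the two-sided ideal of the Hurwitz order generated by `1 + i`, so the Hurwitz units
preserve it. The computation treats integral and half-integral units at once, by writing the doubled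
coordinates as `2 * m + π` with a common `π`. -/
theorem InD4.half_comb {x : Fin (4 * t) → ℤ} (hx : InD4 x) {c : Fin 4 → ℤ} (hc : c ∈ units) :
    ∃ z, InD4 z ∧ (2 : ℤ) • z = comb c x := by
  obtain ⟨-, -, h1, h2, h3⟩ := Finset.mem_filter.1 hc
  obtain ⟨π, m0, hm0⟩ : ∃ π m, c 0 = 2 * m + π := ⟨c 0 % 2, c 0 / 2, by omega⟩
  obtain ⟨m1, hm1⟩ : ∃ m, c 1 = 2 * m + π := ⟨(c 1 - π) / 2, by omega⟩
  obtain ⟨m2, hm2⟩ : ∃ m, c 2 = 2 * m + π := ⟨(c 2 - π) / 2, by omega⟩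
  obtain ⟨m3, hm3⟩ : ∃ m, c 3 = 2 * m + π := ⟨(c 3 - π) / 2, by omega⟩
  choose σ hσ using hx
  have hblk : ∀ l : Fin t, x (blk l 0) = σ l + σ l - x (blk l 1) - x (blk l 2) - x (blk l 3) :=
    fun l => by have := hσ l; omega
  have hco : ∀ l : Fin t, comb c x (blk l 0) = c 0 * x (blk l 0) - c 1 * x (blk l 1) -
        c 2 * x (blk l 2) - c 3 * x (blk l 3) ∧
      comb c x (blk l 1) = c 0 * x (blk l 1) + c 1 * x (blk l 0) + c 2 * x (blk l 3) -
        c 3 * x (blk l 2) ∧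
      comb c x (blk l 2) = c 0 * x (blk l 2) - c 1 * x (blk l 3) + c 2 * x (blk l 0) +
        c 3 * x (blk l 1) ∧
      comb c x (blk l 3) = c 0 * x (blk l 3) + c 1 * x (blk l 2) - c 2 * x (blk l 1) +
        c 3 * x (blk l 0) := by
    intro l
    simp only [comb, Pi.add_apply, Pi.smul_apply, smul_eq_mul, quatI_blk0, quatI_blk1, quatI_blk2,
      quatI_blk3, quatJ_blk0, quatJ_blk1, quatJ_blk2, quatJ_blk3]
    refine ⟨?_, ?_, ?_, ?_⟩ <;> ring
  have heven : ∀ j, 2 ∣ comb c x j := by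
    rw [forall_blk]
    intro l
    obtain ⟨e0, e1, e2, e3⟩ := hco l
    rw [e0, e1, e2, e3, hm0, hm1, hm2, hm3]
    refine ⟨⟨m0 * x (blk l 0) - m1 * x (blk l 1) - m2 * x (blk l 2) - m3 * x (blk l 3) +
        π * (σ l - x (blk l 1) - x (blk l 2) - x (blk l 3)), ?_⟩,
      ⟨m0 * x (blk l 1) + m1 * x (blk l 0) + m2 * x (blk l 3) - m3 * x (blk l 2) +
        π * (σ l - x (blk l 2)), ?_⟩,
      ⟨m0 * x (blk l 2) - m1 * x (blk l 3) + m2 * x (blk l 0) + m3 * x (blk l 1) +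
        π * (σ l - x (blk l 3)), ?_⟩,
      ⟨m0 * x (blk l 3) + m1 * x (blk l 2) - m2 * x (blk l 1) + m3 * x (blk l 0) +
        π * (σ l - x (blk l 1)), ?_⟩⟩ <;> rw [hblk l] <;> ring
  choose z hz using heven
  refine ⟨z, fun l => ?_, funext fun j => by simp [hz j]⟩
  refine ⟨(m0 + m1 + m2 + m3 + 2 * π) * σ l - (m1 + m2 + π) * x (blk l 1) -
    (m2 + m3 + π) * x (blk l 2) - (m1 + m3 + π) * x (blk l 3), ?_⟩
  obtain ⟨e0, e1, e2, e3⟩ := hco l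
  have k0 := hz (blk l 0)
  have k1 := hz (blk l 1)
  have k2 := hz (blk l 2)
  have k3 := hz (blk l 3)
  have : 2 * (z (blk l 0) + z (blk l 1) + z (blk l 2) + z (blk l 3)) =
      comb c x (blk l 0) + comb c x (blk l 1) + comb c x (blk l 2) + comb c x (blk l 3) := by
    rw [k0, k1, k2, k3]
    ring
  apply mul_left_cancel₀ (two_ne_zero (α := ℤ))
  rw [this, e0, e1, e2, e3, hm0, hm1, hm2, hm3, hblk l]
  ring

/-- The relation `2 z = c x` only shows that twice the image of `z` vanishes, which is why the
characteristic must not be two. -/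
theorem unitClosed_annLattice {F : Type*} [Field F] (h2 : (2 : F) ≠ 0) {a b : F}
    (hab : a ^ 2 + b ^ 2 = -1) (w : Fin t → F × F) : UnitClosed (annLattice a b w) := by
  rintro x ⟨hx, hx1, hx2⟩ c hc
  obtain ⟨z, hz, hzc⟩ := hx.half_comb hc
  refine ⟨z, ⟨hz, ?_, ?_⟩, hzc⟩
  · have h := congrArg (psi₁ a b w) hzc
    simp only [comb, psi₁_add, psi₁_smul, psi₁_quatI, psi₁_quatJ w _ hab, psi₂_quatJ w _ hab, hx1,
      hx2] at h
    simpa [h2] using h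
  · have h := congrArg (psi₂ a b w) hzc
    simp only [comb, psi₂_add, psi₂_smul, psi₂_quatI, psi₁_quatJ w _ hab, psi₂_quatJ w _ hab, hx1,
      hx2] at h
    simpa [h2] using h

section Count

variable {F : Type*} [Field F] {a b : F}

/-- The vector `w` with first entry `(1, 0)` and the other entries a multiple of the given ones. -/
def extendVec {m : ℕ} (u : Fin m → F × F) : Fin (m + 1) → F × F :=
  Fin.cons (1, 0) fun l => (-2 * (u l).1, -2 * (u l).2)

/-- The matrix of a quaternion has its norm as determinant, and the combinations below are
multiplications by the adjugate. -/
theorem act_eq_zero (hab : a ^ 2 + b ^ 2 = -1) {x0 x1 x2 x3 c d : F}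
    (hN : x0 ^ 2 + x1 ^ 2 + x2 ^ 2 + x3 ^ 2 ≠ 0)
    (h1 : (x0 + x2 * a - x3 * b) * c + (-x1 + x2 * b + x3 * a) * d = 0)
    (h2 : (x1 + x2 * b + x3 * a) * c + (x0 - x2 * a + x3 * b) * d = 0) : c = 0 ∧ d = 0 := by
  constructor
  · have : (x0 ^ 2 + x1 ^ 2 + x2 ^ 2 + x3 ^ 2) * c = 0 := by
      linear_combination (x0 - x2 * a + x3 * b) * h1 - (-x1 + x2 * b + x3 * a) * h2 +
        (x2 ^ 2 + x3 ^ 2) * c * hab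
    exact (mul_eq_zero.1 this).resolve_left hN
  · have : (x0 ^ 2 + x1 ^ 2 + x2 ^ 2 + x3 ^ 2) * d = 0 := by
      linear_combination (x0 + x2 * a - x3 * b) * h2 - (x1 + x2 * b + x3 * a) * h1 +
        (x2 ^ 2 + x3 ^ 2) * d * hab
    exact (mul_eq_zero.1 this).resolve_left hN

/-- The norm of a nonzero block is a positive integer not exceeding `x ⬝ᵥ x < p`, so `p` does not
divide it. This is why squared lengths have to stay below `p`. -/
theorem block_norm_ne_zero {p : ℕ} [Fact p.Prime] {x : Fin (4 * t) → ℤ} (hxp : x ⬝ᵥ x < p) (l : Fin t)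
    (hl : ¬ (x (blk l 0) = 0 ∧ x (blk l 1) = 0 ∧ x (blk l 2) = 0 ∧ x (blk l 3) = 0)) :
    ((x (blk l 0) : ZMod p) ^ 2 + (x (blk l 1) : ZMod p) ^ 2 + (x (blk l 2) : ZMod p) ^ 2 +
      (x (blk l 3) : ZMod p) ^ 2) ≠ 0 := by
  set N : ℤ := x (blk l 0) ^ 2 + x (blk l 1) ^ 2 + x (blk l 2) ^ 2 + x (blk l 3) ^ 2 with hN
  have hle : N ≤ x ⬝ᵥ x := by
    rw [dot_blk]
    refine le_trans (le_of_eq ?_) (Finset.single_le_sum (f := fun l : Fin t =>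
      x (blk l 0) * x (blk l 0) + x (blk l 1) * x (blk l 1) + x (blk l 2) * x (blk l 2) +
      x (blk l 3) * x (blk l 3)) (fun l _ => by
        have := mul_self_nonneg (x (blk l 0))
        have := mul_self_nonneg (x (blk l 1))
        have := mul_self_nonneg (x (blk l 2))
        have := mul_self_nonneg (x (blk l 3))
        positivity) (Finset.mem_univ l))
    rw [hN]
    ring
  have hpos : 0 < N := by
    by_contra hcon
    apply hl
    have h0 := sq_nonneg (x (blk l 0))
    have h1 := sq_nonneg (x (blk l 1))
    have h2 := sq_nonneg (x (blk l 2))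
    have h3 := sq_nonneg (x (blk l 3))
    refine ⟨?_, ?_, ?_, ?_⟩ <;> refine pow_eq_zero_iff (two_ne_zero) |>.1 ?_ <;> omega
  intro h
  have hcast : ((N : ℤ) : ZMod p) = 0 := by
    rw [hN]
    push_cast
    exact h
  rw [ZMod.intCast_zmod_eq_zero_iff_dvd] at hcast
  have := Int.le_of_dvd hpos hcast
  omega

open Classical in
-- If a block of `x` other than the first is nonzero, its quaternion acts invertibly, and the entry
-- of `u` there is determined by the remaining entries, which leaves one choice out of `p ^ 2`. If
-- only the first block is nonzero, it acts invertibly on the fixed entry `(1, 0)`, and no `u`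
-- annihilates `x`.
theorem card_annihilated_le {m p : ℕ} [Fact p.Prime] (hp2 : p ≠ 2) {a b : ZMod p}
    (hab : a ^ 2 + b ^ 2 = -1) {x : Fin (4 * (m + 1)) → ℤ} (hx0 : x ≠ 0) (hxp : x ⬝ᵥ x < p) :
    (Finset.univ.filter fun u : Fin m → ZMod p × ZMod p =>
      psi₁ a b (extendVec u) x = 0 ∧ psi₂ a b (extendVec u) x = 0).card * p ^ 2 ≤ (p ^ 2) ^ m := by
  have h2 : (2 : ZMod p) ≠ 0 := by
    intro h
    have : ((2 : ℕ) : ZMod p) = 0 := by exact_mod_cast h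
    rw [ZMod.natCast_eq_zero_iff] at this
    exact hp2 ((Nat.prime_dvd_prime_iff_eq (Fact.out : p.Prime) Nat.prime_two).1 this)
  by_cases hall : ∃ l : Fin m, ¬ (x (blk l.succ 0) = 0 ∧ x (blk l.succ 1) = 0 ∧
      x (blk l.succ 2) = 0 ∧ x (blk l.succ 3) = 0)
  · obtain ⟨l, hl⟩ := hall
    have hN := block_norm_ne_zero hxp l.succ hl
    have hinj : Set.InjOn (fun (u : Fin m → ZMod p × ZMod p) (k : {k : Fin m // k ≠ l}) => u k)
        (Finset.univ.filter fun u : Fin m → ZMod p × ZMod p =>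
          psi₁ a b (extendVec u) x = 0 ∧ psi₂ a b (extendVec u) x = 0 :
          Finset (Fin m → ZMod p × ZMod p)) := by
      intro u hu v hv huv
      simp only [Finset.coe_filter, Finset.mem_univ, true_and, Set.mem_ofPred_eq] at hu hv
      have hne : ∀ k, k ≠ l → u k = v k := fun k hk => congrFun huv ⟨k, hk⟩
      have hz : (u l).1 - (v l).1 = 0 ∧ (u l).2 - (v l).2 = 0 := by
        have e1 : psi₁ a b (extendVec u) x - psi₁ a b (extendVec v) x = 0 := by
          rw [hu.1, hv.1, sub_self]
        have e2 : psi₂ a b (extendVec u) x - psi₂ a b (extendVec v) x = 0 := by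
          rw [hu.2, hv.2, sub_self]
        simp only [psi₁, psi₂, ← Finset.sum_sub_distrib] at e1 e2
        rw [Finset.sum_eq_single l.succ] at e1 e2
        · simp only [extendVec, Fin.cons_succ] at e1 e2
          refine act_eq_zero hab hN (mul_left_cancel₀ h2 ?_) (mul_left_cancel₀ h2 ?_)
          · linear_combination -e1
          · linear_combination -e2
        all_goals first
          | exact fun h => absurd (Finset.mem_univ _) h
          | skip
        all_goals
          intro k _ hk
          obtain rfl | ⟨k', rfl⟩ := Fin.eq_zero_or_eq_succ k
          · exact sub_self _
          · have : u k' = v k' := hne k' fun h => hk (by rw [h])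
            simp only [extendVec, Fin.cons_succ, this, sub_self]
      funext k
      by_cases hk : k = l
      · subst hk
        exact Prod.ext (sub_eq_zero.1 hz.1) (sub_eq_zero.1 hz.2)
      · exact hne k hk
    have hcard := Finset.card_le_card_of_injOn _ (fun _ _ => Finset.mem_univ _) hinj
    rw [Finset.card_univ, Fintype.card_fun, Fintype.card_prod, ZMod.card,
      Fintype.card_subtype_compl, Fintype.card_fin, Fintype.card_unique] at hcard
    have hm : m = (m - 1) + 1 := by have := l.isLt; omega
    calc _ ≤ (p * p) ^ (m - 1) * p ^ 2 := Nat.mul_le_mul_right _ hcard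
      _ = (p ^ 2) ^ (m - 1 + 1) := by rw [pow_succ]; ring
      _ = _ := by rw [← hm]
  · push Not at hall
    have hempty : (Finset.univ.filter fun u : Fin m → ZMod p × ZMod p =>
        psi₁ a b (extendVec u) x = 0 ∧ psi₂ a b (extendVec u) x = 0) = ∅ := by
      refine Finset.filter_eq_empty_iff.2 fun u _ hu => ?_
      have hne : ¬ (x (blk 0 0) = 0 ∧ x (blk 0 1) = 0 ∧ x (blk 0 2) = 0 ∧ x (blk 0 3) = 0) := by
        intro h0
        apply hx0
        refine ext_blk fun l => ?_
        refine Fin.cases h0 (fun l => hall l) l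
      have hN := block_norm_ne_zero hxp 0 hne
      obtain ⟨h1, h2⟩ := hu
      rw [psi₁, Fin.sum_univ_succ] at h1
      rw [psi₂, Fin.sum_univ_succ] at h2
      rw [Finset.sum_eq_zero, add_zero] at h1 h2
      · have := act_eq_zero hab hN h1 h2
        simp [extendVec] at this
      all_goals
        intro k _
        obtain ⟨k0, k1, k2, k3⟩ := hall k
        simp [k0, k1, k2, k3]
    rw [hempty]
    simp

open Classical in
/-- The mean value argument: for some `u` the number of short vectors in the lattice of `u` is at most
its average. -/
theorem exists_potential_le {m p : ℕ} [Fact p.Prime] (hp2 : p ≠ 2) {a b : ZMod p}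
    (hab : a ^ 2 + b ^ 2 = -1) (Y : Finset (Fin (4 * (m + 1)) → ℤ))
    (hY : ∀ x ∈ Y, x ≠ 0 ∧ InD4 x ∧ x ⬝ᵥ x < p) (ρ r : ℝ) (S : ℕ) :
    ∃ u : Fin m → ZMod p × ZMod p,
      potential (Y.filter fun x => x ∈ annLattice a b (extendVec u)) ρ r S 1 * p ^ 2 ≤
        ∑ j ∈ Finset.range (S + 1), (Y.filter fun x => ρ ^ (2 * j) * nrm 1 x < r).card := by
  by_contra! hcon
  -- Double counting: for each level and each `x`, count the `u` whose lattice contains `x`.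
  have hsum : ∑ u : Fin m → ZMod p × ZMod p,
      potential (Y.filter fun x => x ∈ annLattice a b (extendVec u)) ρ r S 1 * p ^ 2 ≤
      (∑ j ∈ Finset.range (S + 1), (Y.filter fun x => ρ ^ (2 * j) * nrm 1 x < r).card) *
        (p ^ 2) ^ m := by
    simp only [potential, Finset.sum_mul]
    rw [Finset.sum_comm]
    refine Finset.sum_le_sum fun j _ => ?_
    have hswap : ∀ u : Fin m → ZMod p × ZMod p,
        ((Y.filter fun x => x ∈ annLattice a b (extendVec u)).filter
          fun x => ρ ^ (2 * j) * nrm 1 x < r).card =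
        ∑ x ∈ Y.filter (fun x => ρ ^ (2 * j) * nrm 1 x < r),
          if x ∈ annLattice a b (extendVec u) then 1 else 0 := by
      intro u
      rw [Finset.filter_comm, Finset.card_filter]
    simp only [hswap, Finset.sum_mul]
    rw [Finset.sum_comm, Finset.card_eq_sum_ones, Finset.sum_mul]
    refine Finset.sum_le_sum fun x hx => ?_
    obtain ⟨hx0, hxD, hxp⟩ := hY x (Finset.mem_filter.1 hx).1
    rw [one_mul, ← Finset.sum_mul, ← Finset.card_filter]
    refine le_trans (Nat.mul_le_mul_right _ (Finset.card_le_card ?_))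
      (card_annihilated_le hp2 hab hx0 hxp)
    intro u hu
    simp only [Finset.mem_filter, Finset.mem_univ, true_and] at hu ⊢
    exact hu.2
  have hlt := Finset.sum_lt_sum_of_nonempty (s := (Finset.univ : Finset (Fin m → ZMod p × ZMod p)))
    Finset.univ_nonempty fun u _ => hcon u
  rw [Finset.sum_const, Finset.card_univ, Fintype.card_fun, Fintype.card_prod, ZMod.card,
    Fintype.card_fin, smul_eq_mul, ← sq, mul_comm] at hlt
  omega

end Count

end QuatLattice

/-! ### Volumes and numbers of short vectors -/

namespace QuatLattice

open Matrix

variable {t : ℕ}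

/-- The volume of the unit ball in dimension `4 * t`. -/
noncomputable def unitBall (t : ℕ) : ℝ :=
  volume.real (Metric.ball (0 : EuclideanSpace ℝ (Fin (4 * t))) 1)

theorem volume_real_ball (t : ℕ) (ht : t ≠ 0) {r : ℝ} (hr : 0 ≤ r) :
    volume.real (Metric.ball (0 : EuclideanSpace ℝ (Fin (4 * t))) r) = r ^ (4 * t) * unitBall t := by
  have : Nonempty (Fin (4 * t)) := ⟨⟨0, by omega⟩⟩
  rw [unitBall, measureReal_def, measureReal_def, Measure.addHaar_ball _ _ hr, ENNReal.toReal_mul,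
    ENNReal.toReal_ofReal (by positivity), finrank_euclideanSpace_fin]

theorem unitBall_eq (t : ℕ) (ht : t ≠ 0) :
    unitBall t = Real.pi ^ (2 * t) / (2 * t).factorial := by
  have : Nonempty (Fin (4 * t)) := ⟨⟨0, by omega⟩⟩
  rw [unitBall, measureReal_def, InnerProductSpace.volume_ball_of_dim_even (k := 2 * t)
    (by rw [finrank_euclideanSpace_fin]; ring)]
  simp only [ENNReal.ofReal_one, one_pow, one_mul]
  rw [ENNReal.toReal_ofReal (by positivity)]

theorem unitBall_pos (ht : t ≠ 0) : 0 < unitBall t := by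
  rw [unitBall_eq t ht]
  positivity

/-- From `n ^ n / n! ≤ e ^ n` with `n = 2 * t`, and `π e < 10`. -/
theorem unitBall_le (ht : t ≠ 0) : unitBall t ≤ (5 / (t : ℝ)) ^ (2 * t) := by
  have ht' : (0 : ℝ) < t := by positivity
  have h1 := Real.pow_div_factorial_le_exp (x := 2 * (t : ℝ)) (by positivity) (2 * t)
  have h2 : Real.exp (2 * (t : ℝ)) = Real.exp 1 ^ (2 * t) := by
    rw [← Real.exp_nat_mul]
    push_cast
    ring_nf
  rw [h2] at h1
  rw [unitBall_eq t ht]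
  have hf : (0 : ℝ) < (2 * t).factorial := by positivity
  rw [div_le_iff₀ hf] at h1 ⊢
  have h3 : (Real.pi * Real.exp 1) ^ (2 * t) ≤ 10 ^ (2 * t) := by
    gcongr
    have a := Real.pi_lt_d2
    have b := Real.exp_one_lt_d9
    nlinarith [Real.pi_pos, Real.exp_pos 1]
  have h4 : (5 / (t : ℝ)) ^ (2 * t) * (2 * t) ^ (2 * t) = 10 ^ (2 * t) := by
    rw [← mul_pow]
    congr 1
    field_simp
    norm_num
  have h5 : 0 < (5 / (t : ℝ)) ^ (2 * t) := by positivity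
  have h6 : 0 < Real.exp 1 ^ (2 * t) := by positivity
  have h7 : Real.pi ^ (2 * t) * Real.exp 1 ^ (2 * t) ≤
      (5 / (t : ℝ)) ^ (2 * t) * (2 * t).factorial * Real.exp 1 ^ (2 * t) := by
    rw [← mul_pow]
    refine h3.trans ?_
    rw [← h4]
    nlinarith
  exact le_of_mul_le_mul_right h7 h6

theorem le_unitBall (ht : t ≠ 0) : (1 / (t : ℝ)) ^ (2 * t) ≤ unitBall t := by
  have ht' : (0 : ℝ) < t := by positivity
  rw [unitBall_eq t ht]
  have hf : (0 : ℝ) < (2 * t).factorial := by positivity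
  rw [le_div_iff₀ hf]
  have h1 : ((2 * t).factorial : ℝ) ≤ (2 * t : ℝ) ^ (2 * t) := by
    have := Nat.factorial_le_pow (2 * t)
    exact_mod_cast this
  calc _ ≤ (1 / (t : ℝ)) ^ (2 * t) * (2 * t : ℝ) ^ (2 * t) := by gcongr
    _ = 2 ^ (2 * t) := by
      rw [← mul_pow]
      congr 1
      field_simp
    _ ≤ _ := by
      gcongr
      exact Real.two_le_pi

/-- Parity decides the first coordinate of a block within a window of length two, so the translates
of `[0,2) × [0,1)³` by points of `D₄` are disjoint. -/
theorem InD4.eq_of_floor {x y : Fin (4 * t) → ℤ} (hx : InD4 x) (hy : InD4 y)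
    (h : ∀ l : Fin t, |x (blk l 0) - y (blk l 0)| < 2 ∧ x (blk l 1) = y (blk l 1) ∧
      x (blk l 2) = y (blk l 2) ∧ x (blk l 3) = y (blk l 3)) : x = y := by
  refine ext_blk fun l => ?_
  obtain ⟨h0, h1, h2, h3⟩ := h l
  refine ⟨?_, h1, h2, h3⟩
  obtain ⟨a, ha⟩ := hx l
  obtain ⟨b, hb⟩ := hy l
  rw [abs_lt] at h0
  omega

/-- A volume bound for the number of short vectors of `D₄ᵗ`. -/
theorem card_short_le (ht : t ≠ 0) (Y : Finset (Fin (4 * t) → ℤ)) (hY : ∀ x ∈ Y, InD4 x) {r : ℝ}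
    (hr : 0 ≤ r) (hYr : ∀ x ∈ Y, nrm 1 x < r ^ 2) :
    (Y.card : ℝ) * 2 ^ t ≤ unitBall t * (r + √(7 * t)) ^ (4 * t) := by
  classical
  -- Boxes with sides 2, 1, 1, 1 in every block. Their volume `2 ^ t` is the covolume of `D₄ᵗ`, and
  -- their squared diameter is `(4 + 1 + 1 + 1) * t`, which gives `√(7 * t)`.
  set len : Fin (4 * t) → ℝ := fun j => if (unblk j).2 = 0 then 2 else 1 with hlen
  set C : (Fin (4 * t) → ℤ) → Set (Fin (4 * t) → ℝ) := fun x =>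
    Set.univ.pi fun j => Set.Ico (x j : ℝ) (x j + len j) with hC
  set D : (Fin (4 * t) → ℤ) → Set (EuclideanSpace ℝ (Fin (4 * t))) := fun x =>
    WithLp.ofLp ⁻¹' C x with hD
  have hl0 : ∀ l : Fin t, len (blk l 0) = 2 ∧ len (blk l 1) = 1 ∧ len (blk l 2) = 1 ∧
      len (blk l 3) = 1 := fun l => by simp [hlen]
  have hlp : ∀ j, 0 < len j := fun j => by
    simp only [hlen]
    split_ifs <;> norm_num
  have hCm : ∀ x, MeasurableSet (C x) := fun x =>
    MeasurableSet.univ_pi fun j => measurableSet_Ico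
  have hprod : ∏ j, ENNReal.ofReal (len j) = ENNReal.ofReal (2 ^ t) := by
    rw [← ENNReal.ofReal_prod_of_nonneg fun j _ => (hlp j).le]
    congr 1
    have : ∏ j, len j = ∏ l : Fin t, (len (blk l 0) * len (blk l 1) * len (blk l 2) * len (blk l 3)) :=
      sum_blk (M := Additive ℝ) len
    rw [this]
    simp [hl0]
  have hvol : ∀ x, volume (D x) = ENNReal.ofReal (2 ^ t) := by
    intro x
    rw [hD]
    simp only
    rw [(PiLp.volume_preserving_ofLp (Fin (4 * t))).measure_preimage (hCm x).nullMeasurableSet, hC]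
    simp only
    rw [volume_pi_pi]
    simp only [Real.volume_Ico, add_sub_cancel_left]
    exact hprod
  have hdisj : (Y : Set (Fin (4 * t) → ℤ)).PairwiseDisjoint D := by
    intro x hx y hy hxy
    refine Set.disjoint_left.2 fun z hz hz' => hxy ?_
    have h1 : ∀ j, (x j : ℝ) ≤ z j ∧ z j < x j + len j := fun j => hz j (Set.mem_univ j)
    have h2 : ∀ j, (y j : ℝ) ≤ z j ∧ z j < y j + len j := fun j => hz' j (Set.mem_univ j)
    refine (hY x hx).eq_of_floor (hY y hy) fun l => ?_
    have key : ∀ j, len j = 1 → x j = y j := fun j hj => by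
      obtain ⟨a1, a2⟩ := h1 j
      obtain ⟨b1, b2⟩ := h2 j
      rw [hj] at a2 b2
      have c1 : (x j : ℝ) < y j + 1 := by linarith
      have c2 : (y j : ℝ) < x j + 1 := by linarith
      have c1' : x j < y j + 1 := by exact_mod_cast c1
      have c2' : y j < x j + 1 := by exact_mod_cast c2
      omega
    refine ⟨?_, key _ (hl0 l).2.1, key _ (hl0 l).2.2.1, key _ (hl0 l).2.2.2⟩
    obtain ⟨a1, a2⟩ := h1 (blk l 0)
    obtain ⟨b1, b2⟩ := h2 (blk l 0)
    rw [(hl0 l).1] at a2 b2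
    have c1 : (x (blk l 0) : ℝ) < y (blk l 0) + 2 := by linarith
    have c2 : (y (blk l 0) : ℝ) < x (blk l 0) + 2 := by linarith
    have c1' : x (blk l 0) < y (blk l 0) + 2 := by exact_mod_cast c1
    have c2' : y (blk l 0) < x (blk l 0) + 2 := by exact_mod_cast c2
    rw [abs_lt]
    omega
  have hsub : (⋃ x ∈ Y, D x) ⊆ Metric.ball (0 : EuclideanSpace ℝ (Fin (4 * t))) (r + √(7 * t)) := by
    refine Set.iUnion₂_subset fun x hx z hz => ?_
    have h1 : ∀ j, (x j : ℝ) ≤ z j ∧ z j < x j + len j := fun j => hz j (Set.mem_univ j)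
    rw [mem_ball_zero_iff]
    have e : z = WithLp.toLp 2 (toReal x) + (z - WithLp.toLp 2 (toReal x)) := by abel
    have n1 : ‖(WithLp.toLp 2 (toReal x) : EuclideanSpace ℝ (Fin (4 * t)))‖ < r := by
      rw [EuclideanSpace.norm_eq, Real.sqrt_lt' (by
        rcases hr.lt_or_eq with h | h
        · exact h
        · have := hYr x hx
          rw [← h] at this
          have := nrm_nonneg 1 x
          norm_num at *
          linarith)]
      refine lt_of_eq_of_lt ?_ (hYr x hx)
      simp [nrm, dotProduct, sq]
    have n2 : ‖z - WithLp.toLp 2 (toReal x)‖ ≤ √(7 * t) := by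
      rw [EuclideanSpace.norm_eq]
      apply Real.sqrt_le_sqrt
      have : ∀ j, ‖(z - WithLp.toLp 2 (toReal x)) j‖ ^ 2 ≤ len j ^ 2 := fun j => by
        have := h1 j
        simp only [PiLp.sub_apply, toReal, Real.norm_eq_abs, sq_abs]
        have := hlp j
        nlinarith
      refine (Finset.sum_le_sum fun j _ => this j).trans (le_of_eq ?_)
      rw [sum_blk]
      simp only [hl0]
      simp
      ring
    have n3 := norm_add_le (WithLp.toLp 2 (toReal x)) (z - WithLp.toLp 2 (toReal x))
    rw [← e] at n3
    linarith
  have hmeas := measure_mono (μ := volume) hsub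
  rw [measure_biUnion_finset hdisj fun x _ =>
    (PiLp.volume_preserving_ofLp (Fin (4 * t))).measurable (hCm x)] at hmeas
  simp only [hvol, Finset.sum_const, nsmul_eq_mul] at hmeas
  have hfin : volume (Metric.ball (0 : EuclideanSpace ℝ (Fin (4 * t))) (r + √(7 * t))) ≠ ⊤ :=
    measure_ball_lt_top.ne
  have := ENNReal.toReal_mono hfin hmeas
  rw [ENNReal.toReal_mul, ENNReal.toReal_ofReal (by positivity), ENNReal.toReal_natCast,
    ← measureReal_def, volume_real_ball t ht (by positivity)] at this
  linarith

theorem one_add_div_pow_le {K : ℝ} (hK : 0 < K) (n : ℕ) : (1 + 1 / K) ^ n ≤ Real.exp (n / K) := by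
  have : 1 + 1 / K ≤ Real.exp (1 / K) := by
    have := Real.add_one_le_exp (1 / K)
    linarith
  calc _ ≤ Real.exp (1 / K) ^ n := by gcongr
    _ = _ := by
      rw [← Real.exp_nat_mul]
      congr 1
      ring

/-- The sum over all levels of the volume bounds. -/
theorem sum_card_short_le {k : ℕ} (ht : t ≠ 0) (hk : k ≠ 0) (Y : Finset (Fin (4 * t) → ℤ))
    (hY : ∀ x ∈ Y, InD4 x) {R : ℕ} (hR : R ≠ 0) {δ : ℝ} (hδ : 0 < δ)
    (hRt : 28 * (t : ℝ) ^ 3 ≤ R * (Real.log (1 + δ) / 4) ^ 2) :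
    ∑ j ∈ Finset.range (k * t + 1),
      ((Y.filter fun x => (1 + 1 / (4 * k * t : ℝ)) ^ (2 * j) * nrm 1 x < R).card : ℝ) ≤
      unitBall t * (R : ℝ) ^ (2 * t) * (1 + δ) * (k + 1) / 2 ^ t := by
  set ρ : ℝ := 1 + 1 / (4 * k * t : ℝ) with hρ
  have ht' : (0 : ℝ) < t := by positivity
  have hk' : (0 : ℝ) < k := by positivity
  have hR' : (0 : ℝ) < R := by positivity
  have hρ1 : 1 ≤ ρ := by rw [hρ]; simp; positivity
  have hρ0 : 0 < ρ := by linarith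
  -- Chosen with `exp (4 * z) = 1 + δ`. The boxes enlarge each radius by a factor of at most `1 + z
  -- / t`, hence each volume by at most `(1 + z / t) ^ (4 * t) ≤ 1 + δ`.
  set z : ℝ := Real.log (1 + δ) / 4 with hz
  have hz0 : 0 < z := by
    have := Real.log_pos (show 1 < 1 + δ by linarith)
    positivity
  have hV := unitBall_pos (t := t) ht
  have hlevel : ∀ j ∈ Finset.range (k * t + 1),
      ((Y.filter fun x => ρ ^ (2 * j) * nrm 1 x < R).card : ℝ) ≤
        unitBall t * (R : ℝ) ^ (2 * t) * (1 + δ) / 2 ^ t * ((ρ ^ (4 * t))⁻¹) ^ j := by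
    intro j hj
    have hj' : j ≤ k * t := by
      have := Finset.mem_range.1 hj
      omega
    have hρj0 : 0 < ρ ^ j := by positivity
    -- The smallest radius is therefore still at least `√R / 2`, so the error from the boxes is
    -- relatively small on all levels.
    have hρj : ρ ^ j ≤ 2 := by
      calc ρ ^ j ≤ ρ ^ (k * t) := pow_le_pow_right₀ hρ1 hj'
        _ ≤ Real.exp ((k * t : ℕ) / (4 * k * t)) := one_add_div_pow_le (by positivity) _
        _ = Real.exp (1 / 4) := by
          congr 1
          push_cast
          field_simp
        _ ≤ 2 := by
          have h := Real.exp_one_lt_d9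
          have h4 : Real.exp (1 / 4) ^ 4 = Real.exp 1 := by
            rw [← Real.exp_nat_mul]
            norm_num
          by_contra hcon
          push Not at hcon
          have : (2 : ℝ) ^ 4 < Real.exp (1 / 4) ^ 4 := by gcongr
          rw [h4] at this
          linarith
    set r : ℝ := √R / ρ ^ j with hr
    have hr0 : 0 < r := by positivity
    have hsq : r ^ 2 = R / ρ ^ (2 * j) := by
      rw [hr, div_pow, Real.sq_sqrt hR'.le, ← pow_mul, mul_comm j 2]
    have hc := card_short_le ht (Y.filter fun x => ρ ^ (2 * j) * nrm 1 x < R)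
      (fun x hx => hY x (Finset.mem_filter.1 hx).1) hr0.le (fun x hx => by
        have := (Finset.mem_filter.1 hx).2
        rw [hsq, lt_div_iff₀ (by positivity), mul_comm]
        exact this)
    have hrat : √(7 * t) ≤ r * (1 / (t / z)) := by
      apply Real.sqrt_le_iff.2 ⟨by positivity, ?_⟩
      rw [mul_pow, hsq]
      have h2 : ρ ^ (2 * j) ≤ 4 := by
        rw [mul_comm, pow_mul]
        nlinarith
      have h3 : (R : ℝ) / 4 ≤ R / ρ ^ (2 * j) := by gcongr
      have h4 : 7 * (t : ℝ) ≤ R / 4 * (1 / (t / z)) ^ 2 := by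
        rw [one_div_div, div_pow]
        rw [← sub_nonneg]
        have : (R : ℝ) / 4 * (z ^ 2 / t ^ 2) - 7 * t = (R * z ^ 2 - 28 * t ^ 3) / (4 * t ^ 2) := by
          field_simp
          ring
        rw [this]
        exact div_nonneg (by linarith) (by positivity)
      exact h4.trans (mul_le_mul_of_nonneg_right h3 (by positivity))
    have hexp : (1 + 1 / (t / z)) ^ (4 * t) ≤ 1 + δ := by
      refine (one_add_div_pow_le (by positivity) _).trans (le_of_eq ?_)
      have : ((4 * t : ℕ) : ℝ) / (t / z) = Real.log (1 + δ) := by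
        rw [hz]
        push_cast
        field_simp
      rw [this, Real.exp_log (by linarith)]
    have hpow : (r + √(7 * t)) ^ (4 * t) ≤ r ^ (4 * t) * (1 + δ) := by
      calc _ ≤ (r * (1 + 1 / (t / z))) ^ (4 * t) := by
            gcongr
            linarith
        _ = r ^ (4 * t) * (1 + 1 / (t / z)) ^ (4 * t) := mul_pow _ _ _
        _ ≤ _ := by gcongr
    have hr4 : r ^ (4 * t) = (R : ℝ) ^ (2 * t) * ((ρ ^ (4 * t))⁻¹) ^ j := by
      rw [show 4 * t = 2 * (2 * t) by ring, pow_mul, hsq, div_pow, ← inv_pow, ← pow_mul, ← pow_mul,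
        div_eq_mul_inv, inv_pow]
      ring_nf
    rw [hr4] at hpow
    rw [← le_div_iff₀ (by positivity)] at hc
    refine hc.trans ?_
    rw [div_mul_eq_mul_div]
    refine div_le_div_of_nonneg_right ?_ (by positivity)
    calc _ ≤ unitBall t * ((R : ℝ) ^ (2 * t) * ((ρ ^ (4 * t))⁻¹) ^ j * (1 + δ)) := by gcongr
      _ = _ := by ring
  refine (Finset.sum_le_sum hlevel).trans ?_
  rw [← Finset.mul_sum]
  -- By Bernoulli, `ρ ^ (4 * t) ≥ 1 + 1 / k`, so the ratio is at most `k / (k + 1)`. That `k * t +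
  -- 1` levels together count only like `k + 1` is the source of the factor `t` in the density.
  have hgeo : ∑ j ∈ Finset.range (k * t + 1), ((ρ ^ (4 * t))⁻¹) ^ j ≤ k + 1 := by
    have hb : 1 + 1 / (k : ℝ) ≤ ρ ^ (4 * t) := by
      have h := one_add_mul_le_pow (a := 1 / (4 * k * t : ℝ)) (by
        have : 0 ≤ 1 / (4 * k * t : ℝ) := by positivity
        linarith) (4 * t)
      refine le_trans (le_of_eq ?_) h
      push_cast
      field_simp
    have hx1 : (ρ ^ (4 * t))⁻¹ ≤ k / (k + 1) := by
      rw [inv_le_comm₀ (by positivity) (by positivity), inv_div]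
      refine le_trans (le_of_eq ?_) hb
      field_simp
    have hx0 : 0 ≤ (ρ ^ (4 * t))⁻¹ := by positivity
    set x := (ρ ^ (4 * t))⁻¹
    have hx2 : x < 1 := hx1.trans_lt (by rw [div_lt_one (by positivity)]; linarith)
    calc _ ≤ (1 - x)⁻¹ := by
          rw [← tsum_geometric_of_lt_one hx0 hx2]
          exact (summable_geometric_of_lt_one hx0 hx2).sum_le_tsum _ fun j _ => by positivity
      _ ≤ k + 1 := by
          rw [inv_le_comm₀ (by linarith) (by positivity)]
          have : (k : ℝ) / (k + 1) = 1 - (k + 1 : ℝ)⁻¹ := by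
            field_simp
            ring
          linarith
  calc _ ≤ unitBall t * (R : ℝ) ^ (2 * t) * (1 + δ) / 2 ^ t * (k + 1) := by gcongr
    _ = _ := by ring

end QuatLattice

/-! ### Choice of the prime and of the radius -/

namespace QuatLattice

/-- Primes and radii for which the mean value argument gives dense lattices. -/
theorem exists_parameters {δ : ℝ} (hδ : 0 < δ) (hδ1 : δ ≤ 1) {k : ℕ} (hk : k ≠ 0) :
    ∃ C : ℕ, 0 < C ∧ ∀ᶠ t : ℕ in atTop, ∃ p R : ℕ, p.Prime ∧ p ≠ 2 ∧ p ≤ 2 * (C * t ^ 2) ^ t ∧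
      R ≠ 0 ∧ R < t ^ 4 ∧ R < p ∧ 28 * (t : ℝ) ^ 3 ≤ R * (Real.log (1 + δ) / 4) ^ 2 ∧
      unitBall t * (R : ℝ) ^ (2 * t) * (1 + δ) * (k + 1) ≤ 24 * (k * t) * 2 ^ t * (p : ℝ) ^ 2 ∧
      24 * (k * t) * 2 ^ t * (p : ℝ) ^ 2 ≤
        unitBall t * (R : ℝ) ^ (2 * t) * (1 + δ) ^ 2 * (k + 1) := by
  set z : ℝ := Real.log (1 + δ) / 4 with hz
  have hz0 : 0 < z := by
    have := Real.log_pos (show 1 < 1 + δ by linarith)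
    positivity
  have hz1 : z ≤ 1 := by
    have := Real.log_le_sub_one_of_pos (show 0 < 1 + δ by linarith)
    rw [hz]
    linarith
  obtain ⟨C₁, hC₁⟩ := exists_nat_ge (28 / z ^ 2)
  have hC₁z : 28 ≤ C₁ * z ^ 2 := by rwa [div_le_iff₀ (by positivity)] at hC₁
  have hC₁0 : 0 < C₁ := by
    rcases Nat.eq_zero_or_pos C₁ with h | h
    · rw [h] at hC₁z
      norm_num at hC₁z
    · exact h
  -- The 5 is that of `unitBall_le`: for `R = C₁ * t ^ 3`, the smallest radius allowed by the volume
  -- estimate, `unitBall t * R ^ (2 * t)` is at most `((5 * C₁ * t ^ 2) ^ t) ^ 2`, which is below `p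
  -- ^ 2`.
  refine ⟨5 * C₁, by omega, ?_⟩
  filter_upwards [eventually_ge_atTop 2, eventually_gt_atTop (384 * (5 * C₁) ^ 2)] with t ht2 htC
  set C : ℕ := 5 * C₁ with hC
  have htC₁ : C₁ < t := by nlinarith
  have ht0 : t ≠ 0 := by omega
  have ht' : (0 : ℝ) < t := by positivity
  have hk' : (1 : ℝ) ≤ k := by exact_mod_cast Nat.one_le_iff_ne_zero.2 hk
  have hV := unitBall_pos ht0
  have ht1 : (1 : ℝ) ≤ t := by exact_mod_cast (by omega : 1 ≤ t)
  have hN4 : t ^ 4 ≤ (C * t ^ 2) ^ t := by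
    calc t ^ 4 = (1 * t ^ 2) ^ 2 := by ring
      _ ≤ (C * t ^ 2) ^ 2 := by gcongr; omega
      _ ≤ (C * t ^ 2) ^ t := Nat.pow_le_pow_right (by positivity) ht2
  -- Bertrand's postulate. The size of `p`, about `t ^ (2 * t)`, determines the leading term of the
  -- running time.
  obtain ⟨p, hp, hNp, hp2⟩ := Nat.exists_prime_lt_and_le_two_mul ((C * t ^ 2) ^ t) (by positivity)
  have hNp' : (((C * t ^ 2) ^ t : ℕ) : ℝ) ≤ p := by exact_mod_cast hNp.le
  have hp2' : (p : ℝ) ≤ ((2 * (C * t ^ 2) ^ t : ℕ) : ℝ) := by exact_mod_cast hp2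
  set P : ℕ → Prop := fun r => unitBall t * (r : ℝ) ^ (2 * t) * (1 + δ) * (k + 1) ≤
    24 * (k * t) * 2 ^ t * (p : ℝ) ^ 2 with hP
  have h1 : P (C₁ * t ^ 3) := by
    rw [hP]
    simp only
    have e1 : unitBall t * ((C₁ * t ^ 3 : ℕ) : ℝ) ^ (2 * t) ≤ (p : ℝ) ^ 2 := by
      calc _ ≤ (5 / (t : ℝ)) ^ (2 * t) * ((C₁ * t ^ 3 : ℕ) : ℝ) ^ (2 * t) := by
            gcongr
            exact unitBall_le ht0
        _ = (((C * t ^ 2) ^ t : ℕ) : ℝ) ^ 2 := by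
            rw [← mul_pow, Nat.cast_pow, ← pow_mul, mul_comm t 2]
            congr 1
            rw [hC]
            push_cast
            field_simp
        _ ≤ (p : ℝ) ^ 2 := by gcongr
    have e2 : (1 + δ) * (k + 1) ≤ 24 * (k * t) * 2 ^ t := by
      have : (1 : ℝ) ≤ 2 ^ t := one_le_pow₀ (by norm_num)
      calc (1 + δ) * (k + 1) ≤ 2 * (k + k) := by gcongr; linarith
        _ ≤ 24 * (k * 1) * 1 := by linarith
        _ ≤ _ := by gcongr
    calc _ = (unitBall t * ((C₁ * t ^ 3 : ℕ) : ℝ) ^ (2 * t)) * ((1 + δ) * (k + 1)) := by ring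
      _ ≤ (p : ℝ) ^ 2 * (24 * (k * t) * 2 ^ t) := by gcongr
      _ = _ := by ring
  have h2 : ¬ P (t ^ 4) := by
    rw [hP]
    simp only [not_le]
    have e0 : 96 * (t : ℝ) * (2 * (C : ℝ) ^ 2) ^ t < (t : ℝ) ^ (2 * t) := by
      have a1 : (t : ℝ) ≤ 2 ^ t := by exact_mod_cast Nat.lt_two_pow_self.le
      have a2 : (96 : ℝ) ≤ 96 ^ t := le_self_pow₀ (by norm_num) ht0
      calc 96 * (t : ℝ) * (2 * (C : ℝ) ^ 2) ^ t ≤ (96 : ℝ) ^ t * 2 ^ t * (2 * (C : ℝ) ^ 2) ^ t := by gcongr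
        _ = (384 * (C : ℝ) ^ 2) ^ t := by rw [← mul_pow, ← mul_pow]; ring
        _ < ((t : ℝ) ^ 2) ^ t := by
            have : (384 * (C : ℝ) ^ 2) < t := by exact_mod_cast htC
            have : (384 * (C : ℝ) ^ 2) < t ^ 2 := by nlinarith
            gcongr
        _ = _ := by rw [← pow_mul]
    calc 24 * (k * t) * 2 ^ t * (p : ℝ) ^ 2
        ≤ 24 * (k * t) * 2 ^ t * ((2 * (C * t ^ 2) ^ t : ℕ) : ℝ) ^ 2 := by gcongr
      _ = k * (96 * (t : ℝ) * (2 * C ^ 2) ^ t) * t ^ (4 * t) := by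
          push_cast
          rw [mul_pow, mul_pow (C : ℝ), mul_pow (2 : ℝ) (C ^ 2)]
          ring
      _ < k * (t : ℝ) ^ (2 * t) * t ^ (4 * t) := by gcongr
      _ = k * ((1 / (t : ℝ)) ^ (2 * t) * ((t ^ 4 : ℕ) : ℝ) ^ (2 * t)) := by
          rw [← mul_pow, mul_assoc, ← pow_add, show 2 * t + 4 * t = 3 * (2 * t) by ring, pow_mul]
          congr 2
          push_cast
          field_simp
      _ ≤ (k + 1) * (unitBall t * ((t ^ 4 : ℕ) : ℝ) ^ (2 * t)) := by
          gcongr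
          · linarith
          · exact le_unitBall ht0
      _ ≤ (1 + δ) * ((k + 1) * (unitBall t * ((t ^ 4 : ℕ) : ℝ) ^ (2 * t))) :=
          le_mul_of_one_le_left (by positivity) (by linarith)
      _ = _ := by ring
  classical
  have h34 : C₁ * t ^ 3 ≤ t ^ 4 := by
    calc C₁ * t ^ 3 ≤ t * t ^ 3 := by gcongr
      _ = t ^ 4 := by ring
  -- Maximality gives the second inequality for `R` as well: `P` fails at `R + 1`, and passing from
  -- `R + 1` back to `R` costs only `(1 + 1 / R) ^ (2 * t) ≤ 1 + δ`.
  set R := Nat.findGreatest P (t ^ 4) with hR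
  have hPR : P R := Nat.findGreatest_spec h34 h1
  have hge : C₁ * t ^ 3 ≤ R := Nat.le_findGreatest h34 h1
  have hlt : R < t ^ 4 := lt_of_le_of_ne (Nat.findGreatest_le _) fun h => h2 (h ▸ hPR)
  have hnext : ¬ P (R + 1) := Nat.findGreatest_is_greatest (Nat.lt_succ_self R) hlt
  have hR0 : R ≠ 0 := by
    have : 0 < C₁ * t ^ 3 := by positivity
    omega
  have hRz : 28 * (t : ℝ) ^ 3 ≤ R * z ^ 2 := by
    have : ((C₁ * t ^ 3 : ℕ) : ℝ) ≤ R := by exact_mod_cast hge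
    push_cast at this
    calc 28 * (t : ℝ) ^ 3 ≤ C₁ * z ^ 2 * t ^ 3 := by gcongr
      _ = (C₁ * t ^ 3) * z ^ 2 := by ring
      _ ≤ _ := by gcongr
  have hR' : (0 : ℝ) < R := by positivity
  refine ⟨p, R, hp, ?_, hp2, hR0, hlt, by omega, hRz, hPR, ?_⟩
  · have : 2 ^ 4 ≤ t ^ 4 := Nat.pow_le_pow_left ht2 4
    omega
  · rw [hP] at hnext
    simp only [not_le] at hnext
    refine hnext.le.trans ?_
    have hfac : ((R + 1 : ℕ) : ℝ) ^ (2 * t) ≤ (R : ℝ) ^ (2 * t) * (1 + δ) := by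
      have e1 : ((R + 1 : ℕ) : ℝ) = R * (1 + 1 / R) := by
        push_cast
        field_simp
      rw [e1, mul_pow]
      gcongr
      refine (one_add_div_pow_le hR' _).trans ?_
      rw [← Real.exp_log (show 0 < 1 + δ by linarith)]
      apply Real.exp_le_exp.2
      rw [div_le_iff₀ hR']
      have hlog : Real.log (1 + δ) = 4 * z := by rw [hz]; ring
      rw [hlog]
      push_cast
      have hz2 : R * z ^ 2 ≤ R * z := by
        have : z ^ 2 ≤ z := by nlinarith
        gcongr
      have ht3 : (t : ℝ) ≤ t ^ 3 := le_self_pow₀ ht1 (by norm_num)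
      nlinarith
    calc unitBall t * ((R + 1 : ℕ) : ℝ) ^ (2 * t) * (1 + δ) * (k + 1)
        ≤ unitBall t * ((R : ℝ) ^ (2 * t) * (1 + δ)) * (1 + δ) * (k + 1) := by gcongr
      _ = _ := by ring

end QuatLattice

/-! ### The start matrix: its determinant and the coordinates of short vectors -/

namespace QuatLattice

open Matrix

variable {t : ℕ}

/-- The rows of this matrix are `(2 r i + s i, s i, 0, 0 | 0)` plus a basis of `D₄ᵗ`. -/
def startMatrix (t : ℕ) (r s : ℕ → ℤ) : Matrix (Fin (4 * t)) (Fin (4 * t)) ℤ :=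
  Matrix.of fun i j => (if (j : ℕ) = 0 then 2 * r i + s i else 0) + (if (j : ℕ) = 1 then s i else 0) +
    (if (j : ℕ) = 4 * (i / 4) then 1 else 0) + (if (j : ℕ) = i then 1 else 0)

/-- The conditions on the coefficients under which the rows form a basis of a sublattice of index
`P ^ 2` in `D₄ᵗ`. -/
structure StartCoeff (t : ℕ) (P : ℤ) (r s : ℕ → ℤ) : Prop where
  pos : 0 < P
  r0 : r 0 = P - 1
  s0 : s 0 = 0
  r1 : r 1 = 0
  s1 : s 1 = P - 1
  r_nonneg : ∀ i < 4 * t, 0 ≤ r i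
  r_lt : ∀ i < 4 * t, r i < P
  s_nonneg : ∀ i < 4 * t, 0 ≤ s i
  s_lt : ∀ i < 4 * t, s i < P

theorem startMatrix_blk (r s : ℕ → ℤ) (l l' : Fin t) (q q' : Fin 4) :
    startMatrix t r s (blk l q) (blk l' q') =
      (if (l' : ℕ) = 0 ∧ q' = 0 then 2 * r (4 * l + q) + s (4 * l + q) else 0) +
      (if (l' : ℕ) = 0 ∧ q' = 1 then s (4 * l + q) else 0) +
      (if l' = l ∧ q' = 0 then 1 else 0) + (if l' = l ∧ q' = q then 1 else 0) := by
  have hq := q.isLt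
  have hq' := q'.isLt
  simp only [startMatrix, of_apply, blk_val]
  congr 1
  · congr 1
    · congr 1
      · refine if_congr ?_ rfl rfl
        rw [Fin.ext_iff]
        simp
      · refine if_congr ?_ rfl rfl
        rw [Fin.ext_iff]
        simp
        omega
    · refine if_congr ?_ rfl rfl
      rw [Fin.ext_iff, Fin.ext_iff]
      simp
      omega
  · refine if_congr ?_ rfl rfl
    rw [Fin.ext_iff, Fin.ext_iff]
    omega

/-- With the basis `2 e₀`, `e₀ + e₁`, `e₀ + e₂`, `e₀ + e₃` in every block, numbered as `b₀, b₁, …`,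
row `i` is `b i + r i * b₀ + s i * b₁`, and rows 0 and 1 become `P * b₀` and `P * b₁`. The matrix is
lower triangular with diagonal `2P, P, 1, 1` in the first block and `2, 1, 1, 1` in the others.
Primality of `P` plays no role, so the program can try all moduli. -/
theorem det_startMatrix {P : ℤ} {r s : ℕ → ℤ} (h : StartCoeff t P r s) (ht : t ≠ 0) :
    (startMatrix t r s).det = 2 ^ t * P ^ 2 := by
  have htri : (startMatrix t r s).BlockTriangular OrderDual.toDual := by
    intro i j hij
    have hij' : (i : ℕ) < j := hij
    simp only [startMatrix, of_apply]
    rw [if_neg (show ¬ (j : ℕ) = 0 by omega), if_neg (show ¬ (j : ℕ) = 4 * ((i : ℕ) / 4) by omega),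
      if_neg (show ¬ (j : ℕ) = i by omega)]
    by_cases hj : (j : ℕ) = 1
    · have : (i : ℕ) = 0 := by omega
      rw [if_pos hj, this, h.s0]
      rfl
    · rw [if_neg hj]
      rfl
  rw [det_of_isLowerTriangular _ htri]
  have hd : ∏ i, startMatrix t r s i i = ∏ l : Fin t, (startMatrix t r s (blk l 0) (blk l 0) *
      startMatrix t r s (blk l 1) (blk l 1) * startMatrix t r s (blk l 2) (blk l 2) *
      startMatrix t r s (blk l 3) (blk l 3)) :=
    sum_blk (M := Additive ℤ) fun i => startMatrix t r s i i
  rw [hd]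
  obtain ⟨m, rfl⟩ := Nat.exists_eq_succ_of_ne_zero ht
  rw [Fin.prod_univ_succ, Finset.prod_eq_pow_card (b := 2)]
  · simp [startMatrix_blk, h.r0, h.s0, h.s1]
    ring
  · intro l _
    simp [startMatrix_blk]

theorem abs_le_of_dot_lt {n : ℕ} {x : Fin n → ℤ} {R : ℕ} (hx : x ⬝ᵥ x < R) (j : Fin n) : |x j| ≤ R := by
  have h1 : x j * x j ≤ x ⬝ᵥ x :=
    Finset.single_le_sum (f := fun j => x j * x j) (fun j _ => mul_self_nonneg _) (Finset.mem_univ j)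
  rcases abs_cases (x j) with ⟨h, _⟩ | ⟨h, _⟩ <;> rw [h] <;> nlinarith

theorem abs_mul_le_mul {u v U W : ℤ} (hu : |u| ≤ U) (hv : |v| ≤ W) : |u * v| ≤ U * W := by
  rw [abs_mul]
  exact mul_le_mul hu hv (abs_nonneg _) ((abs_nonneg _).trans hu)

theorem abs_sum_four_le {m : ℕ} {R Q : ℤ} {z c : Fin m → Fin 4 → ℤ} (h0 : ∀ l, |z l 0| ≤ 2 * R)
    (h1 : ∀ l, |z l 1| ≤ R) (h2 : ∀ l, |z l 2| ≤ R) (h3 : ∀ l, |z l 3| ≤ R)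
    (hc : ∀ l q, |c l q| ≤ Q) :
    |∑ l, (z l 0 * c l 0 + z l 1 * c l 1 + z l 2 * c l 2 + z l 3 * c l 3)| ≤ m * (5 * (R * Q)) := by
  refine (Finset.abs_sum_le_sum_abs _ _).trans ?_
  refine (Finset.sum_le_sum (g := fun _ => 5 * (R * Q)) fun l _ => ?_).trans (by simp)
  have e0 := abs_le.1 (abs_mul_le_mul (h0 l) (hc l 0))
  have e1 := abs_le.1 (abs_mul_le_mul (h1 l) (hc l 1))
  have e2 := abs_le.1 (abs_mul_le_mul (h2 l) (hc l 2))
  have e3 := abs_le.1 (abs_mul_le_mul (h3 l) (hc l 3))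
  rw [mul_assoc] at e0
  rw [abs_le]
  constructor <;> linarith

theorem vecMul_blk (M : Matrix (Fin (4 * t)) (Fin (4 * t)) ℤ) (z : Fin (4 * t) → ℤ) (j : Fin (4 * t)) :
    (z ᵥ* M) j = ∑ l : Fin t, (z (blk l 0) * M (blk l 0) j + z (blk l 1) * M (blk l 1) j +
      z (blk l 2) * M (blk l 2) j + z (blk l 3) * M (blk l 3) j) := sum_blk _

section Coord

variable {m : ℕ} {P : ℤ} {r s : ℕ → ℤ} (h : StartCoeff (m + 1) P r s) (z : Fin (4 * (m + 1)) → ℤ)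
  {R : ℕ}
  (hR : (z ᵥ* startMatrix (m + 1) r s) ⬝ᵥ (z ᵥ* startMatrix (m + 1) r s) < R)

include hR

/-- Only the columns 0 and 1 contain `r` and `s`. In the other columns the entries of the vector are
single coordinates or `2 z₀ + z₁ + z₂ + z₃`, so this and the next three bounds can be read off. -/
theorem abs_coord_two_le (l : Fin (m + 1)) : |z (blk l 2)| ≤ R := by
  have : (z ᵥ* startMatrix (m + 1) r s) (blk l 2) = z (blk l 2) := by
    rw [vecMul_blk, Finset.sum_eq_single l]
    · simp [startMatrix_blk]
    · intro l' _ hl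
      simp [startMatrix_blk, hl.symm]
    · simp
  exact this ▸ abs_le_of_dot_lt hR _

theorem abs_coord_three_le (l : Fin (m + 1)) : |z (blk l 3)| ≤ R := by
  have : (z ᵥ* startMatrix (m + 1) r s) (blk l 3) = z (blk l 3) := by
    rw [vecMul_blk, Finset.sum_eq_single l]
    · simp [startMatrix_blk]
    · intro l' _ hl
      simp [startMatrix_blk, hl.symm]
    · simp
  exact this ▸ abs_le_of_dot_lt hR _

theorem abs_coord_one_le (l : Fin m) : |z (blk l.succ 1)| ≤ R := by
  have : (z ᵥ* startMatrix (m + 1) r s) (blk l.succ 1) = z (blk l.succ 1) := by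
    rw [vecMul_blk, Finset.sum_eq_single l.succ]
    · simp [startMatrix_blk]
    · intro l' _ hl
      simp [startMatrix_blk, hl.symm]
    · simp
  exact this ▸ abs_le_of_dot_lt hR _

theorem abs_coord_zero_le (l : Fin m) : |z (blk l.succ 0)| ≤ 2 * R := by
  have e : (z ᵥ* startMatrix (m + 1) r s) (blk l.succ 0) = 2 * z (blk l.succ 0) +
      z (blk l.succ 1) + z (blk l.succ 2) + z (blk l.succ 3) := by
    rw [vecMul_blk, Finset.sum_eq_single l.succ]
    · simp [startMatrix_blk]
      ring
    · intro l' _ hl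
      simp [startMatrix_blk, hl.symm]
    · simp
  have e0 := abs_le.1 (abs_le_of_dot_lt hR (blk l.succ 0))
  have e1 := abs_le.1 (abs_coord_one_le z hR l)
  have e2 := abs_le.1 (abs_coord_two_le z hR l.succ)
  have e3 := abs_le.1 (abs_coord_three_le z hR l.succ)
  rw [e] at e0
  rw [abs_le]
  omega

include h

/-- In column 1 this coordinate has the coefficient `P`, and all other coefficients are below `P`.
Dividing by `P` leaves a bound free of `P`, which keeps the box to be searched small. -/
theorem abs_coord_zero_one_le : |z (blk 0 1)| ≤ (5 * m + 3) * R := by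
  have hP := h.pos
  have hs : ∀ i, i < 4 * (m + 1) → |s i| ≤ P := fun i hi => by
    rw [abs_of_nonneg (h.s_nonneg i hi)]
    exact (h.s_lt i hi).le
  have hc1 : (z ᵥ* startMatrix (m + 1) r s) (blk 0 1) =
      P * z (blk 0 1) + z (blk 0 2) * s 2 + z (blk 0 3) * s 3 +
      ∑ l : Fin m, (z (blk l.succ 0) * s (4 * (l + 1) + (0 : Fin 4)) +
        z (blk l.succ 1) * s (4 * (l + 1) + (1 : Fin 4)) +
        z (blk l.succ 2) * s (4 * (l + 1) + (2 : Fin 4)) +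
        z (blk l.succ 3) * s (4 * (l + 1) + (3 : Fin 4))) := by
    rw [vecMul_blk, Fin.sum_univ_succ]
    congr 1
    · simp [startMatrix_blk, h.s0, h.s1]
      ring
    · refine Finset.sum_congr rfl fun l _ => ?_
      simp [startMatrix_blk, (Fin.succ_ne_zero l).symm]
  have hsum := abs_le.1 (abs_sum_four_le (z := fun (l : Fin m) q => z (blk l.succ q))
    (c := fun l q => s (4 * (l + 1) + q)) (abs_coord_zero_le z hR)
    (abs_coord_one_le z hR) (fun l => abs_coord_two_le z hR l.succ)
    (fun l => abs_coord_three_le z hR l.succ) fun l q => hs _ (by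
      have := l.isLt
      have := q.isLt
      omega))
  have e2 := abs_le.1 (abs_mul_le_mul (abs_coord_two_le z hR 0) (hs 2 (by omega)))
  have e3 := abs_le.1 (abs_mul_le_mul (abs_coord_three_le z hR 0) (hs 3 (by omega)))
  have e1 := abs_le.1 (abs_le_of_dot_lt hR (blk 0 1))
  have hRP : (R : ℤ) ≤ R * P := le_mul_of_one_le_right (by positivity) (by omega)
  rw [hc1] at e1
  have key : P * |z (blk 0 1)| ≤ P * ((5 * m + 3) * R) := by
    rw [← abs_of_pos hP, ← abs_mul, abs_of_pos hP, abs_le]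
    have : P * ((5 * m + 3) * R) = m * (5 * (R * P)) + 3 * (R * P) := by ring
    rw [this]
    constructor <;> linarith
  exact le_of_mul_le_mul_left key hP

theorem abs_coord_zero_zero_le : |z (blk 0 0)| ≤ (20 * m + 20) * R := by
  have hP := h.pos
  have hr : ∀ i, i < 4 * (m + 1) → |2 * r i + s i| ≤ 3 * P := fun i hi => by
    have := h.s_nonneg i hi
    have := h.r_nonneg i hi
    have := h.s_lt i hi
    have := h.r_lt i hi
    rw [abs_of_nonneg (by omega)]
    omega
  have hc0 : (z ᵥ* startMatrix (m + 1) r s) (blk 0 0) =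
      2 * P * z (blk 0 0) + P * z (blk 0 1) + z (blk 0 2) * (2 * r 2 + s 2) +
      z (blk 0 2) + z (blk 0 3) * (2 * r 3 + s 3) + z (blk 0 3) +
      ∑ l : Fin m, (z (blk l.succ 0) * (2 * r (4 * (l + 1) + (0 : Fin 4)) + s (4 * (l + 1) + (0 : Fin 4))) +
        z (blk l.succ 1) * (2 * r (4 * (l + 1) + (1 : Fin 4)) + s (4 * (l + 1) + (1 : Fin 4))) +
        z (blk l.succ 2) * (2 * r (4 * (l + 1) + (2 : Fin 4)) + s (4 * (l + 1) + (2 : Fin 4))) +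
        z (blk l.succ 3) * (2 * r (4 * (l + 1) + (3 : Fin 4)) + s (4 * (l + 1) + (3 : Fin 4)))) := by
    rw [vecMul_blk, Fin.sum_univ_succ]
    congr 1
    · simp [startMatrix_blk, h.s0, h.s1, h.r0, h.r1]
      ring
    · refine Finset.sum_congr rfl fun l _ => ?_
      simp [startMatrix_blk, (Fin.succ_ne_zero l).symm]
  have hsum := abs_le.1 (abs_sum_four_le (z := fun (l : Fin m) q => z (blk l.succ q))
    (c := fun l q => 2 * r (4 * (l + 1) + q) + s (4 * (l + 1) + q)) (abs_coord_zero_le z hR)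
    (abs_coord_one_le z hR) (fun l => abs_coord_two_le z hR l.succ)
    (fun l => abs_coord_three_le z hR l.succ) fun l q => hr _ (by
      have := l.isLt
      have := q.isLt
      omega))
  have e2 := abs_le.1 (abs_mul_le_mul (abs_coord_two_le z hR 0) (hr 2 (by omega)))
  have e3 := abs_le.1 (abs_mul_le_mul (abs_coord_three_le z hR 0) (hr 3 (by omega)))
  have e2' := abs_le.1 (abs_coord_two_le z hR 0)
  have e3' := abs_le.1 (abs_coord_three_le z hR 0)
  have e1 := abs_le.1 (abs_le_of_dot_lt hR (blk 0 0))
  have e5 := abs_le.1 (abs_mul_le_mul (abs_of_pos hP).le (abs_coord_zero_one_le h z hR))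
  have hRP : (R : ℤ) ≤ R * P := le_mul_of_one_le_right (by positivity) (by omega)
  have hmRP : 0 ≤ m * (R * P) := by positivity
  rw [hc0] at e1
  have key : 2 * P * |z (blk 0 0)| ≤ 2 * P * ((20 * m + 20) * R) := by
    have h2P : 0 < 2 * P := by omega
    rw [← abs_of_pos h2P, ← abs_mul, abs_of_pos h2P, abs_le]
    have a1 : 2 * P * ((20 * m + 20) * R) = 40 * (m * (R * P)) + 40 * (R * P) := by ring
    have a2 : P * ((5 * m + 3) * R) = 5 * (m * (R * P)) + 3 * (R * P) := by ring
    have a3 : (R : ℤ) * (3 * P) = 3 * (R * P) := by ring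
    have a4 : (m : ℤ) * (5 * (R * (3 * P))) = 15 * (m * (R * P)) := by ring
    rw [a2] at e5
    rw [a3] at e2 e3
    rw [a4] at hsum
    rw [a1]
    constructor <;> linarith
  exact le_of_mul_le_mul_left key (by omega)

end Coord

/-- Short vectors have small coordinates with respect to the rows of the start matrix. -/
theorem abs_coord_le {P : ℤ} {r s : ℕ → ℤ} (h : StartCoeff t P r s) (z : Fin (4 * t) → ℤ) {R : ℕ}
    (hR : (z ᵥ* startMatrix t r s) ⬝ᵥ (z ᵥ* startMatrix t r s) < R) (i : Fin (4 * t)) :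
    |z i| ≤ 20 * t * R := by
  have ht : 1 ≤ t := by have := i.isLt; omega
  obtain ⟨m, rfl⟩ : ∃ m, t = m + 1 := ⟨t - 1, by omega⟩
  have hR0 : (0 : ℤ) ≤ R := by positivity
  have hmR : (0 : ℤ) ≤ m * R := by positivity
  revert i
  rw [forall_blk]
  intro l
  have e : (20 * ((m + 1 : ℕ) : ℤ) * R) = 20 * (m * R) + 20 * R := by push_cast; ring
  rw [e]
  have f0 : ((20 * m + 20) * R : ℤ) = 20 * (m * R) + 20 * R := by ring
  have f1 : ((5 * m + 3) * R : ℤ) = 5 * (m * R) + 3 * R := by ring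
  refine Fin.cases ⟨?_, ?_, ?_, ?_⟩ (fun l => ⟨?_, ?_, ?_, ?_⟩) l
  · exact f0 ▸ abs_coord_zero_zero_le h z hR
  · have := f1 ▸ abs_coord_zero_one_le h z hR
    linarith
  · have := abs_coord_two_le z hR 0
    linarith
  · have := abs_coord_three_le z hR 0
    linarith
  · have := abs_coord_zero_le z hR l
    linarith
  · have := abs_coord_one_le z hR l
    linarith
  · have := abs_coord_two_le z hR l.succ
    linarith
  · have := abs_coord_three_le z hR l.succ
    linarith

end QuatLattice

namespace QuatLattice

open Matrix

variable {t : ℕ}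

/-! ### Coefficients from a string of digits -/

/-- The first components of the vectors that determine the rows of the block with vector `(x, y)`. -/
def rowFst (a b x y : ℤ) : ℕ → ℤ
  | 0 => 2 * x
  | 1 => x - y
  | 2 => x + a * x + b * y
  | _ => x - b * x + a * y

/-- The second components of the vectors that determine the rows of the block with vector `(x, y)`. -/
def rowSnd (a b x y : ℤ) : ℕ → ℤ
  | 0 => 2 * y
  | 1 => x + y
  | 2 => y + b * x - a * y
  | _ => y + a * x + b * y

/-- The coefficient `r` of the start matrix that belongs to a string of digits. -/
def coefR (P : ℤ) (d : ℕ → ℤ) (i : ℕ) : ℤ :=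
  if i = 0 then P - 1 else if i = 1 then 0 else if i = 2 then d 2 else if i = 3 then d 4 else
    (rowFst (d 0) (d 1) (d (2 * (i / 4) + 4)) (d (2 * (i / 4) + 5)) (i % 4) -
      rowSnd (d 0) (d 1) (d (2 * (i / 4) + 4)) (d (2 * (i / 4) + 5)) (i % 4)) % P

/-- The coefficient `s` of the start matrix that belongs to a string of digits. -/
def coefS (P : ℤ) (d : ℕ → ℤ) (i : ℕ) : ℤ :=
  if i = 0 then 0 else if i = 1 then P - 1 else if i = 2 then d 3 else if i = 3 then d 5 else
    (2 * rowSnd (d 0) (d 1) (d (2 * (i / 4) + 4)) (d (2 * (i / 4) + 5)) (i % 4)) % P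

/-- The start matrix that belongs to a string of digits. -/
def digitMatrix (t : ℕ) (P : ℤ) (d : ℕ → ℤ) : Matrix (Fin (4 * t)) (Fin (4 * t)) ℤ :=
  startMatrix t (coefR P d) (coefS P d)

theorem startCoeff_coef {P : ℤ} (hP : 0 < P) {d : ℕ → ℤ} (hd : ∀ i < 6, 0 ≤ d i ∧ d i < P) :
    StartCoeff t P (coefR P d) (coefS P d) := by
  have hR : ∀ i, 0 ≤ coefR P d i ∧ coefR P d i < P := by
    intro i
    unfold coefR
    split_ifs
    · omega
    · omega
    · exact hd 2 (by norm_num)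
    · exact hd 4 (by norm_num)
    · exact ⟨Int.emod_nonneg _ hP.ne', Int.emod_lt_of_pos _ hP⟩
  have hS : ∀ i, 0 ≤ coefS P d i ∧ coefS P d i < P := by
    intro i
    unfold coefS
    split_ifs
    · omega
    · omega
    · exact hd 3 (by norm_num)
    · exact hd 5 (by norm_num)
    · exact ⟨Int.emod_nonneg _ hP.ne', Int.emod_lt_of_pos _ hP⟩
  exact ⟨hP, rfl, rfl, rfl, rfl, fun i _ => (hR i).1, fun i _ => (hR i).2, fun i _ => (hS i).1,
    fun i _ => (hS i).2⟩

section Ann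

variable {F : Type*} [CommRing F] {a b : F}

theorem annLattice_zero (w : Fin t → F × F) : (0 : Fin (4 * t) → ℤ) ∈ annLattice a b w := by
  refine ⟨fun l => by simp, ?_, ?_⟩ <;> simp [psi₁, psi₂]

theorem annLattice_add {w : Fin t → F × F} {x y : Fin (4 * t) → ℤ} (hx : x ∈ annLattice a b w)
    (hy : y ∈ annLattice a b w) : x + y ∈ annLattice a b w := by
  refine ⟨fun l => ?_, ?_, ?_⟩
  · have := (hx.1 l).add (hy.1 l)
    simp only [Pi.add_apply]
    rwa [show ∀ p q r s p' q' r' s' : ℤ, p + q + r + s + (p' + q' + r' + s') =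
      p + p' + (q + q') + (r + r') + (s + s') from fun _ _ _ _ _ _ _ _ => by ring] at this
  · rw [psi₁_add, hx.2.1, hy.2.1, add_zero]
  · rw [psi₂_add, hx.2.2, hy.2.2, add_zero]

theorem annLattice_smul {w : Fin t → F × F} {x : Fin (4 * t) → ℤ} (c : ℤ)
    (hx : x ∈ annLattice a b w) : c • x ∈ annLattice a b w := by
  refine ⟨fun l => ?_, ?_, ?_⟩
  · have := (hx.1 l).mul_left c
    simp only [Pi.smul_apply, smul_eq_mul]
    convert this using 1
    ring
  · rw [psi₁_smul, hx.2.1, mul_zero]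
  · rw [psi₂_smul, hx.2.2, mul_zero]

theorem vecMul_mem_annLattice {w : Fin t → F × F} {M : Matrix (Fin (4 * t)) (Fin (4 * t)) ℤ}
    (hM : ∀ i, M i ∈ annLattice a b w) (z : Fin (4 * t) → ℤ) : z ᵥ* M ∈ annLattice a b w := by
  rw [vecMul_eq_sum]
  exact Finset.sum_induction _ (· ∈ annLattice a b w) (fun _ _ => annLattice_add) (annLattice_zero w)
    fun i _ => annLattice_smul _ (hM i)

/-- Because `w 0 = (1, 0)`, the part `(2 r + s, s, 0, 0)` in the first block has the image `(2 r +
s, s)`. The hypotheses say, for the four kinds of rows, that it cancels the image of the basis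
vector of `D₄ᵗ`. -/
theorem startMatrix_mem_annLattice {m : ℕ} {w : Fin (m + 1) → F × F} (hw : w 0 = (1, 0)) {r s : ℕ → ℤ}
    (h0 : ∀ l : Fin (m + 1), 2 * (r (4 * l) : F) + s (4 * l) + 2 * (w l).1 = 0 ∧
      (s (4 * l) : F) + 2 * (w l).2 = 0)
    (h1 : ∀ l : Fin (m + 1), 2 * (r (4 * l + 1) : F) + s (4 * l + 1) + (w l).1 - (w l).2 = 0 ∧
      (s (4 * l + 1) : F) + (w l).1 + (w l).2 = 0)
    (h2 : ∀ l : Fin (m + 1), 2 * (r (4 * l + 2) : F) + s (4 * l + 2) + (1 + a) * (w l).1 + b * (w l).2 = 0 ∧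
      (s (4 * l + 2) : F) + b * (w l).1 + (1 - a) * (w l).2 = 0)
    (h3 : ∀ l : Fin (m + 1), 2 * (r (4 * l + 3) : F) + s (4 * l + 3) + (1 - b) * (w l).1 + a * (w l).2 = 0 ∧
      (s (4 * l + 3) : F) + a * (w l).1 + (1 + b) * (w l).2 = 0)
    (i : Fin (4 * (m + 1))) : startMatrix (m + 1) r s i ∈ annLattice a b w := by
  have hb : ∀ (l l' : Fin (m + 1)) (q q' : Fin 4), blk l q = blk l' q' ↔ l = l' ∧ q = q' :=
    fun l l' q q' => ⟨blk_injective, fun h => by rw [h.1, h.2]⟩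
  have key : ∀ (l : Fin (m + 1)) (q : Fin 4), startMatrix (m + 1) r s (blk l q) = fun j =>
      ((2 * r (4 * l + q) + s (4 * l + q)) • Pi.single (blk 0 0) (1 : ℤ) +
      s (4 * l + q) • Pi.single (blk 0 1) (1 : ℤ) + Pi.single (blk l 0) (1 : ℤ) + Pi.single (blk l q) (1 : ℤ)
        : Fin (4 * (m + 1)) → ℤ) j := by
    intro l q
    refine ext_blk fun l' => ?_
    have hl0 : (l' : ℕ) = 0 ↔ l' = 0 := by rw [Fin.ext_iff]; rfl
    simp only [startMatrix_blk, Pi.add_apply, Pi.smul_apply, Pi.single_apply, hb, smul_eq_mul,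
      mul_ite, mul_one, mul_zero, hl0, and_self]
  have hp1 : ∀ (l : Fin (m + 1)) (q : Fin 4), psi₁ a b w (Pi.single (blk l q) (1 : ℤ)) =
      ![(w l).1, -(w l).2, a * (w l).1 + b * (w l).2, -b * (w l).1 + a * (w l).2] q := by
    intro l q
    rw [psi₁, Finset.sum_eq_single l]
    · fin_cases q <;> simp [hb]
    · intro l' _ hl
      simp [hb, hl]
    · simp
  have hp2 : ∀ (l : Fin (m + 1)) (q : Fin 4), psi₂ a b w (Pi.single (blk l q) (1 : ℤ)) =
      ![(w l).2, (w l).1, b * (w l).1 - a * (w l).2, a * (w l).1 + b * (w l).2] q := by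
    intro l q
    rw [psi₂, Finset.sum_eq_single l]
    · fin_cases q <;> simp [hb]
      ring
    · intro l' _ hl
      simp [hb, hl]
    · simp
  have hev : ∀ (l : Fin (m + 1)) (q : Fin 4), InD4 (startMatrix (m + 1) r s (blk l q)) := by
    intro l q l'
    simp only [startMatrix_blk]
    by_cases h0 : (l' : ℕ) = 0 <;> by_cases hl : l' = l <;> fin_cases q <;>
      simp [h0, hl] <;> (try simp [hl] at h0) <;> (try simp [h0]) <;> grind
  revert i
  rw [forall_blk]
  intro l
  refine ⟨⟨hev _ _, ?_, ?_⟩, ⟨hev _ _, ?_, ?_⟩, ⟨hev _ _, ?_, ?_⟩, ⟨hev _ _, ?_, ?_⟩⟩ <;> rw [key] <;>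
    simp only [psi₁_add, psi₂_add, psi₁_smul, psi₂_smul, hp1, hp2, hw]
  · have := (h0 l).1
    simp
    linear_combination this
  · have := (h0 l).2
    simp
    linear_combination this
  · have := (h1 l).1
    simp
    linear_combination this
  · have := (h1 l).2
    simp
    linear_combination this
  · have := (h2 l).1
    simp
    linear_combination this
  · have := (h2 l).2
    simp
    linear_combination this
  · have := (h3 l).1
    simp
    linear_combination this
  · have := (h3 l).2
    simp
    linear_combination this

end Ann

/-- Every lattice of the mean value argument comes from a string of digits. -/
theorem exists_digits {m p : ℕ} [Fact p.Prime] (hp2 : p ≠ 2) (a b : ZMod p)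
    (u : Fin m → ZMod p × ZMod p) : ∃ c < p ^ (2 * (m + 1) + 4), ∀ d : ℕ → ℤ,
      (∀ j < 2 * (m + 1) + 4, d j = ((c / p ^ j % p : ℕ) : ℤ)) →
      ∀ i, digitMatrix (m + 1) p d i ∈ annLattice a b (extendVec u) := by
  have h2 : (2 : ZMod p) ≠ 0 := by
    intro h
    have : ((2 : ℕ) : ZMod p) = 0 := by exact_mod_cast h
    rw [ZMod.natCast_eq_zero_iff] at this
    exact hp2 ((Nat.prime_dvd_prime_iff_eq (Fact.out : p.Prime) Nat.prime_two).1 this)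
  -- The digits are `a`, `b`, the coefficients of rows 2 and 3, which involve halves, and the
  -- entries of `u`. Since they are enumerated, the program has neither to solve `a ^ 2 + b ^ 2 =
  -- -1` nor to invert 2. In the other rows the factor `-2` in `extendVec` makes the coefficients
  -- integral polynomials in the digits.
  set g : ℕ → ZMod p := fun j => if j = 0 then a else if j = 1 then b else
    if j = 2 then (b - 1 - a) / 2 else if j = 3 then -b else if j = 4 then (a + b - 1) / 2 else
    if j = 5 then -a else if h : j / 2 - 3 < m then (if j % 2 = 0 then (u ⟨j / 2 - 3, h⟩).1 else
      (u ⟨j / 2 - 3, h⟩).2) else 0 with hg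
  set c := finFunctionFinEquiv (m := p) (n := 2 * (m + 1) + 4) fun j => ⟨(g j).val, ZMod.val_lt _⟩ with hc
  have hdig : ∀ j < 2 * (m + 1) + 4, (c : ℕ) / p ^ j % p = (g j).val := by
    intro j hj
    have h1 : finFunctionFinEquiv.symm c ⟨j, hj⟩ = ⟨(g j).val, ZMod.val_lt _⟩ := by
      rw [hc, Equiv.symm_apply_apply]
    have h2 := congrArg Fin.val h1
    simpa [finFunctionFinEquiv] using h2
  refine ⟨c, c.isLt, fun d hd => ?_⟩
  have hdg : ∀ j < 2 * (m + 1) + 4, (d j : ZMod p) = g j := by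
    intro j hj
    rw [hd j hj, hdig j hj]
    simp
  have d0 : (d 0 : ZMod p) = a := hdg 0 (by omega)
  have d1 : (d 1 : ZMod p) = b := hdg 1 (by omega)
  have d2 : (d 2 : ZMod p) = (b - 1 - a) / 2 := hdg 2 (by omega)
  have d3 : (d 3 : ZMod p) = -b := hdg 3 (by omega)
  have d4 : (d 4 : ZMod p) = (a + b - 1) / 2 := hdg 4 (by omega)
  have d5 : (d 5 : ZMod p) = -a := hdg 5 (by omega)
  have dx : ∀ l : Fin m, (d (2 * (l + 1) + 4) : ZMod p) = (u l).1 := by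
    intro l
    have := l.isLt
    rw [hdg _ (by omega), hg]
    have e1 : (2 * ((l : ℕ) + 1) + 4) / 2 - 3 = l := by omega
    have e2 : (2 * ((l : ℕ) + 1) + 4) % 2 = 0 := by omega
    simp only [e1, e2, l.isLt, dif_pos, if_true]
    repeat rw [if_neg (by omega)]
  have dy : ∀ l : Fin m, (d (2 * (l + 1) + 5) : ZMod p) = (u l).2 := by
    intro l
    have := l.isLt
    rw [hdg _ (by omega), hg]
    have e1 : (2 * ((l : ℕ) + 1) + 5) / 2 - 3 = l := by omega
    have e2 : (2 * ((l : ℕ) + 1) + 5) % 2 = 1 := by omega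
    simp only [e1, e2, l.isLt, dif_pos]
    repeat rw [if_neg (by omega)]
  have hR : ∀ l q : ℕ, coefR p d (4 * (l + 1) + q) =
      (rowFst (d 0) (d 1) (d (2 * ((4 * (l + 1) + q) / 4) + 4)) (d (2 * ((4 * (l + 1) + q) / 4) + 5))
        ((4 * (l + 1) + q) % 4) -
      rowSnd (d 0) (d 1) (d (2 * ((4 * (l + 1) + q) / 4) + 4)) (d (2 * ((4 * (l + 1) + q) / 4) + 5))
        ((4 * (l + 1) + q) % 4)) % p := by
    intro l q
    unfold coefR
    repeat rw [if_neg (by omega)]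
  have hS : ∀ l q : ℕ, coefS p d (4 * (l + 1) + q) =
      (2 * rowSnd (d 0) (d 1) (d (2 * ((4 * (l + 1) + q) / 4) + 4)) (d (2 * ((4 * (l + 1) + q) / 4) + 5))
        ((4 * (l + 1) + q) % 4)) % p := by
    intro l q
    unfold coefS
    repeat rw [if_neg (by omega)]
  have hR0 := fun l => hR l 0
  have hS0 := fun l => hS l 0
  simp only [add_zero] at hR0 hS0
  have q0 : ∀ l : ℕ, (4 * (l + 1)) / 4 = l + 1 ∧ (4 * (l + 1)) % 4 = 0 := fun l => by omega
  have q1 : ∀ l : ℕ, (4 * (l + 1) + 1) / 4 = l + 1 ∧ (4 * (l + 1) + 1) % 4 = 1 := fun l => by omega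
  have q2 : ∀ l : ℕ, (4 * (l + 1) + 2) / 4 = l + 1 ∧ (4 * (l + 1) + 2) % 4 = 2 := fun l => by omega
  have q3 : ∀ l : ℕ, (4 * (l + 1) + 3) / 4 = l + 1 ∧ (4 * (l + 1) + 3) % 4 = 3 := fun l => by omega
  refine startMatrix_mem_annLattice (by simp [extendVec]) ?_ ?_ ?_ ?_
  · refine Fin.cases ?_ fun l => ?_
    · simp [coefR, coefS, extendVec]
    · simp [hR0, hS0, extendVec, (q0 l).1, (q0 l).2, dx, dy, rowFst, rowSnd]
      ring
  · refine Fin.cases ?_ fun l => ?_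
    · simp [coefR, coefS, extendVec]
    · simp [hR, hS, extendVec, (q1 l).1, (q1 l).2, dx, dy, rowFst, rowSnd]
      constructor <;> ring
  · refine Fin.cases ?_ fun l => ?_
    · simp [coefR, coefS, extendVec, d2, d3]
      field_simp
      ring
    · simp [hR, hS, extendVec, (q2 l).1, (q2 l).2, dx, dy, d0, d1, rowFst, rowSnd]
      constructor <;> ring
  · refine Fin.cases ?_ fun l => ?_
    · simp [coefR, coefS, extendVec, d4, d5]
      field_simp
      ring
    · simp [hR, hS, extendVec, (q3 l).1, (q3 l).2, dx, dy, d0, d1, rowFst, rowSnd]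
      constructor <;> ring

end QuatLattice

namespace QuatLattice

open Matrix

variable {t : ℕ}

/-! ### Stretching integer matrices -/

/-- The stretch along `y` on the rows of an integer matrix, with the denominator `c` cleared. -/
def intStretch (c : ℤ) (y : Fin (4 * t) → ℤ) (B : Matrix (Fin (4 * t)) (Fin (4 * t)) ℤ) :
    Matrix (Fin (4 * t)) (Fin (4 * t)) ℤ := c • B + vecMulVec (B *ᵥ y) y

/-- The four stretches along a quaternionic line. -/
def intQuatStretch (c : ℤ) (y : Fin (4 * t) → ℤ) (B : Matrix (Fin (4 * t)) (Fin (4 * t)) ℤ) :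
    Matrix (Fin (4 * t)) (Fin (4 * t)) ℤ :=
  intStretch c (quatI (quatJ (quatI y))) (intStretch c (quatJ (quatI y))
    (intStretch c (quatI y) (intStretch c y B)))

/-- An integer matrix as a real matrix. -/
def realMatrix (B : Matrix (Fin (4 * t)) (Fin (4 * t)) ℤ) : Matrix (Fin (4 * t)) (Fin (4 * t)) ℝ :=
  B.map fun x => (x : ℝ)

theorem toReal_vecMul (z : Fin (4 * t) → ℤ) (B : Matrix (Fin (4 * t)) (Fin (4 * t)) ℤ) :
    toReal (z ᵥ* B) = toReal z ᵥ* realMatrix B := by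
  funext j
  simp [toReal, realMatrix, vecMul, dotProduct]

theorem realMatrix_mulVec (B : Matrix (Fin (4 * t)) (Fin (4 * t)) ℤ) (y : Fin (4 * t) → ℤ) :
    toReal (B *ᵥ y) = realMatrix B *ᵥ toReal y := by
  funext j
  simp [toReal, realMatrix, mulVec, dotProduct]

theorem det_realMatrix (B : Matrix (Fin (4 * t)) (Fin (4 * t)) ℤ) :
    (realMatrix B).det = (B.det : ℝ) :=
  (RingHom.map_det (Int.castRingHom ℝ) B).symm

/-- Only the direction counts, so the integer vector, which is `D` times the real one, defines the
same stretch. -/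
theorem stretch_smul {α D : ℝ} (hD : D ≠ 0) (y : Fin (4 * t) → ℝ) :
    stretch α (D • y) = stretch α y := by
  by_cases hy : y = 0
  · rw [hy, smul_zero]
  have h2 : y ⬝ᵥ y ≠ 0 := fun h => hy (dotProduct_self_eq_zero.1 h)
  simp only [stretch, smul_dotProduct, dotProduct_smul, smul_vecMulVec, vecMulVec_smul, smul_smul,
    smul_eq_mul]
  congr 2
  field_simp

theorem quatStretch_smul {α D : ℝ} (hD : D ≠ 0) (y : Fin (4 * t) → ℝ) :
    quatStretch α (D • y) = quatStretch α y := by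
  simp only [quatStretch, quatI_smul, quatJ_smul, stretch_smul hD]

/-- Multiplying by `c = b * (y ⬝ᵥ y)` clears the denominator of the factor `1 / b / (y ⬝ᵥ y)`
exactly, so no division is needed. -/
theorem realMatrix_intStretch {b : ℕ} (hb : b ≠ 0) {c : ℤ} {y : Fin (4 * t) → ℤ}
    (hy : y ⬝ᵥ y ≠ 0) (hc : c = b * (y ⬝ᵥ y)) (B : Matrix (Fin (4 * t)) (Fin (4 * t)) ℤ) :
    realMatrix (intStretch c y B) = (c : ℝ) • (realMatrix B * stretch (1 / b) (toReal y)) := by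
  have h1 : realMatrix (intStretch c y B) =
      (c : ℝ) • realMatrix B + vecMulVec (realMatrix B *ᵥ toReal y) (toReal y) := by
    rw [← realMatrix_mulVec]
    ext i j
    simp [realMatrix, intStretch, vecMulVec_apply, toReal, -zsmul_eq_mul]
  have hb' : (b : ℝ) ≠ 0 := by exact_mod_cast hb
  have hy' : (((y ⬝ᵥ y : ℤ)) : ℝ) ≠ 0 := by exact_mod_cast hy
  rw [h1, stretch, mul_add, mul_one, smul_add, mul_smul_comm, mul_vecMulVec, smul_smul, toReal_dot]
  have : (c : ℝ) * (1 / b / ((y ⬝ᵥ y : ℤ) : ℝ)) = 1 := by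
    rw [hc]
    push_cast
    field_simp
  rw [this, one_smul]

theorem int_quatI_dot_quatI (y : Fin (4 * t) → ℤ) : quatI y ⬝ᵥ quatI y = y ⬝ᵥ y := by
  rw [quatI_dot, quatI_quatI, dotProduct_neg, neg_neg]

theorem int_quatJ_dot_quatJ (y : Fin (4 * t) → ℤ) : quatJ y ⬝ᵥ quatJ y = y ⬝ᵥ y := by
  rw [quatJ_dot, quatJ_quatJ, dotProduct_neg, neg_neg]

/-- `quatI` and `quatJ` preserve lengths, so the same `c` serves for all four stretches. -/
theorem realMatrix_intQuatStretch {b : ℕ} (hb : b ≠ 0) {c : ℤ} {y : Fin (4 * t) → ℤ}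
    (hy : y ⬝ᵥ y ≠ 0) (hc : c = b * (y ⬝ᵥ y)) (B : Matrix (Fin (4 * t)) (Fin (4 * t)) ℤ) :
    realMatrix (intQuatStretch c y B) =
      ((c ^ 4 : ℤ) : ℝ) • (realMatrix B * quatStretch (1 / b) (toReal y)) := by
  have e1 := int_quatI_dot_quatI y
  have e2 := int_quatJ_dot_quatJ (quatI y)
  have e3 := int_quatI_dot_quatI (quatJ (quatI y))
  rw [e1] at e2
  rw [e2] at e3
  rw [intQuatStretch, realMatrix_intStretch hb (e3 ▸ hy) (e3 ▸ hc),
    realMatrix_intStretch hb (e2 ▸ hy) (e2 ▸ hc), realMatrix_intStretch hb (e1 ▸ hy) (e1 ▸ hc),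
    realMatrix_intStretch hb hy hc, quatStretch]
  simp only [toReal_quatI, toReal_quatJ, smul_mul, smul_smul, ← mul_assoc]
  congr 1
  push_cast
  ring

/-- The relations between an integer matrix in the course of the stretching process, its scale `D`,
the number `s` of stretches and the real transformation `T` that was applied so far. -/
structure Stretched (b R : ℕ) (B₀ : Matrix (Fin (4 * t)) (Fin (4 * t)) ℤ) (s : ℕ) (D : ℤ)
    (B : Matrix (Fin (4 * t)) (Fin (4 * t)) ℤ) (T : Matrix (Fin (4 * t)) (Fin (4 * t)) ℝ) : Prop where
  pos : 0 < D
  eq : realMatrix B = (D : ℝ) • (realMatrix B₀ * T)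
  lin : QuatLinear T
  det : T.det = (1 + 1 / (b : ℝ)) ^ (4 * s)
  le : ∀ x, nrm 1 x ≤ nrm T x
  pot : ∀ (X : Finset (Fin (4 * t) → ℤ)) (S : ℕ), UnitClosed (X : Set (Fin (4 * t) → ℤ)) →
    (∀ z : Fin (4 * t) → ℤ, z ᵥ* B₀ ≠ 0 → (z ᵥ* B₀) ⬝ᵥ (z ᵥ* B₀) < R → z ᵥ* B₀ ∈ X) →
    potential X (1 + 1 / (b : ℝ)) R S 1 < 24 * (S + 1) →
    potential X (1 + 1 / (b : ℝ)) R S T + 24 * s ≤ potential X (1 + 1 / (b : ℝ)) R S 1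

theorem nrm_one (x : Fin (4 * t) → ℤ) : nrm 1 x = ((x ⬝ᵥ x : ℤ) : ℝ) := by
  rw [nrm, vecMul_one, toReal_dot]

theorem Stretched.start (b R : ℕ) (B₀ : Matrix (Fin (4 * t)) (Fin (4 * t)) ℤ) :
    Stretched b R B₀ 0 1 B₀ 1 :=
  ⟨one_pos, by simp, .one, by simp, fun _ => le_rfl, fun _ _ _ _ _ => by simp⟩

section Stretched

variable {b R s : ℕ} {B₀ B : Matrix (Fin (4 * t)) (Fin (4 * t)) ℤ} {D : ℤ}
  {T : Matrix (Fin (4 * t)) (Fin (4 * t)) ℝ}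

theorem Stretched.toReal_vecMul (h : Stretched b R B₀ s D B T) (z : Fin (4 * t) → ℤ) :
    toReal (z ᵥ* B) = (D : ℝ) • (toReal (z ᵥ* B₀) ᵥ* T) := by
  rw [QuatLattice.toReal_vecMul, h.eq, vecMul_smul, ← vecMul_vecMul, ← QuatLattice.toReal_vecMul]

theorem Stretched.dot (h : Stretched b R B₀ s D B T) (z : Fin (4 * t) → ℤ) :
    (((z ᵥ* B) ⬝ᵥ (z ᵥ* B) : ℤ) : ℝ) = (D : ℝ) ^ 2 * nrm T (z ᵥ* B₀) := by
  rw [← toReal_dot, h.toReal_vecMul, smul_dotProduct, dotProduct_smul, nrm, smul_eq_mul, smul_eq_mul]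
  ring

/-- The vector with coordinates `z` is no longer short. -/
def Done (R : ℕ) (B₀ : Matrix (Fin (4 * t)) (Fin (4 * t)) ℤ)
    (T : Matrix (Fin (4 * t)) (Fin (4 * t)) ℝ) (z : Fin (4 * t) → ℤ) : Prop :=
  z ᵥ* B₀ = 0 ∨ (R : ℝ) ≤ nrm T (z ᵥ* B₀)

theorem Done.mono {T' : Matrix (Fin (4 * t)) (Fin (4 * t)) ℝ} {z : Fin (4 * t) → ℤ}
    (h : Done R B₀ T z) (hT : ∀ x, nrm T x ≤ nrm T' x) : Done R B₀ T' z :=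
  h.imp id fun h => h.trans (hT _)

theorem int_dot_self_nonneg (x : Fin (4 * t) → ℤ) : 0 ≤ x ⬝ᵥ x :=
  Finset.sum_nonneg fun i _ => mul_self_nonneg (x i)

/-- These are the tests the program can make on integers. A vanishing image means `z ᵥ* B₀ = 0`,
because `T` shortens nothing. -/
theorem Stretched.done (h : Stretched b R B₀ s D B T) {z : Fin (4 * t) → ℤ}
    (hz : (z ᵥ* B) ⬝ᵥ (z ᵥ* B) ≤ 0 ∨ R * D ^ 2 ≤ (z ᵥ* B) ⬝ᵥ (z ᵥ* B)) : Done R B₀ T z := by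
  have hD : (0 : ℝ) < D := by exact_mod_cast h.pos
  rcases hz with hz | hz
  · left
    have h0 : (z ᵥ* B) ⬝ᵥ (z ᵥ* B) = 0 := le_antisymm hz (int_dot_self_nonneg _)
    have h1 := h.dot z
    rw [h0, Int.cast_zero] at h1
    have h2 : nrm T (z ᵥ* B₀) = 0 := by
      rcases mul_eq_zero.1 h1.symm with h | h
      · exact absurd h (by positivity)
      · exact h
    have h3 := h.le (z ᵥ* B₀)
    rw [h2, nrm_one] at h3
    have h4 : (z ᵥ* B₀) ⬝ᵥ (z ᵥ* B₀) = 0 :=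
      le_antisymm (by exact_mod_cast h3) (int_dot_self_nonneg _)
    exact dotProduct_self_eq_zero.1 h4
  · right
    have h1 := h.dot z
    have h2 : ((R * D ^ 2 : ℤ) : ℝ) ≤ (((z ᵥ* B) ⬝ᵥ (z ᵥ* B) : ℤ) : ℝ) := by exact_mod_cast hz
    rw [h1] at h2
    push_cast at h2
    rw [mul_comm] at h2
    exact le_of_mul_le_mul_left h2 (by positivity)

/-- A vector that is short under `T` was short at the start, since `T` shortens nothing. It
therefore belongs to every `X` admitted in `Stretched.pot`, and `potential_mul_quatStretch` applies.
-/
theorem Stretched.step (h : Stretched b R B₀ s D B T) (hb : b ≠ 0) {z : Fin (4 * t) → ℤ} {c : ℤ}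
    (hz : 0 < (z ᵥ* B) ⬝ᵥ (z ᵥ* B)) (hzR : (z ᵥ* B) ⬝ᵥ (z ᵥ* B) < R * D ^ 2)
    (hc : c = b * ((z ᵥ* B) ⬝ᵥ (z ᵥ* B))) :
    ∃ T', Stretched b R B₀ (s + 1) (D * c ^ 4) (intQuatStretch c (z ᵥ* B) B) T' ∧
      ∀ x, nrm T x ≤ nrm T' x := by
  have hD : (0 : ℝ) < D := by exact_mod_cast h.pos
  have hb0 : (0 : ℤ) < b := by exact_mod_cast Nat.pos_of_ne_zero hb
  have hc0 : 0 < c := by rw [hc]; positivity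
  set y := toReal (z ᵥ* B₀) ᵥ* T with hy
  have hyn : nrm T (z ᵥ* B₀) = y ⬝ᵥ y := rfl
  have hdot := h.dot z
  have hy0 : y ≠ 0 := by
    intro h0
    rw [hyn, h0, zero_dotProduct, mul_zero] at hdot
    have : (z ᵥ* B) ⬝ᵥ (z ᵥ* B) = 0 := by exact_mod_cast hdot
    omega
  have hyR : nrm T (z ᵥ* B₀) < R := by
    have h2 : (((z ᵥ* B) ⬝ᵥ (z ᵥ* B) : ℤ) : ℝ) < ((R * D ^ 2 : ℤ) : ℝ) := by exact_mod_cast hzR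
    rw [hdot] at h2
    push_cast at h2
    rw [mul_comm (R : ℝ)] at h2
    exact lt_of_mul_lt_mul_left h2 (by positivity)
  have hα : (0 : ℝ) ≤ 1 / b := by positivity
  refine ⟨T * quatStretch (1 / b) y, ⟨by positivity [h.pos], ?_, h.lin.mul_quatStretch _ _, ?_,
    fun x => (h.le x).trans (nrm_le_nrm_mul_quatStretch hα _ _ _), ?_⟩,
    fun x => nrm_le_nrm_mul_quatStretch hα _ _ _⟩
  · rw [realMatrix_intQuatStretch hb hz.ne' hc, h.toReal_vecMul, quatStretch_smul hD.ne', h.eq,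
      smul_mul, smul_smul, mul_assoc]
    congr 1
    push_cast
    ring
  · rw [det_mul, h.det, det_quatStretch _ hy0]
    ring
  · intro X S hX hmem hlt
    have h1 := h.pot X S hX hmem hlt
    have hx0 : z ᵥ* B₀ ≠ 0 := by
      intro h0
      apply hy0
      rw [hy, h0]
      have : toReal (0 : Fin (4 * t) → ℤ) = 0 := by funext j; simp [toReal]
      rw [this, zero_vecMul]
    have hxR : (z ᵥ* B₀) ⬝ᵥ (z ᵥ* B₀) < R := by
      have := (h.le (z ᵥ* B₀)).trans_lt hyR
      rw [nrm_one] at this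
      exact_mod_cast this
    have h2 := potential_mul_quatStretch (ρ := 1 + 1 / (b : ℝ)) (r := R) (S := S) hX (by linarith) h.lin
      (by omega) (hmem z hx0 hxR) hy0 hyR
    rw [add_sub_cancel_left, ← hy] at h2
    omega

end Stretched

/-! ### Density -/

theorem packingDensity_eq {d : ℕ} {B : Matrix (Fin d) (Fin d) ℤ} (hB : B.det ≠ 0) :
    packingDensity (rowLattice B) =
      volume.real (Metric.ball (0 : EuclideanSpace ℝ (Fin d)) (shortestLength (rowLattice B) / 2)) /
        |(B.det : ℝ)| := by
  rw [packingDensity]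
  congr 1
  set v : Fin d → EuclideanSpace ℝ (Fin d) := fun i => WithLp.toLp 2 fun j => (B i j : ℝ) with hv
  set e := (EuclideanSpace.basisFun (Fin d) ℝ).toBasis with he
  have hdet : e.det v = (B.det : ℝ) := by
    rw [Module.Basis.det_apply, ← Matrix.det_transpose]
    have : (e.toMatrix v)ᵀ = B.map fun x => (x : ℝ) := by
      ext i j
      simp [Module.Basis.toMatrix_apply, he, hv]
    rw [this]
    exact (RingHom.map_det (Int.castRingHom ℝ) B).symm
  have hunit : IsUnit (e.det v) := by
    rw [hdet]
    exact isUnit_iff_ne_zero.2 (by exact_mod_cast hB)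
  obtain ⟨hli, hsp⟩ := (Module.Basis.is_basis_iff_det e).2 hunit
  set b := Module.Basis.mk hli hsp.ge with hb
  have hbv : ⇑b = v := Module.Basis.coe_mk hli hsp.ge
  have hL : rowLattice B = Submodule.span ℤ (Set.range b) := by
    rw [hbv, hv]
    rfl
  rw [hL, ZLattice.covolume_eq_measure_fundamentalDomain _ _ (ZSpan.isAddFundamentalDomain b volume),
    ZSpan.measureReal_fundamentalDomain b volume e, hbv, hdet]
  have : volume.real (ZSpan.fundamentalDomain e) = 1 := by
    rw [measureReal_def, measure_congr (ZSpan.fundamentalDomain_ae_parallelepiped e volume), he,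
      OrthonormalBasis.coe_toBasis, OrthonormalBasis.volume_parallelepiped, ENNReal.toReal_one]
  rw [this, mul_one]

theorem exists_of_mem_rowLattice {d : ℕ} {B : Matrix (Fin d) (Fin d) ℤ}
    {v : EuclideanSpace ℝ (Fin d)} (hv : v ∈ rowLattice B) :
    ∃ z : Fin d → ℤ, v = WithLp.toLp 2 fun j => ((z ᵥ* B) j : ℝ) := by
  obtain ⟨z, rfl⟩ := (Submodule.mem_span_range_iff_exists_fun ℤ).1 hv
  refine ⟨z, ?_⟩
  ext j
  simp [vecMul, dotProduct]

theorem mem_rowLattice {d : ℕ} (B : Matrix (Fin d) (Fin d) ℤ) (i : Fin d) :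
    (WithLp.toLp 2 fun j => (B i j : ℝ)) ∈ rowLattice B := Submodule.subset_span ⟨i, rfl⟩

/-- The density that a matrix `M` at the end of the stretching process guarantees. -/
theorem density_of_stretched (ht : t ≠ 0) {P : ℤ} {r s' : ℕ → ℤ} (hco : StartCoeff t P r s') {b R s : ℕ}
    {D : ℤ} {B : Matrix (Fin (4 * t)) (Fin (4 * t)) ℤ} {T : Matrix (Fin (4 * t)) (Fin (4 * t)) ℝ}
    (h : Stretched b R (startMatrix t r s') s D B T) (hs : 4 * s ≤ b) (hb : b ≠ 0)
    (hdone : ∀ z : Fin (4 * t) → ℤ, (∀ i, |z i| ≤ 20 * t * R) → Done R (startMatrix t r s') T z) :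
    B.det ≠ 0 ∧ unitBall t * (R : ℝ) ^ (2 * t) / (2 ^ (4 * t) * Real.exp 1 * 2 ^ t * (P : ℝ) ^ 2) ≤
      packingDensity (rowLattice B) := by
  have hD : (0 : ℝ) < D := by exact_mod_cast h.pos
  have hP : (0 : ℝ) < P := by exact_mod_cast hco.pos
  have hV := unitBall_pos (t := t) ht
  have hdet : (B.det : ℝ) = (D : ℝ) ^ (4 * t) * (2 ^ t * (P : ℝ) ^ 2 * (1 + 1 / (b : ℝ)) ^ (4 * s)) := by
    rw [← det_realMatrix, h.eq, det_smul, Fintype.card_fin, det_mul, h.det, det_realMatrix,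
      det_startMatrix hco ht]
    push_cast
    ring
  have hdet0 : (0 : ℝ) < B.det := by
    rw [hdet]
    positivity
  have hB : B.det ≠ 0 := by
    intro h0
    rw [h0] at hdet0
    simp at hdet0
  refine ⟨hB, ?_⟩
  -- At most `b / 4` stretches, each with determinant `(1 + 1 / b) ^ 4`: this is the factor `e` in
  -- the density.
  have hle : (B.det : ℝ) ≤ (D : ℝ) ^ (4 * t) * (2 ^ t * (P : ℝ) ^ 2 * Real.exp 1) := by
    rw [hdet]
    gcongr
    have hb0 : (0 : ℝ) < b := by positivity
    calc (1 + 1 / (b : ℝ)) ^ (4 * s) ≤ (1 + 1 / (b : ℝ)) ^ b :=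
          pow_le_pow_right₀ (by simp) hs
      _ ≤ Real.exp (b / b) := one_add_div_pow_le hb0 b
      _ = _ := by rw [div_self hb0.ne']
  -- Outside the box the vectors are long from the start, and stretching keeps them long.
  have hall : ∀ z, Done R (startMatrix t r s') T z := by
    intro z
    by_cases hz : (z ᵥ* startMatrix t r s') ⬝ᵥ (z ᵥ* startMatrix t r s') < R
    · exact hdone z (abs_coord_le hco z hz)
    · right
      refine le_trans ?_ (h.le _)
      rw [nrm_one]
      exact_mod_cast not_lt.1 hz
  have hshort : (D : ℝ) * √R ≤ shortestLength (rowLattice B) := by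
    refine le_csInf ?_ ?_
    · refine ⟨_, _, mem_rowLattice B ⟨0, by omega⟩, ?_, rfl⟩
      intro h0
      apply hB
      refine det_eq_zero_of_row_eq_zero ⟨0, by omega⟩ fun j => ?_
      have := congrArg (fun v : EuclideanSpace ℝ (Fin (4 * t)) => v j) h0
      simpa using this
    · rintro _ ⟨v, hv, hv0, rfl⟩
      obtain ⟨z, rfl⟩ := exists_of_mem_rowLattice hv
      have hsq : ‖(WithLp.toLp 2 fun j => ((z ᵥ* B) j : ℝ) : EuclideanSpace ℝ (Fin (4 * t)))‖ ^ 2 =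
          (D : ℝ) ^ 2 * nrm T (z ᵥ* startMatrix t r s') := by
        rw [← h.dot z, EuclideanSpace.norm_sq_eq]
        simp [dotProduct, sq]
      refine le_of_sq_le_sq ?_ (norm_nonneg _)
      rw [hsq, mul_pow, Real.sq_sqrt (by positivity)]
      refine mul_le_mul_of_nonneg_left ?_ (by positivity)
      refine (hall z).resolve_left fun h0 => hv0 ?_
      have h1 := h.toReal_vecMul z
      rw [h0] at h1
      have h2 : toReal (0 : Fin (4 * t) → ℤ) = 0 := by funext j; simp [toReal]
      rw [h2, zero_vecMul, smul_zero] at h1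
      ext j
      exact congrFun h1 j
  rw [packingDensity_eq hB, abs_of_pos hdet0, volume_real_ball t ht (by
    have : 0 ≤ (D : ℝ) * √R := by positivity
    linarith)]
  have hpow : ((D : ℝ) * √R / 2) ^ (4 * t) = (D : ℝ) ^ (4 * t) * (R : ℝ) ^ (2 * t) / 2 ^ (4 * t) := by
    rw [div_pow, mul_pow]
    congr 2
    rw [show 4 * t = 2 * (2 * t) by ring, pow_mul (√(R : ℝ)), Real.sq_sqrt (by positivity)]
  calc unitBall t * (R : ℝ) ^ (2 * t) / (2 ^ (4 * t) * Real.exp 1 * 2 ^ t * (P : ℝ) ^ 2)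
      = ((D : ℝ) * √R / 2) ^ (4 * t) * unitBall t /
        ((D : ℝ) ^ (4 * t) * (2 ^ t * (P : ℝ) ^ 2 * Real.exp 1)) := by
        rw [hpow]
        field_simp
    _ ≤ _ := by
      have h0 : 0 ≤ (D : ℝ) * √R := by positivity
      gcongr
      exact mul_nonneg (pow_nonneg (by linarith) _) hV.le

/-! ### Candidates that succeed -/

/-- For the `u` of the mean value argument, let `X` be the set of short nonzero vectors of its
lattice. Its potential is at most `24 * (k * t)`, so the potential argument applies, and 24 units
per stretch allow `k * t` stretches. This holds whatever vectors are chosen for the stretches and in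
whatever order. -/
theorem exists_good_candidate {k p R : ℕ} [Fact p.Prime] (ht : t ≠ 0) (hk : k ≠ 0) {δ : ℝ} (hδ : 0 < δ)
    (hp2 : p ≠ 2) (hR : R ≠ 0) (hRp : R < p) (hRt : 28 * (t : ℝ) ^ 3 ≤ R * (Real.log (1 + δ) / 4) ^ 2)
    (hV : unitBall t * (R : ℝ) ^ (2 * t) * (1 + δ) * (k + 1) ≤ 24 * (k * t) * 2 ^ t * (p : ℝ) ^ 2) :
    ∃ c < p ^ (2 * t + 4), ∀ d : ℕ → ℤ, (∀ j < 2 * t + 4, d j = ((c / p ^ j % p : ℕ) : ℤ)) →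
      ∀ s D B T, Stretched (4 * k * t) R (digitMatrix t p d) s D B T → s ≤ k * t := by
  classical
  obtain ⟨m, rfl⟩ : ∃ m, t = m + 1 := ⟨t - 1, by omega⟩
  obtain ⟨a, b, hab⟩ := ZMod.sq_add_sq p (-1 : ZMod p)
  have hp0 : 0 < p := (Fact.out : p.Prime).pos
  have h2 : (2 : ZMod p) ≠ 0 := by
    intro h
    have : ((2 : ℕ) : ZMod p) = 0 := by exact_mod_cast h
    rw [ZMod.natCast_eq_zero_iff] at this
    exact hp2 ((Nat.prime_dvd_prime_iff_eq (Fact.out : p.Prime) Nat.prime_two).1 this)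
  set Y : Finset (Fin (4 * (m + 1)) → ℤ) :=
    (Fintype.piFinset fun _ => Finset.Icc (-(R : ℤ)) R).filter fun x => x ≠ 0 ∧ InD4 x ∧ x ⬝ᵥ x < R with hYdef
  have hYmem : ∀ x, x ∈ Y ↔ x ≠ 0 ∧ InD4 x ∧ x ⬝ᵥ x < R := by
    intro x
    rw [hYdef, Finset.mem_filter, Fintype.mem_piFinset]
    refine ⟨fun h => h.2, fun h => ⟨fun j => ?_, h⟩⟩
    rw [Finset.mem_Icc]
    exact abs_le.1 (abs_le_of_dot_lt h.2.2 j)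
  obtain ⟨u, hu⟩ := exists_potential_le hp2 hab Y (fun x hx => by
    obtain ⟨h0, h1, h3⟩ := (hYmem x).1 hx
    exact ⟨h0, h1, h3.trans (by exact_mod_cast hRp)⟩) (1 + 1 / ((4 * k * (m + 1) : ℕ) : ℝ)) R (k * (m + 1))
  obtain ⟨c, hc, hcd⟩ := exists_digits hp2 a b u
  refine ⟨c, hc, fun d hd s D B T h => ?_⟩
  set X := Y.filter fun x => x ∈ annLattice a b (extendVec u) with hX
  have hsum := sum_card_short_le (t := m + 1) (by omega) hk Y (fun x hx => ((hYmem x).1 hx).2.1) hR hδ hRt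
  have hpot : potential X (1 + 1 / ((4 * k * (m + 1) : ℕ) : ℝ)) R (k * (m + 1)) 1 ≤ 24 * (k * (m + 1)) := by
    have h1 : ((potential X (1 + 1 / ((4 * k * (m + 1) : ℕ) : ℝ)) R (k * (m + 1)) 1 * p ^ 2 : ℕ) : ℝ) ≤
        24 * (k * (m + 1)) * (p : ℝ) ^ 2 := by
      refine (Nat.cast_le.2 hu).trans ?_
      push_cast at hsum ⊢
      refine hsum.trans ?_
      rw [div_le_iff₀ (by positivity)]
      refine hV.trans (le_of_eq ?_)
      push_cast
      ring
    have h3 : potential X (1 + 1 / ((4 * k * (m + 1) : ℕ) : ℝ)) R (k * (m + 1)) 1 * p ^ 2 ≤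
        24 * (k * (m + 1)) * p ^ 2 := by exact_mod_cast h1
    exact Nat.le_of_mul_le_mul_right h3 (by positivity)
  have hclosed : UnitClosed (X : Set (Fin (4 * (m + 1)) → ℤ)) := by
    intro x hx q hq
    obtain ⟨hxY, hxa⟩ := Finset.mem_filter.1 hx
    obtain ⟨h0, h1, h3⟩ := (hYmem x).1 hxY
    obtain ⟨z, hz, hzx⟩ := unitClosed_annLattice h2 hab _ x hxa q hq
    have hzz : toReal z ⬝ᵥ toReal z = toReal x ⬝ᵥ toReal x := by
      have h4 := congrArg toReal hzx
      rw [toReal_comb] at h4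
      have h5 : toReal ((2 : ℤ) • z) = (2 : ℝ) • toReal z := by
        funext j
        simp [toReal]
      have h6 := comb_dot_self (fun i => (q i : ℝ)) (toReal x)
      have h7 : ((q 0 : ℝ) ^ 2 + (q 1 : ℝ) ^ 2 + (q 2 : ℝ) ^ 2 + (q 3 : ℝ) ^ 2) = 4 := by
        exact_mod_cast sq_sum_of_mem_units hq
      rw [← h4, h5, h7, smul_dotProduct, dotProduct_smul, smul_eq_mul, smul_eq_mul] at h6
      linarith
    rw [toReal_dot, toReal_dot] at hzz
    have hzz' : z ⬝ᵥ z = x ⬝ᵥ x := by exact_mod_cast hzz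
    refine ⟨z, Finset.mem_coe.2 (Finset.mem_filter.2 ⟨(hYmem z).2 ⟨?_, hz.1, hzz' ▸ h3⟩, hz⟩), hzx⟩
    rintro rfl
    rw [zero_dotProduct] at hzz'
    exact h0 (dotProduct_self_eq_zero.1 hzz'.symm)
  have := h.pot X (k * (m + 1)) hclosed (fun z hz0 hzR => by
    have hz := vecMul_mem_annLattice (hcd d hd) z
    exact Finset.mem_filter.2 ⟨(hYmem _).2 ⟨hz0, hz.1, hzR⟩, hz⟩) (by
      omega)
  omega

end QuatLattice

/-! ### The zeta value and the final inequality for the density -/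

namespace QuatLattice

theorem tendsto_riemannZeta_four_mul :
    Tendsto (fun t : ℕ => (riemannZeta (4 * (t : ℂ))).re) atTop (𝓝 1) := by
  have h1 := LSeries.tendsto_atTop (f := 1) (by
    rw [LSeries.abscissaOfAbsConv_one]
    exact EReal.coe_lt_top 1)
  have h2 : Tendsto (fun t : ℕ => 4 * (t : ℝ)) atTop atTop :=
    tendsto_natCast_atTop_atTop.const_mul_atTop (by norm_num)
  have h3 := (Complex.continuous_re.tendsto _).comp (h1.comp h2)
  simp only [Pi.one_apply, Complex.one_re] at h3
  refine h3.congr' ?_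
  filter_upwards [eventually_ge_atTop 1] with t ht
  have ht' : (1 : ℝ) ≤ t := by exact_mod_cast ht
  simp only [Function.comp]
  rw [LSeries_one_eq_riemannZeta]
  · push_cast
    rfl
  · simp
    linarith

/-- Both `ζ(4t)` and `1 - exp (-t)` tend to 1, while `(1 - ε) * (1 + ε / 8) ^ 3 < (1 - ε) * (1 + ε)
< 1`. -/
theorem eventually_zeta_le {ε : ℝ} (hε : 0 < ε) (hε1 : ε < 1) :
    ∀ᶠ t : ℕ in atTop, (1 - ε) * (1 + ε / 8) ^ 3 * (riemannZeta (4 * (t : ℂ))).re ≤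
      1 - Real.exp (-(t : ℝ)) := by
  have h1 : Tendsto (fun t : ℕ => (1 - ε) * (1 + ε / 8) ^ 3 * (riemannZeta (4 * (t : ℂ))).re) atTop
      (𝓝 ((1 - ε) * (1 + ε / 8) ^ 3 * 1)) := tendsto_riemannZeta_four_mul.const_mul _
  have h2 : Tendsto (fun t : ℕ => 1 - Real.exp (-(t : ℝ))) atTop (𝓝 (1 - 0)) :=
    (Real.tendsto_exp_neg_atTop_nhds_zero.comp tendsto_natCast_atTop_atTop).const_sub 1
  have hlt : (1 - ε) * (1 + ε / 8) ^ 3 * 1 < 1 - 0 := by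
    have h3 : (1 + ε / 8) ^ 3 < 1 + ε := by nlinarith [mul_pos hε hε, mul_pos hε (mul_pos hε hε)]
    nlinarith
  exact (h1.eventually_lt h2 hlt).mono fun t ht => ht.le

/-- Three factors `1 + ε / 8` are lost: two in the choice of the radius and one in `(k + 1) / k`.
The pair `u`, `v` kept by the search replaces `R ^ (2 * t)`, `p ^ 2` and only has to be at least as
good. -/
theorem density_bound {ε : ℝ} (hε : 0 < ε) {t k p R : ℕ} (ht : t ≠ 0) (hk : k ≠ 0)
    (hkε : 1 ≤ k * (ε / 8)) (hp : 0 < p)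
    (hV : 24 * (k * t) * 2 ^ t * (p : ℝ) ^ 2 ≤
      unitBall t * (R : ℝ) ^ (2 * t) * (1 + ε / 8) ^ 2 * (k + 1))
    (hz : (1 - ε) * (1 + ε / 8) ^ 3 * (riemannZeta (4 * (t : ℂ))).re ≤ 1 - Real.exp (-(t : ℝ)))
    {u v Δ : ℝ} (hv : 0 < v) (huv : (R : ℝ) ^ (2 * t) * v ≤ u * (p : ℝ) ^ 2)
    (hΔ : unitBall t * u / (2 ^ (4 * t) * Real.exp 1 * 2 ^ t * v) ≤ Δ) :
    (1 - ε) * (24 * (t : ℝ) * (riemannZeta (4 * (t : ℂ))).re /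
      (2 ^ (4 * t) * (Real.exp 1 * (1 - Real.exp (-(t : ℝ)))))) ≤ Δ := by
  have hU := unitBall_pos ht
  have ht' : (0 : ℝ) < t := by positivity
  have hk' : (0 : ℝ) < k := by positivity
  have hp' : (0 : ℝ) < p := by positivity
  have hE : 0 < 1 - Real.exp (-(t : ℝ)) := by
    have : Real.exp (-(t : ℝ)) < 1 := Real.exp_zero ▸ Real.exp_lt_exp.2 (by linarith)
    linarith
  have key : 24 * t * 2 ^ t * v ≤ unitBall t * u * (1 + ε / 8) ^ 3 := by
    have h1 : (k + 1 : ℝ) ≤ k * (1 + ε / 8) := by linarith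
    have hu : 0 ≤ u * (p : ℝ) ^ 2 := le_trans (by positivity) huv
    have h2 : 24 * (k * t) * 2 ^ t * (p : ℝ) ^ 2 * v ≤
        unitBall t * (u * (p : ℝ) ^ 2) * (1 + ε / 8) ^ 2 * (k * (1 + ε / 8)) := by
      calc _ ≤ unitBall t * (R : ℝ) ^ (2 * t) * (1 + ε / 8) ^ 2 * (k + 1) * v := by gcongr
        _ = unitBall t * ((R : ℝ) ^ (2 * t) * v) * (1 + ε / 8) ^ 2 * (k + 1) := by ring
        _ ≤ _ := by gcongr
    have h3 : (k * (p : ℝ) ^ 2) * (24 * t * 2 ^ t * v) ≤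
        (k * (p : ℝ) ^ 2) * (unitBall t * u * (1 + ε / 8) ^ 3) := by
      refine le_of_eq_of_le (by ring) (h2.trans (le_of_eq (by ring)))
    exact le_of_mul_le_mul_left h3 (by positivity)
  refine le_trans ?_ hΔ
  rw [mul_div_assoc', div_le_div_iff₀ (by positivity) (by positivity)]
  have h4 : (1 - ε) * (24 * t * (riemannZeta (4 * (t : ℂ))).re) * (2 ^ t * v) ≤
      unitBall t * u * (1 - Real.exp (-(t : ℝ))) := by
    -- If the left side is not positive there is nothing to prove, so the sign of the zeta value
    -- need not be known.
    rcases le_or_gt ((1 - ε) * (riemannZeta (4 * (t : ℂ))).re) 0 with hneg | hpos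
    · have hu : 0 ≤ unitBall t * u := by
        have : (0 : ℝ) ≤ 24 * t * 2 ^ t * v := by positivity
        have h5 : 0 ≤ unitBall t * u * (1 + ε / 8) ^ 3 := this.trans key
        exact nonneg_of_mul_nonneg_left h5 (by positivity)
      have h6 : (1 - ε) * (24 * t * (riemannZeta (4 * (t : ℂ))).re) * (2 ^ t * v) =
        ((1 - ε) * (riemannZeta (4 * (t : ℂ))).re) * (24 * t * 2 ^ t * v) := by ring
      rw [h6]
      exact (mul_nonpos_of_nonpos_of_nonneg hneg (by positivity)).trans (mul_nonneg hu hE.le)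
    · have hu : 0 ≤ unitBall t * u := by
        have : (0 : ℝ) ≤ 24 * t * 2 ^ t * v := by positivity
        have h5 : 0 ≤ unitBall t * u * (1 + ε / 8) ^ 3 := this.trans key
        exact nonneg_of_mul_nonneg_left h5 (by positivity)
      calc _ = ((1 - ε) * (riemannZeta (4 * (t : ℂ))).re) * (24 * t * 2 ^ t * v) := by ring
        _ ≤ ((1 - ε) * (riemannZeta (4 * (t : ℂ))).re) * (unitBall t * u * (1 + ε / 8) ^ 3) := by gcongr
        _ = unitBall t * u * ((1 - ε) * (1 + ε / 8) ^ 3 * (riemannZeta (4 * (t : ℂ))).re) := by ring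
        _ ≤ _ := by gcongr
  calc _ = ((1 - ε) * (24 * t * (riemannZeta (4 * (t : ℂ))).re) * (2 ^ t * v)) *
        (2 ^ (4 * t) * Real.exp 1) := by ring
    _ ≤ (unitBall t * u * (1 - Real.exp (-(t : ℝ)))) * (2 ^ (4 * t) * Real.exp 1) := by gcongr
    _ = _ := by ring

end QuatLattice

namespace Ram

open BitMachine QuatLattice Matrix

/-! ### Subprograms

Scalar variables: `1` dimension, `18` number whose digits are extracted, `20`, `21`, `22` loop variables,
`23`, `24` and `31` to `34` loaded entries, `26` factor of a stretch, `28` inner product, `12` scale.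
Array variables: `0` matrix, `1` vector. -/

/-- Assign to `x` the power of `e` with exponent `m`. -/
def powCmd (x i : ℕ) (e m : Expr) : Cmd :=
  .seq (.set x (.const 1)) (Cmd.for_ i m (.set x (.var x * e)))

/-- Write the digits of `src`, minus an offset, into an array. -/
def digitsCmd (a : ℕ) (src cnt base off : Expr) : Cmd :=
  .seq (.set 18 src) (Cmd.for_ 20 cnt
    (.seq (.store a (.var 20) (.var 18 % base - off)) (.set 18 (.var 18 / base))))

/-- An inner product. -/
def dotCmd (a₁ : ℕ) (e₁ : Expr) (a₂ : ℕ) (e₂ : Expr) : Cmd :=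
  .seq (.set 28 (.const 0)) (Cmd.for_ 22 (.var 1)
    (.seq (.load 23 a₁ e₁) (.seq (.load 24 a₂ e₂) (.set 28 (.var 28 + .var 23 * .var 24)))))

/-- The stretch of the matrix along the vector. -/
def stretchCmd : Cmd :=
  .seq (Cmd.for_ 20 (.var 1)
    (.seq (dotCmd 0 (.var 20 * .var 1 + .var 22) 1 (.var 22))
      (Cmd.for_ 21 (.var 1) (.seq (.load 23 0 (.var 20 * .var 1 + .var 21)) (.seq (.load 24 1 (.var 21))
        (.store 0 (.var 20 * .var 1 + .var 21) (.var 26 * .var 23 + .var 28 * .var 24)))))))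
    (.set 12 (.var 12 * .var 26))

/-- Replace the entries in every block of the vector by expressions in these entries. -/
def rotCmd (f : Fin 4 → Expr) : Cmd :=
  Cmd.for_ 20 (.var 0)
    (.seq (.load 31 1 (.const 4 * .var 20)) (.seq (.load 32 1 (.const 4 * .var 20 + .const 1))
    (.seq (.load 33 1 (.const 4 * .var 20 + .const 2)) (.seq (.load 34 1 (.const 4 * .var 20 + .const 3))
    (.seq (.store 1 (.const 4 * .var 20) (f 0)) (.seq (.store 1 (.const 4 * .var 20 + .const 1) (f 1))
    (.seq (.store 1 (.const 4 * .var 20 + .const 2) (f 2))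
      (.store 1 (.const 4 * .var 20 + .const 3) (f 3)))))))))

/-- The matrix stored in an array. -/
def matOf (t : ℕ) (f : ℕ → ℤ) : Matrix (Fin (4 * t)) (Fin (4 * t)) ℤ :=
  Matrix.of fun i j => f (i * (4 * t) + j)

/-- The vector stored in an array. -/
def vecOf (t : ℕ) (f : ℕ → ℤ) : Fin (4 * t) → ℤ := fun j => f j

section Specs

variable {h : ℤ} {A : ℕ} {s : St}

theorem wp_pow {x i : ℕ} {e m : Expr} (q N : ℕ) (hxi : i ≠ x) (he : e.eval s.v = q)
    (hev : ∀ y ∈ e.vars, y ≠ x ∧ y ≠ i) (hm : m.eval s.v = N) (hmv : ∀ y ∈ m.vars, y ≠ x ∧ y ≠ i)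
    (hN : (N : ℤ) < h) (hb : ∀ j ≤ N, (q : ℤ) ^ j < h) :
    Wp h A (powCmd x i e m) s fun s' n => n ≤ 3 * N + 3 ∧ s'.v x = (q : ℤ) ^ N := by
  have h1 : (1 : ℤ) < h := by simpa using hb 0 (by omega)
  refine wp_seq (wp_set (by simpa using h1) ?_)
  refine wp_for N 1 (fun j s' => s'.v x = (q : ℤ) ^ j) (by simp [Cmd.wv, hxi])
    (fun y hy => by simpa [Cmd.wv] using hmv y hy) ?_ hN (by simp [hxi.symm]) ?_ ?_
  · rw [← hm]
    exact Expr.eval_congr fun y hy => by simp [(hmv y hy).1]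
  · intro j s' hj hf hi hI
    have he' : e.eval s'.v = q := by
      rw [← he]
      refine Expr.eval_congr fun y hy => ?_
      have := hev y hy
      rw [hf.v y (by simp [Cmd.for_, Cmd.wv, this])]
      simp [this.1]
    refine wp_set ?_ ⟨le_rfl, ?_⟩
    · rw [Expr.eval_mul, Expr.eval_var, hI, he', ← pow_succ, abs_of_nonneg (by positivity)]
      exact hb _ hj
    · simp [hxi.symm, hI, he', pow_succ]
  · intro s' n _ hn hI
    exact ⟨by omega, hI⟩

theorem wp_digits {a : ℕ} {src cnt base off : Expr} (c N P : ℕ) (Z : ℤ) (hc : src.eval s.v = c)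
    (hN : cnt.eval s.v = N) (hP : base.eval s.v = P) (hZ : off.eval s.v = Z)
    (hcnt : ∀ y ∈ cnt.vars, y ≠ 18 ∧ y ≠ 20) (hbase : ∀ y ∈ base.vars, y ≠ 18 ∧ y ≠ 20)
    (hoff : ∀ y ∈ off.vars, y ≠ 18 ∧ y ≠ 20) (hch : (c : ℤ) < h) (hNh : (N : ℤ) < h) (hNA : N ≤ A)
    (hP0 : 0 < P) (hPh : P + |Z| < h) :
    Wp h A (digitsCmd a src cnt base off) s fun s' n => n ≤ 4 * N + 3 ∧
      ∀ j < N, s'.a a j = ((c / P ^ j % P : ℕ) : ℤ) - Z := by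
  refine wp_seq (wp_set (by rw [hc, abs_of_nonneg (by positivity)]; exact hch) ?_)
  refine wp_for N 2 (fun i s' => s'.v 18 = ((c / P ^ i : ℕ) : ℤ) ∧
      ∀ j < i, s'.a a j = ((c / P ^ j % P : ℕ) : ℤ) - Z) (by simp [Cmd.wv])
    (fun y hy => by simpa [Cmd.wv] using hcnt y hy) ?_ hNh (by simp [hc]) ?_ ?_
  · rw [← hN]
    exact Expr.eval_congr fun y hy => by simp [(hcnt y hy).1]
  · intro i s' hi hf hvi ⟨hu, hd⟩
    have hev : ∀ e : Expr, (∀ y ∈ e.vars, y ≠ 18 ∧ y ≠ 20) → e.eval s'.v = e.eval s.v := by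
      intro e he
      refine Expr.eval_congr fun y hy => ?_
      have := he y hy
      rw [hf.v y (by simp [Cmd.for_, Cmd.wv, this])]
      simp [this.1]
    have e1 := hev _ hbase
    have e2 := hev _ hoff
    rw [hP] at e1
    rw [hZ] at e2
    have hval : (Expr.var 18 % base - off).eval s'.v = ((c / P ^ i % P : ℕ) : ℤ) - Z := by
      simp [e1, e2, hu]
    refine wp_seq (wp_store i (by simp [hvi]) (by omega) ?_ ?_)
    · rw [hval]
      have h1 : c / P ^ i % P < P := Nat.mod_lt _ hP0
      have h2 := neg_abs_le Z
      have h3 := le_abs_self Z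
      rw [abs_lt]
      omega
    · rw [hval]
      have hval2 : (Expr.var 18 / base).eval s'.v = ((c / P ^ (i + 1) : ℕ) : ℤ) := by
        rw [Expr.eval_div, Expr.eval_var, hu, e1, pow_succ, ← Nat.div_div_eq_div_mul]
        simp
      refine wp_set ?_ ⟨le_rfl, ?_, ?_⟩
      · rw [St.seta_v, hval2, abs_of_nonneg (by positivity)]
        have := Nat.div_le_self c (P ^ (i + 1))
        omega
      · simp [hval2]
      · intro j hj
        simp only [St.setv_a, St.seta_a, if_true, Function.update_apply]
        split_ifs with hji
        · rw [hji]
        · exact hd j (by omega)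
  · intro s' n _ hn hI
    exact ⟨by omega, hI.2⟩

/-- The address expressions are evaluated while the scratch variables 22, 23, 24, 28 change, so
their values are required in all states that agree with `s` elsewhere. -/
theorem wp_dot {a₁ a₂ : ℕ} {e₁ e₂ : Expr} (n : ℕ) (f₁ f₂ : ℕ → ℕ) (hn : s.v 1 = n) (hnh : (n : ℤ) < h)
    (he₁ : ∀ (s' : St) i, (∀ y, y ≠ 22 → y ≠ 23 → y ≠ 24 → y ≠ 28 → s'.v y = s.v y) → s'.v 22 = (i : ℕ) →
      e₁.eval s'.v = f₁ i)
    (he₂ : ∀ (s' : St) i, (∀ y, y ≠ 22 → y ≠ 23 → y ≠ 24 → y ≠ 28 → s'.v y = s.v y) → s'.v 22 = (i : ℕ) →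
      e₂.eval s'.v = f₂ i)
    (hf₁ : ∀ i < n, f₁ i < A) (hf₂ : ∀ i < n, f₂ i < A) {U V : ℤ}
    (hU : ∀ i < n, |s.a a₁ (f₁ i)| ≤ U) (hV : ∀ i < n, |s.a a₂ (f₂ i)| ≤ V) (hUV : n * (U * V) < h) :
    Wp h A (dotCmd a₁ e₁ a₂ e₂) s fun s' m => m ≤ 5 * n + 3 ∧
      s'.v 28 = ∑ i ∈ Finset.range n, s.a a₁ (f₁ i) * s.a a₂ (f₂ i) := by
  refine wp_seq (wp_set (by simp; omega) ?_)
  refine wp_for n 3 (fun i s' => s'.v 28 = ∑ i ∈ Finset.range i, s.a a₁ (f₁ i) * s.a a₂ (f₂ i))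
    (by simp [Cmd.wv]) (fun y hy => by simp [Expr.vars] at hy; simp [Cmd.wv, hy]) (by simp [hn]) hnh
    (by simp) ?_ ?_
  · intro i s' hi hf hvi hI
    have hfr : ∀ y, y ≠ 22 → y ≠ 23 → y ≠ 24 → y ≠ 28 → s'.v y = s.v y := by
      intro y h1 h2 h3 h4
      rw [hf.v y (by simp [Cmd.for_, Cmd.wv, *])]
      simp [h4]
    have hfa : s'.a = s.a := by
      funext b
      rw [hf.a b (by simp [Cmd.for_, Cmd.wa])]
      rfl
    refine wp_seq (wp_load (f₁ i) (he₁ _ i hfr hvi) (hf₁ i hi) ?_)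
    refine wp_seq (wp_load (f₂ i) (he₂ _ i (fun y h1 h2 h3 h4 => by simp [h2, hfr y h1 h2 h3 h4])
      (by simp [hvi])) (hf₂ i hi) ?_)
    have hval : (Expr.var 28 + .var 23 * .var 24).eval
        ((s'.setv 23 (s'.a a₁ (f₁ i))).setv 24 ((s'.setv 23 (s'.a a₁ (f₁ i))).a a₂ (f₂ i))).v =
        ∑ i ∈ Finset.range (i + 1), s.a a₁ (f₁ i) * s.a a₂ (f₂ i) := by
      simp [hI, hfa, Finset.sum_range_succ]
    refine wp_set ?_ ⟨le_rfl, by simp [hI, hfa, Finset.sum_range_succ]⟩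
    rw [hval]
    refine lt_of_le_of_lt (Finset.abs_sum_le_sum_abs _ _) ?_
    have hUV0 : 0 ≤ U * V := mul_nonneg ((abs_nonneg _).trans (hU i hi)) ((abs_nonneg _).trans (hV i hi))
    refine lt_of_le_of_lt (Finset.sum_le_card_nsmul _ _ (U * V) fun j hj => ?_) ?_
    · have := Finset.mem_range.1 hj
      exact abs_mul_le_mul (hU j (by omega)) (hV j (by omega))
    · rw [Finset.card_range, nsmul_eq_mul]
      refine lt_of_le_of_lt (mul_le_mul_of_nonneg_right ?_ hUV0) hUV
      exact_mod_cast hi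
  · intro s' m _ hm hI
    exact ⟨by omega, hI⟩

theorem idx_inj {n i j i' j' : ℕ} (hj : j < n) (hj' : j' < n) :
    i * n + j = i' * n + j' ↔ i = i' ∧ j = j' := by
  constructor
  · intro e
    have hn : 0 < n := by omega
    have hdiv : ∀ i j, j < n → (i * n + j) / n = i := fun i j hj => by
      rw [Nat.add_comm, Nat.add_mul_div_right _ _ hn, Nat.div_eq_of_lt hj, zero_add]
    have hii : i = i' := by rw [← hdiv i j hj, e, hdiv i' j' hj']
    subst hii
    omega
  · rintro ⟨rfl, rfl⟩
    rfl

theorem idx_lt {n i j : ℕ} (hi : i < n) (hj : j < n) : i * n + j < n * n := by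
  nlinarith

/-- A row is overwritten only after its inner product with the vector has been taken, so rows before
`i` hold the new entries `G` and the others still the old ones. The left side of `hXh` bounds the
new entries. -/
theorem wp_stretch {t : ℕ} (hn : s.v 1 = (4 * t : ℕ)) (hth : ((4 * t : ℕ) : ℤ) < h) (ht : 1 ≤ t)
    (hA : 4 * t * (4 * t) ≤ A) {X Y C : ℤ} (hX : ∀ i j, |matOf t (s.a 0) i j| ≤ X)
    (hY : ∀ j, |vecOf t (s.a 1) j| ≤ Y) (hC : |s.v 26| ≤ C) (hD : |s.v 12| * C < h)
    (hXh : C * X + (4 * t : ℕ) * (X * Y) * Y < h) (hY1 : 1 ≤ Y) :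
    Wp h A stretchCmd s fun s' m => m ≤ 20 * (4 * t) ^ 2 ∧
      matOf t (s'.a 0) = intStretch (s.v 26) (vecOf t (s.a 1)) (matOf t (s.a 0)) ∧
      s'.v 12 = s.v 12 * s.v 26 := by
  set n := 4 * t with hndef
  set F : ℕ → ℤ := s.a 0 with hF
  set g : ℕ → ℤ := s.a 1 with hg
  have hXp : ∀ i < n, ∀ j < n, |F (i * n + j)| ≤ X := fun i hi j hj => hX ⟨i, hi⟩ ⟨j, hj⟩
  have hYp : ∀ j < n, |g j| ≤ Y := fun j hj => hY ⟨j, hj⟩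
  have hX0 : 0 ≤ X := (abs_nonneg _).trans (hXp 0 (by omega) 0 (by omega))
  have hC0 : 0 ≤ C := (abs_nonneg _).trans hC
  set w : ℕ → ℤ := fun i => ∑ k ∈ Finset.range n, F (i * n + k) * g k with hw
  have hwb : ∀ i < n, |w i| ≤ n * (X * Y) := by
    intro i hi
    refine (Finset.abs_sum_le_sum_abs _ _).trans ?_
    refine (Finset.sum_le_card_nsmul _ _ (X * Y) fun k hk => ?_).trans (by simp)
    exact abs_mul_le_mul (hXp i hi k (Finset.mem_range.1 hk)) (hYp k (Finset.mem_range.1 hk))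
  set G : ℕ → ℕ → ℤ := fun i j => s.v 26 * F (i * n + j) + w i * g j with hG
  have hGb : ∀ i < n, ∀ j < n, |G i j| < h := by
    intro i hi j hj
    refine lt_of_le_of_lt (abs_add_le _ _) (lt_of_le_of_lt (add_le_add ?_ ?_) hXh)
    · exact abs_mul_le_mul hC (hXp i hi j hj)
    · exact abs_mul_le_mul (hwb i hi) (hYp j hj)
  have hXYh : n * (X * Y) < h := by
    have h1 : (0 : ℤ) ≤ n * (X * Y) := by positivity
    nlinarith [mul_nonneg hC0 hX0]
  refine wp_seq (wp_for n (10 * n + 5) (fun i s' => (∀ i' < n, ∀ j' < n, s'.a 0 (i' * n + j') =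
      if i' < i then G i' j' else F (i' * n + j')) ∧ s'.a 1 = g) (by simp [Cmd.wv, Cmd.for_, dotCmd])
    (fun y hy => by simp [Expr.vars] at hy; simp [Cmd.wv, Cmd.for_, dotCmd, hy]) (by simpa using hn) hth
    (by simp [hF, hg]) ?_ ?_)
  · intro i s1 hi hf hvi ⟨hI, hI1⟩
    have hv1 : s1.v 1 = n := by rw [hf.v 1 (by decide), hn]
    have hv26 : s1.v 26 = s.v 26 := hf.v 26 (by decide)
    refine wp_seq ((wp_dot n (fun k => i * n + k) (fun k => k) hv1 hth (fun s' k hs' hk => ?_)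
      (fun s' k hs' hk => by simpa using hk) (fun k hk => (idx_lt hi hk).trans_le hA)
      (fun k hk => lt_of_lt_of_le (by nlinarith) hA) (U := X) (V := Y) (fun k hk => ?_) (fun k hk => ?_)
      hXYh).mono fun s2 m2 f2 ⟨hm2, h2⟩ => ?_)
    · simp [hs' 20, hs' 1, hk, hv1, hvi]
    · rw [hI i hi k hk, if_neg (by omega)]
      exact hXp i hi k hk
    · rw [hI1]
      exact hYp k hk
    have hw2 : s2.v 28 = w i := by
      rw [h2, hw]
      refine Finset.sum_congr rfl fun k hk => ?_
      rw [hI i hi k (Finset.mem_range.1 hk), if_neg (by omega), hI1]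
    have ha2 : s2.a = s1.a := funext fun b => f2.a b (by simp [dotCmd, Cmd.for_, Cmd.wa])
    have hv2 : s2.v 1 = n := by rw [f2.v 1 (by decide), hv1]
    have hv220 : s2.v 20 = i := by rw [f2.v 20 (by decide), hvi]
    have hv226 : s2.v 26 = s.v 26 := by rw [f2.v 26 (by decide), hv26]
    refine wp_for n 3 (fun j s' => (∀ i' < n, ∀ j' < n, s'.a 0 (i' * n + j') =
      if i' < i ∨ (i' = i ∧ j' < j) then G i' j' else F (i' * n + j')) ∧ s'.a 1 = g) (by simp [Cmd.wv])
      (fun y hy => by simp [Expr.vars] at hy; simp [Cmd.wv, hy]) (by simpa using hv2) hth ?_ ?_ ?_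
    · simp only [St.setv_a, ha2, not_lt_zero, and_false, or_false]
      exact ⟨hI, hI1⟩
    · intro j s3 hj f3 hvj ⟨hJ, hJ1⟩
      have hv3 : s3.v 1 = n := by rw [f3.v 1 (by decide), hv2]
      have hv320 : s3.v 20 = i := by rw [f3.v 20 (by decide), hv220]
      have hv326 : s3.v 26 = s.v 26 := by rw [f3.v 26 (by decide), hv226]
      have hv328 : s3.v 28 = w i := by rw [f3.v 28 (by decide), hw2]
      have hadr := idx_lt hi hj
      refine wp_seq (wp_load (i * n + j) (by simp [hv3, hv320, hvj]) (by omega) ?_)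
      refine wp_seq (wp_load j (by simp [hvj]) (lt_of_lt_of_le (by nlinarith) hA) ?_)
      have hval : ∀ σ : St, σ.v 26 = s.v 26 → σ.v 23 = F (i * n + j) → σ.v 28 = w i → σ.v 24 = g j →
          (Expr.var 26 * .var 23 + .var 28 * .var 24).eval σ.v = G i j := by
        intro σ e1 e2 e3 e4
        simp [e1, e2, e3, e4, hG]
      have hval' := hval ((s3.setv 23 (s3.a 0 (i * n + j))).setv 24
        ((s3.setv 23 (s3.a 0 (i * n + j))).a 1 j)) (by simp [hv326])
        (by simp; rw [hJ i hi j hj, if_neg (by omega)]) (by simp [hv328]) (by simp [hJ1])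
      refine wp_store (i * n + j) (by simp [hv3, hv320, hvj]) (by omega) ?_ ⟨le_rfl, ?_, ?_⟩
      · rw [hval']
        exact hGb i hi j hj
      · rw [hval']
        intro i' hi' j' hj'
        simp only [St.setv_a, St.seta_a, if_true, Function.update_apply, idx_inj hj' hj]
        by_cases hij : i' = i ∧ j' = j
        · rw [if_pos hij, if_pos (by omega), hij.1, hij.2]
        · rw [if_neg hij, hJ i' hi' j' hj']
          refine if_congr ?_ rfl rfl
          omega
      · simpa using hJ1
    · intro s3 m3 f3 hm3 ⟨hJ, hJ1⟩
      refine ⟨by omega, ?_, hJ1⟩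
      intro i' hi' j' hj'
      rw [St.setv_a, hJ i' hi' j' hj']
      refine if_congr ?_ rfl rfl
      omega
  · intro s1 m1 f1 hm1 ⟨hI, hI1⟩
    have hv26 : s1.v 26 = s.v 26 := f1.v 26 (by decide)
    have hv12 : s1.v 12 = s.v 12 := f1.v 12 (by decide)
    refine wp_set ?_ ⟨?_, ?_, ?_⟩
    · simp only [Expr.eval_mul, Expr.eval_var, hv26, hv12, abs_mul]
      exact (mul_le_mul_of_nonneg_left hC (abs_nonneg _)).trans_lt hD
    · have : n * (10 * n + 5 + 2) + 2 + 1 ≤ 20 * n ^ 2 := by nlinarith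
      exact le_trans (by omega) this
    · ext i j
      have := hI i i.isLt j j.isLt
      rw [if_pos i.isLt] at this
      simp only [matOf, of_apply, St.setv_a]
      rw [this, hG, hw]
      simp only [intStretch, Matrix.add_apply, Matrix.smul_apply, smul_eq_mul, vecMulVec_apply, mulVec,
        dotProduct, of_apply, vecOf, Finset.sum_range]
      rfl
    · simp [hv26, hv12]

/-- All four entries of a block are loaded before the first one is overwritten, so `f` may refer to
the old values through the variables 31 to 34. -/
theorem wp_rot {t : ℕ} (f : Fin 4 → Expr) (g : Fin 4 → (Fin 4 → ℤ) → ℤ) (h0 : s.v 0 = t)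
    (hth : ((4 * t : ℕ) : ℤ) < h) (hA : 4 * t ≤ A)
    (hfg : ∀ v q, (f q).eval v = g q ![v 31, v 32, v 33, v 34])
    {Y : ℤ} (hY : ∀ j, |vecOf t (s.a 1) j| ≤ Y) (hYh : Y < h)
    (hg : ∀ q e, (∀ q', |e q'| ≤ Y) → |g q e| ≤ Y) :
    Wp h A (rotCmd f) s fun s' m => m ≤ 10 * t + 2 ∧
      ∀ l q, vecOf t (s'.a 1) (blk l q) = g q fun q' => vecOf t (s.a 1) (blk l q') := by
  set F : ℕ → ℤ := s.a 1 with hF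
  have hYp : ∀ l < t, ∀ q : Fin 4, |F (4 * l + q)| ≤ Y := fun l hl q => by
    have := hY ⟨4 * l + q, by omega⟩
    exact this
  refine wp_for t 8 (fun l s' => ∀ l' < t, ∀ q : Fin 4, s'.a 1 (4 * l' + q) = if l' < l then
      g q fun q' => F (4 * l' + q') else F (4 * l' + q)) (by simp [Cmd.wv])
    (fun y hy => by simp [Expr.vars] at hy; simp [Cmd.wv, hy]) (by simpa using h0)
    (by omega) (by simp [hF]) ?_ ?_
  · intro l s1 hl f1 hvl hI
    have hI' : ∀ q : Fin 4, s1.a 1 (4 * l + q) = F (4 * l + q) := fun q => by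
      rw [hI l hl q, if_neg (by omega)]
    have i0 : s1.a 1 (4 * l) = F (4 * l) := hI' 0
    have i1 : s1.a 1 (4 * l + 1) = F (4 * l + 1) := hI' 1
    have i2 : s1.a 1 (4 * l + 2) = F (4 * l + 2) := hI' 2
    have i3 : s1.a 1 (4 * l + 3) = F (4 * l + 3) := hI' 3
    refine wp_seq (wp_load (4 * l) (by simp [hvl]) (by omega) ?_)
    refine wp_seq (wp_load (4 * l + 1) (by simp [hvl]) (by omega) ?_)
    refine wp_seq (wp_load (4 * l + 2) (by simp [hvl]) (by omega) ?_)
    refine wp_seq (wp_load (4 * l + 3) (by simp [hvl]) (by omega) ?_)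
    have hvals : ∀ σ : St, σ.v 31 = F (4 * l) → σ.v 32 = F (4 * l + 1) → σ.v 33 = F (4 * l + 2) →
        σ.v 34 = F (4 * l + 3) → ∀ q, (f q).eval σ.v = g q fun q' => F (4 * l + q') := by
      intro σ e1 e2 e3 e4 q
      rw [hfg]
      congr 1
      funext q'
      fin_cases q' <;> simp [*]
    have hb : ∀ q, |g q fun q' => F (4 * l + q')| < h := fun q =>
      (hg q _ fun q' => hYp l hl q').trans_lt hYh
    refine wp_seq (wp_store (4 * l) (by simp [hvl]) (by omega)
      (by rw [hvals _ (by simp [i0]) (by simp [i1]) (by simp [i2]) (by simp [i3])]; exact hb 0) ?_)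
    rw [hvals _ (by simp [i0]) (by simp [i1]) (by simp [i2]) (by simp [i3])]
    refine wp_seq (wp_store (4 * l + 1) (by simp [hvl]) (by omega)
      (by rw [hvals _ (by simp [i0]) (by simp [i1]) (by simp [i2]) (by simp [i3])]; exact hb 1) ?_)
    rw [hvals _ (by simp [i0]) (by simp [i1]) (by simp [i2]) (by simp [i3])]
    refine wp_seq (wp_store (4 * l + 2) (by simp [hvl]) (by omega)
      (by rw [hvals _ (by simp [i0]) (by simp [i1]) (by simp [i2]) (by simp [i3])]; exact hb 2) ?_)
    rw [hvals _ (by simp [i0]) (by simp [i1]) (by simp [i2]) (by simp [i3])]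
    refine wp_store (4 * l + 3) (by simp [hvl]) (by omega)
      (by rw [hvals _ (by simp [i0]) (by simp [i1]) (by simp [i2]) (by simp [i3])]; exact hb 3) ⟨by omega, ?_⟩
    rw [hvals _ (by simp [i0]) (by simp [i1]) (by simp [i2]) (by simp [i3])]
    intro l' hl' q
    simp only [St.setv_a, St.seta_a, if_true, Function.update_apply]
    by_cases hll : l' = l
    · subst hll
      rw [if_pos (show l' < l' + 1 by omega)]
      fin_cases q <;> simp
    · have hq := q.isLt
      rw [if_neg (by omega), if_neg (by omega), if_neg (by omega), if_neg (by omega), hI l' hl' q]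
      refine if_congr ?_ rfl rfl
      omega
  · intro s' m _ hm hI
    refine ⟨by omega, fun l q => ?_⟩
    have := hI l l.isLt q
    rw [if_pos l.isLt] at this
    simp only [vecOf, blk_val]
    exact this

/-- Left multiplication of the vector by `i`. -/
def rotICmd : Cmd := rotCmd ![.const 0 - .var 32, .var 31, .const 0 - .var 34, .var 33]

/-- Left multiplication of the vector by `j`. -/
def rotJCmd : Cmd := rotCmd ![.const 0 - .var 33, .var 34, .var 31, .const 0 - .var 32]

theorem wp_rotI {t : ℕ} (h0 : s.v 0 = t) (hth : ((4 * t : ℕ) : ℤ) < h) (hA : 4 * t ≤ A) {Y : ℤ}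
    (hY : ∀ j, |vecOf t (s.a 1) j| ≤ Y) (hYh : Y < h) :
    Wp h A rotICmd s fun s' m => m ≤ 10 * t + 2 ∧ vecOf t (s'.a 1) = quatI (vecOf t (s.a 1)) := by
  refine (wp_rot _ (fun q e => ![-e 1, e 0, -e 3, e 2] q) h0 hth hA (fun v q => ?_) hY hYh
    (fun q e he => ?_)).mono fun s' m _ hs' => ⟨hs'.1, ext_blk fun l => ?_⟩
  · fin_cases q <;> simp
  · fin_cases q <;> simp [he]
  · simp [hs'.2]

theorem wp_rotJ {t : ℕ} (h0 : s.v 0 = t) (hth : ((4 * t : ℕ) : ℤ) < h) (hA : 4 * t ≤ A) {Y : ℤ}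
    (hY : ∀ j, |vecOf t (s.a 1) j| ≤ Y) (hYh : Y < h) :
    Wp h A rotJCmd s fun s' m => m ≤ 10 * t + 2 ∧ vecOf t (s'.a 1) = quatJ (vecOf t (s.a 1)) := by
  refine (wp_rot _ (fun q e => ![-e 2, e 3, e 0, -e 1] q) h0 hth hA (fun v q => ?_) hY hYh
    (fun q e he => ?_)).mono fun s' m _ hs' => ⟨hs'.1, ext_blk fun l => ?_⟩
  · fin_cases q <;> simp
  · fin_cases q <;> simp [he]
  · simp [hs'.2]

end Specs

end Ram

/-! ### Testing one vector and stretching along it -/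

namespace Ram

open BitMachine QuatLattice Matrix

/-- The vector of the matrix with the coordinates in array `5`. -/
def combineCmd : Cmd :=
  Cmd.for_ 21 (.var 1) (.seq (dotCmd 5 (.var 22) 0 (.var 22 * .var 1 + .var 21))
    (.store 1 (.var 21) (.var 28)))

/-- The four stretches along the quaternionic line of the vector with squared length in variable `25`. -/
def quatStretchCmd : Cmd :=
  .seq (.set 26 (.var 2 * .var 25)) (.seq stretchCmd (.seq rotICmd (.seq stretchCmd (.seq rotJCmd
    (.seq stretchCmd (.seq rotICmd (.seq stretchCmd (.set 11 (.var 11 + .const 1)))))))))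

/-- Test the vector with number in variable `16`, and stretch along it if it is short. -/
def vectorCmd : Cmd :=
  .seq (digitsCmd 5 (.var 16) (.var 1) (.var 14) (.var 13)) (.seq combineCmd
    (.seq (dotCmd 1 (.var 22) 1 (.var 22)) (.seq (.set 25 (.var 28))
    (.ite (.var 25) (.ite (.var 5 * (.var 12 * .var 12) - .var 25)
      (.ite (.var 3 + .const 1 - .var 11) quatStretchCmd (.set 27 (.const 0))) (.set 27 (.const 0)))
      (.set 27 (.const 0))))))

/-- The coordinate vector with number `v` in the box with half side `Z`. -/
def boxVec (t Z v : ℕ) : Fin (4 * t) → ℤ := fun i => ((v / (2 * Z + 1) ^ (i : ℕ) % (2 * Z + 1) : ℕ) : ℤ) - Z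

theorem abs_boxVec_le (t Z v : ℕ) (i : Fin (4 * t)) : |boxVec t Z v i| ≤ Z := by
  have := Nat.mod_lt (v / (2 * Z + 1) ^ (i : ℕ)) (show 0 < 2 * Z + 1 by omega)
  rw [boxVec, abs_le]
  omega

theorem exists_boxVec {t Z : ℕ} {z : Fin (4 * t) → ℤ} (hz : ∀ i, |z i| ≤ Z) :
    ∃ v < (2 * Z + 1) ^ (4 * t), boxVec t Z v = z := by
  have hlt : ∀ i, (z i + Z).toNat < 2 * Z + 1 := fun i => by
    have := abs_le.1 (hz i)
    omega
  set c := finFunctionFinEquiv (m := 2 * Z + 1) (n := 4 * t) fun i => ⟨(z i + Z).toNat, hlt i⟩ with hc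
  refine ⟨c, c.isLt, funext fun i => ?_⟩
  have h1 : finFunctionFinEquiv.symm c i = ⟨(z i + Z).toNat, hlt i⟩ := by
    rw [hc, Equiv.symm_apply_apply]
  have h2 := congrArg Fin.val h1
  have h3 : (c : ℕ) / (2 * Z + 1) ^ (i : ℕ) % (2 * Z + 1) = (z i + Z).toNat := by
    simpa [finFunctionFinEquiv] using h2
  have := abs_le.1 (hz i)
  rw [boxVec, h3]
  omega

theorem abs_dot_le {n : ℕ} {x y : Fin n → ℤ} {U V : ℤ} (hx : ∀ i, |x i| ≤ U) (hy : ∀ i, |y i| ≤ V) :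
    |x ⬝ᵥ y| ≤ n * (U * V) := by
  refine (Finset.abs_sum_le_sum_abs _ _).trans ?_
  refine (Finset.sum_le_card_nsmul _ _ (U * V) fun i _ => ?_).trans (by simp)
  exact abs_mul_le_mul (hx i) (hy i)

theorem abs_intStretch_le {t : ℕ} {c C X Y : ℤ} {y : Fin (4 * t) → ℤ}
    {B : Matrix (Fin (4 * t)) (Fin (4 * t)) ℤ} (hc : |c| ≤ C) (hX : ∀ i j, |B i j| ≤ X)
    (hY : ∀ j, |y j| ≤ Y) (i j : Fin (4 * t)) :
    |intStretch c y B i j| ≤ C * X + (4 * t : ℕ) * (X * Y) * Y := by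
  simp only [intStretch, Matrix.add_apply, Matrix.smul_apply, smul_eq_mul, vecMulVec_apply]
  exact (abs_add_le _ _).trans (add_le_add (abs_mul_le_mul hc (hX i j))
    (abs_mul_le_mul (abs_dot_le (hX i) hY) (hY j)))

theorem abs_quatI_le {t : ℕ} {y : Fin (4 * t) → ℤ} {Y : ℤ} (hY : ∀ j, |y j| ≤ Y) (j : Fin (4 * t)) :
    |quatI y j| ≤ Y := by
  revert j
  rw [forall_blk]
  intro l
  simp [hY]

theorem abs_quatJ_le {t : ℕ} {y : Fin (4 * t) → ℤ} {Y : ℤ} (hY : ∀ j, |y j| ≤ Y) (j : Fin (4 * t)) :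
    |quatJ y j| ≤ Y := by
  revert j
  rw [forall_blk]
  intro l
  simp [hY]

theorem ten_mul_le_sq (t : ℕ) : 10 * t ≤ 3 * (4 * t) ^ 2 := by
  have := Nat.le_self_pow two_ne_zero t
  nlinarith

theorem vector_steps_le (t : ℕ) (ht : 1 ≤ t) : 4 * (4 * t) + 3 + (10 * (4 * t) ^ 2 + 2 + (5 * (4 * t) + 3 +
    (1 + (1 + (1 + (1 + 100 * (4 * t) ^ 2)))))) ≤ 200 * (4 * t) ^ 2 := by nlinarith

section Specs

variable {h : ℤ} {A : ℕ} {s : St}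

theorem wp_combine {t : ℕ} (hn : s.v 1 = (4 * t : ℕ)) (hth : ((4 * t : ℕ) : ℤ) < h)
    (hA : 4 * t * (4 * t) ≤ A) {X Z : ℤ} (hX : ∀ i j, |matOf t (s.a 0) i j| ≤ X)
    (hZ : ∀ j, |vecOf t (s.a 5) j| ≤ Z) (hh : (4 * t : ℕ) * (Z * X) < h) :
    Wp h A combineCmd s fun s' m => m ≤ 10 * (4 * t) ^ 2 + 2 ∧
      vecOf t (s'.a 1) = vecOf t (s.a 5) ᵥ* matOf t (s.a 0) := by
  set n := 4 * t with hndef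
  set F : ℕ → ℤ := s.a 0 with hF
  set g : ℕ → ℤ := s.a 5 with hg
  have hXp : ∀ i < n, ∀ j < n, |F (i * n + j)| ≤ X := fun i hi j hj => hX ⟨i, hi⟩ ⟨j, hj⟩
  have hZp : ∀ j < n, |g j| ≤ Z := fun j hj => hZ ⟨j, hj⟩
  refine wp_for n (5 * n + 4) (fun j s' => ∀ j' < j, s'.a 1 j' =
      ∑ i ∈ Finset.range n, g i * F (i * n + j')) (by decide)
    (fun y hy => by simp [Expr.vars] at hy; subst hy; decide) (by simpa using hn) hth (by simp) ?_ ?_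
  · intro j s1 hj f1 hvj hI
    have hv1 : s1.v 1 = n := by rw [f1.v 1 (by decide), hn]
    have ha0 : s1.a 0 = F := f1.a 0 (by decide)
    have ha5 : s1.a 5 = g := f1.a 5 (by decide)
    refine wp_seq ((wp_dot n (fun k => k) (fun k => k * n + j) hv1 hth (fun s' k hs' hk => by simpa using hk)
      (fun s' k hs' hk => ?_) (fun k hk => lt_of_lt_of_le (by nlinarith) hA)
      (fun k hk => (idx_lt hk hj).trans_le hA) (U := Z) (V := X) (fun k hk => ?_) (fun k hk => ?_)
      hh).mono fun s2 m2 f2 ⟨hm2, h2⟩ => ?_)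
    · simp [hs' 21, hs' 1, hk, hv1, hvj]
    · rw [ha5]
      exact hZp k hk
    · rw [ha0]
      exact hXp k hk j hj
    · have hv21 : s2.v 21 = j := by rw [f2.v 21 (by decide), hvj]
      have ha1 : s2.a 1 = s1.a 1 := f2.a 1 (by decide)
      rw [ha0, ha5] at h2
      refine wp_store j (by simp [hv21]) (lt_of_lt_of_le (by nlinarith) hA) ?_ ⟨by omega, ?_⟩
      · rw [Expr.eval_var, h2]
        refine lt_of_le_of_lt (Finset.abs_sum_le_sum_abs _ _) (lt_of_le_of_lt ?_ hh)
        refine (Finset.sum_le_card_nsmul _ _ (Z * X) fun k hk => ?_).trans (by simp)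
        exact abs_mul_le_mul (hZp k (Finset.mem_range.1 hk)) (hXp k (Finset.mem_range.1 hk) j hj)
      · intro j' hj'
        simp only [St.setv_a, St.seta_a, if_true, Function.update_apply, Expr.eval_var]
        split_ifs with hjj
        · rw [h2, hjj]
        · rw [ha1]
          exact hI j' (by omega)
  · intro s1 m1 f1 hm1 hI
    refine ⟨?_, ?_⟩
    · have : n * (5 * n + 4 + 2) + 2 ≤ 10 * n ^ 2 + 2 := by
        rcases Nat.eq_zero_or_pos t with h0 | h0
        · simp [hndef, h0]
        · nlinarith
      exact le_trans (by omega) this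
    · funext j
      rw [vecOf, hI j j.isLt, Finset.sum_range]
      rfl

/-- Sizes are measured in powers of `X`. With vector entries at most `X ^ 2` and factor at most `X ^
5`, one stretch raises the exponent for the matrix entries by 6 and the one for the scale by 5. The
exponents run through 7, 13, 19, 25 and 6, 11, 16, 21. They are rounded up to 32, a power of two,
which suits the iterated bound. -/
theorem wp_quatStretch {t : ℕ} (ht : 1 ≤ t) (h0 : s.v 0 = t) (hn : s.v 1 = (4 * t : ℕ))
    (hA : 4 * t * (4 * t) ≤ A) {X : ℤ} (hX2 : 2 ≤ X) (hX : ∀ i j, |matOf t (s.a 0) i j| ≤ X)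
    (hY : ∀ j, |vecOf t (s.a 1) j| ≤ X ^ 2) (hC : |s.v 2 * s.v 25| ≤ X ^ 5) (hD : |s.v 12| ≤ X)
    (htX : ((4 * t : ℕ) : ℤ) ≤ X) (hXh : X ^ 32 < h) (h11 : |s.v 11 + 1| < h) :
    Wp h A quatStretchCmd s fun s' m => m ≤ 100 * (4 * t) ^ 2 ∧
      matOf t (s'.a 0) = intQuatStretch (s.v 2 * s.v 25) (vecOf t (s.a 1)) (matOf t (s.a 0)) ∧
      s'.v 12 = s.v 12 * (s.v 2 * s.v 25) ^ 4 ∧ s'.v 11 = s.v 11 + 1 ∧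
      (∀ i j, |matOf t (s'.a 0) i j| ≤ X ^ 32) ∧ |s'.v 12| ≤ X ^ 32 := by
  have hpw : ∀ {a b : ℕ}, a ≤ b → X ^ a ≤ X ^ b := fun h => pow_le_pow_right₀ (by omega) h
  have hlt : ∀ {a : ℕ}, a ≤ 32 → X ^ a < h := fun h => (hpw h).trans_lt hXh
  have hth : ((4 * t : ℕ) : ℤ) < h := by
    have := hlt (a := 1) (by norm_num)
    rw [pow_one] at this
    omega
  have h4t : 4 * t ≤ A := (Nat.le_mul_self _).trans hA
  set c := s.v 2 * s.v 25 with hc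
  set y := vecOf t (s.a 1) with hy
  set B := matOf t (s.a 0) with hB
  have hbound : ∀ e : ℕ, X ^ 5 * X ^ e + (4 * t : ℕ) * (X ^ e * X ^ 2) * X ^ 2 ≤ X ^ (e + 6) := by
    intro e
    have h1 : (4 * t : ℕ) * (X ^ e * X ^ 2) * X ^ 2 ≤ X * (X ^ e * X ^ 2) * X ^ 2 := by gcongr
    have h2 : (0 : ℤ) ≤ X ^ e * X ^ 5 := by positivity
    calc _ ≤ X ^ 5 * X ^ e + X * (X ^ e * X ^ 2) * X ^ 2 := by linarith
      _ = 2 * (X ^ e * X ^ 5) := by ring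
      _ ≤ X * (X ^ e * X ^ 5) := by gcongr
      _ = _ := by ring
  have hstep : ∀ (e : ℕ) {M : Matrix (Fin (4 * t)) (Fin (4 * t)) ℤ} {w : Fin (4 * t) → ℤ},
      (∀ i j, |M i j| ≤ X ^ e) → (∀ j, |w j| ≤ X ^ 2) → ∀ i j, |intStretch c w M i j| ≤ X ^ (e + 6) :=
    fun e M w hM hw i j => (abs_intStretch_le hC hM hw i j).trans (hbound e)
  have hDb : ∀ (e : ℕ) {D : ℤ}, |D| ≤ X ^ e → |D * c| ≤ X ^ (e + 5) := fun e D hD =>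
    (abs_mul_le_mul hD hC).trans (le_of_eq (by ring))
  have hX' : ∀ i j, |B i j| ≤ X ^ 1 := by simpa using hX
  have hD' : |s.v 12| ≤ X ^ 1 := by simpa using hD
  have hY1 : 1 ≤ X ^ 2 := one_le_pow₀ (by omega)
  have y1 := abs_quatI_le hY
  have y2 := abs_quatJ_le y1
  have y3 := abs_quatI_le y2
  have b1 := hstep 1 hX' hY
  have b2 := hstep 7 b1 y1
  have b3 := hstep 13 b2 y2
  have b4 := hstep 19 b3 y3
  have d1 := hDb 1 hD'
  have d2 := hDb 6 d1
  have d3 := hDb 11 d2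
  have d4 := hDb 16 d3
  refine wp_seq (wp_set (by simpa [hc] using hC.trans_lt (hlt (by norm_num))) ?_)
  set s0 := s.setv 26 ((Expr.var 2 * Expr.var 25).eval s.v) with hs0
  have c0 : s0.v 26 = c := by simp [hs0, hc]
  have k0 : s0.v 12 = s.v 12 := by simp [hs0]
  refine wp_seq ((wp_stretch (s := s0) (X := X ^ 1) (Y := X ^ 2) (C := X ^ 5) (by simpa [hs0] using hn) hth ht hA
    hX' hY (by rw [c0]; exact hC)
    (by rw [k0]; exact (mul_le_mul_of_nonneg_right hD' (by positivity)).trans_lt (by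
      rw [← pow_add]; exact hlt (by norm_num)))
    ((hbound 1).trans_lt (hlt (by norm_num))) hY1).mono fun s1 m1 f1 ⟨n1, M1, D1⟩ => ?_)
  have M1' : matOf t (s1.a 0) = intStretch c y B := by rw [M1, c0]; rfl
  have D1' : s1.v 12 = s.v 12 * c := by rw [D1, c0, k0]
  have V1 : vecOf t (s1.a 1) = y := by rw [f1.a 1 (by decide)]; rfl
  refine wp_seq ((wp_rotI (t := t) (Y := X ^ 2) (by rw [f1.v 0 (by decide)]; simpa [hs0] using h0) hth h4t
    (by rw [V1]; exact hY) (hlt (by norm_num))).mono fun s2 m2 f2 ⟨n2, V2⟩ => ?_)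
  have M2 : matOf t (s2.a 0) = intStretch c y B := by rw [f2.a 0 (by decide), M1']
  rw [V1] at V2
  have D2 : s2.v 12 = s.v 12 * c := by rw [f2.v 12 (by decide), D1']
  have c2 : s2.v 26 = c := by rw [f2.v 26 (by decide), f1.v 26 (by decide), c0]
  have e2 : s2.v 1 = (4 * t : ℕ) := by
    rw [f2.v 1 (by decide), f1.v 1 (by decide)]
    simpa [hs0] using hn
  have z2 : s2.v 0 = t := by
    rw [f2.v 0 (by decide), f1.v 0 (by decide)]
    simpa [hs0] using h0
  refine wp_seq ((wp_stretch (X := X ^ 7) (Y := X ^ 2) (C := X ^ 5) e2 hth ht hA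
    (by rw [M2]; exact b1) (by rw [V2]; exact y1) (by rw [c2]; exact hC)
    (by rw [D2]; exact (mul_le_mul_of_nonneg_right d1 (by positivity)).trans_lt (by
      rw [← pow_add]; exact hlt (by norm_num)))
    ((hbound 7).trans_lt (hlt (by norm_num))) hY1).mono fun s3 m3 f3 ⟨n3, M3, D3⟩ => ?_)
  rw [c2, V2, M2] at M3
  rw [c2, D2] at D3
  have V3 : vecOf t (s3.a 1) = quatI y := by rw [f3.a 1 (by decide), V2]
  refine wp_seq ((wp_rotJ (t := t) (Y := X ^ 2) (by rw [f3.v 0 (by decide), z2]) hth h4t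
    (by rw [V3]; exact y1) (hlt (by norm_num))).mono fun s4 m4 f4 ⟨n4, V4⟩ => ?_)
  rw [V3] at V4
  have M4 := f4.a 0 (by decide)
  have D4 := f4.v 12 (by decide)
  rw [D3] at D4
  have c4 : s4.v 26 = c := by rw [f4.v 26 (by decide), f3.v 26 (by decide), c2]
  have e4 : s4.v 1 = (4 * t : ℕ) := by rw [f4.v 1 (by decide), f3.v 1 (by decide), e2]
  have z4 : s4.v 0 = t := by rw [f4.v 0 (by decide), f3.v 0 (by decide), z2]
  rw [← M4] at M3
  refine wp_seq ((wp_stretch (X := X ^ 13) (Y := X ^ 2) (C := X ^ 5) e4 hth ht hA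
    (by rw [M3]; exact b2) (by rw [V4]; exact y2) (by rw [c4]; exact hC)
    (by rw [D4]; exact (mul_le_mul_of_nonneg_right d2 (by positivity)).trans_lt (by
      rw [← pow_add]; exact hlt (by norm_num)))
    ((hbound 13).trans_lt (hlt (by norm_num))) hY1).mono fun s5 m5 f5 ⟨n5, M5, D5⟩ => ?_)
  rw [c4, V4, M3] at M5
  rw [c4, D4] at D5
  have V5 : vecOf t (s5.a 1) = quatJ (quatI y) := by rw [f5.a 1 (by decide), V4]
  refine wp_seq ((wp_rotI (t := t) (Y := X ^ 2) (by rw [f5.v 0 (by decide), z4]) hth h4t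
    (by rw [V5]; exact y2) (hlt (by norm_num))).mono fun s6 m6 f6 ⟨n6, V6⟩ => ?_)
  rw [V5] at V6
  have M6 := f6.a 0 (by decide)
  have D6 := f6.v 12 (by decide)
  rw [D5] at D6
  have c6 : s6.v 26 = c := by rw [f6.v 26 (by decide), f5.v 26 (by decide), c4]
  have e6 : s6.v 1 = (4 * t : ℕ) := by rw [f6.v 1 (by decide), f5.v 1 (by decide), e4]
  rw [← M6] at M5
  refine wp_seq ((wp_stretch (X := X ^ 19) (Y := X ^ 2) (C := X ^ 5) e6 hth ht hA
    (by rw [M5]; exact b3) (by rw [V6]; exact y3) (by rw [c6]; exact hC)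
    (by rw [D6]; exact (mul_le_mul_of_nonneg_right d3 (by positivity)).trans_lt (by
      rw [← pow_add]; exact hlt (by norm_num)))
    ((hbound 19).trans_lt (hlt (by norm_num))) hY1).mono fun s7 m7 f7 ⟨n7, M7, D7⟩ => ?_)
  rw [c6, V6, M5] at M7
  rw [c6, D6] at D7
  have q7 : s7.v 11 = s.v 11 := by
    rw [f7.v 11 (by decide), f6.v 11 (by decide), f5.v 11 (by decide), f4.v 11 (by decide),
      f3.v 11 (by decide), f2.v 11 (by decide), f1.v 11 (by decide)]
    simp [hs0]
  refine wp_set (by simpa [q7] using h11) ⟨?_, ?_, ?_, ?_, ?_, ?_⟩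
  · have q1 : 1 ≤ (4 * t) ^ 2 := Nat.one_le_pow _ _ (by omega)
    have q2 := ten_mul_le_sq t
    generalize (4 * t) ^ 2 = q at *
    omega
  · simpa [intQuatStretch] using M7
  · rw [St.setv_v, if_neg (by norm_num), D7]
    ring
  · simp [q7]
  · intro i j
    rw [St.setv_a, M7]
    exact (b4 i j).trans (hpw (by norm_num))
  · rw [St.setv_v, if_neg (by norm_num), D7]
    exact d4.trans (hpw (by norm_num))

/-- The result of testing one vector. -/
theorem wp_vector {t b S R Z v σ : ℕ} {B : Matrix (Fin (4 * t)) (Fin (4 * t)) ℤ} {D X : ℤ} (ht : 1 ≤ t)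
    (h0 : s.v 0 = t) (hn : s.v 1 = (4 * t : ℕ)) (h2 : s.v 2 = b) (h3 : s.v 3 = S) (h5 : s.v 5 = R)
    (h13 : s.v 13 = Z) (h14 : s.v 14 = (2 * Z + 1 : ℕ)) (h16 : s.v 16 = v) (h11 : s.v 11 = σ)
    (h12 : s.v 12 = D) (hB : matOf t (s.a 0) = B) (hA : 4 * t * (4 * t) ≤ A) (hX2 : 2 ≤ X)
    (hX : ∀ i j, |B i j| ≤ X) (hD : |D| ≤ X) (htX : ((4 * t : ℕ) : ℤ) ≤ X)
    (hZX : ((4 * t * (3 * Z + 2) : ℕ) : ℤ) ≤ X) (hbX : ((b * (4 * t) : ℕ) : ℤ) ≤ X) (hXh : X ^ 32 < h)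
    (hvX : (v : ℤ) ≤ X) (hσX : (σ : ℤ) + 1 ≤ X) :
    Wp h A vectorCmd s fun s' m => m ≤ 200 * (4 * t) ^ 2 ∧
      ((matOf t (s'.a 0) = B ∧ s'.v 12 = D ∧ s'.v 11 = σ ∧
        ((boxVec t Z v ᵥ* B) ⬝ᵥ (boxVec t Z v ᵥ* B) ≤ 0 ∨
          R * D ^ 2 ≤ (boxVec t Z v ᵥ* B) ⬝ᵥ (boxVec t Z v ᵥ* B) ∨ S < σ)) ∨
      (0 < (boxVec t Z v ᵥ* B) ⬝ᵥ (boxVec t Z v ᵥ* B) ∧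
        (boxVec t Z v ᵥ* B) ⬝ᵥ (boxVec t Z v ᵥ* B) < R * D ^ 2 ∧ σ ≤ S ∧ s'.v 11 = (σ + 1 : ℕ) ∧
        matOf t (s'.a 0) = intQuatStretch (b * ((boxVec t Z v ᵥ* B) ⬝ᵥ (boxVec t Z v ᵥ* B)))
          (boxVec t Z v ᵥ* B) B ∧
        s'.v 12 = D * (b * ((boxVec t Z v ᵥ* B) ⬝ᵥ (boxVec t Z v ᵥ* B))) ^ 4 ∧
        (∀ i j, |matOf t (s'.a 0) i j| ≤ X ^ 32) ∧ |s'.v 12| ≤ X ^ 32)) := by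
  have hpw : ∀ {a b : ℕ}, a ≤ b → X ^ a ≤ X ^ b := fun h => pow_le_pow_right₀ (by omega) h
  have hlt : ∀ {a : ℕ}, a ≤ 32 → X ^ a < h := fun h => (hpw h).trans_lt hXh
  have hXlt : X < h := by simpa using hlt (a := 1) (by norm_num)
  have hth : ((4 * t : ℕ) : ℤ) < h := by omega
  have h4t : 4 * t ≤ A := (Nat.le_mul_self _).trans hA
  have hZ3 : ((3 * Z + 2 : ℕ) : ℤ) ≤ X :=
    le_trans (by exact_mod_cast Nat.le_mul_of_pos_left _ (by omega)) hZX
  have hZ4 : ((4 * t : ℕ) : ℤ) * Z ≤ X :=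
    le_trans (by exact_mod_cast Nat.mul_le_mul_left _ (by omega)) hZX
  set y := boxVec t Z v ᵥ* B with hy
  refine wp_seq ((wp_digits (h := h) (A := A) (s := s) (a := 5) (src := .var 16) (cnt := .var 1)
    (base := .var 14) (off := .var 13) v (4 * t) (2 * Z + 1) Z (by simpa using h16) (by simpa using hn)
    (by simpa using h14) (by simpa using h13)
    (by simp [Expr.vars]) (by simp [Expr.vars]) (by simp [Expr.vars]) (by omega) hth h4t (by omega)
    (by rw [abs_of_nonneg (by positivity)]; push_cast at hZ3 ⊢; omega)).mono
    fun s1 m1 f1 ⟨n1, V1⟩ => ?_)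
  have hz : vecOf t (s1.a 5) = boxVec t Z v := funext fun i => V1 i i.isLt
  have hB1 : matOf t (s1.a 0) = B := by rw [f1.a 0 (by decide), hB]
  have hsq : ((4 * t : ℕ) : ℤ) * (Z * X) ≤ X ^ 2 := by
    rw [← mul_assoc, sq]
    exact mul_le_mul_of_nonneg_right hZ4 (by omega)
  refine wp_seq ((wp_combine (s := s1) (t := t) (X := X) (Z := Z) (by rw [f1.v 1 (by decide), hn]) hth hA
    (by rw [hB1]; exact hX) (by rw [hz]; exact abs_boxVec_le t Z v)
    (hsq.trans_lt (hlt (by norm_num)))).mono fun s2 m2 f2 ⟨n2, V2⟩ => ?_)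
  rw [hz, hB1, ← hy] at V2
  have hyb : ∀ j, |y j| ≤ X ^ 2 := fun j =>
    (abs_dot_le (abs_boxVec_le t Z v) fun i => hX i j).trans hsq
  have hfr : ∀ x, x ∉ vectorCmd.wv → s2.v x = s.v x := fun x hx => by
    simp only [vectorCmd, Cmd.wv, List.mem_append, not_or] at hx
    rw [f2.v x hx.2.1, f1.v x hx.1]
  have hny : |y ⬝ᵥ y| ≤ (4 * t : ℕ) * (X ^ 2 * X ^ 2) := abs_dot_le hyb hyb
  have hny5 : (4 * t : ℕ) * (X ^ 2 * X ^ 2) ≤ X ^ 5 :=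
    (mul_le_mul_of_nonneg_right htX (by positivity)).trans (le_of_eq (by ring))
  have hyp : ∀ k < 4 * t, |s2.a 1 k| ≤ X ^ 2 := fun k hk => by
    have := hyb ⟨k, hk⟩
    rw [← V2] at this
    exact this
  refine wp_seq ((wp_dot (4 * t) (fun k => k) (fun k => k) (by rw [f2.v 1 (by decide), f1.v 1 (by decide), hn])
    hth (fun s' k _ hk => by simpa using hk) (fun s' k _ hk => by simpa using hk) (fun k hk => by omega)
    (fun k hk => by omega) hyp hyp (hny5.trans_lt (hlt (by norm_num)))).mono fun s3 m3 f3 ⟨n3, V3⟩ => ?_)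
  have hdot : s3.v 28 = y ⬝ᵥ y := by
    rw [V3, ← V2, Finset.sum_range]
    rfl
  have hcost := vector_steps_le t ht
  refine wp_seq (wp_set (by
    rw [Expr.eval_var, hdot]
    exact (hny.trans hny5).trans_lt (hlt (by norm_num))) ?_)
  set s4 := s3.setv 25 ((Expr.var 28).eval s3.v) with hs4
  have e25 : s4.v 25 = y ⬝ᵥ y := by simp [hs4, hdot]
  have a40 : s4.a 0 = s.a 0 := by
    rw [hs4, St.setv_a, f3.a 0 (by decide), f2.a 0 (by decide), f1.a 0 (by decide)]
  have fr4 : ∀ x, x ∉ [18, 20, 21, 22, 23, 24, 25, 28] → s4.v x = s.v x := by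
    intro x hx
    simp only [List.mem_cons, List.not_mem_nil, or_false, not_or] at hx
    rw [hs4, St.setv_v, if_neg (by omega), f3.v x (by simp [dotCmd, Cmd.for_, Cmd.wv]; omega),
      f2.v x (by simp [combineCmd, dotCmd, Cmd.for_, Cmd.wv]; omega),
      f1.v x (by simp [digitsCmd, Cmd.for_, Cmd.wv]; omega)]
  have e5 : s4.v 5 = R := by rw [fr4 5 (by decide), h5]
  have e12 : s4.v 12 = D := by rw [fr4 12 (by decide), h12]
  have e3 : s4.v 3 = S := by rw [fr4 3 (by decide), h3]
  have e11 : s4.v 11 = σ := by rw [fr4 11 (by decide), h11]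
  have e2 : s4.v 2 = b := by rw [fr4 2 (by decide), h2]
  have hh0 : |(Expr.const 0).eval s4.v| < h := by simp; omega
  -- In the three branches without a stretch, the assignment to variable 27 is idle: no command
  -- reads this variable.
  refine wp_ite (fun t1 => wp_ite (fun t2 => wp_ite (fun t3 => ?_) fun t3 => ?_) fun t2 => ?_) fun t1 => ?_
  · simp only [Expr.eval_var, Expr.eval_sub, Expr.eval_mul, Expr.eval_add, Expr.eval_const, e25, e5, e12, e3,
      e11] at t1 t2 t3
    have V4 : vecOf t (s4.a 1) = y := by rw [hs4, St.setv_a, f3.a 1 (by decide), V2]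
    refine (wp_quatStretch (s := s4) (t := t) (X := X) ht (by rw [fr4 0 (by decide), h0])
      (by rw [fr4 1 (by decide), hn]) hA hX2 (by rw [a40, hB]; exact hX) (by rw [V4]; exact hyb) ?_
      (by rw [e12]; exact hD) htX hXh ?_).mono fun s5 m5 f5 ⟨n5, M5, D5, S5, X5, Y5⟩ => ⟨by omega, ?_⟩
    · rw [e2, e25, abs_mul, abs_of_nonneg (by positivity : (0 : ℤ) ≤ b)]
      calc (b : ℤ) * |y ⬝ᵥ y| ≤ b * ((4 * t : ℕ) * (X ^ 2 * X ^ 2)) := by gcongr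
        _ = ((b * (4 * t) : ℕ) : ℤ) * X ^ 4 := by push_cast; ring
        _ ≤ X * X ^ 4 := by gcongr
        _ = X ^ 5 := by ring
    · rw [e11, abs_of_nonneg (by positivity)]
      omega
    · right
      rw [e2, e25, V4, a40, hB] at M5
      rw [e2, e25, e12] at D5
      rw [e11] at S5
      refine ⟨t1, by rw [sq]; linarith, by omega, by simpa using S5, M5, D5, X5, Y5⟩
  all_goals
    rw [Expr.eval_var, e25] at t1
    refine wp_set hh0 ⟨by omega, Or.inl ⟨?_, ?_, ?_, ?_⟩⟩
    · rw [St.setv_a, a40, hB]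
    · simp [e12]
    · simp [e11]
  · simp only [Expr.eval_var, Expr.eval_sub, Expr.eval_add, Expr.eval_const, e3, e11] at t3
    exact Or.inr (Or.inr (by omega))
  · simp only [Expr.eval_var, Expr.eval_sub, Expr.eval_mul, e25, e5, e12] at t2
    exact Or.inr (Or.inl (by rw [sq]; linarith))
  · exact Or.inl t1

end Specs

end Ram

/-! ### Treating a box of vectors, and building the start matrix -/

namespace Ram

open BitMachine QuatLattice Matrix

/-- Treat every vector of the box as often as it may take to make it long. -/
def boxCmd : Cmd := Cmd.for_ 16 (.var 15) (Cmd.for_ 17 (.var 3 + .const 1) vectorCmd)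

/-- The coefficients of the row with number in variable `20`. -/
def rowCmd : Cmd :=
  .ite (.const 4 - .var 20)
    (.ite (.var 20) (.ite (.var 20 - .const 1) (.ite (.var 20 - .const 2)
      (.seq (.load 35 4 (.const 4)) (.load 36 4 (.const 5)))
      (.seq (.load 35 4 (.const 2)) (.load 36 4 (.const 3))))
      (.seq (.set 35 (.const 0)) (.set 36 (.var 8 - .const 1))))
      (.seq (.set 35 (.var 8 - .const 1)) (.set 36 (.const 0))))
    (.seq (.load 23 4 (.const 2 * (.var 20 / .const 4) + .const 4))
      (.seq (.load 24 4 (.const 2 * (.var 20 / .const 4) + .const 5))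
      (.seq (.ite (.var 20 % .const 4) (.ite (.var 20 % .const 4 - .const 1)
        (.ite (.var 20 % .const 4 - .const 2)
        (.seq (.set 33 (.var 23 - .var 32 * .var 23 + .var 31 * .var 24))
          (.set 34 (.var 24 + .var 31 * .var 23 + .var 32 * .var 24)))
        (.seq (.set 33 (.var 23 + .var 31 * .var 23 + .var 32 * .var 24))
          (.set 34 (.var 24 + .var 32 * .var 23 - .var 31 * .var 24))))
        (.seq (.set 33 (.var 23 - .var 24)) (.set 34 (.var 23 + .var 24))))
        (.seq (.set 33 (.const 2 * .var 23)) (.set 34 (.const 2 * .var 24))))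
      (.seq (.set 35 ((.var 33 - .var 34) % .var 8)) (.set 36 ((.const 2 * .var 34) % .var 8))))))

/-- The expression that is `1` where `e` vanishes and `0` elsewhere. -/
def isZero (e : Expr) : Expr := .const 1 / (.const 1 + e * e)

/-- The start matrix that belongs to the number in variable `10`. -/
def startCmd : Cmd :=
  .seq (digitsCmd 4 (.var 10) (.const 2 * .var 0 + .const 4) (.var 8) (.const 0))
    (.seq (.load 31 4 (.const 0)) (.seq (.load 32 4 (.const 1))
    (Cmd.for_ 20 (.var 1) (.seq rowCmd (Cmd.for_ 21 (.var 1) (.store 0 (.var 20 * .var 1 + .var 21)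
      ((.const 2 * .var 35 + .var 36) * isZero (.var 21) + .var 36 * isZero (.var 21 - .const 1) +
        isZero (.var 21 - .const 4 * (.var 20 / .const 4)) + isZero (.var 21 - .var 20))))))))

@[simp] theorem isZero_eval (e : Expr) (v : ℕ → ℤ) :
    (isZero e).eval v = if e.eval v = 0 then 1 else 0 := by
  simp only [isZero, Expr.eval_div, Expr.eval_const, Expr.eval_add, Expr.eval_mul]
  split_ifs with h
  · simp [h]
  · exact Int.ediv_eq_zero_of_lt (by norm_num) (by have := mul_self_pos.2 h; omega)

section Specs

variable {h : ℤ} {A : ℕ} {s : St}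

/-- The values of the variables that stay fixed while a box of vectors is treated. -/
structure BoxVars (t b S R Z : ℕ) (s : St) : Prop where
  v0 : s.v 0 = t
  v1 : s.v 1 = (4 * t : ℕ)
  v2 : s.v 2 = b
  v3 : s.v 3 = S
  v5 : s.v 5 = R
  v13 : s.v 13 = Z
  v14 : s.v 14 = (2 * Z + 1 : ℕ)

theorem BoxVars.of_eq {t b S R Z : ℕ} {s' : St} (hs : BoxVars t b S R Z s)
    (h : ∀ x ∈ [0, 1, 2, 3, 5, 13, 14], s'.v x = s.v x) : BoxVars t b S R Z s' :=
  ⟨by rw [h 0 (by simp), hs.v0], by rw [h 1 (by simp), hs.v1], by rw [h 2 (by simp), hs.v2],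
    by rw [h 3 (by simp), hs.v3], by rw [h 5 (by simp), hs.v5], by rw [h 13 (by simp), hs.v13],
    by rw [h 14 (by simp), hs.v14]⟩

/-- The invariant of the stretching process. -/
structure BoxInv (t b S R : ℕ) (E : ℤ) (B₀ : Matrix (Fin (4 * t)) (Fin (4 * t)) ℤ) (s : St) (σ : ℕ)
    (T : Matrix (Fin (4 * t)) (Fin (4 * t)) ℝ) : Prop where
  stretched : Stretched b R B₀ σ (s.v 12) (matOf t (s.a 0)) T
  v11 : s.v 11 = σ
  le : σ ≤ S + 1
  entry : ∀ i j, |matOf t (s.a 0) i j| ≤ E ^ 32 ^ σ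
  scale : |s.v 12| ≤ E ^ 32 ^ σ

theorem BoxInv.congr {t b S R σ : ℕ} {E : ℤ} {B₀ : Matrix (Fin (4 * t)) (Fin (4 * t)) ℤ} {s' : St}
    {T : Matrix (Fin (4 * t)) (Fin (4 * t)) ℝ} (hs : BoxInv t b S R E B₀ s σ T) (h11 : s'.v 11 = s.v 11)
    (h12 : s'.v 12 = s.v 12) (h0 : matOf t (s'.a 0) = matOf t (s.a 0)) : BoxInv t b S R E B₀ s' σ T :=
  ⟨by rw [h12, h0]; exact hs.stretched, by rw [h11, hs.v11], hs.le, by rw [h0]; exact hs.entry,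
    by rw [h12]; exact hs.scale⟩

/-- Each inner round finds the vector `v` done, or stretches along it, or finds the limit `S`
exceeded. So after `i` rounds `v` is done or at least `i` stretches have been made, and after `S +
1` rounds `v` is done or the candidate has failed. Done vectors stay done, as no stretch shortens
anything. Each stretch raises the size bound `E ^ 32 ^ σ` to its 32nd power, and the test `σ ≤ S`
ends this growth at `σ = S + 1`. -/
theorem wp_box {t b S R Z N : ℕ} {E : ℤ} {B₀ : Matrix (Fin (4 * t)) (Fin (4 * t)) ℤ} (ht : 1 ≤ t)
    (hb : b ≠ 0) (hv : BoxVars t b S R Z s) (h15 : s.v 15 = N) (h11 : s.v 11 = 0) (h12 : s.v 12 = 1)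
    (hB : matOf t (s.a 0) = B₀) (hA : 4 * t * (4 * t) ≤ A) (hE2 : 2 ≤ E) (hB₀ : ∀ i j, |B₀ i j| ≤ E)
    (htE : ((4 * t : ℕ) : ℤ) ≤ E) (hZE : ((4 * t * (3 * Z + 2) : ℕ) : ℤ) ≤ E)
    (hbE : ((b * (4 * t) : ℕ) : ℤ) ≤ E) (hNE : (N : ℤ) ≤ E) (hSE : (S : ℤ) + 2 ≤ E)
    (hEh : E ^ 32 ^ (S + 2) < h) :
    Wp h A boxCmd s fun s' m => m ≤ N * ((S + 1) * (200 * (4 * t) ^ 2 + 2) + 4) + 2 ∧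
      ∃ σ T, BoxInv t b S R E B₀ s' σ T ∧ (S < σ ∨ ∀ v < N, Done R B₀ T (boxVec t Z v)) := by
  have hEh1 : E < h := lt_of_le_of_lt (le_self_pow₀ (by omega) (by positivity)) hEh
  refine wp_for N ((S + 1) * (200 * (4 * t) ^ 2 + 2) + 2) (fun v s' => ∃ σ T, BoxInv t b S R E B₀ s' σ T ∧
    (S < σ ∨ ∀ v' < v, Done R B₀ T (boxVec t Z v'))) (by decide)
    (fun y hy => by simp [Expr.vars] at hy; subst hy; decide) (by simpa using h15) (by omega) ?_ ?_ ?_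
  · refine ⟨0, 1, ?_, Or.inr (by simp)⟩
    have : Stretched b R B₀ 0 (s.v 12) (matOf t (s.a 0)) 1 := by
      rw [h12, hB]
      exact Stretched.start b R B₀
    refine BoxInv.congr (s := s) ⟨this, by simp [h11], by omega, ?_, ?_⟩ (by simp) (by simp) rfl
    · simpa [hB] using hB₀
    · simp [h12]
      omega
  · intro v s1 hvN f1 hs16 hI
    have hv1 : BoxVars t b S R Z s1 := hv.of_eq fun x hx => f1.v x (by revert x; decide)
    refine wp_for (S + 1) (200 * (4 * t) ^ 2) (fun i s' => ∃ σ T, BoxInv t b S R E B₀ s' σ T ∧ (S < σ ∨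
      ((∀ v' < v, Done R B₀ T (boxVec t Z v')) ∧ (Done R B₀ T (boxVec t Z v) ∨ i ≤ σ)))) (by decide)
      (fun y hy => by simp [Expr.vars] at hy; subst hy; decide) (by simp [hv1.v3]) (by push_cast; omega)
      ?_ ?_ ?_
    · obtain ⟨σ, T, hinv, hor⟩ := hI
      exact ⟨σ, T, hinv.congr (by simp) (by simp) rfl, hor.imp id fun h => ⟨h, Or.inr (by omega)⟩⟩
    · rintro i s2 hiS f2 hs17 ⟨σ, T, hinv, hor⟩
      have hv2 : BoxVars t b S R Z s2 := hv1.of_eq fun x hx => f2.v x (by revert x; decide)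
      have hσ := hinv.le
      have hEX : E ≤ E ^ 32 ^ σ := le_self_pow₀ (by omega) (by positivity)
      have hX32 : (E ^ 32 ^ σ) ^ 32 = E ^ 32 ^ (σ + 1) := by rw [← pow_mul, pow_succ]
      refine (wp_vector (h := h) (A := A) (s := s2) (X := E ^ 32 ^ σ) (v := v) ht hv2.v0 hv2.v1 hv2.v2 hv2.v3
        hv2.v5 hv2.v13 hv2.v14 (by rw [f2.v 16 (by decide), hs16]) hinv.v11 rfl rfl hA (hE2.trans hEX) hinv.entry
        hinv.scale (htE.trans hEX) (hZE.trans hEX) (hbE.trans hEX) ?_ (by omega) (by omega)).mono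
        fun s3 m3 f3 ⟨hm3, hpost⟩ => ⟨hm3, ?_⟩
      · rw [hX32]
        refine lt_of_le_of_lt (pow_le_pow_right₀ (by omega) ?_) hEh
        exact Nat.pow_le_pow_right (by norm_num) (by omega)
      · rcases hpost with ⟨pB, pD, pσ, pdone⟩ | ⟨p1, p2, p3, pσ, pB, pD, pX, pY⟩
        · refine ⟨σ, T, hinv.congr (by simp [pσ, hinv.v11]) (by simp [pD]) pB, ?_⟩
          rcases hor with hor | ⟨hall, -⟩
          · exact Or.inl hor
          · rcases pdone with pd | pd | pd
            · exact Or.inr ⟨hall, Or.inl (hinv.stretched.done (Or.inl pd))⟩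
            · exact Or.inr ⟨hall, Or.inl (hinv.stretched.done (Or.inr pd))⟩
            · exact Or.inl pd
        · obtain ⟨T', hT', hmono⟩ := hinv.stretched.step hb p1 p2 rfl
          refine ⟨σ + 1, T', ⟨?_, ?_, by omega, ?_, ?_⟩, ?_⟩
          · rw [St.setv_a, St.setv_v, if_neg (by norm_num), pB, pD]
            exact hT'
          · rw [St.setv_v, if_neg (by norm_num), pσ]
          · rw [← hX32]
            exact pX
          · rw [← hX32, St.setv_v, if_neg (by norm_num)]
            exact pY
          · rcases hor with hor | ⟨hall, hor⟩
            · omega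
            · exact Or.inr ⟨fun v' hv' => (hall v' hv').mono hmono,
                hor.imp (fun h => h.mono hmono) fun h => by omega⟩
    · rintro s2 m2 f2 hm2 ⟨σ, T, hinv, hor⟩
      refine ⟨hm2, σ, T, hinv.congr (by simp) (by simp) rfl, ?_⟩
      rcases hor with hor | ⟨hall, hdone | hle⟩
      · exact Or.inl hor
      · refine Or.inr fun v' hv' => ?_
        rcases Nat.lt_succ_iff_lt_or_eq.1 hv' with h | rfl
        exacts [hall v' h, hdone]
      · exact Or.inl (by omega)
  · rintro s1 m1 f1 hm1 ⟨σ, T, hinv, hor⟩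
    exact ⟨hm1.trans (le_of_eq (by ring)), σ, T, hinv, hor⟩

theorem wp_row {P : ℕ} {i t : ℕ} (hi : i < 4 * t) (h20 : s.v 20 = i) (h8 : s.v 8 = P) (hA : 2 * t + 4 ≤ A)
    (hd : ∀ j < 2 * t + 4, 0 ≤ s.a 4 j ∧ s.a 4 j < P) (h31 : s.v 31 = s.a 4 0) (h32 : s.v 32 = s.a 4 1)
    (hPh : 4 * (P : ℤ) * P < h) :
    Wp h A rowCmd s fun s' m => m ≤ 20 ∧ s'.v 35 = coefR P (s.a 4) i ∧ s'.v 36 = coefS P (s.a 4) i := by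
  have hP0 : (0 : ℤ) < P := by
    have := hd 0 (by omega)
    omega
  have hPP : (P : ℤ) < h := by nlinarith
  refine wp_ite (fun c4 => ?_) fun c4 => ?_
  · simp only [Expr.eval_sub, Expr.eval_const, Expr.eval_var, h20] at c4
    refine wp_ite (fun c0 => wp_ite (fun c1 => wp_ite (fun c2 => ?_) fun c2 => ?_) fun c1 => ?_) fun c0 => ?_
    · simp only [Expr.eval_sub, Expr.eval_const, Expr.eval_var, h20] at c2
      obtain rfl : i = 3 := by omega
      refine wp_seq (wp_load 4 (by simp) (by omega) (wp_load 5 (by simp) (by omega) ?_))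
      exact ⟨by norm_num, by simp [coefR], by simp [coefS]⟩
    · simp only [Expr.eval_sub, Expr.eval_const, Expr.eval_var, h20] at c1 c2
      obtain rfl : i = 2 := by omega
      refine wp_seq (wp_load 2 (by simp) (by omega) (wp_load 3 (by simp) (by omega) ?_))
      exact ⟨by norm_num, by simp [coefR], by simp [coefS]⟩
    · simp only [Expr.eval_sub, Expr.eval_const, Expr.eval_var, h20] at c0 c1
      obtain rfl : i = 1 := by omega
      refine wp_seq (wp_set (by simp; omega) (wp_set ?_ ?_))
      · simp only [Expr.eval_sub, Expr.eval_const, Expr.eval_var, St.setv_v, if_neg (show ¬ (8 = 35) by norm_num),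
          h8]
        rw [abs_of_nonneg (by omega)]
        omega
      · exact ⟨by norm_num, by simp [coefR], by simp [coefS, h8]⟩
    · simp only [Expr.eval_var, h20] at c0
      obtain rfl : i = 0 := by omega
      refine wp_seq (wp_set ?_ (wp_set (by simp; omega) ?_))
      · simp only [Expr.eval_sub, Expr.eval_const, Expr.eval_var, h8]
        rw [abs_of_nonneg (by omega)]
        omega
      · exact ⟨by norm_num, by simp [coefR, h8], by simp [coefS]⟩
  · simp only [Expr.eval_sub, Expr.eval_const, Expr.eval_var, h20] at c4
    have hdx := hd (2 * (i / 4) + 4) (by omega)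
    have hdy := hd (2 * (i / 4) + 5) (by omega)
    have hda := hd 0 (by omega)
    have hdb := hd 1 (by omega)
    have hR : coefR P (s.a 4) i = (rowFst (s.a 4 0) (s.a 4 1) (s.a 4 (2 * (i / 4) + 4))
        (s.a 4 (2 * (i / 4) + 5)) (i % 4) - rowSnd (s.a 4 0) (s.a 4 1) (s.a 4 (2 * (i / 4) + 4))
        (s.a 4 (2 * (i / 4) + 5)) (i % 4)) % P := by
      unfold coefR
      repeat rw [if_neg (by omega)]
    have hS : coefS P (s.a 4) i = (2 * rowSnd (s.a 4 0) (s.a 4 1) (s.a 4 (2 * (i / 4) + 4))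
        (s.a 4 (2 * (i / 4) + 5)) (i % 4)) % P := by
      unfold coefS
      repeat rw [if_neg (by omega)]
    rw [hR, hS]
    generalize hx : s.a 4 (2 * (i / 4) + 4) = x at *
    generalize hy : s.a 4 (2 * (i / 4) + 5) = y at *
    generalize ha : s.a 4 0 = a at *
    generalize hb : s.a 4 1 = b at *
    have hadr : ((2 * (i / 4) + 4 : ℕ) : ℤ) = 2 * ((i : ℤ) / 4) + 4 := by push_cast; rfl
    have hadr' : ((2 * (i / 4) + 5 : ℕ) : ℤ) = 2 * ((i : ℤ) / 4) + 5 := by push_cast; rfl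
    refine wp_seq (wp_load (2 * (i / 4) + 4) (by simp [h20]) (by omega) ?_)
    refine wp_seq (wp_load (2 * (i / 4) + 5) (by simp [h20]) (by omega) ?_)
    rw [St.setv_a, hx, hy]
    set s1 := (s.setv 23 x).setv 24 y with hs1
    have e20 : s1.v 20 = i := by simp [hs1, h20]
    have e8 : s1.v 8 = P := by simp [hs1, h8]
    have e23 : s1.v 23 = x := by simp [hs1]
    have e24 : s1.v 24 = y := by simp [hs1]
    have e31 : s1.v 31 = a := by simp [hs1, h31]
    have e32 : s1.v 32 = b := by simp [hs1, h32]
    have mb : ∀ {u v : ℤ}, 0 ≤ u ∧ u < P → 0 ≤ v ∧ v < P → 0 ≤ u * v ∧ u * v ≤ (P : ℤ) * P := fun hu hv =>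
      ⟨mul_nonneg hu.1 hv.1, mul_le_mul hu.2.le hv.2.le hv.1 hP0.le⟩
    have max_ := mb hda hdx
    have may := mb hda hdy
    have mbx := mb hdb hdx
    have mby := mb hdb hdy
    have hPPP : (P : ℤ) ≤ P * P := le_mul_of_one_le_left hP0.le (by omega)
    have hPP4 : 4 * ((P : ℤ) * P) < h := by linarith
    suffices hmid : Wp h A (.ite (.var 20 % .const 4) (.ite (.var 20 % .const 4 - .const 1)
        (.ite (.var 20 % .const 4 - .const 2)
        (.seq (.set 33 (.var 23 - .var 32 * .var 23 + .var 31 * .var 24))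
          (.set 34 (.var 24 + .var 31 * .var 23 + .var 32 * .var 24)))
        (.seq (.set 33 (.var 23 + .var 31 * .var 23 + .var 32 * .var 24))
          (.set 34 (.var 24 + .var 32 * .var 23 - .var 31 * .var 24))))
        (.seq (.set 33 (.var 23 - .var 24)) (.set 34 (.var 23 + .var 24))))
        (.seq (.set 33 (.const 2 * .var 23)) (.set 34 (.const 2 * .var 24)))) s1 fun s2 m => m ≤ 5 ∧
        s2.v 33 = rowFst a b x y (i % 4) ∧ s2.v 34 = rowSnd a b x y (i % 4) ∧ s2.v 8 = P by
      refine wp_seq (hmid.mono fun s2 m2 _ ⟨hm2, g33, g34, g8⟩ => ?_)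
      have hm : ∀ u : ℤ, |u % P| < h := fun u => by
        rw [abs_of_nonneg (Int.emod_nonneg _ hP0.ne')]
        exact (Int.emod_lt_of_pos _ hP0).trans hPP
      refine wp_seq (wp_set ?_ (wp_set ?_ ?_))
      · simp only [Expr.eval_mod, Expr.eval_sub, Expr.eval_var, g8]
        exact hm _
      · simp only [Expr.eval_mod, Expr.eval_mul, Expr.eval_const, Expr.eval_var, St.setv_v,
          if_neg (show ¬ (8 = 35) by norm_num), g8]
        exact hm _
      · exact ⟨by omega, by simp [g33, g34, g8], by simp [g34, g8]⟩
    refine wp_ite (fun c0 => wp_ite (fun c1 => wp_ite (fun c2 => ?_) fun c2 => ?_) fun c1 => ?_) fun c0 => ?_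
    · simp only [Expr.eval_sub, Expr.eval_mod, Expr.eval_const, Expr.eval_var, e20] at c2
      have hi4 : i % 4 = 3 := by omega
      rw [hi4]
      refine wp_seq (wp_set ?_ (wp_set ?_ ?_))
      · simp only [Expr.eval_sub, Expr.eval_add, Expr.eval_mul, Expr.eval_var, e23, e24, e31, e32]
        rw [abs_lt]
        constructor <;> linarith
      · simp [e23, e24, e31, e32]
        rw [abs_lt]
        constructor <;> linarith
      · exact ⟨by norm_num, by simp [rowFst, e23, e24, e31, e32], by simp [rowSnd, e23, e24, e31, e32], by simp [e8]⟩
    · simp only [Expr.eval_sub, Expr.eval_mod, Expr.eval_const, Expr.eval_var, e20] at c1 c2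
      have hi4 : i % 4 = 2 := by omega
      rw [hi4]
      refine wp_seq (wp_set ?_ (wp_set ?_ ?_))
      · simp only [Expr.eval_add, Expr.eval_mul, Expr.eval_var, e23, e24, e31, e32]
        rw [abs_lt]
        constructor <;> linarith
      · simp [e23, e24, e31, e32]
        rw [abs_lt]
        constructor <;> linarith
      · exact ⟨by norm_num, by simp [rowFst, e23, e24, e31, e32], by simp [rowSnd, e23, e24, e31, e32], by simp [e8]⟩
    · simp only [Expr.eval_sub, Expr.eval_mod, Expr.eval_const, Expr.eval_var, e20] at c0 c1
      have hi4 : i % 4 = 1 := by omega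
      rw [hi4]
      refine wp_seq (wp_set ?_ (wp_set ?_ ?_))
      · simp only [Expr.eval_sub, Expr.eval_var, e23, e24]
        rw [abs_lt]
        constructor <;> linarith
      · simp [e23, e24]
        rw [abs_lt]
        constructor <;> linarith
      · exact ⟨by norm_num, by simp [rowFst, e23, e24], by simp [rowSnd, e23, e24], by simp [e8]⟩
    · simp only [Expr.eval_mod, Expr.eval_const, Expr.eval_var, e20] at c0
      have hi4 : i % 4 = 0 := by omega
      rw [hi4]
      refine wp_seq (wp_set ?_ (wp_set ?_ ?_))
      · simp only [Expr.eval_mul, Expr.eval_const, Expr.eval_var, e23]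
        rw [abs_lt]
        constructor <;> linarith
      · simp only [Expr.eval_mul, Expr.eval_const, Expr.eval_var, St.setv_v, if_neg (show ¬ (24 = 33) by norm_num),
          e24]
        rw [abs_lt]
        constructor <;> linarith
      · exact ⟨by norm_num, by simp [rowFst, e23], by simp [rowSnd, e24], by simp [e8]⟩

theorem start_steps_le (t : ℕ) (ht : 1 ≤ t) :
    4 * (2 * t + 4) + 3 + (1 + (1 + (4 * t * (20 + (4 * t * (1 + 2) + 2) + 2) + 2))) ≤ 50 * (4 * t) ^ 2 := by
  nlinarith

theorem wp_start {t P c : ℕ} (ht : 1 ≤ t) (h0 : s.v 0 = t) (hn : s.v 1 = (4 * t : ℕ)) (h8 : s.v 8 = P)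
    (h10 : s.v 10 = c) (hP0 : 0 < P) (hA : 4 * t * (4 * t) ≤ A) (hA' : 2 * t + 4 ≤ A) (hch : (c : ℤ) < h)
    (hth : ((4 * t : ℕ) : ℤ) < h) (hth' : ((2 * t + 4 : ℕ) : ℤ) < h) (hPh : 4 * (P : ℤ) * P + 2 < h) :
    Wp h A startCmd s fun s' m => m ≤ 50 * (4 * t) ^ 2 ∧ ∃ d : ℕ → ℤ,
      (∀ j < 2 * t + 4, d j = ((c / P ^ j % P : ℕ) : ℤ)) ∧ matOf t (s'.a 0) = digitMatrix t P d := by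
  have hPP : (P : ℤ) ≤ P * P := by exact_mod_cast Nat.le_mul_self P
  refine wp_seq ((wp_digits (h := h) (A := A) (s := s) (a := 4) c (2 * t + 4) P 0 (by simpa using h10)
    (by simp [h0]) (by simpa using h8) (by simp) (by simp [Expr.vars]) (by simp [Expr.vars]) (by simp [Expr.vars])
    hch hth' hA' hP0 (by simp; linarith)).mono fun s1 m1 f1 ⟨n1, V1⟩ => ?_)
  simp only [sub_zero] at V1
  set d := s1.a 4 with hd
  have hdb : ∀ j < 2 * t + 4, 0 ≤ d j ∧ d j < P := fun j hj => by
    rw [V1 j hj]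
    exact ⟨by positivity, by exact_mod_cast Nat.mod_lt _ hP0⟩
  refine wp_seq (wp_load 0 (by simp) (by omega) (wp_seq (wp_load 1 (by simp) (by omega) ?_)))
  set s2 := (s1.setv 31 (s1.a 4 0)).setv 32 ((s1.setv 31 (s1.a 4 0)).a 4 1) with hs2
  have e1 : s2.v 1 = (4 * t : ℕ) := by
    simp only [hs2, St.setv_v]
    simpa using (f1.v 1 (by decide)).trans hn
  have e8 : s2.v 8 = P := by
    simp only [hs2, St.setv_v]
    simpa using (f1.v 8 (by decide)).trans h8
  have e31 : s2.v 31 = d 0 := by simp [hs2, hd]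
  have e32 : s2.v 32 = d 1 := by simp [hs2, hd]
  have a4 : s2.a 4 = d := rfl
  have hcoef : StartCoeff t P (coefR P d) (coefS P d) :=
    startCoeff_coef (by exact_mod_cast hP0) fun i hi => hdb i (by omega)
  set G : ℕ → ℕ → ℤ := fun i j => (if j = 0 then 2 * coefR P d i + coefS P d i else 0) +
    (if j = 1 then coefS P d i else 0) + (if j = 4 * (i / 4) then 1 else 0) + (if j = i then 1 else 0) with hG
  have hGb : ∀ i < 4 * t, ∀ j, |G i j| < h := by
    intro i hi j
    have r0 := hcoef.r_nonneg i hi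
    have r1 := hcoef.r_lt i hi
    have q0 := hcoef.s_nonneg i hi
    have q1 := hcoef.s_lt i hi
    rw [hG, abs_lt]
    simp only
    constructor <;> split_ifs <;> linarith
  refine wp_for (4 * t) (20 + (4 * t * (1 + 2) + 2)) (fun i s' => ∀ i' < i, ∀ j' < 4 * t,
    s'.a 0 (i' * (4 * t) + j') = G i' j') (by decide)
    (fun y hy => by simp [Expr.vars] at hy; subst hy; decide) (by simpa using e1) hth (by simp) ?_ ?_
  · intro i s3 hi f3 hvi hI
    have g1 : s3.v 1 = (4 * t : ℕ) := by rw [f3.v 1 (by decide), e1]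
    have g8 : s3.v 8 = P := by rw [f3.v 8 (by decide), e8]
    have g4 : s3.a 4 = d := by rw [f3.a 4 (by decide), a4]
    refine wp_seq ((wp_row (s := s3) (P := P) hi hvi g8 hA' (by rw [g4]; exact hdb)
      (by rw [f3.v 31 (by decide), e31, g4]) (by rw [f3.v 32 (by decide), e32, g4]) (by linarith)).mono
      fun s4 m4 f4 ⟨n4, r4, q4⟩ => ?_)
    rw [g4] at r4 q4
    have k1 : s4.v 1 = (4 * t : ℕ) := by rw [f4.v 1 (by decide), g1]
    have k20 : s4.v 20 = i := by rw [f4.v 20 (by decide), hvi]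
    have ka : s4.a 0 = s3.a 0 := f4.a 0 (by decide)
    refine wp_for (4 * t) 1 (fun j s' => ∀ i' j', (i' < i ∨ (i' = i ∧ j' < j)) → j' < 4 * t →
      s'.a 0 (i' * (4 * t) + j') = G i' j') (by decide)
      (fun y hy => by simp [Expr.vars] at hy; subst hy; decide) (by simpa using k1) hth ?_ ?_ ?_
    · intro i' j' hor hj'
      rw [St.setv_a, ka]
      exact hI i' (by omega) j' hj'
    · intro j s5 hj f5 hvj hJ
      have u1 : s5.v 1 = (4 * t : ℕ) := by rw [f5.v 1 (by decide), k1]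
      have u20 : s5.v 20 = i := by rw [f5.v 20 (by decide), k20]
      have u35 : s5.v 35 = coefR P d i := by rw [f5.v 35 (by decide), r4]
      have u36 : s5.v 36 = coefS P d i := by rw [f5.v 36 (by decide), q4]
      have hval : ((Expr.const 2 * .var 35 + .var 36) * isZero (.var 21) + .var 36 * isZero (.var 21 - .const 1) +
          isZero (.var 21 - .const 4 * (.var 20 / .const 4)) + isZero (.var 21 - .var 20)).eval s5.v = G i j := by
        have c1 : ((j : ℤ) - 1 = 0) ↔ j = 1 := by omega
        have c2 : ((j : ℤ) - 4 * ((i : ℤ) / 4) = 0) ↔ j = 4 * (i / 4) := by omega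
        have c3 : ((j : ℤ) - i = 0) ↔ j = i := by omega
        simp only [Expr.eval_add, Expr.eval_mul, Expr.eval_const, Expr.eval_var, Expr.eval_sub, Expr.eval_div,
          isZero_eval, u20, u35, u36, hvj, c1, c2, c3, Nat.cast_eq_zero, hG, mul_ite, mul_one, mul_zero]
      refine wp_store (i * (4 * t) + j) (by simp [u1, u20, hvj]) ((idx_lt hi hj).trans_le hA)
        (by rw [hval]; exact hGb i hi j) ⟨le_rfl, ?_⟩
      rw [hval]
      intro i' j' hor hj'
      simp only [St.setv_a, St.seta_a, if_true, Function.update_apply, idx_inj hj' hj]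
      split_ifs with hij
      · rw [hij.1, hij.2]
      · exact hJ i' j' (by omega) hj'
    · intro s5 m5 _ hm5 hJ
      exact ⟨by omega, fun i' hi' j' hj' => hJ i' j' (by omega) hj'⟩
  · intro s3 m3 _ hm3 hI
    refine ⟨le_trans (by omega) (start_steps_le t ht), d, V1, ?_⟩
    ext i j
    exact hI i i.isLt j j.isLt

end Specs

end Ram

/-! ### Certified candidates and the best matrix so far -/

namespace Ram

open BitMachine QuatLattice Matrix

/-- Keep the stretched matrix if it is better than the best one so far. -/
def acceptCmd : Cmd :=
  .ite (.var 3 + .const 1 - .var 11)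
    (.ite (.var 6 * .var 30 - .var 29 * (.var 8 * .var 8))
      (.seq (.copy 3 0) (.seq (.set 29 (.var 6)) (.set 30 (.var 8 * .var 8))))
      (.set 27 (.const 0)))
    (.set 27 (.const 0))

/-- Treat the candidate with the number in variable `10`. -/
def candidateCmd : Cmd :=
  .seq startCmd (.seq (.set 11 (.const 0)) (.seq (.set 12 (.const 1)) (.seq boxCmd acceptCmd)))

/-- Run through all radii, moduli and candidates. -/
def searchCmd : Cmd :=
  Cmd.for_ 5 (.var 0 * .var 0 * (.var 0 * .var 0))
    (.seq (powCmd 6 20 (.var 5) (.const 2 * .var 0))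
    (.seq (.set 13 (.const 20 * .var 0 * .var 5))
    (.seq (.set 14 (.const 2 * .var 13 + .const 1))
    (.seq (powCmd 15 20 (.var 14) (.var 1))
      (Cmd.for_ 7 (.var 4) (.seq (.set 8 (.var 7 + .const 1)) (Cmd.for_ 10 (.var 9) candidateCmd)))))))

/-- Write the best matrix. -/
def outputCmd : Cmd := Cmd.for_ 20 (.var 1 * .var 1) (.seq (.load 23 3 (.var 20)) (.emit (.var 23)))

/-- Compute the values that depend on the dimension only. -/
def setupCmd (k C : ℕ) : Cmd :=
  .seq (.set 1 (.const 4 * .var 0)) (.seq (.set 3 (.const k * .var 0))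
    (.seq (.set 2 (.const (4 * k : ℕ) * .var 0)) (.seq (powCmd 4 20 (.const C * (.var 0 * .var 0)) (.var 0))
    (.seq (.set 4 (.const 2 * .var 4)) (.seq (powCmd 9 20 (.var 4) (.const 2 * .var 0 + .const 4))
    (.seq (.set 29 (.const 0)) (.set 30 (.const 1))))))))

/-- The whole program. -/
def latticeCmd (k C : ℕ) : Cmd := .seq (setupCmd k C) (.seq searchCmd outputCmd)

/-- The best matrix so far, with the square of the quotient of radius and modulus that belongs to it. -/
structure Best (t : ℕ) (s : St) (u v : ℕ) : Prop where
  v29 : s.v 29 = u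
  v30 : s.v 30 = v
  pos : 0 < v
  dens : u ≠ 0 → (matOf t (s.a 3)).det ≠ 0 ∧
    unitBall t * u / (2 ^ (4 * t) * Real.exp 1 * 2 ^ t * v) ≤ packingDensity (rowLattice (matOf t (s.a 3)))

/-- The candidate is never stretched more often than allowed. -/
def Good (t k R P c : ℕ) : Prop :=
  ∀ d : ℕ → ℤ, (∀ j < 2 * t + 4, d j = ((c / P ^ j % P : ℕ) : ℤ)) → ∀ s D B T,
    Stretched (4 * k * t) R (digitMatrix t P d) s D B T → s ≤ k * t

/-- The candidates of a set are not better than the best matrix so far. -/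
def Covers (t k : ℕ) (s : St) (K : ℕ → ℕ → ℕ → Prop) : Prop :=
  ∃ u v, Best t s u v ∧ ∀ R P c, K R P c → Good t k R P c → R ^ (2 * t) * v ≤ u * P ^ 2

theorem Covers.congr {t k : ℕ} {s s' : St} {K K' : ℕ → ℕ → ℕ → Prop} (H : Covers t k s K)
    (h29 : s'.v 29 = s.v 29) (h30 : s'.v 30 = s.v 30) (h3 : s'.a 3 = s.a 3)
    (hK : ∀ R P c, K' R P c → K R P c) : Covers t k s' K' := by
  obtain ⟨u, v, hb, hc⟩ := H
  exact ⟨u, v, ⟨by rw [h29, hb.v29], by rw [h30, hb.v30], hb.pos, by rw [h3]; exact hb.dens⟩,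
    fun R P c h => hc R P c (hK R P c h)⟩

/-- Sizes that suffice for a run of the program. -/
structure Sizes (t k Q A : ℕ) (E h : ℤ) : Prop where
  t_pos : 1 ≤ t
  k_pos : 1 ≤ k
  Q_pos : 1 ≤ Q
  addr : 4 * t * (4 * t) ≤ A
  addr' : 2 * t + 4 ≤ A
  two : 2 ≤ E
  dim : ((2 * (2 * t + 4) : ℕ) : ℤ) ≤ E
  box : ((4 * t * (3 * (20 * t * t ^ 4) + 2) : ℕ) : ℤ) ≤ E
  card : (((2 * (20 * t * t ^ 4) + 1) ^ (4 * t) : ℕ) : ℤ) ≤ E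
  scale : ((4 * k * t * (4 * t) : ℕ) : ℤ) ≤ E
  lim : ((Q ^ (2 * t + 4) : ℕ) : ℤ) ≤ E
  modulus : 4 * (Q : ℤ) * Q + 4 ≤ E
  radius : (((t ^ 4) ^ (2 * t) : ℕ) : ℤ) ≤ E
  tower : E ^ 32 ^ (k * t + 2) < h

/-- A bound for the number of steps that a candidate takes. -/
def candidateSteps (t k N : ℕ) : ℕ := 50 * (4 * t) ^ 2 + N * ((k * t + 1) * (200 * (4 * t) ^ 2 + 2) + 4) + 10

theorem abs_digitMatrix_le {t P : ℕ} {d : ℕ → ℤ} (hP : 0 < P) (hd : ∀ i < 6, 0 ≤ d i ∧ d i < P)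
    (i j : Fin (4 * t)) : |digitMatrix t P d i j| ≤ 4 * P + 2 := by
  have hco : StartCoeff t P (coefR P d) (coefS P d) := startCoeff_coef (by exact_mod_cast hP) hd
  have r0 := hco.r_nonneg i i.isLt
  have r1 := hco.r_lt i i.isLt
  have q0 := hco.s_nonneg i i.isLt
  have q1 := hco.s_lt i i.isLt
  simp only [digitMatrix, startMatrix, of_apply]
  rw [abs_le]
  constructor <;> split_ifs <;> linarith

section Specs

variable {h E : ℤ} {A t k Q : ℕ} {s : St}

theorem Sizes.lt_h (H : Sizes t k Q A E h) : E < h :=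
  lt_of_le_of_lt (le_self_pow₀ (by linarith [H.two]) (by positivity)) H.tower

/-- The quotients `R ^ (2 * t) / P ^ 2` and `u / v` are compared by cross multiplication. Accepting
needs `σ ≤ S`, and exactly then `hdens` certifies the density. -/
theorem wp_accept {R P u v : ℕ} {B : Matrix (Fin (4 * t)) (Fin (4 * t)) ℤ} {S σ : ℕ} (h3 : s.v 3 = S)
    (h11 : s.v 11 = σ) (h6 : s.v 6 = (R ^ (2 * t) : ℕ)) (h8 : s.v 8 = P) (hB : matOf t (s.a 0) = B)
    (hP : 0 < P) (hbest : Best t s u v) (hh : 0 < h) (hRh : ((R ^ (2 * t) : ℕ) : ℤ) < h) (hPh : (P : ℤ) * P < h)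
    (hdens : σ ≤ S → B.det ≠ 0 ∧ unitBall t * (R : ℝ) ^ (2 * t) / (2 ^ (4 * t) * Real.exp 1 * 2 ^ t * (P : ℝ) ^ 2) ≤
      packingDensity (rowLattice B)) :
    Wp h A acceptCmd s fun s' m => m ≤ 5 ∧ ∃ u' v', Best t s' u' v' ∧ u * v' ≤ u' * v ∧
      (σ ≤ S → R ^ (2 * t) * v' ≤ u' * P ^ 2) := by
  have keep : Best t (s.setv 27 0) u v := ⟨by simp [hbest.v29], by simp [hbest.v30], hbest.pos, hbest.dens⟩
  refine wp_ite (fun c1 => wp_ite (fun c2 => ?_) fun c2 => ?_) fun c1 => ?_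
  · simp only [Expr.eval_sub, Expr.eval_add, Expr.eval_const, Expr.eval_var, h3, h11] at c1
    refine wp_seq (wp_copy (wp_seq (wp_set ?_ (wp_set ?_ ?_))))
    · simpa [h6, abs_of_nonneg] using hRh
    · simpa [h8, abs_of_nonneg] using hPh
    · simp only [Expr.eval_sub, Expr.eval_mul, Expr.eval_var, h6, h8, hbest.v29, hbest.v30] at c2
      refine ⟨by norm_num, R ^ (2 * t), P ^ 2, ⟨by simp [h6], by simp [h8, sq], by positivity, fun _ => ?_⟩, ?_, fun _ => le_rfl⟩
      · simpa [hB] using hdens (by omega)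
      · have : ((u * P ^ 2 : ℕ) : ℤ) ≤ ((R ^ (2 * t) * v : ℕ) : ℤ) := by push_cast at c2 ⊢; rw [sq]; linarith
        exact_mod_cast this
  · refine wp_set (by simpa using hh) ⟨by norm_num, u, v, keep, le_rfl, fun _ => ?_⟩
    simp only [Expr.eval_sub, Expr.eval_mul, Expr.eval_var, h6, h8, hbest.v29, hbest.v30] at c2
    have : ((R ^ (2 * t) * v : ℕ) : ℤ) ≤ ((u * P ^ 2 : ℕ) : ℤ) := by push_cast at c2 ⊢; rw [sq]; linarith
    exact_mod_cast this
  · simp only [Expr.eval_sub, Expr.eval_add, Expr.eval_const, Expr.eval_var, h3, h11] at c1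
    exact wp_set (by simpa using hh) ⟨by norm_num, u, v, keep, le_rfl, fun h => by omega⟩

/-- If the limit was not exceeded, all vectors of the box are done, and `density_of_stretched`
certifies the matrix. A good candidate never exceeds the limit, so it is always compared with the
best one. Earlier comparisons persist because the best quotient never decreases. -/
theorem wp_candidate {R P c : ℕ} {K : ℕ → ℕ → ℕ → Prop} (H : Sizes t k Q A E h)
    (hv : BoxVars t (4 * k * t) (k * t) R (20 * t * R) s) (h6 : s.v 6 = (R ^ (2 * t) : ℕ)) (h8 : s.v 8 = P)
    (h10 : s.v 10 = c) (h15 : s.v 15 = ((2 * (20 * t * R) + 1) ^ (4 * t) : ℕ)) (hR : R < t ^ 4)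
    (hP0 : 0 < P) (hPQ : P ≤ Q) (hc : c < Q ^ (2 * t + 4)) (hcov : Covers t k s K) :
    Wp h A candidateCmd s fun s' m => m ≤ candidateSteps t k ((2 * (20 * t * t ^ 4) + 1) ^ (4 * t)) ∧
      Covers t k s' fun R' P' c' => K R' P' c' ∨ (R' = R ∧ P' = P ∧ c' = c) := by
  have hEh := H.lt_h
  have ht := H.t_pos
  have hk := H.k_pos
  have hPPQ : 4 * (P : ℤ) * P ≤ 4 * (Q : ℤ) * Q := by
    have : (P : ℤ) ≤ Q := by exact_mod_cast hPQ
    nlinarith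
  have hmod := H.modulus
  have hdim := H.dim
  have htwo := H.two
  have hlim := H.lim
  push_cast at hdim
  refine wp_seq ((wp_start (h := h) (A := A) (s := s) (t := t) (P := P) (c := c) ht hv.v0 hv.v1 h8 h10 hP0 H.addr
    H.addr' ?_ ?_ ?_ ?_).mono fun s1 m1 f1 ⟨hm1, d, hd, hB⟩ => ?_)
  · have : (c : ℤ) < (Q ^ (2 * t + 4) : ℕ) := by exact_mod_cast hc
    linarith
  · push_cast; linarith
  · push_cast; linarith
  · linarith
  have hdb : ∀ i < 2 * t + 4, 0 ≤ d i ∧ d i < P := fun j hj => by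
    rw [hd j hj]
    exact ⟨by positivity, by exact_mod_cast Nat.mod_lt _ hP0⟩
  refine wp_seq (wp_set (by simp; linarith) (wp_seq (wp_set (by simp; linarith) ?_)))
  set s2 := (s1.setv 11 ((Expr.const 0).eval s1.v)).setv 12
    ((Expr.const 1).eval (s1.setv 11 ((Expr.const 0).eval s1.v)).v) with hs2
  have e2 : ∀ x, x ≠ 11 → x ≠ 12 → x ∉ startCmd.wv → s2.v x = s.v x := fun x h1 h2 h3 => by
    rw [hs2, St.setv_v, if_neg h2, St.setv_v, if_neg h1, f1.v x h3]
  have hv2 : BoxVars t (4 * k * t) (k * t) R (20 * t * R) s2 := hv.of_eq fun x hx =>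
    e2 x (by revert x; decide) (by revert x; decide) (by revert x; decide)
  set N := (2 * (20 * t * t ^ 4) + 1) ^ (4 * t) with hN
  have hNle : (2 * (20 * t * R) + 1) ^ (4 * t) ≤ N := by
    refine Nat.pow_le_pow_left ?_ _
    have := Nat.mul_le_mul_left (20 * t) hR.le
    omega
  refine wp_seq ((wp_box (h := h) (A := A) (s := s2) (t := t) (b := 4 * k * t) (S := k * t) (R := R)
    (Z := 20 * t * R) (N := (2 * (20 * t * R) + 1) ^ (4 * t)) (E := E) (B₀ := digitMatrix t P d) ht
    (by positivity) hv2 ?_ (by simp [hs2]) (by simp [hs2]) hB H.addr H.two ?_ ?_ ?_ H.scale ?_ ?_ H.tower).mono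
    fun s3 m3 f3 ⟨hm3, σ, T, hinv, hor⟩ => ?_)
  · rw [e2 15 (by decide) (by decide) (by decide), h15]
  · intro i j
    refine (abs_digitMatrix_le hP0 (fun i hi => hdb i (by omega)) i j).trans ?_
    have : (P : ℤ) ≤ P * P := by exact_mod_cast Nat.le_mul_self P
    nlinarith
  · push_cast; linarith
  · refine le_trans ?_ H.box
    have := Nat.mul_le_mul_left (20 * t) hR.le
    exact_mod_cast Nat.mul_le_mul_left _ (by omega)
  · refine le_trans ?_ H.card
    exact_mod_cast hNle
  · refine le_trans ?_ H.scale
    have : k * t + 2 ≤ 4 * k * t * (4 * t) := by nlinarith [Nat.mul_le_mul hk ht]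
    exact_mod_cast this
  obtain ⟨u, v, hbest, hcv⟩ := hcov
  have e3 : ∀ x, x ≠ 11 → x ≠ 12 → x ∉ startCmd.wv → x ∉ boxCmd.wv → s3.v x = s.v x := fun x h1 h2 h3 h4 => by
    rw [f3.v x h4, e2 x h1 h2 h3]
  have hbest3 : Best t s3 u v := ⟨by rw [e3 29 (by decide) (by decide) (by decide) (by decide), hbest.v29],
    by rw [e3 30 (by decide) (by decide) (by decide) (by decide), hbest.v30], hbest.pos, by
      rw [f3.a 3 (by decide), hs2, St.setv_a, St.setv_a, f1.a 3 (by decide)]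
      exact hbest.dens⟩
  refine (wp_accept (h := h) (A := A) (s := s3) (R := R) (P := P) (S := k * t) (σ := σ) (u := u) (v := v)
    (B := matOf t (s3.a 0)) (by rw [f3.v 3 (by decide), hv2.v3]) hinv.v11
    (by rw [e3 6 (by decide) (by decide) (by decide) (by decide), h6])
    (by rw [e3 8 (by decide) (by decide) (by decide) (by decide), h8]) rfl hP0 hbest3 (by linarith) ?_ (by nlinarith)
    fun hσ => ?_).mono fun s4 m4 _ ⟨hm4, u', v', hb', hle, hcand⟩ => ⟨?_, u', v', hb', ?_⟩
  · refine lt_of_le_of_lt (le_trans ?_ H.radius) hEh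
    exact_mod_cast Nat.pow_le_pow_left hR.le _
  · have hco : StartCoeff t P (coefR P d) (coefS P d) :=
      startCoeff_coef (by exact_mod_cast hP0) fun i hi => hdb i (by omega)
    exact density_of_stretched (by omega) hco hinv.stretched (by linarith) (by positivity) fun z hz => by
      obtain ⟨w, hw, rfl⟩ := exists_boxVec (Z := 20 * t * R) (t := t) (z := z) (by simpa using hz)
      exact (hor.resolve_left (by omega)) w hw
  · unfold candidateSteps
    have := Nat.mul_le_mul_right ((k * t + 1) * (200 * (4 * t) ^ 2 + 2) + 4) hNle
    omega
  · rintro R' P' c' (hK | ⟨rfl, rfl, rfl⟩) hg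
    · have h1 := hcv R' P' c' hK hg
      refine Nat.le_of_mul_le_mul_right (c := v) ?_ hbest.pos
      calc R' ^ (2 * t) * v' * v = R' ^ (2 * t) * v * v' := by ring
        _ ≤ u * P' ^ 2 * v' := Nat.mul_le_mul_right _ h1
        _ = u * v' * P' ^ 2 := by ring
        _ ≤ u' * v * P' ^ 2 := Nat.mul_le_mul_right _ hle
        _ = _ := by ring
    · exact hcand (hg d hd _ _ _ _ hinv.stretched)

end Specs

end Ram

/-! ### The search, the output and the whole program -/

namespace Ram

open BitMachine QuatLattice Matrix

/-- A bound for the number of steps of the search. -/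
def searchSteps (t k Q N : ℕ) : ℕ :=
  t ^ 4 * (20 * t + 14 + (Q * (Q ^ (2 * t + 4) * (candidateSteps t k N + 2) + 5) + 2)) + 2

section Specs

variable {h E : ℤ} {A t k Q : ℕ} {s : St}

/-- The values that depend on the dimension only. -/
structure FixedVars (t k Q : ℕ) (s : St) : Prop where
  v0 : s.v 0 = t
  v1 : s.v 1 = (4 * t : ℕ)
  v2 : s.v 2 = (4 * k * t : ℕ)
  v3 : s.v 3 = (k * t : ℕ)
  v4 : s.v 4 = Q
  v9 : s.v 9 = (Q ^ (2 * t + 4) : ℕ)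

theorem FixedVars.of_eq {s' : St} (hs : FixedVars t k Q s)
    (h : ∀ x ∈ [0, 1, 2, 3, 4, 9], s'.v x = s.v x) : FixedVars t k Q s' :=
  ⟨by rw [h 0 (by simp), hs.v0], by rw [h 1 (by simp), hs.v1], by rw [h 2 (by simp), hs.v2],
    by rw [h 3 (by simp), hs.v3], by rw [h 4 (by simp), hs.v4], by rw [h 9 (by simp), hs.v9]⟩

theorem wp_setup {C : ℕ} (hC : 1 ≤ C) (hQ : Q = 2 * (C * t ^ 2) ^ t) (H : Sizes t k Q A E h) (h0 : s.v 0 = t) :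
    Wp h A (setupCmd k C) s fun s' m => m ≤ 9 * t + 30 ∧ FixedVars t k Q s' ∧
      Covers t k s' fun _ _ _ => False := by
  have hEh := H.lt_h
  have ht := H.t_pos
  have hdim := H.dim
  have htwo := H.two
  have hlim := H.lim
  have hmod := H.modulus
  have hscale := H.scale
  have hQE : (Q : ℤ) ≤ E := by nlinarith [mul_self_nonneg ((Q : ℤ) - 1)]
  have hq : (C * t ^ 2) ^ t ≤ Q := by omega
  have hbt : ((4 * k * t : ℕ) : ℤ) ≤ E := le_trans (by exact_mod_cast Nat.le_mul_of_pos_right _ (by omega)) hscale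
  push_cast at hdim hbt
  have hk0 : (0 : ℤ) ≤ k * t := by positivity
  refine wp_seq (wp_set ?_ ?_)
  · rw [Expr.eval_mul, Expr.eval_const, Expr.eval_var, h0, abs_of_nonneg (by positivity)]
    linarith
  refine wp_seq (wp_set ?_ ?_)
  · simp only [Expr.eval_mul, Expr.eval_const, Expr.eval_var, St.setv_v, if_neg (show ¬ (0 = 1) by norm_num), h0]
    rw [abs_of_nonneg (by positivity)]
    linarith
  refine wp_seq (wp_set ?_ ?_)
  · simp only [Expr.eval_mul, Expr.eval_const, Expr.eval_var, St.setv_v, if_neg (show ¬ (0 = 1) by norm_num),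
      if_neg (show ¬ (0 = 3) by norm_num), h0]
    rw [abs_of_nonneg (by positivity)]
    push_cast
    linarith
  set s1 := ((s.setv 1 ((Expr.const 4 * Expr.var 0).eval s.v)).setv 3 ((Expr.const k * Expr.var 0).eval
    (s.setv 1 ((Expr.const 4 * Expr.var 0).eval s.v)).v)) with hs1
  have e0 : s1.v 0 = t := by simp [hs1, h0]
  have e1 : s1.v 1 = (4 * t : ℕ) := by simp [hs1, h0]
  have e3 : s1.v 3 = (k * t : ℕ) := by simp [hs1, h0]
  clear_value s1
  refine wp_seq ((wp_pow (h := h) (A := A) (C * t ^ 2) t (by norm_num) (by simp [e0, sq]) (by simp [Expr.vars])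
    (by simp [e0]) (by simp [Expr.vars]) (by linarith) fun j hj => ?_).mono fun s2 m2 f2 ⟨hm2, hv2⟩ => ?_)
  · refine lt_of_le_of_lt (le_trans ?_ hQE) hEh
    refine le_trans ?_ (show (((C * t ^ 2) ^ t : ℕ) : ℤ) ≤ Q by exact_mod_cast hq)
    rw [Nat.cast_pow]
    exact pow_le_pow_right₀ (by exact_mod_cast Nat.mul_pos hC (by positivity)) hj
  have e2 : ∀ x, x ≠ 2 → x ≠ 4 → x ≠ 20 → s2.v x = s1.v x := fun x h1 h2 h3 => by
    rw [f2.v x (by simp [powCmd, Cmd.for_, Cmd.wv, h2, h3]), St.setv_v, if_neg h1]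
  have e22 : s2.v 2 = (4 * k * t : ℕ) := by
    rw [f2.v 2 (by simp [powCmd, Cmd.for_, Cmd.wv])]
    simp [e0]
  have hQv : (Expr.const 2 * Expr.var 4).eval s2.v = Q := by
    rw [hQ]
    simp [hv2]
  refine wp_seq (wp_set ?_ ?_)
  · rw [hQv, abs_of_nonneg (by positivity)]
    linarith
  rw [hQv]
  refine wp_seq ((wp_pow (h := h) (A := A) Q (2 * t + 4) (by norm_num) (by simp) (by simp [Expr.vars])
    (by simp [e2, e0]) (by simp [Expr.vars]) (by push_cast; linarith) fun j hj => ?_).mono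
    fun s3 m3 f3 ⟨hm3, hv3⟩ => ?_)
  · refine lt_of_le_of_lt (le_trans ?_ hlim) hEh
    rw [Nat.cast_pow]
    exact pow_le_pow_right₀ (by exact_mod_cast H.Q_pos) hj
  have g3 : ∀ x, x ≠ 4 → x ≠ 9 → x ≠ 20 → s3.v x = s2.v x := fun x h1 h2 h3 => by
    rw [f3.v x (by simp [powCmd, Cmd.for_, Cmd.wv, h2, h3]), St.setv_v, if_neg h1]
  -- The quotient `0 / 1` means that nothing has been found, and `Best` then asserts nothing about
  -- the matrix.
  refine wp_seq (wp_set (by simp; linarith) (wp_set (by simp; linarith) ⟨by omega, ?_, 0, 1, ?_, by simp⟩))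
  · have g4 : s3.v 4 = Q := by rw [f3.v 4 (by decide)]; simp
    constructor
    · simp [g3, e2, e0]
    · simp [g3, e2, e1]
    · simp [g3, e22]
    · simp [g3, e2, e3]
    · simp [g4]
    · simp [hv3]
  · exact ⟨by simp, by simp, by norm_num, by simp⟩

/-- Composite moduli are tried as well, and for moduli below `Q` the same digit string occurs for
many `c`. Both are harmless: certificates do not depend on the origin of a matrix, and the number of
rounds is bounded in terms of `Q` anyway. -/
theorem wp_search (H : Sizes t k Q A E h) (hf : FixedVars t k Q s) (hcov : Covers t k s fun _ _ _ => False) :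
    Wp h A searchCmd s fun s' m => m ≤ searchSteps t k Q ((2 * (20 * t * t ^ 4) + 1) ^ (4 * t)) ∧
      Covers t k s' fun R P c => R < t ^ 4 ∧ (0 < P ∧ P ≤ Q) ∧ c < Q ^ (2 * t + 4) := by
  have hEh := H.lt_h
  have ht := H.t_pos
  have hdim := H.dim
  have htwo := H.two
  have hlim := H.lim
  have hmod := H.modulus
  have hbox := H.box
  have hQE : (Q : ℤ) ≤ E := by nlinarith [mul_self_nonneg ((Q : ℤ) - 1)]
  have hT : 60 * t * t ^ 4 + 2 ≤ 4 * t * (3 * (20 * t * t ^ 4) + 2) := by nlinarith [Nat.zero_le (t * t ^ 4)]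
  have hTE : ((60 * t * t ^ 4 + 2 : ℕ) : ℤ) ≤ E := le_trans (by exact_mod_cast hT) hbox
  push_cast at hdim hTE
  set N := (2 * (20 * t * t ^ 4) + 1) ^ (4 * t) with hN
  have ht4 : (1 : ℤ) ≤ t := by exact_mod_cast ht
  have hRE : (t : ℤ) ^ 4 ≤ E := by nlinarith [pow_pos (show (0 : ℤ) < t by omega) 4]
  refine wp_for (t ^ 4) (20 * t + 12 + (Q * (Q ^ (2 * t + 4) * (candidateSteps t k N + 2) + 5) + 2))
    (fun i s' => Covers t k s' fun R P c => R < i ∧ (0 < P ∧ P ≤ Q) ∧ c < Q ^ (2 * t + 4)) (by decide)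
    (fun y hy => by simp [Expr.vars] at hy; subst hy; decide) (by simp [hf.v0]; ring)
    (by push_cast; linarith) (hcov.congr (by simp) (by simp) rfl (by simp)) ?_ ?_
  · intro R s1 hR f1 h5 hI
    have hf1 := hf.of_eq (s' := s1) fun x hx => f1.v x (by revert x; decide)
    have hR' : (R : ℤ) < (t : ℤ) ^ 4 := by exact_mod_cast hR
    have htR : (t : ℤ) * R ≤ t * (t : ℤ) ^ 4 := by nlinarith
    refine wp_seq ((wp_pow (h := h) (A := A) R (2 * t) (by norm_num) (by simp [h5]) (by simp [Expr.vars])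
      (by simp [hf1.v0]) (by simp [Expr.vars]) (by push_cast; linarith) fun j hj => ?_).mono
      fun s2 m2 f2 ⟨hm2, h6⟩ => ?_)
    · refine lt_of_le_of_lt (le_trans ?_ H.radius) hEh
      have : R ^ j ≤ (t ^ 4) ^ (2 * t) := (Nat.pow_le_pow_left hR.le _).trans
        (Nat.pow_le_pow_right (by positivity) hj)
      exact_mod_cast this
    have hf2 := hf1.of_eq (s' := s2) fun x hx => f2.v x (by revert x; decide)
    have h5' : s2.v 5 = R := by rw [f2.v 5 (by decide), h5]
    have hZ : (Expr.const 20 * Expr.var 0 * Expr.var 5).eval s2.v = (20 * t * R : ℕ) := by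
      simp [hf2.v0, h5']
    refine wp_seq (wp_set ?_ ?_)
    · rw [hZ, abs_of_nonneg (by positivity)]
      push_cast
      nlinarith
    rw [hZ]
    have hW : (Expr.const 2 * Expr.var 13 + Expr.const 1).eval (s2.setv 13 (20 * t * R : ℕ)).v =
        (2 * (20 * t * R) + 1 : ℕ) := by
      simp
    refine wp_seq (wp_set ?_ ?_)
    · rw [hW, abs_of_nonneg (by positivity)]
      push_cast
      nlinarith
    rw [hW]
    set s3 := (s2.setv 13 (20 * t * R : ℕ)).setv 14 (2 * (20 * t * R) + 1 : ℕ) with hs3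
    have hf3 : FixedVars t k Q s3 := hf2.of_eq fun x hx => by
      rw [hs3, St.setv_v, if_neg (by revert x; decide), St.setv_v, if_neg (by revert x; decide)]
    have h13 : s3.v 13 = (20 * t * R : ℕ) := by simp [hs3]
    have h14 : s3.v 14 = (2 * (20 * t * R) + 1 : ℕ) := by simp [hs3]
    have h6' : s3.v 6 = (R ^ (2 * t) : ℕ) := by simp [hs3, h6]
    have h53 : s3.v 5 = R := by simp [hs3, h5']
    have hI3 : Covers t k s3 fun R' P c => R' < R ∧ (0 < P ∧ P ≤ Q) ∧ c < Q ^ (2 * t + 4) := by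
      refine hI.congr ?_ ?_ ?_ fun _ _ _ h => h
      · simp [hs3, f2.v 29 (by decide)]
      · simp [hs3, f2.v 30 (by decide)]
      · simp [hs3, f2.a 3 (by decide)]
    clear_value s3
    refine wp_seq ((wp_pow (h := h) (A := A) (2 * (20 * t * R) + 1) (4 * t) (by norm_num) (by simp [h14])
      (by simp [Expr.vars]) (by simp [hf3.v1]) (by simp [Expr.vars]) (by push_cast; linarith) fun j hj => ?_).mono
      fun s4 m4 f4 ⟨hm4, h15⟩ => ?_)
    · refine lt_of_le_of_lt (le_trans ?_ H.card) hEh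
      have : (2 * (20 * t * R) + 1) ^ j ≤ (2 * (20 * t * t ^ 4) + 1) ^ (4 * t) := by
        refine (Nat.pow_le_pow_left ?_ _).trans (Nat.pow_le_pow_right (by positivity) hj)
        have := Nat.mul_le_mul_left (20 * t) hR.le
        omega
      exact_mod_cast this
    have hf4 := hf3.of_eq (s' := s4) fun x hx => f4.v x (by revert x; decide)
    have k6 : s4.v 6 = (R ^ (2 * t) : ℕ) := by rw [f4.v 6 (by decide), h6']
    have k13 : s4.v 13 = (20 * t * R : ℕ) := by rw [f4.v 13 (by decide), h13]
    have k14 : s4.v 14 = (2 * (20 * t * R) + 1 : ℕ) := by rw [f4.v 14 (by decide), h14]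
    have k5 : s4.v 5 = R := by rw [f4.v 5 (by decide), h53]
    have k15 : s4.v 15 = ((2 * (20 * t * R) + 1) ^ (4 * t) : ℕ) := by rw [h15, Nat.cast_pow]
    have hI4 := hI3.congr (s' := s4) (f4.v 29 (by decide)) (f4.v 30 (by decide)) (f4.a 3 (by decide))
      fun _ _ _ h => h
    refine wp_for Q (Q ^ (2 * t + 4) * (candidateSteps t k N + 2) + 3) (fun i s' => Covers t k s' fun R' P c =>
        (R' < R ∧ (0 < P ∧ P ≤ Q) ∧ c < Q ^ (2 * t + 4)) ∨ (R' = R ∧ (0 < P ∧ P ≤ i) ∧ c < Q ^ (2 * t + 4)))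
      (by decide) (fun y hy => by simp [Expr.vars] at hy; subst hy; decide) (by simp [hf4.v4])
      (by linarith) (hI4.congr (by simp) (by simp) rfl fun R' P c h => ?_) ?_ ?_
    · rcases h with h | h
      exacts [h, by omega]
    · intro p s5 hp f5 h7 hJ
      have hf5 := hf4.of_eq (s' := s5) fun x hx => f5.v x (by revert x; decide)
      have hPv : (Expr.var 7 + Expr.const 1).eval s5.v = (p + 1 : ℕ) := by simp [h7]
      have hpQ : (p : ℤ) + 1 ≤ Q := by exact_mod_cast hp
      refine wp_seq (wp_set (by rw [hPv, abs_of_nonneg (by positivity)]; push_cast; linarith) ?_)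
      rw [hPv]
      have hf6 : FixedVars t k Q (s5.setv 8 (p + 1 : ℕ)) := hf5.of_eq fun x hx => by
        rw [St.setv_v, if_neg (by revert x; decide)]
      refine wp_for (Q ^ (2 * t + 4)) (candidateSteps t k N) (fun i s' => Covers t k s' fun R' P c =>
          ((R' < R ∧ (0 < P ∧ P ≤ Q) ∧ c < Q ^ (2 * t + 4)) ∨
            (R' = R ∧ (0 < P ∧ P ≤ p) ∧ c < Q ^ (2 * t + 4))) ∨ (R' = R ∧ P = p + 1 ∧ c < i))
        (by decide) (fun y hy => by simp [Expr.vars] at hy; subst hy; decide) (by simp [hf5.v9])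
        (by linarith) (hJ.congr (by simp) (by simp) rfl fun R' P c h => ?_) ?_ ?_
      · rcases h with h | h
        exacts [h, by omega]
      · intro c s7 hc f7 h10 hL
        have hf7 := hf6.of_eq (s' := s7) fun x hx => f7.v x (by revert x; decide)
        have a7 : ∀ x ∈ [5, 6, 13, 14, 15], s7.v x = s4.v x := fun x hx => by
          rw [f7.v x (by revert x; decide), St.setv_v, if_neg (by revert x; decide),
            f5.v x (by revert x; decide)]
        refine (wp_candidate (K := fun R' P c' => ((R' < R ∧ (0 < P ∧ P ≤ Q) ∧ c' < Q ^ (2 * t + 4)) ∨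
            (R' = R ∧ (0 < P ∧ P ≤ p) ∧ c' < Q ^ (2 * t + 4))) ∨ (R' = R ∧ P = p + 1 ∧ c' < c)) H
          ⟨hf7.v0, hf7.v1, hf7.v2, hf7.v3, by rw [a7 5 (by simp), k5], by rw [a7 13 (by simp), k13],
            by rw [a7 14 (by simp), k14]⟩ (by rw [a7 6 (by simp), k6])
          (P := p + 1) (by rw [f7.v 8 (by decide)]; simp) h10 (by rw [a7 15 (by simp), k15]) hR (by omega) hp hc
          hL).mono fun s8 m8 _ ⟨hm8, hcv⟩ => ⟨hm8, hcv.congr (by simp) (by simp) rfl fun R' P' c' h => ?_⟩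
        rcases h with h | ⟨h1, h2, h3⟩
        · exact Or.inl (Or.inl h)
        · rcases Nat.lt_succ_iff_lt_or_eq.1 h3 with h3 | h3
          exacts [Or.inl (Or.inr ⟨h1, h2, h3⟩), Or.inr ⟨h1, h2, h3⟩]
      · intro s7 m7 _ hm7 hL
        refine ⟨by omega, hL.congr (by simp) (by simp) rfl fun R' P' c' h => ?_⟩
        rcases h with h | ⟨h1, ⟨h2, h3⟩, h4⟩
        · exact Or.inl (Or.inl h)
        · rcases Nat.le_succ_iff.1 h3 with h3 | h3
          exacts [Or.inl (Or.inr ⟨h1, ⟨h2, h3⟩, h4⟩), Or.inr ⟨h1, h3, h4⟩]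
    · intro s5 m5 _ hm5 hJ
      have hm5' : m5 ≤ Q * (Q ^ (2 * t + 4) * (candidateSteps t k N + 2) + 5) + 2 := hm5
      refine ⟨by omega, hJ.congr (by simp) (by simp) rfl fun R' P' c' ⟨h1, h2, h3⟩ => ?_⟩
      rcases Nat.lt_succ_iff_lt_or_eq.1 h1 with h1 | h1
      exacts [Or.inl ⟨h1, h2, h3⟩, Or.inr ⟨h1, h2, h3⟩]
  · intro s1 m1 _ hm1 hI
    exact ⟨hm1.trans (le_of_eq (by rw [searchSteps]; ring)), hI⟩

theorem ofFn_flatten_eq {n : ℕ} (f : ℕ → ℤ) :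
    (List.ofFn fun i : Fin n => List.ofFn fun j : Fin n => f (i * n + j)).flatten =
      (List.range (n * n)).map f := by
  refine (List.ofFn_mul fun x : Fin (n * n) => f x).symm.trans (List.ext_getElem (by simp) fun i h₁ h₂ => ?_)
  simp

theorem wp_output (hf : s.v 1 = (4 * t : ℕ)) (hA : 4 * t * (4 * t) ≤ A) (hh : ((4 * t * (4 * t) : ℕ) : ℤ) < h)
    (ho : s.out = []) :
    Wp h A outputCmd s fun s' m => m ≤ 4 * (4 * t * (4 * t)) + 2 ∧
      s'.out = matrixEntries (matOf t (s.a 3)) := by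
  refine wp_for (4 * t * (4 * t)) 2 (fun i s' => s'.out = (List.range i).map (s.a 3)) (by decide)
    (fun y hy => by simp [Expr.vars] at hy; subst hy; decide) (by simp [hf]) hh (by simpa using ho) ?_ ?_
  · intro i s1 hi f1 h20 hI
    refine wp_seq (wp_load i (by simp [h20]) (by omega) (wp_emit ⟨by norm_num, ?_⟩))
    simp [hI, List.range_succ, f1.a 3 (by decide)]
  · intro s1 m1 _ hm1 hI
    refine ⟨by omega, ?_⟩
    rw [hI, ← ofFn_flatten_eq]
    rfl

/-- A bound for the number of steps of the program. -/
def latticeSteps (t k Q : ℕ) : ℕ :=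
  9 * t + 32 + searchSteps t k Q ((2 * (20 * t * t ^ 4) + 1) ^ (4 * t)) + 4 * (4 * t * (4 * t))

theorem wp_lattice {C : ℕ} (hC : 1 ≤ C) (hQ : Q = 2 * (C * t ^ 2) ^ t) (H : Sizes t k Q A E h) (h0 : s.v 0 = t)
    (ho : s.out = []) :
    Wp h A (latticeCmd k C) s fun s' m => m ≤ latticeSteps t k Q ∧
      ∃ (B : Matrix (Fin (4 * t)) (Fin (4 * t)) ℤ) (u v : ℕ), s'.out = matrixEntries B ∧ 0 < v ∧
        (u ≠ 0 → B.det ≠ 0 ∧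
          unitBall t * u / (2 ^ (4 * t) * Real.exp 1 * 2 ^ t * v) ≤ packingDensity (rowLattice B)) ∧
        ∀ R P c, R < t ^ 4 → 0 < P → P ≤ Q → c < Q ^ (2 * t + 4) → Good t k R P c →
          R ^ (2 * t) * v ≤ u * P ^ 2 := by
  refine wp_seq ((wp_setup hC hQ H h0).mono fun s1 m1 f1 ⟨hm1, hf1, hc1⟩ => ?_)
  refine wp_seq ((wp_search H hf1 hc1).mono fun s2 m2 f2 ⟨hm2, u, v, hb, hc2⟩ => ?_)
  refine (wp_output (t := t) (by rw [f2.v 1 (by decide), hf1.v1]) H.addr ?_ ?_).mono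
    fun s3 m3 _ ⟨hm3, ho3⟩ => ⟨?_, _, u, v, ho3, hb.pos, hb.dens, fun R P c h1 h2 h3 h4 => hc2 R P c ⟨h1, ⟨h2, h3⟩, h4⟩⟩
  · refine lt_of_le_of_lt (le_trans ?_ H.scale) H.lt_h
    have := Nat.mul_le_mul_right (4 * t) (show 4 * t ≤ 4 * k * t from
      Nat.mul_le_mul_right t (by have := H.k_pos; omega))
    exact_mod_cast this
  · rw [f2.out (by decide), f1.out rfl, ho]
  · rw [latticeSteps]
    omega

end Specs

end Ram

/-! ### Computing the base of the packing, and transfer to the bit machine -/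

namespace Ram

open BitMachine

/-- The configuration in which only the input, a counter, and the base have been set. -/
def towerConfig (t m : ℕ) (z : ℤ) : Config :=
  ⟨fun x => if x = 0 then (t : ℤ) else if x = 5 then (m : ℤ) else if x = 8 then z else 0, []⟩

/-- Square the base as often as the counter says. -/
def squareProg : Prog :=
  .loop (.var 5) (.seq (.assign 8 (.var 8 * .var 8)) (.assign 5 (.var 5 - .const 1)))

/-- Set the base to `2 ^ 2 ^ (K * t)`. -/
def towerProg (K : ℕ) : Prog :=
  .seq (.assign 8 (.const 2)) (.seq (.assign 5 (.const K * .var 0)) squareProg)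

theorem towerConfig_update_base (t m : ℕ) (z z' : ℤ) :
    (⟨Function.update (towerConfig t m z).val 8 z', (towerConfig t m z).out⟩ : Config) = towerConfig t m z' := by
  unfold towerConfig
  congr 1
  funext x
  simp only [Function.update_apply]
  split_ifs <;> simp_all

theorem towerConfig_update_counter (t m m' : ℕ) (z : ℤ) :
    (⟨Function.update (towerConfig t m z).val 5 m', (towerConfig t m z).out⟩ : Config) = towerConfig t m' z := by
  unfold towerConfig
  congr 1
  funext x
  simp only [Function.update_apply]
  split_ifs <;> simp_all

theorem bits_towerConfig_le {t m β : ℕ} {z : ℤ} (ht : bits t ≤ β) (hm : bits m ≤ β) (hz : bits z ≤ β) (x : ℕ) :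
    bits ((towerConfig t m z).val x) ≤ β := by
  simp only [towerConfig]
  split_ifs
  exacts [ht, hm, hz, (show bits 0 = 1 from rfl) ▸ (one_le_bits z).trans hz]

theorem squareProg_run {t L β : ℕ} (ht : bits t ≤ β) (hL : bits L ≤ β) (hβ : bits (2 ^ 2 ^ L) ≤ β) (m : ℕ) :
    ∀ i, i + m = L → ∃ n, Run squareProg (towerConfig t m (2 ^ 2 ^ i)) (towerConfig t 0 (2 ^ 2 ^ L)) n ∧
      n ≤ (m + 1) * (100 * β ^ 2) := by
  have hβ1 : 1 ≤ β := (one_le_bits _).trans ht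
  have hββ : β ≤ β ^ 2 := Nat.le_self_pow (by norm_num) _
  have hm : ∀ m ≤ L, bits (m : ℤ) ≤ β := fun m hm => (bits_mono (by simpa using hm)).trans hL
  have hi : ∀ i ≤ L, bits (2 ^ 2 ^ i) ≤ β := fun i hi => (bits_mono (by
    rw [abs_of_pos (by positivity), abs_of_pos (by positivity)]
    exact pow_le_pow_right₀ (by norm_num) (Nat.pow_le_pow_right (by norm_num) hi))).trans hβ
  induction m with
  | zero =>
    intro i hiL
    obtain rfl : i = L := by omega
    refine ⟨_, Run.loop_stop _ (by simp [towerConfig]), ?_⟩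
    have := bits_towerConfig_le ht (hm 0 (by omega)) hβ 5
    simp only [Expr.cost]
    linarith
  | succ m ih =>
    intro i hiL
    obtain ⟨n, hrun, hn⟩ := ih (i + 1) (by omega)
    have b1 := bits_towerConfig_le ht (hm (m + 1) (by omega)) (hi i (by omega))
    have b2 := bits_towerConfig_le ht (hm (m + 1) (by omega)) (hi (i + 1) (by omega))
    have c1 := assign_cost_le hβ1 b1 (.var 8 * .var 8)
    have c2 := assign_cost_le hβ1 b2 (.var 5 - .const 1)
    have r1 := Run.assign 8 (.var 8 * .var 8) (towerConfig t (m + 1) (2 ^ 2 ^ i))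
    have r2 := Run.assign 5 (.var 5 - .const 1) (towerConfig t (m + 1) (2 ^ 2 ^ (i + 1)))
    have e1 : (Expr.var 8 * Expr.var 8).eval (towerConfig t (m + 1) (2 ^ 2 ^ i)).val = 2 ^ 2 ^ (i + 1) := by
      simp only [Expr.eval_mul, Expr.eval_var, towerConfig]
      norm_num
      rw [← pow_add, pow_succ]
      ring_nf
    have e2 : (Expr.var 5 - Expr.const 1).eval (towerConfig t (m + 1) (2 ^ 2 ^ (i + 1))).val = (m : ℕ) := by
      simp [towerConfig]
    rw [e1] at r1 c1
    rw [e2] at r2 c2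
    rw [towerConfig_update_base] at r1
    rw [towerConfig_update_counter] at r2
    refine ⟨_, Run.loop_step (by simp [towerConfig]) (Run.seq r1 r2) hrun, ?_⟩
    have w1 : (Expr.var 8 * Expr.var 8).wt = 2 := rfl
    have w2 : (Expr.var 5 - Expr.const 1).wt = 3 := by decide
    rw [w1] at c1
    rw [w2] at c2
    have c3 := b1 5
    simp only [Expr.cost] at c1 c2 ⊢
    nlinarith

theorem towerProg_run {K t β : ℕ} (ht : bits t ≤ β) (hL : bits (K * t : ℕ) ≤ β) (hβ : bits (2 ^ 2 ^ (K * t)) ≤ β) :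
    ∃ n, Run (towerProg K) (init t) (towerConfig t 0 (2 ^ 2 ^ (K * t))) n ∧
      n ≤ (K * t + 1) * ((200 + 2 * (bits K + 1) ^ 3) * β ^ 2) := by
  have hβ1 : 1 ≤ β := (one_le_bits _).trans ht
  obtain ⟨n, hrun, hn⟩ := squareProg_run (t := t) ht hL hβ (K * t) 0 (by omega)
  have e0 : init t = towerConfig t 0 0 := by
    unfold init towerConfig
    congr 1
    funext x
    simp [Function.update_apply]
  have hz : ∀ b : ℤ, |b| ≤ 2 → bits b ≤ β := fun b hb => (bits_mono (hb.trans (by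
    rw [abs_of_pos (by positivity)]
    exact le_self_pow₀ (by norm_num) (by positivity)))).trans hβ
  have b1 := bits_towerConfig_le ht (hz (0 : ℕ) (by simp)) (hz 0 (by simp))
  have b2 := bits_towerConfig_le ht (hz (0 : ℕ) (by simp)) (hz 2 (by simp))
  have c1 := assign_cost_le hβ1 b1 (.const 2)
  have c2 := assign_cost_le hβ1 b2 (.const K * .var 0)
  have r1 := Run.assign 8 (.const 2) (towerConfig t 0 0)
  have r2 := Run.assign 5 (.const K * .var 0) (towerConfig t 0 2)
  have e2 : (Expr.const K * Expr.var 0).eval (towerConfig t 0 2).val = (K * t : ℕ) := by simp [towerConfig]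
  rw [Expr.eval_const] at r1 c1
  rw [e2] at r2 c2
  rw [towerConfig_update_base] at r1
  rw [towerConfig_update_counter] at r2
  rw [e0]
  have hrun' : Run squareProg (towerConfig t (K * t) 2) (towerConfig t 0 (2 ^ 2 ^ (K * t))) n := by
    simpa using hrun
  refine ⟨_, Run.seq r1 (Run.seq r2 hrun'), ?_⟩
  have w1 : (Expr.const 2).wt = 3 := by decide
  have w2 : (Expr.const K * Expr.var 0).wt = bits K + 1 := rfl
  rw [w1] at c1
  rw [w2] at c2
  set w := 2 * (bits K + 1) ^ 3
  have h1 : (K * t + 1) * ((200 + w) * β ^ 2) = (K * t + 1) * (100 * β ^ 2) + (100 * β ^ 2 + w * β ^ 2) +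
      K * t * (100 * β ^ 2 + w * β ^ 2) := by ring
  rw [h1]
  have h2 : 0 ≤ K * t * (100 * β ^ 2 + w * β ^ 2) := Nat.zero_le _
  linarith

/-- A program for a random access machine, preceded by the computation of the base. -/
theorem outputs_of_wp {K t A : ℕ} {p : Cmd} {n : ℕ} {l : List ℤ} (hA : 1 ≤ A) (hAt : A ≤ 2 ^ 2 ^ (K * t))
    (htK : t < 2 ^ 2 ^ (K * t)) (hKt : K * t < 2 ^ 2 ^ (K * t))
    (H : Wp (2 ^ 2 ^ (K * t)) A p ⟨fun x => if x = 0 then (t : ℤ) else 0, fun _ _ => 0, []⟩ fun s' m =>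
      m ≤ n ∧ s'.out = l) :
    ∃ m, Outputs (.seq (towerProg K) p.compile) t l m ∧
      m ≤ (p.fac + 200 + 2 * (bits K + 1) ^ 3) * (n + K * t + 1) * (A + 1) * ((2 ^ (K * t) + 1) * A + 2) ^ 2 := by
  set h : ℤ := 2 ^ 2 ^ (K * t) with hh
  set β := (2 ^ (K * t) + 1) * A + 2 with hβdef
  set s : St := ⟨fun x => if x = 0 then (t : ℤ) else 0, fun _ _ => 0, []⟩ with hs
  have h0 : 0 < h := by positivity
  -- `(2 * h) ^ A` is the power of two with exponent `(2 ^ (K * t) + 1) * A`. Its leading digit and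
  -- the sign add two bits.
  have hβ : bits ((2 * h) ^ A) ≤ β := by
    rw [hβdef, bits_le_succ_iff, hh, ← pow_succ', ← pow_mul, Int.natAbs_pow]
    exact Nat.pow_lt_pow_right (by norm_num) (by omega)
  have hhA : h < (2 * h) ^ A := lt_of_lt_of_le (by omega) (le_self_pow₀ (by omega) (by omega))
  have hbits : ∀ b : ℤ, |b| ≤ h → bits b ≤ β := fun b hb => (bits_mono (by
    rw [abs_of_pos (pow_pos (show 0 < 2 * h by omega) A)]
    omega)).trans hβ
  have hth : (t : ℤ) < h := by
    rw [hh]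
    exact_mod_cast htK
  have hKh : ((K * t : ℕ) : ℤ) < h := by
    rw [hh]
    exact_mod_cast hKt
  have hAh : (A : ℤ) ≤ h := by
    rw [hh]
    exact_mod_cast hAt
  obtain ⟨n₁, hrun₁, hn₁⟩ := towerProg_run (K := K) (t := t) (β := β) (hbits _ (by simpa using hth.le))
    (hbits _ (by rw [abs_of_nonneg (by positivity)]; exact hKh.le)) (hbits _ (by rw [abs_of_pos h0]))
  have hbdd : Bdd h s := ⟨fun x => by
    simp only [hs]
    split_ifs
    · simpa using hth
    · simpa using h0, fun b i => by simpa [hs] using h0⟩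
  have hrep : Rep h A s (towerConfig t 0 h) := by
    have hp : (0 : ℤ) ≤ (2 * h) ^ A := by positivity
    refine ⟨fun x => ?_, fun b => ?_, by simp [towerConfig], rfl, by simpa [towerConfig] using hp,
      by simpa [towerConfig] using hp, fun x => ?_⟩
    · simp only [towerConfig, scal, hs]
      split_ifs <;> first | rfl | omega
    · simp only [towerConfig, arr, hs, pack]
      rw [if_neg (by omega), if_neg (by omega), if_neg (by omega)]
      simp
    · simp only [towerConfig]
      rw [if_neg (by omega)]
      split_ifs
      · simpa using hp
      · rw [abs_of_pos h0]
        exact hhA.le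
      · simpa using hp
  obtain ⟨s', m, hex, hm, hout⟩ := H
  obtain ⟨c', m', hrun₂, hm', hrep'⟩ := hex.simulate hA (hAh.trans hhA.le) hβ hbdd _ hrep
  refine ⟨_, ⟨c', Run.seq hrun₁ hrun₂, by rw [hrep'.out, hout]⟩, ?_⟩
  set w := 2 * (bits K + 1) ^ 3
  calc n₁ + m' ≤ (K * t + 1) * ((200 + w) * β ^ 2) + m * (p.fac * ((A + 1) * β ^ 2)) := add_le_add hn₁ hm'
    _ ≤ (n + K * t + 1) * ((p.fac + 200 + w) * ((A + 1) * β ^ 2)) +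
        0 := ?_
    _ = _ := by ring
  have e1 : (K * t + 1) * ((200 + w) * β ^ 2) ≤ (K * t + 1) * ((p.fac + 200 + w) * ((A + 1) * β ^ 2)) :=
    Nat.mul_le_mul_left _ (Nat.mul_le_mul (by omega) (Nat.le_mul_of_pos_left _ (by omega)))
  have e2 : m * (p.fac * ((A + 1) * β ^ 2)) ≤ n * ((p.fac + 200 + w) * ((A + 1) * β ^ 2)) :=
    Nat.mul_le_mul hm (Nat.mul_le_mul_right _ (by omega))
  linarith

end Ram

/-! ### Growth of the sizes and of the running time -/

namespace Ram

/-- Growth at most like a power. -/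
def PolyBound (f : ℕ → ℕ) : Prop := ∃ d, ∀ t, 2 ≤ t → f t ≤ t ^ d

namespace PolyBound

theorem const (c : ℕ) : PolyBound fun _ => c :=
  ⟨c, fun _ ht => Nat.lt_two_pow_self.le.trans (Nat.pow_le_pow_left ht c)⟩

theorem id : PolyBound fun t => t := ⟨1, fun _ _ => by simp⟩

theorem mul {f g : ℕ → ℕ} (hf : PolyBound f) (hg : PolyBound g) : PolyBound fun t => f t * g t := by
  obtain ⟨a, ha⟩ := hf
  obtain ⟨b, hb⟩ := hg
  exact ⟨a + b, fun t ht => by rw [pow_add]; exact Nat.mul_le_mul (ha t ht) (hb t ht)⟩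

theorem add {f g : ℕ → ℕ} (hf : PolyBound f) (hg : PolyBound g) : PolyBound fun t => f t + g t := by
  obtain ⟨a, ha⟩ := hf
  obtain ⟨b, hb⟩ := hg
  refine ⟨max a b + 1, fun t ht => ?_⟩
  have h1 := (ha t ht).trans (Nat.pow_le_pow_right (by omega) (le_max_left a b))
  have h2 := (hb t ht).trans (Nat.pow_le_pow_right (by omega) (le_max_right a b))
  rw [pow_succ]
  nlinarith

theorem pow {f : ℕ → ℕ} (hf : PolyBound f) (n : ℕ) : PolyBound fun t => f t ^ n := by
  obtain ⟨a, ha⟩ := hf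
  exact ⟨a * n, fun t ht => by rw [pow_mul]; exact Nat.pow_le_pow_left (ha t ht) n⟩

theorem eventually_le {f : ℕ → ℕ} (hf : PolyBound f) : ∀ᶠ t in atTop, f t < 2 ^ t := by
  obtain ⟨d, hd⟩ := hf
  have h := (tendsto_pow_const_div_const_pow_of_one_lt d (r := 2) (by norm_num)).eventually_lt_const
    (show (0 : ℝ) < 1 by norm_num)
  filter_upwards [h, eventually_ge_atTop 2] with t ht h2
  rw [div_lt_one (by positivity)] at ht
  exact (hd t h2).trans_lt (by exact_mod_cast ht)

end PolyBound

/-- The three factors are the number of pairs of a modulus and a candidate, the number of vectors in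
the largest box, and a polynomial for all the rest. -/
theorem latticeSteps_le {t k Q : ℕ} (hQ : 1 ≤ Q) : latticeSteps t k Q ≤
    Q ^ (2 * t + 5) * (2 * (20 * t * t ^ 4) + 1) ^ (4 * t) * (9 * t + 34 + 64 * t ^ 2 +
      t ^ 4 * (20 * t + 40 + (800 * t ^ 2 + (k * t + 1) * (3200 * t ^ 2 + 2)))) := by
  unfold latticeSteps searchSteps candidateSteps
  set N := (2 * (20 * t * t ^ 4) + 1) ^ (4 * t) with hN
  have hN1 : 1 ≤ N := Nat.one_le_pow _ _ (by omega)
  set P := Q ^ (2 * t + 4) with hP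
  have hP1 : 1 ≤ P := Nat.one_le_pow _ _ (by omega)
  have hG : Q ^ (2 * t + 5) = Q * P := by rw [hP, ← pow_succ']
  rw [hG]
  set q := (k * t + 1) * (200 * (4 * t) ^ 2 + 2) with hq
  have hq' : (k * t + 1) * (3200 * t ^ 2 + 2) = q := by rw [hq]; ring
  rw [hq']
  have hQP : Q ≤ Q * P := Nat.le_mul_of_pos_right _ hP1
  have hQPN : Q * P ≤ Q * P * N := Nat.le_mul_of_pos_right _ hN1
  set G := Q * P * N with hGdef
  have hG1 : 1 ≤ G := by linarith
  have h1 : Q * (P * (50 * (4 * t) ^ 2 + N * (q + 4) + 10 + 2) + 5) ≤ G * (800 * t ^ 2 + q + 21) := by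
    have e : Q * (P * (50 * (4 * t) ^ 2 + N * (q + 4) + 10 + 2) + 5) =
      Q * P * (800 * t ^ 2 + 12) + G * (q + 4) + 5 * Q := by rw [hGdef]; ring
    have := Nat.mul_le_mul_right (800 * t ^ 2 + 12) hQPN
    rw [e]
    nlinarith
  have h2 : t ^ 4 * (20 * t + 14 + (Q * (P * (50 * (4 * t) ^ 2 + N * (q + 4) + 10 + 2) + 5) + 2)) ≤
      t ^ 4 * (G * (20 * t + 40 + (800 * t ^ 2 + q))) := by
    refine Nat.mul_le_mul_left _ ?_
    have := Nat.mul_le_mul_right (20 * t + 16) hG1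
    nlinarith
  have h3 := Nat.mul_le_mul_right (9 * t + 34 + 64 * t ^ 2) hG1
  nlinarith

/-- The number of addresses that the program uses. -/
def addresses (t : ℕ) : ℕ := 16 * t ^ 2 + 2 * t + 8

/-- The largest of the initial quantities, `Q ^ (2 * t + 4)` and the like, have bit lengths of
degree at most 3 in `t`, so `E = 2 ^ t ^ 4` dominates them. After `k * t + 2` steps of the tower the
exponent of two is `t ^ 4 * 32 ^ (k * t + 2) = t ^ 4 * 2 ^ 10 * 2 ^ (5 * k * t)`. The additional `2
^ t` in `2 ^ ((5 * k + 1) * t)` pays for `t ^ 4 * 2 ^ 10`. -/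
theorem eventually_sizes {k C : ℕ} (hk : 1 ≤ k) (hC : 1 ≤ C) : ∀ᶠ t : ℕ in atTop,
    Sizes t k (2 * (C * t ^ 2) ^ t) (addresses t) (2 ^ t ^ 4) (2 ^ 2 ^ ((5 * k + 1) * t)) := by
  have p1 : PolyBound fun t => 2 * (2 * t + 4) + 4 * t * (3 * (20 * t * t ^ 4) + 2) + 4 * k * t * (4 * t) +
      (2 * (20 * t * t ^ 4) + 1) + t ^ 4 + C * t ^ 2 + t ^ 4 * 2 ^ 10 := by
    repeat
      with_reducible first
        | apply PolyBound.add
        | apply PolyBound.mul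
        | apply PolyBound.pow
        | exact PolyBound.id
        | exact PolyBound.const _
  filter_upwards [p1.eventually_le, eventually_ge_atTop 4] with t ht ht4
  have b1 : 2 * (2 * t + 4) < 2 ^ t := by omega
  have b2 : 4 * t * (3 * (20 * t * t ^ 4) + 2) < 2 ^ t := by omega
  have b3 : 4 * k * t * (4 * t) < 2 ^ t := by omega
  have b4 : 2 * (20 * t * t ^ 4) + 1 < 2 ^ t := by omega
  have b5 : t ^ 4 < 2 ^ t := by omega
  have b6 : C * t ^ 2 < 2 ^ t := by omega
  have b7 : t ^ 4 * 2 ^ 10 < 2 ^ t := by omega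
  clear ht
  have hE : ∀ {x a : ℕ}, x ≤ 2 ^ a → a ≤ t ^ 4 → ((x : ℕ) : ℤ) ≤ 2 ^ t ^ 4 := fun hx ha => by
    exact_mod_cast hx.trans (Nat.pow_le_pow_right (by norm_num) ha)
  have t4 : t ≤ t ^ 4 := Nat.le_self_pow (by norm_num) t
  have tt : t * (4 * t) ≤ t ^ 4 := by nlinarith [Nat.pow_le_pow_left ht4 2]
  have hq : (C * t ^ 2) ^ t ≤ 2 ^ (t * t) := by
    rw [pow_mul]
    exact Nat.pow_le_pow_left b6.le t
  have hQ : 2 * (C * t ^ 2) ^ t ≤ 2 ^ (t * t + 1) := by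
    rw [pow_succ' 2]
    exact Nat.mul_le_mul_left 2 hq
  refine ⟨by omega, hk, ?_, ?_, ?_, ?_, hE b1.le t4, hE b2.le t4, ?_, hE b3.le t4, ?_, ?_, ?_, ?_⟩
  · have : 0 < (C * t ^ 2) ^ t := by positivity
    omega
  · unfold addresses
    nlinarith
  · unfold addresses
    nlinarith
  · exact le_self_pow₀ (by norm_num) (by positivity)
  · refine hE (a := t * (4 * t)) ?_ tt
    rw [pow_mul 2]
    exact Nat.pow_le_pow_left b4.le _
  · refine hE (a := (t * t + 1) * (2 * t + 4)) ?_ ?_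
    · rw [pow_mul]
      exact Nat.pow_le_pow_left hQ _
    · nlinarith [Nat.pow_le_pow_left ht4 2, Nat.pow_le_pow_left ht4 3]
  · have : 4 * (2 * (C * t ^ 2) ^ t) * (2 * (C * t ^ 2) ^ t) + 4 ≤ 2 ^ (2 * (t * t + 1) + 3) := by
      have e : 2 ^ (2 * (t * t + 1) + 3) = 8 * (2 ^ (t * t + 1) * 2 ^ (t * t + 1)) := by ring
      have h1 := Nat.mul_le_mul hQ hQ
      have h2 : 1 ≤ 2 ^ (t * t + 1) * 2 ^ (t * t + 1) := Nat.mul_pos (by positivity) (by positivity)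
      rw [e]
      nlinarith
    exact_mod_cast hE this (by nlinarith [Nat.pow_le_pow_left ht4 2])
  · refine hE (a := t * (2 * t)) ?_ (by nlinarith)
    rw [pow_mul 2]
    exact Nat.pow_le_pow_left b5.le _
  · rw [← pow_mul]
    refine pow_lt_pow_right₀ (by norm_num) ?_
    have e1 : (32 : ℕ) ^ (k * t + 2) = 2 ^ 10 * 2 ^ (5 * k * t) := by
      rw [show 32 = 2 ^ 5 by norm_num, ← pow_mul, ← pow_add]
      congr 1
      ring
    have e2 : 2 ^ ((5 * k + 1) * t) = 2 ^ t * 2 ^ (5 * k * t) := by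
      rw [← pow_add]
      congr 1
      ring
    rw [e1, e2, ← mul_assoc]
    exact Nat.mul_lt_mul_of_pos_right b7 (by positivity)

/-- The number of bit operations of the program is bounded by the leading term and a power with exponent
`t ^ 2`. -/
theorem eventually_cost_le (k K C w : ℕ) (hC : 1 ≤ C) : ∃ G : ℕ, 1 ≤ G ∧ ∀ᶠ t : ℕ in atTop,
    w * (latticeSteps t k (2 * (C * t ^ 2) ^ t) + K * t + 1) * (addresses t + 1) *
      ((2 ^ (K * t) + 1) * addresses t + 2) ^ 2 ≤ t ^ (4 * t ^ 2) * G ^ t ^ 2 := by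
  refine ⟨(2 * C) ^ 7 * 2 ^ (15 + 2 * K), Nat.mul_pos (by positivity) (by positivity), ?_⟩
  have p1 : PolyBound fun t => w * ((9 * t + 34 + 64 * t ^ 2 +
      t ^ 4 * (20 * t + 40 + (800 * t ^ 2 + (k * t + 1) * (3200 * t ^ 2 + 2)))) + K * t + 1) *
      ((16 * t ^ 2 + 2 * t + 8) + 1) * (2 * (16 * t ^ 2 + 2 * t + 8) + 2) ^ 2 := by
    repeat
      with_reducible first
        | apply PolyBound.add
        | apply PolyBound.mul
        | apply PolyBound.pow
        | exact PolyBound.id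
        | exact PolyBound.const _
  have p2 : PolyBound fun t => 2 * (20 * t * t ^ 4) + 1 := by
    repeat
      with_reducible first
        | apply PolyBound.add
        | apply PolyBound.mul
        | apply PolyBound.pow
        | exact PolyBound.id
        | exact PolyBound.const _
  filter_upwards [p1.eventually_le, p2.eventually_le, eventually_ge_atTop 1] with t h1 h2 ht
  set a := addresses t with ha
  have ha' : 16 * t ^ 2 + 2 * t + 8 = a := rfl
  rw [ha'] at h1
  set Q := 2 * (C * t ^ 2) ^ t with hQdef
  have hQ : 1 ≤ Q := by
    have : 0 < (C * t ^ 2) ^ t := by positivity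
    omega
  set N := (2 * (20 * t * t ^ 4) + 1) ^ (4 * t) with hN
  have hN1 : 1 ≤ N := Nat.one_le_pow _ _ (by omega)
  have hNle : N ≤ 2 ^ (t * (4 * t)) := by
    rw [pow_mul]
    exact Nat.pow_le_pow_left h2.le _
  set q := 9 * t + 34 + 64 * t ^ 2 +
      t ^ 4 * (20 * t + 40 + (800 * t ^ 2 + (k * t + 1) * (3200 * t ^ 2 + 2))) with hq
  have hsteps : latticeSteps t k Q ≤ Q ^ (2 * t + 5) * N * q := latticeSteps_le hQ
  have hG1 : 1 ≤ Q ^ (2 * t + 5) * N := Nat.mul_pos (by positivity) hN1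
  have s1 : latticeSteps t k Q + K * t + 1 ≤ Q ^ (2 * t + 5) * N * (q + K * t + 1) := by
    have := Nat.mul_le_mul_right (K * t + 1) hG1
    nlinarith
  have s2 : (2 ^ (K * t) + 1) * a + 2 ≤ 2 ^ (K * t) * (2 * a + 2) := by
    have : 1 ≤ 2 ^ (K * t) := Nat.one_le_two_pow
    nlinarith
  -- The leading term arises here: `(t ^ 2) ^ (t * (2 * t + 5)) = t ^ (4 * t ^ 2) * t ^ (10 * t)`,
  -- and `t ^ (10 * t)` is at most `2 ^ (10 * t ^ 2)`, of lower order like everything else.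
  have s3 : Q ^ (2 * t + 5) ≤ t ^ (4 * t ^ 2) * (((2 * C) ^ 7) ^ t ^ 2 * (2 ^ 10) ^ t ^ 2) := by
    have e1 : Q ^ (2 * t + 5) = 2 ^ (2 * t + 5) * C ^ (t * (2 * t + 5)) * (t ^ (4 * t ^ 2) * t ^ (10 * t)) := by
      rw [hQdef, mul_pow, ← pow_mul, mul_pow, ← pow_mul, ← pow_add]
      ring_nf
    have e2 : 2 ^ (2 * t + 5) ≤ 2 ^ (7 * t ^ 2) := Nat.pow_le_pow_right (by norm_num) (by nlinarith)
    have e3 : C ^ (t * (2 * t + 5)) ≤ C ^ (7 * t ^ 2) := Nat.pow_le_pow_right hC (by nlinarith)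
    have e4 : t ^ (10 * t) ≤ 2 ^ (t * (10 * t)) := by
      rw [pow_mul 2]
      exact Nat.pow_le_pow_left Nat.lt_two_pow_self.le _
    calc Q ^ (2 * t + 5) ≤ 2 ^ (7 * t ^ 2) * C ^ (7 * t ^ 2) * (t ^ (4 * t ^ 2) * 2 ^ (t * (10 * t))) := by
          rw [e1]
          exact Nat.mul_le_mul (Nat.mul_le_mul e2 e3) (Nat.mul_le_mul_left _ e4)
      _ = _ := by
          rw [← mul_pow, pow_mul, ← pow_mul 2 10]
          ring_nf
  have hKt : K * t ≤ K * t ^ 2 := Nat.mul_le_mul_left K (Nat.le_self_pow (by norm_num) t)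
  have htt : t ≤ t ^ 2 := Nat.le_self_pow (by norm_num) t
  calc w * (latticeSteps t k Q + K * t + 1) * (a + 1) * ((2 ^ (K * t) + 1) * a + 2) ^ 2
      ≤ w * (Q ^ (2 * t + 5) * N * (q + K * t + 1)) * (a + 1) * (2 ^ (K * t) * (2 * a + 2)) ^ 2 := by
        gcongr
    _ = Q ^ (2 * t + 5) * N * (2 ^ (K * t)) ^ 2 * (w * (q + K * t + 1) * (a + 1) * (2 * a + 2) ^ 2) := by ring
    _ ≤ t ^ (4 * t ^ 2) * (((2 * C) ^ 7) ^ t ^ 2 * (2 ^ 10) ^ t ^ 2) * 2 ^ (t * (4 * t)) * (2 ^ (K * t ^ 2)) ^ 2 *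
        2 ^ t ^ 2 := by
        have h3 : 2 ^ t ≤ 2 ^ t ^ 2 := Nat.pow_le_pow_right (by norm_num) htt
        have h4 : 2 ^ (K * t) ≤ 2 ^ (K * t ^ 2) := Nat.pow_le_pow_right (by norm_num) hKt
        exact Nat.mul_le_mul (Nat.mul_le_mul (Nat.mul_le_mul s3 hNle) (Nat.pow_le_pow_left h4 2)) (h1.le.trans h3)
    _ = t ^ (4 * t ^ 2) * ((2 * C) ^ 7 * 2 ^ (15 + 2 * K)) ^ t ^ 2 := by
        rw [mul_pow _ _ (t ^ 2), ← pow_mul 2 (15 + 2 * K), ← pow_mul 2 10, ← pow_mul 2 (K * t ^ 2)]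
        have : 2 ^ ((15 + 2 * K) * t ^ 2) = 2 ^ (10 * t ^ 2) * 2 ^ (t * (4 * t)) * 2 ^ (K * t ^ 2 * 2) *
            2 ^ t ^ 2 := by
          rw [← pow_add, ← pow_add, ← pow_add]
          congr 1
          ring
        rw [this]
        ring

end Ram

/-! ### The theorem -/

open Ram QuatLattice in
theorem corollary5p6 (ε : ℝ) (hε₀ : 0 < ε) (hε₁ : ε < 1) :
    ∃ (p : BitMachine.Prog) (δ : ℕ → ℝ), Tendsto δ atTop (𝓝 0) ∧
      ∀ᶠ t : ℕ in atTop, ∃ (B : Matrix (Fin (4 * t)) (Fin (4 * t)) ℤ) (n : ℕ),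
        BitMachine.Outputs p t (matrixEntries B) n ∧
        (n : ℝ) ≤ Real.exp (4 * (t : ℝ) ^ 2 * Real.log t * (1 + δ t)) ∧
        B.det ≠ 0 ∧
        (1 - ε) * (24 * (t : ℝ) * (riemannZeta (4 * (t : ℂ))).re /
            (2 ^ (4 * t) * (Real.exp 1 * (1 - Real.exp (-(t : ℝ)))))) ≤
          packingDensity (rowLattice B) := by
  -- Large enough for `(k + 1) / k ≤ 1 + ε / 8`.
  obtain ⟨k, hk⟩ := exists_nat_ge (8 / ε)
  have hkε : 1 ≤ k * (ε / 8) := by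
    rw [div_le_iff₀ hε₀] at hk
    linarith
  have hk0 : k ≠ 0 := by
    rintro rfl
    norm_num at hkε
  obtain ⟨C, hC, hpar⟩ := exists_parameters (δ := ε / 8) (by linarith) (by linarith) hk0
  set K := 5 * k + 1 with hK
  obtain ⟨G, hG, hcost⟩ := eventually_cost_le k K C
    ((latticeCmd k C).fac + 200 + 2 * (BitMachine.bits K + 1) ^ 3) hC
  -- With this error term the bound `exp (4 t² log t (1 + δ t))` equals `t ^ (4 * t ^ 2) * G ^ t ^
  -- 2` exactly.
  refine ⟨.seq (towerProg K) (latticeCmd k C).compile, fun t => Real.log G / 4 / Real.log t, ?_, ?_⟩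
  · exact (Real.tendsto_log_atTop.comp tendsto_natCast_atTop_atTop).const_div_atTop _
  filter_upwards [hpar, hcost, eventually_sizes (Nat.one_le_iff_ne_zero.2 hk0) hC, eventually_zeta_le hε₀ hε₁,
    eventually_ge_atTop 2] with t ⟨p, R, hp, hp2, hpQ, hR0, hRt, hRp, hlog, hV₁, hV₂⟩ hn hsz hζ ht
  have ht0 : t ≠ 0 := by omega
  obtain ⟨s', m, hex, hm, B, u, v, hout, hv, hdens, hbest⟩ := wp_lattice hC rfl hsz
    (s := ⟨fun x => if x = 0 then (t : ℤ) else 0, fun _ _ => 0, []⟩) (by simp) rfl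
  have hlt : ∀ x : ℕ, (x : ℤ) ≤ 2 ^ t ^ 4 → x < 2 ^ 2 ^ (K * t) := fun x hx => by
    exact_mod_cast hx.trans_lt hsz.lt_h
  have hpos : 0 < 2 ^ (K * t) := by positivity
  have hKt : K * t < 2 ^ 2 ^ (K * t) := Nat.lt_two_pow_self.trans Nat.lt_two_pow_self
  have htK : t < 2 ^ 2 ^ (K * t) := lt_of_le_of_lt (Nat.le_mul_of_pos_left t (by omega)) hKt
  have haddr : addresses t ≤ 2 ^ 2 ^ (K * t) := by
    refine (hlt _ (le_trans ?_ hsz.box)).le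
    have : addresses t ≤ 4 * t * (3 * (20 * t * t ^ 4) + 2) := by
      unfold addresses
      nlinarith [Nat.pow_le_pow_left ht 6]
    exact_mod_cast this
  obtain ⟨n, hrun, hle⟩ := outputs_of_wp (K := K) (t := t) (A := addresses t) (p := latticeCmd k C)
    (by unfold addresses; omega) haddr htK hKt ⟨s', m, hex, hm, hout⟩
  have : Fact p.Prime := ⟨hp⟩
  obtain ⟨c, hc, hgood⟩ := exists_good_candidate ht0 hk0 (by linarith : (0 : ℝ) < ε / 8) hp2 hR0 hRp hlog hV₁
  -- The good candidate is among those searched, so the quotient kept by the program is at least `R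
  -- ^ (2 * t) / p ^ 2`. In particular it is not zero, and the output is a certified matrix.
  have hfound : R ^ (2 * t) * v ≤ u * p ^ 2 :=
    hbest R p c hRt hp.pos hpQ (hc.trans_le (Nat.pow_le_pow_left hpQ _)) hgood
  have hu : u ≠ 0 := by
    rintro rfl
    have : 0 < R ^ (2 * t) * v := by positivity
    omega
  obtain ⟨hdet, hΔ⟩ := hdens hu
  refine ⟨B, n, hrun, ?_, hdet, density_bound hε₀ ht0 hk0 hkε hp.pos hV₂ hζ (u := u) (v := v)
    (by exact_mod_cast hv) (by exact_mod_cast hfound) hΔ⟩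
  have ht' : (0 : ℝ) < t := by positivity
  have hG' : (0 : ℝ) < G := by exact_mod_cast hG
  have hlogt : Real.log t ≠ 0 := (Real.log_pos (by exact_mod_cast ht)).ne'
  have e : 4 * (t : ℝ) ^ 2 * Real.log t * (1 + Real.log G / 4 / Real.log t) =
      ((4 * t ^ 2 : ℕ) : ℝ) * Real.log t + ((t ^ 2 : ℕ) : ℝ) * Real.log G := by
    push_cast
    field_simp
  rw [e, Real.exp_add, Real.exp_nat_mul, Real.exp_nat_mul, Real.exp_log ht', Real.exp_log hG']
  exact_mod_cast hle.trans hn
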